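/- **Notation.** $\lg=\log_2$. A binary tree is empty or a node with a left and a right binary subtree; $|t|$ is its number of nodes, $h(t)$ its height (number of nodes on a longest root-to-leaf path), $t[v]$ the subtree rooted at $v$, and $t_\ell[v],t_r[v]$ are the left and right subtrees of $v$. An ordinal tree is a root with a finite (possibly empty) sequence of ordinal trees. $\mathsf{BP}$ denotes the balanced-parenthesis code ($\mathsf{BP}(\text{empty})=\varepsilon$, $\mathsf{BP}(t)=(\,\mathsf{BP}(t_\ell)\,)\,\mathsf{BP}(t_r)$ for binary trees; $\mathsf{BP}(t)=(\,\mathsf{BP}(t_1)\cdots\mathsf{BP}(t_k)\,)$ for ordinal trees), $\gamma$ the Elias gamma code. **Hypersuccinct code, binary trees.** For $|t|=n$ put $B=\max\{1,\lceil(\lg n)/8\rceil\}$ and $\mu=\lceil(\lg n)/4\rceil$ (with $\lg 0:=0$). Partition $t$ into micro trees bottom-up: call a node heavy if its subtree has at least $B$ nodes. A node with two heavy children forms a micro tree by itself, and the components containing its children become micro trees. Any other node is merged with the components of those children whose component is not yet a micro tree, and the result becomes a micro tree once it has at least $B$ nodes. The component of the root is a micro tree as well. Let $\mu_1,\dots,\mu_m$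 be the micro trees in depth-first order. Contracting each of them to a node gives the top tier $\Upsilon$, a binary tree (the component attached in the left/right subtree of the root of $\mu_i$ is the left/right child of $\mu_i$). Let $C$ be the length-restricted Huffman code of the string $\mu_1\cdots\mu_m$ over the alphabet of tree shapes: $C(s)=1\cdot\mathrm{Huff}(s)$ if $|\mathrm{Huff}(s)|\le 2|s|+2\lfloor\lg(|s|+1)\rfloor$, and $C(s)=0\,\gamma(|s|+1)\,\mathsf{BP}(s)$ otherwise. Then $\mathsf H(t)$ is the concatenation of $\gamma(n+1)$, $\gamma(m+1)$, $\mathsf{BP}(\Upsilon)$, a table of $C$ (for every occurring shape $s$: its codeword, preceded by its length in gamma code, then $\gamma(|s|)\,\mathsf{BP}(s)$; the table starts with the number of entries in gamma code), $C(\mu_1)\cdots C(\mu_m)$, and for every micro tree two numbers of $\lceil\lg(\mu+1)\rceil$ bits, which give the ranks, among its null pointers, of the null pointers at which its left and its right child component are attached (0 if there is none). **Hypersuccinct code, ordinal trees.** The same construction with the Farzan–Munro decomposition of ordinal trees: bottom-up, each node packs those components of its children that are not yet micro trees, from left to right, into components sharing this node as root; a component is closed as soon as it has at least $B$ nodes.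 At a node with at least two heavy children the components of all heavy children become micro trees, and components are also closed at the heavy children. All components at a node become micro trees unless the node has at most one heavy child and they form a single component of fewer than $B$ nodes. The top tier $\Upsilon$ is an ordinal tree with a dummy root, whose children are the micro trees that contain the root of $t$. The code $\mathsf H(t)$ is the concatenation of $\gamma(n)$, $\gamma(m)$, $\mathsf{BP}(\Upsilon)$, the table of $C$, $C(\mu_1)\cdots C(\mu_m)$, the portals, and the edge types. The portal of a micro tree is the place where its external edge leaves it, stored as a preorder rank and a child rank of $\lceil\lg(\mu+1)\rceil$ bits each ((0,0) if there is none). The edge type (3 bits) is that of the edge from a micro tree to its parent in $\Upsilon$: *new* or *continued left* / *right* if the edge leaves the root of the parent component to the left / right of all children of that root inside the component (*continued* if the micro tree shares its root with the preceding one), and *external* otherwise. **Theorem.** All $o(n)$ terms below are bounds that depend only on $n=|t|$ (and on the distribution, respectively on the function $k$), uniformly over all trees of size $n$. (A) For each of the following distributions $\mathbb P$ on binary trees there is an $o(n)$ bound such that $$|\mathsf H(t)|\le \lg\frac1{\mathbb P[t]}+o(|t|)\qquad\text{for all } t \text{ with } \mathbb P[t]>0 .$$ 1. The uniform distribution on binary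 trees of size $n$. 2. The uniform distribution on full binary trees of size $n$ (every node has 0 or 2 children). 3. The uniform distribution on unary paths of size $n$ (no node has 2 children). 4. The uniform distribution on Motzkin trees of size $n$ (no node has a right child only). 5. Random binary search trees: $\mathbb P[t]=\prod_v p(|t_\ell[v]|,|t_r[v]|)$ with $p(\ell,r)=\frac1{\ell+r+1}$. 6. Almost paths, for every constant $K\in\mathbb N_0$: $\mathbb P[t]=\prod_v p(|t_\ell[v]|,|t_r[v]|)$ with $p(\ell,r)=\max\{\frac1{\ell+r+1},\frac1{2(K+1)}\}$ if $\ell\le K$ or $r\le K$, and $p(\ell,r)=0$ otherwise. 7. The uniform distribution on AVL trees of height $h$ (at every node the heights of the two subtrees differ by at most 1). 8. The uniform distribution on $\alpha$-weight-balanced trees of size $n$, for every constant $\alpha>0$ ($|t_\ell[v]|+1\ge\alpha(|t[v]|+1)$ and $|t_r[v]|+1\ge\alpha(|t[v]|+1)$ for all $v$). 9. The uniform distribution on AVL trees of size $n$. 10. The uniform distribution on shapes of left-leaning red-black trees of size $n$. These are the binary trees whose edges (including those to null pointers, which are black) can be coloured red and black such that all paths from the root to a null pointer have the same number of black edges, none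 of these paths has two consecutive red edges, and a node with exactly one red child edge has it on the left. (B) For each of the following distributions on binary trees, $p$ being a function with $\mathbb P[t]=\prod_v p(|t_\ell[v]|,|t_r[v]|)$, the expected length satisfies $$\sum_{|t|=n}\mathbb P[t]\,|\mathsf H(t)|\le \sum_{|t|=n}\mathbb P[t]\lg\frac1{\mathbb P[t]}+o(n).$$ 1. Binomial random trees, for every constant $\alpha\in(0,1)$: $p(\ell,r)=\alpha^\ell(1-\alpha)^r\binom{\ell+r}{\ell}$. 2. Random fringe-balanced binary search trees, for every constant $s\in\mathbb N_0$: with $n=\ell+r+1$, $p(\ell,r)=\binom{\ell}{s}\binom{r}{s}/\binom{n}{2s+1}$ if $n\ge 2s+1$, and $p(\ell,r)=1/n$ otherwise. (C) For each of the following distributions on ordinal trees, $|\mathsf H(t)|\le\lg(1/\mathbb P[t])+o(|t|)$ for all $t$ with $\mathbb P[t]>0$. In 2 and 3, $\mathbb P[t]=\prod_v p(n_1,\dots,n_j)$, where $n_1,\dots,n_j$ are the sizes of the subtrees of $v$ from left to right. 1. The uniform distribution on full $m$-ary trees of size $n$ (every node has 0 or $m$ children), for every constant $m\ge2$. 2.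 Uniform composition trees: $p(n_1,\dots,n_j)=2^{-(n_1+\cdots+n_j-1)}$ for $j\ge1$, and $p()=1$. 3. Random LRM-trees: $p(n_1,\dots,n_j)=\prod_{i=1}^j\frac1{n_1+\cdots+n_i}$. (D) For every function $k:\mathbb N\to\mathbb N_0$ with $k(n)=o(\log n)$ there is an $o(n)$ bound such that for every binary tree $t$ of size $n$, $|\mathsf H(t)|\le H^{\mathrm{type}}_{k(n)}(t)+o(n)$, where $$H_k^{\mathrm{type}}(t)=\sum_{z\in\{1,2,3\}^k}\sum_{i=0}^3 n^t_{z,i}\lg\frac{n^t_z}{n^t_{z,i}} .$$ Here the type of a node is 0, 1, 2, 3 if it is a leaf, has a left child only, has two children, or has a right child only. The $k$-history of a node $v$ is the length-$k$ suffix of $1^k h(v)$, where $h(v)$ is the string of the types of the proper ancestors of $v$ from the root down. $n_z^t$ is the number of nodes with $k$-history $z$, and $n_{z,i}^t$ the number of those that have type $i$ (terms with $n_{z,i}^t=0$ are 0). (E) There is an $o(n)$ bound such that for every binary tree $t$ of size $n$, $|\mathsf H(t)|\le H_{st}(t)+o(n)$, where $H_{st}(t)=\sum_{v\in t}\lg|t[v]|$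 is the subtree-size entropy. -/

import Mathlib

open Filter Asymptotics

namespace Hypersuccinct

/-! ### Trees

Binary trees are Mathlib's `BinaryTree Unit`; `BinaryTree.numNodes` is the size, `BinaryTree.height`
the height (the empty tree has height `0`), `BinaryTree.treesOfNumNodesEq n` the finite set of all
binary trees with `n` nodes. -/

abbrev BTree : Type := BinaryTree Unit

/-- Ordinal trees: a root with a finite sequence of ordinal trees as children. -/
inductive OTree : Type
  | node (children : List OTree) : OTree

mutual
def OTree.decEq : (s t : OTree) → Decidable (s = t)
  | .node ss, .node ts =>
    match OTree.decEqList ss ts with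
    | isTrue h => isTrue (by rw [h])
    | isFalse h => isFalse (by intro e; exact h (OTree.node.inj e))
def OTree.decEqList : (ss ts : List OTree) → Decidable (ss = ts)
  | [], [] => isTrue rfl
  | [], _ :: _ => isFalse (by simp)
  | _ :: _, [] => isFalse (by simp)
  | s :: ss, t :: ts =>
    match OTree.decEq s t, OTree.decEqList ss ts with
    | isTrue h, isTrue h' => isTrue (by rw [h, h'])
    | isFalse h, _ => isFalse (by simp [h])
    | _, isFalse h => isFalse (by simp [h])
end

instance : DecidableEq OTree := OTree.decEq

mutual
/-- The number of nodes of an ordinal tree. -/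
def OTree.size : OTree → ℕ
  | .node ts => 1 + OTree.sizeList ts
/-- The number of nodes of a sequence of ordinal trees. -/
def OTree.sizeList : List OTree → ℕ
  | [] => 0
  | t :: ts => t.size + OTree.sizeList ts
end

/-! ### Elementary codes. Bits are Booleans. -/

/-- The `w` low-order bits of `x`, most significant bit first. -/
def fixedWidth (w x : ℕ) : List Bool :=
  ((List.range w).map fun i => x.testBit i).reverse

/-- The Elias gamma code of a number `n ≥ 1`, of length `2 ⌊lg n⌋ + 1`. -/
def eliasGamma (n : ℕ) : List Bool :=
  List.replicate (Nat.log 2 n) false ++ fixedWidth (Nat.log 2 n + 1) n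

/-- The balanced-parenthesis encoding of binary trees; `true` is the opening parenthesis. -/
def bp : BTree → List Bool
  | .nil => []
  | .node _ l r => true :: bp l ++ false :: bp r

mutual
/-- The balanced-parenthesis encoding of ordinal trees. -/
def bpOrd : OTree → List Bool
  | .node ts => true :: bpOrdList ts ++ [false]
/-- The balanced-parenthesis encoding of sequences of ordinal trees. -/
def bpOrdList : List OTree → List Bool
  | [] => []
  | t :: ts => bpOrd t ++ bpOrdList ts
end

/-! ### Huffman codes -/

/-- Binary code trees whose leaves carry letters. -/
inductive CodeTree (α : Type) : Type
  | leaf (a : α) : CodeTree α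
  | node (left right : CodeTree α) : CodeTree α

def CodeTree.letters {α : Type} : CodeTree α → List α
  | .leaf a => [a]
  | .node l r => l.letters ++ r.letters

/-- The path from the root to the leaf with letter `a` (`false` is left, `true` is right). -/
def CodeTree.codeword {α : Type} [DecidableEq α] : CodeTree α → α → List Bool
  | .leaf _, _ => []
  | .node l r, a => if a ∈ l.letters then false :: l.codeword a else true :: r.codeword a

/-- Comparison of weighted code trees by weight. -/
def lighter {α : Type} (x y : ℕ × CodeTree α) : Prop := x.1 ≤ y.1

instance {α : Type} : DecidableRel (lighter (α := α)) :=
  fun x y => inferInstanceAs (Decidable (x.1 ≤ y.1))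

/-- Huffman's algorithm on a list of code trees sorted by weight: as long as there are at least two
code trees, replace two of least weight by a code tree that has them as its subtrees. -/
def huffmanMerge {α : Type} : List (ℕ × CodeTree α) → Option (CodeTree α)
  | [] => none
  | [(_, s)] => some s
  | (a, s) :: (b, u) :: rest =>
    huffmanMerge (List.orderedInsert lighter (a + b, .node s u) rest)
  termination_by ws => ws.length
  decreasing_by simp [List.orderedInsert_length]

/-- The Huffman code for the string `ms`: letters are weighted by their number of occurrences. -/
def huffmanCode {α : Type} [DecidableEq α] (ms : List α) (a : α) : List Bool :=
  match huffmanMerge (List.insertionSort lighter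
      (ms.dedup.map fun x => (ms.count x, CodeTree.leaf x))) with
  | none => []
  | some T => T.codeword a

/-! ### Storing a sequence of micro-tree shapes

Here `α` is a type of trees with size function `size` and balanced-parenthesis encoding `par`. -/

/-- The length-restricted version of the tree code `C`. -/
def lengthRestricted {α : Type} (size : α → ℕ) (par : α → List Bool) (C : α → List Bool) (t : α) :
    List Bool :=
  if 2 * size t + 2 * Nat.log 2 (size t + 1) < (C t).length then
    false :: eliasGamma (size t + 1) ++ par t
  else true :: C t

/-- The length-restricted Huffman code for the string `ms`. -/
def microCode {α : Type} [DecidableEq α] (size : α → ℕ) (par : α → List Bool) (ms : List α) :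
    α → List Bool :=
  lengthRestricted size par (huffmanCode ms)

/-- The code table: the number of occurring shapes, and for each of them its codeword (preceded by
the length of the codeword), its size and its balanced-parenthesis encoding. -/
def codeTable {α : Type} [DecidableEq α] (size : α → ℕ) (par : α → List Bool) (ms : List α) :
    List Bool :=
  eliasGamma (ms.dedup.length + 1) ++
    ms.dedup.flatMap fun a =>
      eliasGamma ((microCode size par ms a).length + 1) ++ microCode size par ms a ++
        eliasGamma (size a) ++ par a

/-! ### Parameters of the tree covering for trees with `n` nodes -/

/-- The block parameter `B = ⌈(lg n) / 8⌉`; it has to be at least `1`, which matters only for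
`n ≤ 1`. -/
noncomputable def blockParam (n : ℕ) : ℕ := max 1 ⌈Real.logb 2 n / 8⌉₊

/-- The bound `μ = ⌈(lg n) / 4⌉` on the size of micro trees. -/
noncomputable def microBound (n : ℕ) : ℕ := ⌈Real.logb 2 n / 4⌉₊

/-- The number `⌈lg (μ + 1)⌉` of bits of an integer that locates a portal. -/
noncomputable def portalWidth (n : ℕ) : ℕ := Nat.clog 2 (microBound n + 1)

/-! ### The Farzan-Munro decomposition of binary trees -/

/-- A component (connected piece) of a decomposed binary tree together with everything below it:
`portal c` is a null pointer of the component at whose place the decomposed tree continues with the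
component `c`, which is another micro tree. -/
inductive BCover : Type
  | nil : BCover
  | portal (child : BCover) : BCover
  | node (left right : BCover) : BCover

namespace BCover

/-- The number of nodes of the component itself. -/
def localSize : BCover → ℕ
  | .nil => 0
  | .portal _ => 0
  | .node l r => l.localSize + r.localSize + 1

/-- The local shape of the component. -/
def shape : BCover → BTree
  | .nil => .nil
  | .portal _ => .nil
  | .node l r => .node () l.shape r.shape

/-- All components hanging below, in depth-first order (each one listed with what is below it). -/
def components : BCover → List BCover
  | .nil => []
  | .portal c => c :: c.components
  | .node l r => l.components ++ r.components

/-- The tree obtained from what is below the portals by contracting each component to a node: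
the left (right) child of a component is the component whose portal is in the left (right)
subtree of its root. -/
def topTier : BCover → BTree
  | .nil => .nil
  | .portal (.node l r) => .node () l.topTier r.topTier
  | .portal _ => .nil
  | .node l r => if l.topTier = .nil then r.topTier else l.topTier

/-- The null pointers of the component from left to right; `true` marks the portals. -/
def nulls : BCover → List Bool
  | .nil => [false]
  | .portal _ => [true]
  | .node l r => l.nulls ++ r.nulls

/-- The ranks, among all null pointers of the component, of the portal in the left and of the portal
in the right subtree of the root (`0` if there is no such portal). -/
def portalRanks : BCover → ℕ × ℕ
  | .node l r =>
    (if true ∈ l.nulls then l.nulls.idxOf true else 0,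
      if true ∈ r.nulls then l.nulls.length + r.nulls.idxOf true else 0)
  | _ => (0, 0)

end BCover

/-- Keep a child's active component, unless it is already permanent. -/
def attach (x : BCover × Bool) : BCover := if x.2 then .portal x.1 else x.1

/-- The Farzan-Munro algorithm on binary trees. It returns the active component of the root and
whether this component has been declared permanent. A node is heavy if its subtree has at least
`B` nodes. If both children are heavy, their components and the component consisting of the root
only are permanent. Otherwise the root is merged with the components of its children, except for
those that are permanent already. -/
def coverBinary (B : ℕ) : BTree → BCover × Bool
  | .nil => (.nil, false)
  | .node _ l r =>
    if B ≤ l.numNodes ∧ B ≤ r.numNodes then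
      (.node (.portal (coverBinary B l).1) (.portal (coverBinary B r).1), true)
    else
      (.node (attach (coverBinary B l)) (attach (coverBinary B r)),
        decide (B ≤ (BCover.node (attach (coverBinary B l)) (attach (coverBinary B r))).localSize))

/-- The list of micro trees in depth-first order. -/
def microTreesBinary (B : ℕ) (t : BTree) : List BCover :=
  if t = .nil then [] else (BCover.portal (coverBinary B t).1).components

/-- The top tier: each micro tree is contracted to a single node. -/
def topTierBinary (B : ℕ) (t : BTree) : BTree :=
  if t = .nil then .nil else (BCover.portal (coverBinary B t).1).topTier

/-- The hypersuccinct code of a binary tree for block parameter `B`, with `w` bits for each portal: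
the size of the tree and the number of micro trees (both increased by one, so that the empty tree is
included), the top tier, the code table, the codewords of all micro trees, and the portals. -/
def encodeBinary (B w : ℕ) (t : BTree) : List Bool :=
  let cs := microTreesBinary B t
  let ms := cs.map BCover.shape
  eliasGamma (t.numNodes + 1) ++ eliasGamma (cs.length + 1) ++
    bp (topTierBinary B t) ++
    codeTable BinaryTree.numNodes bp ms ++
    ms.flatMap (microCode BinaryTree.numNodes bp ms) ++
    cs.flatMap fun c => fixedWidth w c.portalRanks.1 ++ fixedWidth w c.portalRanks.2

/-- The hypersuccinct code of binary trees. -/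
noncomputable def hyperBinary (t : BTree) : List Bool :=
  encodeBinary (blockParam t.numNodes) (portalWidth t.numNodes) t

/-! ### The Farzan-Munro decomposition of ordinal trees -/

/-- A component of a decomposed ordinal tree together with everything below it. A component is
`node items`, its root having the items as children from left to right; a child `portal cs`
is missing in the component: it is the shared root of the components `cs`, among which its own
children are distributed from left to right. -/
inductive OCover : Type
  | node (items : List OCover) : OCover
  | portal (components : List OCover) : OCover

namespace OCover

def isNode : OCover → Bool
  | .node _ => true
  | .portal _ => false

mutual
/-- The number of nodes of the component itself. -/
def localSize : OCover → ℕ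
  | .node ps => 1 + localSizeList ps
  | .portal _ => 0
def localSizeList : List OCover → ℕ
  | [] => 0
  | p :: ps => p.localSize + localSizeList ps
end

mutual
/-- The local shape of the component, as a sequence of length one (of length zero for a portal). -/
def shapes : OCover → List OTree
  | .node ps => [.node (shapesList ps)]
  | .portal _ => []
def shapesList : List OCover → List OTree
  | [] => []
  | p :: ps => p.shapes ++ shapesList ps
end

/-- The local shape of a component. -/
def shape : OCover → OTree
  | .node ps => .node (shapesList ps)
  | .portal _ => .node []

mutual
/-- The top tier below a component or a part of it: the components reached through its portals, from
left to right, contracted to single nodes. -/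
def topsBelow : OCover → List OTree
  | .node ps => topsBelowList ps
  | .portal cs => contract cs
def topsBelowList : List OCover → List OTree
  | [] => []
  | p :: ps => p.topsBelow ++ topsBelowList ps
/-- The top tiers of several components. -/
def contract : List OCover → List OTree
  | [] => []
  | c :: cs => .node c.topsBelow :: contract cs
end

end OCover

/-- The type of the edge of the top tier from a component `P` to its child `C`: the root of `C` is a
child of the root of `P` and comes before (`newLeft`, `continuedLeft`) or after (`newRight`,
`continuedRight`) all children of the root of `P` inside `P`, where `continued` means that `C` shares
its root with the child component immediately before it; `external` is any other edge. -/
inductive EdgeType : Type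
  | newLeft | continuedLeft | newRight | continuedRight | external

/-- Edge types are stored in three bits. -/
def EdgeType.code : EdgeType → List Bool
  | .newLeft => fixedWidth 3 0
  | .continuedLeft => fixedWidth 3 1
  | .newRight => fixedWidth 3 2
  | .continuedRight => fixedWidth 3 3
  | .external => fixedWidth 3 4

namespace OCover

mutual
/-- All components below an item, in depth-first order, each with the type of its parent edge;
`e` is the type for the first component of a shared root, `e'` the type for the further ones. -/
def itemComponents (e e' : EdgeType) : OCover → List (EdgeType × OCover)
  | .node ps => innerComponents ps
  | .portal cs => groupComponents e e' cs
/-- All components below the children of a non-root node of a component. -/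
def innerComponents : List OCover → List (EdgeType × OCover)
  | [] => []
  | p :: ps => itemComponents .external .external p ++ innerComponents ps
/-- All components below the children of the root of a component; `seen` tells whether there is a
child inside the component further to the left. -/
def rootComponents (seen : Bool) : List OCover → List (EdgeType × OCover)
  | [] => []
  | p :: ps =>
    (if seen = false then itemComponents .newLeft .continuedLeft p
      else if ps.any isNode then itemComponents .external .external p
      else itemComponents .newRight .continuedRight p) ++ rootComponents (seen || p.isNode) ps
/-- All components strictly below a component. -/
def ownComponents : OCover → List (EdgeType × OCover)
  | .node ps => rootComponents false ps
  | .portal _ => []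
/-- Components sharing a root, and all components below them. -/
def groupComponents (e e' : EdgeType) : List OCover → List (EdgeType × OCover)
  | [] => []
  | c :: cs => (e, c) :: ownComponents c ++ groupComponents e' e' cs
end

mutual
/-- The positions of the portals below a node of a component: the preorder rank, relative to this
node, of the node that misses a child, and the number of its children inside the component to the
left of the missing child. -/
def portalPositions : OCover → List (ℕ × ℕ)
  | .node ps => portalPositionsList 0 1 ps
  | .portal _ => []
/-- The same for the children of a node; `k` children inside the component have been passed, and
`s` is the preorder rank of the next one. -/
def portalPositionsList (k s : ℕ) : List OCover → List (ℕ × ℕ)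
  | [] => []
  | p :: ps =>
    if p.isNode then
      (p.portalPositions.map fun x => (s + x.1, x.2)) ++
        portalPositionsList (k + 1) (s + p.localSize) ps
    else (0, k) :: portalPositionsList k s ps
end

/-- The number of children of the root inside the component. -/
def rootDegree : OCover → ℕ
  | .node ps => ps.countP isNode
  | .portal _ => 0

/-- The position of the external edge of a component (`(0, 0)` if there is none): a portal that is
neither to the left nor to the right of all children of the root inside the component. -/
def externalPortal (c : OCover) : ℕ × ℕ :=
  ((c.portalPositions.filter fun x =>
    decide (¬ (x.1 = 0 ∧ (x.2 = 0 ∨ x.2 = c.rootDegree)))).head?).getD (0, 0)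

end OCover

/-- Greedy packing of the children of a node into components, from left to right. `cur` holds the
children in the current component. A component is complete as soon as it has at least `B` nodes
(including the shared root). If `branching`, missing (heavy) children also separate components.
Missing children to the right of all packed children are attached to the last component. -/
def pack (B : ℕ) (branching : Bool) (cur : List OCover) : List OCover → List (List OCover)
  | [] => [cur]
  | p :: ps =>
    if p.isNode then
      if B ≤ 1 + OCover.localSizeList (cur ++ [p]) then
        if ps.any OCover.isNode then (cur ++ [p]) :: pack B branching [] ps
        else [cur ++ [p] ++ ps]
      else pack B branching (cur ++ [p]) ps
    else if branching = true ∧ cur.any OCover.isNode = true then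
      if ps.any OCover.isNode then cur :: pack B branching [p] ps
      else [cur ++ p :: ps]
    else pack B branching (cur ++ [p]) ps

/-- The step of the Farzan-Munro algorithm at a node. For each child, `xs` tells whether it is heavy,
which components contain it, and whether these are permanent. With at least two heavy children, the
components of all heavy children are permanent and the other children are packed separately
between them. Otherwise all children are packed, except that a heavy child whose components are
permanent is skipped. The result is permanent unless it is a single component of fewer than `B`
nodes at a node with at most one heavy child. -/
def coverStep (B : ℕ) (xs : List (Bool × List OCover × Bool)) : List OCover × Bool :=
  let branching : Bool := decide (2 ≤ xs.countP fun x => x.1)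
  let items : List OCover :=
    xs.flatMap fun x => if x.2.2 || (branching && x.1) then [OCover.portal x.2.1] else x.2.1
  let comps : List OCover := (pack B branching [] items).map OCover.node
  (comps, branching || decide (2 ≤ comps.length) || decide (B ≤ OCover.localSizeList comps))

mutual
/-- The Farzan-Munro algorithm on ordinal trees: the components containing the root, and whether
they are permanent. -/
def coverOrdinal (B : ℕ) : OTree → List OCover × Bool
  | .node ts => coverStep B (coverOrdinalList B ts)
def coverOrdinalList (B : ℕ) : List OTree → List (Bool × List OCover × Bool)
  | [] => []
  | t :: ts => (decide (B ≤ t.size), coverOrdinal B t) :: coverOrdinalList B ts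
end

/-- The micro trees in depth-first order, with the types of their parent edges (the edges from the
dummy root of the top tier to the micro trees that contain the root of the tree are external). -/
def microTreesOrdinal (B : ℕ) (t : OTree) : List (EdgeType × OCover) :=
  OCover.groupComponents .external .external (coverOrdinal B t).1

/-- The top tier, with a dummy root. -/
def topTierOrdinal (B : ℕ) (t : OTree) : OTree :=
  .node (OCover.contract (coverOrdinal B t).1)

/-- The hypersuccinct code of an ordinal tree for block parameter `B`, with `w`-bit integers for
portals: the size of the tree and the number of micro trees, the top tier, the code table, the
codewords of all micro trees, the portals of the external edges, and the types of the parent edges. -/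
def encodeOrdinal (B w : ℕ) (t : OTree) : List Bool :=
  let cs := microTreesOrdinal B t
  let ms := cs.map fun c => c.2.shape
  eliasGamma t.size ++ eliasGamma cs.length ++
    bpOrd (topTierOrdinal B t) ++
    codeTable OTree.size bpOrd ms ++
    ms.flatMap (microCode OTree.size bpOrd ms) ++
    (cs.flatMap fun c =>
      fixedWidth w c.2.externalPortal.1 ++ fixedWidth w c.2.externalPortal.2) ++
    cs.flatMap fun c => c.1.code

/-- The hypersuccinct code of ordinal trees. -/
noncomputable def hyperOrdinal (t : OTree) : List Bool :=
  encodeOrdinal (blockParam t.size) (portalWidth t.size) t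

/-! ### Optimal compression up to lower-order terms -/

/-- `code` uses at most `lg (1 / P t) + o(n)` bits for every tree `t` of size `n` with `P t > 0`. -/
def OptimalPointwise {α : Type} (code : α → List Bool) (size : α → ℕ) (P : α → ℝ) : Prop :=
  ∃ r : ℕ → ℝ, r =o[atTop] (fun n : ℕ => (n : ℝ)) ∧
    ∀ t : α, 0 < P t → ((code t).length : ℝ) ≤ Real.logb 2 (1 / P t) + r (size t)

/-- The expected code length of a random binary tree of size `n` is at most the entropy of its
distribution plus `o(n)`. -/
def OptimalOnAverage (code : BTree → List Bool) (P : BTree → ℝ) : Prop :=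
  ∃ r : ℕ → ℝ, r =o[atTop] (fun n : ℕ => (n : ℝ)) ∧
    ∀ n : ℕ, ∑ t ∈ BinaryTree.treesOfNumNodesEq n, P t * ((code t).length : ℝ) ≤
      ∑ t ∈ BinaryTree.treesOfNumNodesEq n, P t * Real.logb 2 (1 / P t) + r n

/-! ### Tree distributions -/

open Classical in
/-- The uniform distribution on each set of those elements of `S` with the same value of `index`. -/
noncomputable def uniformOn {α : Type} (S : Set α) (index : α → ℕ) (t : α) : ℝ :=
  if t ∈ S then 1 / (Set.ncard {s | s ∈ S ∧ index s = index t} : ℝ) else 0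

/-- The fixed-size source: the product over all nodes of `p`, applied to the sizes of the left and
of the right subtree. -/
def fixedSize (p : ℕ → ℕ → ℝ) : BTree → ℝ
  | .nil => 1
  | .node _ l r => p l.numNodes r.numNodes * fixedSize p l * fixedSize p r

mutual
/-- The fixed-size ordinal source: the product over all nodes of `p`, applied to the sequence of the
sizes of the subtrees. -/
def fixedSizeOrdinal (p : List ℕ → ℝ) : OTree → ℝ
  | .node ts => p (ts.map OTree.size) * fixedSizeOrdinalList p ts
def fixedSizeOrdinalList (p : List ℕ → ℝ) : List OTree → ℝ
  | [] => 1
  | t :: ts => fixedSizeOrdinal p t * fixedSizeOrdinalList p ts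
end

/-- Random binary search trees. -/
noncomputable def pBst (l r : ℕ) : ℝ := 1 / ((l : ℝ) + r + 1)

/-- Binomial random trees. -/
noncomputable def pBinomial (α : ℝ) (l r : ℕ) : ℝ :=
  α ^ l * (1 - α) ^ r * ((l + r).choose l : ℝ)

/-- Almost paths. -/
noncomputable def pAlmostPath (K l r : ℕ) : ℝ :=
  if l ≤ K ∨ r ≤ K then max (1 / ((l : ℝ) + r + 1)) (1 / (2 * ((K : ℝ) + 1))) else 0

/-- Fringe-balanced random binary search trees. -/
noncomputable def pFringeBalanced (s l r : ℕ) : ℝ :=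
  if 2 * s + 1 ≤ l + r + 1 then
    (l.choose s : ℝ) * (r.choose s : ℝ) / ((l + r + 1).choose (2 * s + 1) : ℝ)
  else 1 / ((l : ℝ) + r + 1)

/-- Uniform composition trees: the `2 ^ (s - 1)` compositions of `s ≥ 1` are equally likely, and `0`
has the empty composition only (note that `0 - 1 = 0` for natural numbers). -/
noncomputable def pComposition (ns : List ℕ) : ℝ := 1 / 2 ^ (ns.sum - 1)

/-- Random LRM-trees. -/
noncomputable def pLrm (ns : List ℕ) : ℝ :=
  ∏ j ∈ Finset.range ns.length, 1 / ((ns.take (j + 1)).sum : ℝ)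

/-- Every node satisfies `Q`, applied to its left and right subtree. -/
def EveryNode (Q : BTree → BTree → Prop) : BTree → Prop
  | .nil => True
  | .node _ l r => Q l r ∧ EveryNode Q l ∧ EveryNode Q r

/-- Full binary trees: every node has two children or none. -/
def fullTrees : Set BTree := {t | EveryNode (fun l r => l = .nil ↔ r = .nil) t}

/-- Unary paths: no node has two children. -/
def unaryPaths : Set BTree := {t | EveryNode (fun l r => l = .nil ∨ r = .nil) t}

/-- Motzkin trees: no node has a right child only. -/
def motzkinTrees : Set BTree := {t | EveryNode (fun l r => l = .nil → r = .nil) t}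

/-- AVL trees. -/
def avlTrees : Set BTree :=
  {t | EveryNode (fun l r => l.height ≤ r.height + 1 ∧ r.height ≤ l.height + 1) t}

/-- `α`-weight-balanced trees. -/
def weightBalancedTrees (α : ℝ) : Set BTree :=
  {t | EveryNode (fun l r =>
    α * ((l.numNodes : ℝ) + r.numNodes + 1 + 1) ≤ (l.numNodes : ℝ) + 1 ∧
    α * ((l.numNodes : ℝ) + r.numNodes + 1 + 1) ≤ (r.numNodes : ℝ) + 1) t}

/-- The edges below a node can be coloured as in a left-leaning red-black tree, if the edge to the
node itself is red (`red = true`) or black (`red = false`): there are `b` black edges on every path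
from the node down to a null pointer, no two consecutive edges on such a path are red, and a
node with only one red child edge has it on the left. Edges to null pointers are black. -/
def RedBlackColorable : Bool → ℕ → BTree → Prop
  | red, b, .nil => red = false ∧ b = 0
  | red, b, .node _ l r =>
    ∃ redL redR : Bool,
      (red = true → redL = false ∧ redR = false) ∧
      (redR = true → redL = true) ∧
      ((redL = true ∧ RedBlackColorable true b l) ∨
        (redL = false ∧ ∃ b', b = b' + 1 ∧ RedBlackColorable false b' l)) ∧
      ((redR = true ∧ RedBlackColorable true b r) ∨
        (redR = false ∧ ∃ b', b = b' + 1 ∧ RedBlackColorable false b' r))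

/-- Shapes of left-leaning red-black trees. -/
def redBlackTrees : Set BTree := {t | ∃ b, RedBlackColorable false b t}

mutual
/-- Every node has `m` children or none. -/
def OTree.IsFull (m : ℕ) : OTree → Prop
  | .node ts => (ts = [] ∨ ts.length = m) ∧ OTree.AllFull m ts
def OTree.AllFull (m : ℕ) : List OTree → Prop
  | [] => True
  | t :: ts => t.IsFull m ∧ OTree.AllFull m ts
end

/-- Full `m`-ary trees. -/
def fullOrdinalTrees (m : ℕ) : Set OTree := {t | t.IsFull m}

/-! ### Empirical entropies -/

/-- The type of a node with left subtree `l` and right subtree `r`: `0` for a leaf, `1` for a left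
child only, `2` for two children, `3` for a right child only. -/
def nodeType : BTree → BTree → Fin 4
  | .nil, .nil => 0
  | .node _ _ _, .nil => 1
  | .node _ _ _, .node _ _ _ => 2
  | .nil, .node _ _ _ => 3

/-- For every node of a tree its history (the types of its proper ancestors from the root down)
and its type, where the root itself has history `h`. -/
def histories : List (Fin 4) → BTree → List (List (Fin 4) × Fin 4)
  | _, .nil => []
  | h, .node _ l r =>
    (h, nodeType l r) :: histories (h ++ [nodeType l r]) l ++ histories (h ++ [nodeType l r]) r

/-- The suffix of length `k` of `1 ^ k h`. -/
def kHistory (k : ℕ) (h : List (Fin 4)) : List (Fin 4) :=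
  (List.replicate k 1 ++ h).drop h.length

/-- The number of nodes with `k`-history `z`. -/
def countHistory (k : ℕ) (t : BTree) (z : List (Fin 4)) : ℕ :=
  (histories [] t).countP fun x => decide (kHistory k x.1 = z)

/-- The number of nodes with `k`-history `z` and type `i`. -/
def countHistoryType (k : ℕ) (t : BTree) (z : List (Fin 4)) (i : Fin 4) : ℕ :=
  (histories [] t).countP fun x => decide (kHistory k x.1 = z ∧ x.2 = i)

/-- The `k`-th order empirical type entropy. The `k`-histories are the words of length `k` over the
letters `1, 2, 3`. -/
noncomputable def typeEntropy (k : ℕ) (t : BTree) : ℝ :=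
  ∑ z : Fin k → Fin 3, ∑ i : Fin 4,
    (countHistoryType k t (List.ofFn fun j => (z j).succ) i : ℝ) *
      Real.logb 2 ((countHistory k t (List.ofFn fun j => (z j).succ) : ℝ) /
        (countHistoryType k t (List.ofFn fun j => (z j).succ) i : ℝ))

/-- The subtree-size entropy. -/
noncomputable def subtreeSizeEntropy : BTree → ℝ
  | .nil => 0
  | .node _ l r =>
    Real.logb 2 ((l.numNodes : ℝ) + r.numNodes + 1) + subtreeSizeEntropy l + subtreeSizeEntropy r

end Hypersuccinct

/-!
The code length is governed by a single bound. Let `μ₁, …, μₘ` be the micro trees of `t`, which have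
fewer than `2 B` nodes each; there are at most `8 n / B` of them. The greedy merges of Huffman's
algorithm lose at most one bit per codeword against the empirical entropy (`huffmanMerge_spec`), and
by Gibbs' inequality the empirical entropy of `μ₁ ⋯ μₘ` is at most `∑ lg (1 / w (μᵢ)) + m lg Z` for
every positive weight function `w` of total weight at most `Z`. Everything else, i.e. the top tier,
the table, the portals and the edge types, takes `O(m lg B) + o(n)` bits, as `B = Θ(lg n)` and only
`16 ^ B = O(√n)` shapes can occur. This gives `length_hyperBinary_le` and `length_hyperOrdinal_le`,
in which `w` may also be a weight on decorated micro trees, i.e. on any data from which the shape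
can be read off. For each source it remains to choose a decoration and a weight such that
`lg Z = o(B)` and `∑ lg (1 / w (μᵢ))` is at most the information content of `t`, up to `o(n)`.

* If `p` is monotone, the probability of a shape can serve as its weight, since cutting off subtrees
  does not decrease `p` (`length_hyperBinary_le_of_monotone`). This settles random search trees and
  almost paths. The subtree-size entropy is the information content of `t` as a random search tree.
  Composition trees and LRM-trees are similar, with the sizes of the siblings generated one after
  another (`IsSequentialSource.optimalPointwise`).
* For AVL, red-black and weight-balanced trees, a micro tree is cut at its heavy nodes, so that it
  is made of intact light subtrees of `t` (`length_hyperBinary_le_fringe`). Each of them is drawn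
  uniformly from the trees with the same label, e.g. the same size and height. Replacing the light
  subtrees by others with the same labels stays within the class, so the product of the numbers of
  choices is at most the size of the class (`prod_ncard_fringe_le`). The balance conditions make the
  heavy nodes few.
* In the average case the light subtrees are drawn from the source itself, and the expected number
  of heavy nodes is `O(n / √B)`, because both subtrees of a node are large with positive probability
  (`IsBalancedSource`, `optimalOnAverage_of_balanced`).
* For the empirical type entropy, the weight of a micro tree is its probability in the process that
  generates the types of the nodes with the empirical conditional probabilities, where every node
  is a portal to another micro tree with probability `1 / (B + 1)` (`typeWeight`). The unknown
  history of the root of a micro tree is one of `3 ^ k` words, and costs `k lg 3 = o(B)` bits.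
* For classes given by the admissible node types, filling the portals of a micro tree by leaves
  yields a tree of the class. Grafting shows that the numbers `N k` of trees with `k + 1` nodes
  satisfy `N i * N j ≤ N (i + j)`, and the sizes of the filled micro trees add up to that of `t`. So
  uniform filled micro trees cost at most `lg N (n - 1)` bits, and the positions of the portals cost
  `o(n)` bits (`length_hyperBinary_le_typeClass`). Full `m`-ary trees are treated in the same way,
  except that a micro tree may lack some of the children of its root, so that the subtrees at these
  children are filled instead (`length_hyperOrdinal_le_full`).
-/

namespace Hypersuccinct

/-! ### Redundancy of Huffman codes -/

namespace CodeTree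

variable {α : Type}

/-- The total weight of the leaves of a code tree. -/
def weight (c : α → ℕ) : CodeTree α → ℕ
  | .leaf a => c a
  | .node l r => l.weight c + r.weight c

/-- The weighted path length of a code tree. -/
def cost (c : α → ℕ) : CodeTree α → ℕ
  | .leaf _ => 0
  | .node l r => (l.weight c + r.weight c) + (l.cost c + r.cost c)

theorem weight_eq_sum (c : α → ℕ) (T : CodeTree α) : T.weight c = (T.letters.map c).sum := by
  induction T with
  | leaf a => simp [weight, letters]
  | node l r hl hr => simp [weight, letters, hl, hr]

theorem sum_length_codeword [DecidableEq α] (c : α → ℕ) (T : CodeTree α) (h : T.letters.Nodup) :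
    (T.letters.map fun a => c a * (T.codeword a).length).sum = T.cost c := by
  induction T with
  | leaf a => simp [cost, letters, codeword]
  | node l r hl hr =>
    simp only [letters, List.nodup_append] at h
    obtain ⟨h1, h2, h3⟩ := h
    have e1 : (l.letters.map fun a => c a * ((CodeTree.node l r).codeword a).length) =
        l.letters.map fun a => c a + c a * (l.codeword a).length := by
      apply List.map_congr_left
      intro a ha
      simp only [codeword, ha, if_true, List.length_cons]
      ring
    have e2 : (r.letters.map fun a => c a * ((CodeTree.node l r).codeword a).length) =
        r.letters.map fun a => c a + c a * (r.codeword a).length := by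
      apply List.map_congr_left
      intro a ha
      have : a ∉ l.letters := fun h => h3 a h a ha rfl
      simp only [codeword, this, if_false, List.length_cons]
      ring
    rw [letters, List.map_append, List.sum_append, e1, e2, List.sum_map_add, List.sum_map_add,
      hl h1, hr h2, ← weight_eq_sum, ← weight_eq_sum, cost]
    ring

end CodeTree

/-- Merging two least weights `a ≤ b` loses at most `b - a` against the entropy. -/
theorem two_mul_le_entropy {a b : ℝ} (ha : 0 < a) (hab : a ≤ b) :
    2 * a ≤ a * Real.logb 2 ((a + b) / a) + b * Real.logb 2 ((a + b) / b) := by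
  have hb : 0 < b := lt_of_lt_of_le ha hab
  have h1 : 1 ≤ Real.logb 2 ((a + b) / a) := by
    rw [Real.le_logb_iff_rpow_le (by norm_num) (by positivity), le_div_iff₀ ha]
    norm_num; linarith
  have h2 : a / b ≤ Real.logb 2 ((a + b) / b) := by
    rw [Real.le_logb_iff_rpow_le (by norm_num) (by positivity)]
    have := rpow_one_add_le_one_add_mul_self (s := 1) (p := a / b) (by norm_num)
      (by positivity) ((div_le_one hb).2 hab)
    calc (2 : ℝ) ^ (a / b) ≤ 1 + a / b * 1 := by norm_num at this ⊢; exact this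
      _ = (a + b) / b := by field_simp; ring
  have h3 : b * (a / b) = a := by field_simp
  nlinarith [mul_le_mul_of_nonneg_left h1 ha.le, mul_le_mul_of_nonneg_left h2 hb.le]

section Huffman

variable {α : Type}

instance : Std.Total (lighter (α := α)) := ⟨fun x y => le_total x.1 y.1⟩
instance : IsTrans (ℕ × CodeTree α) lighter := ⟨fun _ _ _ h h' => le_trans h h'⟩

/-- The result of Huffman's algorithm on weights of total `W` costs at most the entropy plus `W`.
The telescoping argument needs the stronger form with a lower bound `v` of all weights. -/
theorem huffmanMerge_spec (c : α → ℕ) (W : ℝ) (hW : 0 < W) (k : ℕ) :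
    ∀ (ws : List (ℕ × CodeTree α)) (v : ℕ), ws.length = k + 1 → ws.Pairwise lighter →
      (∀ x ∈ ws, 0 < x.1 ∧ x.1 = x.2.weight c ∧ v ≤ x.1) →
      (ws.map fun x => (x.1 : ℝ)).sum = W →
      ∃ T, huffmanMerge ws = some T ∧ T.letters.Perm (ws.flatMap fun x => x.2.letters) ∧
        (T.cost c : ℝ) + v ≤ (ws.map fun x => (x.1 : ℝ) * Real.logb 2 (W / x.1)).sum + W +
          (ws.map fun x => (x.2.cost c : ℝ)).sum := by
  induction k with
  | zero =>
    intro ws v hlen _ hpos hsum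
    match ws, hlen with
    | [(w, s)], _ =>
      refine ⟨s, by simp [huffmanMerge], by simp, ?_⟩
      have h := hpos (w, s) (by simp)
      simp only [List.map_cons, List.map_nil, List.sum_cons, List.sum_nil, add_zero] at hsum ⊢
      have h2 : (v : ℝ) ≤ w := by exact_mod_cast h.2.2
      rw [← hsum, div_self (by exact_mod_cast h.1.ne')]
      simp; linarith
  | succ k ih =>
    intro ws v hlen hsort hpos hsum
    match ws, hlen with
    | (a, s) :: (b, u) :: rest, hlen =>
      obtain ⟨ha, has, hva⟩ := hpos (a, s) (by simp)
      obtain ⟨hb, hbu, hvb⟩ := hpos (b, u) (by simp)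
      simp only at ha has hva hb hbu hvb
      have hperm := List.perm_orderedInsert lighter (a + b, CodeTree.node s u) rest
      rw [List.pairwise_cons, List.pairwise_cons] at hsort
      obtain ⟨hs1, hs2, hs3⟩ := hsort
      have hab : a ≤ b := hs1 (b, u) (by simp)
      obtain ⟨T, hT, hlet, hcost⟩ := ih
        (List.orderedInsert lighter (a + b, .node s u) rest) b
        (by simpa [List.orderedInsert_length] using hlen)
        (hs3.orderedInsert _ _)
        (by
          intro x hx
          rw [hperm.mem_iff, List.mem_cons] at hx
          rcases hx with rfl | hx
          · refine ⟨by simp; omega, ?_, by simp⟩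
            simp [CodeTree.weight, has, hbu]
          · have := hpos x (by simp [hx])
            exact ⟨this.1, this.2.1, hs2 x hx⟩)
        (by
          rw [(hperm.map _).sum_eq, ← hsum]
          simp; ring)
      refine ⟨T, by rw [huffmanMerge, hT], ?_, ?_⟩
      · refine hlet.trans ((hperm.flatMap_right _).trans ?_)
        simp [CodeTree.letters]
      · rw [(hperm.map _).sum_eq, (hperm.map _).sum_eq] at hcost
        simp only [List.map_cons, List.sum_cons, CodeTree.cost] at hcost ⊢
        rw [← has, ← hbu] at hcost
        push_cast at hcost
        have ha' : (0 : ℝ) < a := by exact_mod_cast ha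
        have hb' : (0 : ℝ) < b := by exact_mod_cast hb
        have key := two_mul_le_entropy ha' (show (a : ℝ) ≤ b by exact_mod_cast hab)
        have hva' : (v : ℝ) ≤ a := by exact_mod_cast hva
        rw [Real.logb_div (by positivity) (by positivity),
          Real.logb_div (by positivity) (by positivity)] at key
        rw [Real.logb_div (by positivity) (by positivity)] at hcost
        rw [Real.logb_div (by positivity) (by positivity),
          Real.logb_div (by positivity) (by positivity)]
        nlinarith

variable [DecidableEq α]

theorem sum_map_eq_sum_dedup (ms : List α) (f : α → ℝ) :
    (ms.map f).sum = (ms.dedup.map fun x => (ms.count x : ℝ) * f x).sum := by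
  rw [Finset.sum_list_map_count, ← List.sum_toFinset _ ms.nodup_dedup]
  refine Finset.sum_congr (by ext; simp) fun x _ => by simp

/-- The Huffman code of a string exceeds its zeroth-order empirical entropy by at most one bit per
letter. -/
theorem sum_length_huffmanCode_le (ms : List α) :
    (ms.map fun x => ((huffmanCode ms x).length : ℝ)).sum ≤
      (ms.map fun x => Real.logb 2 (ms.length / ms.count x)).sum + ms.length := by
  rcases eq_or_ne ms [] with rfl | hne
  · simp
  have hW : (0 : ℝ) < ms.length := by exact_mod_cast List.length_pos_iff.2 hne
  set ws₀ := ms.dedup.map fun x => (ms.count x, CodeTree.leaf x) with hws₀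
  have hperm := List.perm_insertionSort lighter ws₀
  have hlen : (List.insertionSort lighter ws₀).length ≠ 0 := by
    simpa [List.length_insertionSort, hws₀] using hne
  obtain ⟨k, hk⟩ := Nat.exists_eq_succ_of_ne_zero hlen
  obtain ⟨T, hT, hlet, hcost⟩ := huffmanMerge_spec (fun x => ms.count x) ms.length hW k
    (List.insertionSort lighter ws₀) 0 hk (List.pairwise_insertionSort _ _)
    (by
      intro x hx
      rw [hperm.mem_iff, hws₀, List.mem_map] at hx
      obtain ⟨y, hy, rfl⟩ := hx
      exact ⟨List.count_pos_iff.2 (List.mem_dedup.1 hy), by simp [CodeTree.weight], by simp⟩)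
    (by
      rw [(hperm.map _).sum_eq, hws₀, List.map_map]
      simpa [Function.comp_def] using (sum_map_eq_sum_dedup ms fun _ => 1).symm)
  have hlet' : T.letters.Perm ms.dedup := by
    refine hlet.trans ((hperm.flatMap_right _).trans ?_)
    simp [hws₀, List.flatMap_map, CodeTree.letters]
  have hcode : ∀ x, huffmanCode ms x = T.codeword x := by
    intro x
    simp only [huffmanCode]
    rw [← hws₀, hT]
  have h1 : (ms.map fun x => ((huffmanCode ms x).length : ℝ)).sum = T.cost fun x => ms.count x := by
    rw [← CodeTree.sum_length_codeword _ T (hlet'.nodup_iff.2 ms.nodup_dedup),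
      (hlet'.map _).sum_eq, sum_map_eq_sum_dedup]
    simp [hcode, Function.comp_def]
  have h2 : (ms.map fun x => Real.logb 2 (ms.length / ms.count x)).sum =
      ((List.insertionSort lighter ws₀).map fun x =>
        (x.1 : ℝ) * Real.logb 2 (ms.length / x.1)).sum := by
    rw [(hperm.map _).sum_eq, sum_map_eq_sum_dedup, hws₀, List.map_map]
    rfl
  have h3 : ((List.insertionSort lighter ws₀).map fun x =>
      (x.2.cost (fun x => ms.count x) : ℝ)).sum = 0 := by
    rw [(hperm.map _).sum_eq, hws₀, List.map_map]
    simp [Function.comp_def, CodeTree.cost]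
  rw [h1, h2]
  rw [h3] at hcost
  simpa using hcost

/-- Gibbs' inequality for lists: relative frequencies are the cheapest weights. -/
theorem sum_logb_count_le (ds : List α) (w : α → ℝ) (hw : ∀ d ∈ ds, 0 < w d) {Z : ℝ}
    (hZ : ∑ d ∈ ds.toFinset, w d ≤ Z) :
    (ds.map fun d => Real.logb 2 (ds.length / ds.count d)).sum ≤
      (ds.map fun d => Real.logb 2 (1 / w d)).sum + ds.length * Real.logb 2 Z := by
  rcases eq_or_ne ds [] with rfl | hne
  · simp
  have hm : (0 : ℝ) < ds.length := by exact_mod_cast List.length_pos_iff.2 hne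
  have hZ0 : 0 < Z := by
    obtain ⟨d, hd⟩ := List.exists_mem_of_ne_nil ds hne
    exact (hw d hd).trans_le ((Finset.single_le_sum (f := w) (fun x hx => (hw x (by simpa using hx)).le)
      (by simpa using hd)).trans hZ)
  have hl2 : 0 < Real.log 2 := Real.log_pos (by norm_num)
  have hconst : (ds.length : ℝ) * Real.logb 2 Z = (ds.map fun _ => Real.logb 2 Z).sum := by simp
  rw [hconst, ← List.sum_map_add, ← sub_nonpos]
  have : (ds.map fun d => Real.logb 2 (ds.length / ds.count d)).sum -
      (ds.map fun d => Real.logb 2 (1 / w d) + Real.logb 2 Z).sum =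
      ∑ d ∈ ds.toFinset, (ds.count d : ℝ) *
        (Real.logb 2 (ds.length / ds.count d) - (Real.logb 2 (1 / w d) + Real.logb 2 Z)) := by
    rw [Finset.sum_list_map_count, Finset.sum_list_map_count, ← Finset.sum_sub_distrib]
    refine Finset.sum_congr rfl fun d _ => ?_
    simp only [nsmul_eq_mul]; ring
  rw [this]
  have bound : ∀ d ∈ ds.toFinset, (ds.count d : ℝ) *
        (Real.logb 2 (ds.length / ds.count d) - (Real.logb 2 (1 / w d) + Real.logb 2 Z)) ≤
      (1 / Real.log 2) * (ds.length * w d / Z - ds.count d) := by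
    intro d hd
    have hd' := List.mem_toFinset.1 hd
    have hc : (0 : ℝ) < ds.count d := by exact_mod_cast List.count_pos_iff.2 hd'
    have hwd := hw d hd'
    have e : Real.logb 2 (ds.length / ds.count d) - (Real.logb 2 (1 / w d) + Real.logb 2 Z) =
        Real.log (ds.length * w d / (Z * ds.count d)) / Real.log 2 := by
      rw [← Real.logb_mul (by positivity) hZ0.ne', ← Real.logb_div (by positivity) (by positivity)]
      rw [Real.logb]; congr 2; field_simp
    rw [e]
    have hlog := Real.log_le_sub_one_of_pos (show 0 < ds.length * w d / (Z * ds.count d) by positivity)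
    calc (ds.count d : ℝ) * (Real.log (ds.length * w d / (Z * ds.count d)) / Real.log 2)
        ≤ ds.count d * ((ds.length * w d / (Z * ds.count d) - 1) / Real.log 2) := by gcongr
      _ = _ := by field_simp
  refine (Finset.sum_le_sum bound).trans ?_
  rw [← Finset.mul_sum, Finset.sum_sub_distrib]
  have hcnt : ∑ d ∈ ds.toFinset, (ds.count d : ℝ) = ds.length := by
    exact_mod_cast List.sum_toFinset_count_eq_length ds
  rw [hcnt, ← Finset.sum_div, ← Finset.mul_sum]
  have : (ds.length : ℝ) * ∑ d ∈ ds.toFinset, w d ≤ ds.length * Z := by gcongr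
  apply mul_nonpos_of_nonneg_of_nonpos (by positivity)
  rw [sub_nonpos, div_le_iff₀ hZ0]
  exact this

/-- The Huffman code is at most one bit per letter worse than any weights on decorated letters, up
to the logarithm of the total weight `Z`. The decoration may carry information that is not part of
the letter. -/
theorem sum_length_huffmanCode_le_of_weights {δ : Type} [DecidableEq δ] (ds : List δ) (proj : δ → α)
    (w : δ → ℝ) (hw : ∀ d ∈ ds, 0 < w d) {Z : ℝ} (hZ : ∑ d ∈ ds.toFinset, w d ≤ Z) :
    ((ds.map proj).map fun x => ((huffmanCode (ds.map proj) x).length : ℝ)).sum ≤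
      (ds.map fun d => Real.logb 2 (1 / w d)).sum + ds.length * Real.logb 2 Z + ds.length := by
  refine (sum_length_huffmanCode_le _).trans ?_
  have h := sum_logb_count_le ds w hw hZ
  have : ((ds.map proj).map fun x =>
      Real.logb 2 ((ds.map proj).length / (ds.map proj).count x)).sum ≤
      (ds.map fun d => Real.logb 2 (ds.length / ds.count d)).sum := by
    rw [List.map_map]
    apply List.sum_le_sum
    intro d hd
    have h1 : 0 < ds.count d := List.count_pos_iff.2 hd
    have h2 : ds.count d ≤ (ds.map proj).count (proj d) := List.count_le_count_map
    have hm : 0 < ds.length := List.length_pos_of_mem hd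
    simp only [Function.comp_apply, List.length_map]
    apply Real.logb_le_logb_of_le (by norm_num)
    · have : (0 : ℝ) < (ds.map proj).count (proj d) := by exact_mod_cast h1.trans_le h2
      have : (0 : ℝ) < ds.length := by exact_mod_cast hm
      positivity
    · have : (0 : ℝ) < ds.count d := by exact_mod_cast h1
      gcongr
  simp only [List.length_map] at this ⊢
  linarith

end Huffman

end Hypersuccinct

namespace Hypersuccinct

/-! ### Lengths of the parts of the code -/

@[simp] theorem length_fixedWidth (w x : ℕ) : (fixedWidth w x).length = w := by
  simp [fixedWidth]

@[simp] theorem length_eliasGamma (n : ℕ) : (eliasGamma n).length = 2 * Nat.log 2 n + 1 := by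
  simp [eliasGamma]; ring

theorem length_bp (t : BTree) : (bp t).length = 2 * t.numNodes := by
  induction t with
  | nil => simp [bp]
  | node a l r hl hr => simp [bp, hl, hr, BinaryTree.numNodes]; ring

theorem nat_log_succ_le (n : ℕ) : Nat.log 2 (n + 1) ≤ n := by
  have := Nat.log_lt_self 2 (x := n + 1) (by omega)
  omega

section Generic

variable {α : Type} (size : α → ℕ) (par : α → List Bool)

theorem length_lengthRestricted_le (C : α → List Bool) (x : α) (hx : (par x).length = 2 * size x) :
    (lengthRestricted size par C x).length ≤ (C x).length + 1 ∧
      (lengthRestricted size par C x).length ≤ 4 * size x + 2 := by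
  have := nat_log_succ_le (size x)
  unfold lengthRestricted
  split_ifs with h
  · simp only [List.length_cons, List.length_append, length_eliasGamma, hx]
    omega
  · simp only [List.length_cons]
    omega

variable [DecidableEq α]

theorem length_flatMap_microCode_le (ms : List α) (hpar : ∀ x ∈ ms, (par x).length = 2 * size x) :
    ((ms.flatMap (microCode size par ms)).length : ℝ) ≤
      (ms.map fun x => ((huffmanCode ms x).length : ℝ)).sum + ms.length := by
  have h : (ms.length : ℝ) = (ms.map fun _ => (1 : ℝ)).sum := by simp
  rw [h, ← List.sum_map_add, List.length_flatMap, Nat.cast_list_sum, List.map_map]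
  apply List.sum_le_sum
  intro x hx
  have := (length_lengthRestricted_le size par (huffmanCode ms) x (hpar x hx)).1
  simp only [Function.comp_apply, microCode]
  exact_mod_cast this

theorem length_codeTable_le (ms : List α) (N : ℕ) (hpar : ∀ x ∈ ms, (par x).length = 2 * size x)
    (hN : ∀ x ∈ ms, size x ≤ N) :
    (codeTable size par ms).length ≤ ms.dedup.length * (16 * N + 12) + 1 := by
  simp only [codeTable, List.length_append, length_eliasGamma, List.length_flatMap]
  have h1 := nat_log_succ_le ms.dedup.length
  have h2 : (ms.dedup.map fun a => ((2 * Nat.log 2 ((microCode size par ms a).length + 1) + 1 +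
      (microCode size par ms a).length + (2 * Nat.log 2 (size a) + 1)) + (par a).length)).sum ≤
      ms.dedup.length * (16 * N + 10) := by
    have := List.sum_le_card_nsmul (ms.dedup.map fun a =>
      ((2 * Nat.log 2 ((microCode size par ms a).length + 1) + 1 +
      (microCode size par ms a).length + (2 * Nat.log 2 (size a) + 1)) + (par a).length))
      (16 * N + 10) (by
        intro y hy
        obtain ⟨x, hx, rfl⟩ := List.mem_map.1 hy
        have hx := List.mem_dedup.1 hx
        have h3 : (microCode size par ms x).length ≤ 4 * size x + 2 :=
          (length_lengthRestricted_le size par _ x (hpar x hx)).2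
        have h4 := nat_log_succ_le (microCode size par ms x).length
        have h5 := Nat.log_le_self 2 (size x)
        have h6 := hN x hx
        have h7 := hpar x hx
        omega)
    simpa using this
  have h8 : ms.dedup.length * (16 * N + 12) = ms.dedup.length * (16 * N + 10) +
    2 * ms.dedup.length := by ring
  omega

/-- The letters, their code table and the code words together take at most the cost of arbitrary
weights on decorated letters, apart from lower-order terms. -/
theorem length_table_add_length_codes_le {δ : Type} [DecidableEq δ] (ds : List δ) (proj : δ → α)
    (N U : ℕ) (hpar : ∀ d ∈ ds, (par (proj d)).length = 2 * size (proj d))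
    (hN : ∀ d ∈ ds, size (proj d) ≤ N) (hU : (ds.map proj).dedup.length ≤ U)
    (w : δ → ℝ) (hw : ∀ d ∈ ds, 0 < w d) {Z : ℝ} (hZ : ∑ d ∈ ds.toFinset, w d ≤ Z) :
    ((codeTable size par (ds.map proj)).length : ℝ) +
      (((ds.map proj).flatMap (microCode size par (ds.map proj))).length : ℝ) ≤
      (ds.map fun d => Real.logb 2 (1 / w d)).sum + ds.length * (Real.logb 2 Z + 2) +
        (U * (16 * N + 12) + 1) := by
  have hpar' : ∀ x ∈ ds.map proj, (par x).length = 2 * size x := by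
    simpa using hpar
  have hN' : ∀ x ∈ ds.map proj, size x ≤ N := by simpa using hN
  have h1 := length_flatMap_microCode_le size par (ds.map proj) hpar'
  have h2 := length_codeTable_le size par (ds.map proj) N hpar' hN'
  have h3 := sum_length_huffmanCode_le_of_weights ds proj w hw hZ
  have h4 : ((codeTable size par (ds.map proj)).length : ℝ) ≤ U * (16 * N + 12) + 1 := by
    have := h2.trans (Nat.add_le_add_right (Nat.mul_le_mul_right _ hU) 1)
    exact_mod_cast this
  rw [List.length_map] at h1
  linarith

end Generic

/-! ### The decomposition of binary trees -/

namespace BCover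

/-- The decomposed tree. -/
def toTree : BCover → BTree
  | .nil => .nil
  | .portal c => c.toTree
  | .node l r => .node () l.toTree r.toTree

/-- The number of portals of a component. -/
def portals : BCover → ℕ
  | .nil => 0
  | .portal _ => 1
  | .node l r => l.portals + r.portals

/-- The component is nonempty. -/
def IsNode : BCover → Prop
  | .node _ _ => True
  | _ => False

/-- Portals lead to nonempty components. -/
def WF : BCover → Prop
  | .nil => True
  | .portal c => c.IsNode ∧ c.WF
  | .node l r => l.WF ∧ r.WF

/-- A tree as a component without portals. -/
def ofTree : BTree → BCover
  | .nil => .nil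
  | .node _ l r => .node (ofTree l) (ofTree r)

@[simp] theorem localSize_ofTree (t : BTree) : (ofTree t).localSize = t.numNodes := by
  induction t with
  | nil => rfl
  | node a l r hl hr => simp [ofTree, localSize, hl, hr, BinaryTree.numNodes]

@[simp] theorem components_ofTree (t : BTree) : (ofTree t).components = [] := by
  induction t with
  | nil => rfl
  | node a l r hl hr => simp [ofTree, components, hl, hr]

@[simp] theorem shape_ofTree (t : BTree) : (ofTree t).shape = t := by
  induction t with
  | nil => rfl
  | node a l r hl hr => simp [ofTree, shape, hl, hr]

@[simp] theorem portals_ofTree (t : BTree) : (ofTree t).portals = 0 := by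
  induction t with
  | nil => rfl
  | node a l r hl hr => simp [ofTree, portals, hl, hr]

theorem numNodes_shape (c : BCover) : c.shape.numNodes = c.localSize := by
  induction c with
  | nil => rfl
  | portal c _ => rfl
  | node l r hl hr => simp [shape, localSize, hl, hr, BinaryTree.numNodes]

theorem numNodes_topTier_le (c : BCover) :
    c.topTier.numNodes ≤ c.components.length ∧
      (portal c).topTier.numNodes ≤ (portal c).components.length := by
  induction c with
  | nil => simp [topTier, BinaryTree.numNodes, components]
  | portal c ih => exact ⟨ih.2, by simp [topTier, BinaryTree.numNodes]⟩
  | node l r hl hr =>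
    constructor
    · simp only [topTier, components, List.length_append]
      split_ifs
      · exact hr.1.trans (by omega)
      · exact hl.1.trans (by omega)
    · simp only [topTier, components, List.length_append, List.length_cons, BinaryTree.numNodes]
      have := hl.1; have := hr.1
      omega

end BCover

open BCover

theorem isNode_coverBinary (B : ℕ) {t : BTree} (ht : t ≠ .nil) : (coverBinary B t).1.IsNode := by
  cases t with
  | nil => exact absurd rfl ht
  | node a l r => unfold coverBinary; split_ifs <;> trivial

theorem coverBinary_light {B : ℕ} {t : BTree} (ht : t.numNodes < B) :
    coverBinary B t = (ofTree t, false) := by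
  induction t with
  | nil => rfl
  | node a l r hl hr =>
    simp only [BinaryTree.numNodes] at ht
    have h1 := hl (by omega)
    have h2 := hr (by omega)
    rw [coverBinary, if_neg (by omega), h1, h2]
    simp [attach, ofTree, localSize]
    omega

@[simp] theorem toTree_attach (x : BCover × Bool) : (attach x).toTree = x.1.toTree := by
  unfold attach; split_ifs <;> simp [toTree]

theorem toTree_coverBinary (B : ℕ) (t : BTree) : (coverBinary B t).1.toTree = t := by
  induction t with
  | nil => rfl
  | node a l r hl hr =>
    unfold coverBinary
    split_ifs <;> simp [toTree, hl, hr]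

theorem wf_attach {B : ℕ} {t : BTree} (h : (coverBinary B t).1.WF) :
    (attach (coverBinary B t)).WF := by
  unfold attach
  split_ifs with h1
  · refine ⟨isNode_coverBinary B ?_, h⟩
    rintro rfl
    simp [coverBinary] at h1
  · exact h

theorem wf_coverBinary {B : ℕ} (hB : 1 ≤ B) (t : BTree) : (coverBinary B t).1.WF := by
  induction t with
  | nil => trivial
  | node a l r hl hr =>
    unfold coverBinary
    split_ifs with h
    · refine ⟨⟨isNode_coverBinary B ?_, hl⟩, ⟨isNode_coverBinary B ?_, hr⟩⟩
      · rintro rfl; simp [BinaryTree.numNodes] at h; omega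
      · rintro rfl; simp [BinaryTree.numNodes] at h; omega
    · exact ⟨wf_attach hl, wf_attach hr⟩

/-- A property of components holds for a component and all components below it. -/
def BCover.All (p : BCover → Prop) (c : BCover) : Prop := p c ∧ ∀ d ∈ c.components, p d

/-- Components have fewer than `2 B` nodes; an active component has fewer than `B` nodes and at most
one portal. Every component has at most two portals. -/
theorem coverBinary_local {B : ℕ} (hB : 1 ≤ B) (t : BTree) :
    BCover.All (fun c => c.localSize < 2 * B ∧ c.portals ≤ 2) (coverBinary B t).1 ∧
      ((coverBinary B t).2 = false →
        (coverBinary B t).1.localSize < B ∧ (coverBinary B t).1.portals ≤ 1) := by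
  induction t with
  | nil => simp [coverBinary, BCover.All, localSize, portals, components]; omega
  | node a l r hl hr =>
    by_cases h : B ≤ l.numNodes ∧ B ≤ r.numNodes
    · rw [coverBinary, if_pos h]
      refine ⟨⟨⟨by simp [localSize]; omega, by simp [portals]⟩, ?_⟩, by simp⟩
      intro d hd
      simp only [components, List.mem_append, List.mem_cons] at hd
      rcases hd with (rfl | hd) | (rfl | hd)
      · exact hl.1.1
      · exact hl.1.2 d hd
      · exact hr.1.1
      · exact hr.1.2 d hd
    · rw [coverBinary, if_neg h]
      have key : ∀ s : BTree,
          (BCover.All (fun c => c.localSize < 2 * B ∧ c.portals ≤ 2) (coverBinary B s).1 ∧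
            ((coverBinary B s).2 = false →
            (coverBinary B s).1.localSize < B ∧ (coverBinary B s).1.portals ≤ 1)) →
          (attach (coverBinary B s)).localSize < B ∧ (attach (coverBinary B s)).portals ≤ 1 ∧
          (s.numNodes < B → (attach (coverBinary B s)).portals = 0) ∧
          ∀ d ∈ (attach (coverBinary B s)).components, d.localSize < 2 * B ∧ d.portals ≤ 2 := by
        intro s hs
        rcases hp : (coverBinary B s).2 with _ | _
        · have e : attach (coverBinary B s) = (coverBinary B s).1 := by simp [attach, hp]
          rw [e]
          refine ⟨(hs.2 hp).1, (hs.2 hp).2, fun hlt => ?_, hs.1.2⟩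
          rw [coverBinary_light hlt]; simp
        · have e : attach (coverBinary B s) = .portal (coverBinary B s).1 := by simp [attach, hp]
          rw [e]
          refine ⟨by simp [localSize]; omega, by simp [portals], fun hlt => ?_, ?_⟩
          · rw [coverBinary_light hlt] at hp; simp at hp
          · intro d hd
            rcases List.mem_cons.1 hd with rfl | hd
            · exact hs.1.1
            · exact hs.1.2 d hd
      have kl := key l hl
      have kr := key r hr
      have hport : (attach (coverBinary B l)).portals + (attach (coverBinary B r)).portals ≤ 1 := by
        by_cases h1 : l.numNodes < B
        · have := kl.2.2.1 h1; have := kr.2.1; omega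
        · have := kr.2.2.1 (by omega); have := kl.2.1; omega
      refine ⟨⟨⟨by simp only [localSize]; omega, by simp only [portals]; omega⟩, ?_⟩, ?_⟩
      · intro d hd
        rcases List.mem_append.1 hd with hd | hd
        · exact kl.2.2.2 d hd
        · exact kr.2.2.2 d hd
      · intro hp
        simp only [decide_eq_false_iff_not, not_le] at hp
        exact ⟨hp, hport⟩

/-- The number of micro trees of the two kinds is controlled by the potential `B M + a`, where `M`
counts the permanent components and `a` is the size of an active one. -/
theorem coverBinary_potential {B : ℕ} (t : BTree) (ht : B ≤ t.numNodes) :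
    B * ((coverBinary B t).1.components.length + if (coverBinary B t).2 then 1 else 0) +
      (if (coverBinary B t).2 then 0 else (coverBinary B t).1.localSize) + 3 * B ≤
      4 * t.numNodes := by
  induction t with
  | nil =>
    have : B = 0 := by simpa [BinaryTree.numNodes] using ht
    simp [coverBinary, this, localSize]
  | node a l r hl hr =>
    by_cases h : B ≤ l.numNodes ∧ B ≤ r.numNodes
    · have h1 := hl h.1
      have h2 := hr h.2
      rw [coverBinary, if_pos h]
      simp only [components, List.length_append, List.length_cons, BinaryTree.numNodes, if_true]
      have e1 : B * (coverBinary B l).1.components.length ≤ B * ((coverBinary B l).1.components.length +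
        if (coverBinary B l).2 then 1 else 0) := Nat.mul_le_mul_left _ (by omega)
      have e2 : B * (coverBinary B r).1.components.length ≤ B * ((coverBinary B r).1.components.length +
        if (coverBinary B r).2 then 1 else 0) := Nat.mul_le_mul_left _ (by omega)
      simp only [Nat.mul_add, Nat.mul_one] at *
      omega
    · rw [coverBinary, if_neg h]
      have key : ∀ s : BTree, (B ≤ s.numNodes →
          B * ((coverBinary B s).1.components.length + if (coverBinary B s).2 then 1 else 0) +
          (if (coverBinary B s).2 then 0 else (coverBinary B s).1.localSize) + 3 * B ≤
          4 * s.numNodes) →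
          B * (attach (coverBinary B s)).components.length + (attach (coverBinary B s)).localSize ≤
            4 * s.numNodes - (if s.numNodes < B then 3 * s.numNodes else 3 * B) := by
        intro s hs
        split_ifs with hlt
        · rw [coverBinary_light hlt]; simp [attach]; omega
        · have := hs (by omega)
          rcases hp : (coverBinary B s).2 with _ | _
          · have e : attach (coverBinary B s) = (coverBinary B s).1 := by simp [attach, hp]
            rw [e]
            simp [hp] at this
            omega
          · have e : attach (coverBinary B s) = .portal (coverBinary B s).1 := by simp [attach, hp]
            rw [e]
            simp [hp] at this
            simp only [components, List.length_cons, localSize]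
            omega
      have kl := key l hl
      have kr := key r hr
      set x := attach (coverBinary B l)
      set y := attach (coverBinary B r)
      simp only [components, List.length_append, BinaryTree.numNodes, localSize] at ht ⊢
      by_cases hB : B ≤ x.localSize + y.localSize + 1 <;>
        by_cases h1 : l.numNodes < B <;> by_cases h2 : r.numNodes < B <;>
        simp only [hB, h1, h2, decide_true, decide_false, Bool.false_eq_true, if_true, if_false,
          Nat.mul_add, Nat.mul_one, Nat.mul_zero] at kl kr ⊢ <;> omega

theorem length_microTreesBinary_le {B : ℕ} {t : BTree} (ht : B ≤ t.numNodes) :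
    B * (microTreesBinary B t).length ≤ 4 * t.numNodes := by
  unfold microTreesBinary
  split_ifs with h
  · simp
  · have := coverBinary_potential t ht
    simp only [components, List.length_cons, Nat.mul_add, Nat.mul_one] at *
    omega

theorem microTreesBinary_local {B : ℕ} (hB : 1 ≤ B) (t : BTree) :
    ∀ c ∈ microTreesBinary B t, c.localSize < 2 * B ∧ c.portals ≤ 2 := by
  intro c hc
  unfold microTreesBinary at hc
  split_ifs at hc with h
  · simp at hc
  · rcases List.mem_cons.1 hc with rfl | hc
    · exact (coverBinary_local hB t).1.1
    · exact (coverBinary_local hB t).1.2 c hc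

theorem numNodes_topTierBinary_le (B : ℕ) (t : BTree) :
    (topTierBinary B t).numNodes ≤ (microTreesBinary B t).length := by
  unfold topTierBinary microTreesBinary
  split_ifs
  · simp [BinaryTree.numNodes]
  · exact (numNodes_topTier_le _).2

/-! ### The number of shapes -/

/-- The binary trees with fewer than `N` nodes. -/
def treesBelow (N : ℕ) : Finset BTree :=
  (Finset.range N).biUnion BinaryTree.treesOfNumNodesEq

@[simp] theorem mem_treesBelow {N : ℕ} {t : BTree} : t ∈ treesBelow N ↔ t.numNodes < N := by
  simp [treesBelow, BinaryTree.mem_treesOfNumNodesEq]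

theorem card_treesBelow_le (N : ℕ) : (treesBelow N).card ≤ 4 ^ N := by
  refine (Finset.card_biUnion_le).trans ?_
  have : ∀ k ∈ Finset.range N, (BinaryTree.treesOfNumNodesEq k).card ≤ 4 ^ k := by
    intro k _
    rw [BinaryTree.treesOfNumNodesEq_card_eq_catalan, catalan_eq_centralBinom_div]
    refine (Nat.div_le_self _ _).trans ?_
    rw [Nat.centralBinom_eq_two_mul_choose]
    calc (2 * k).choose k ≤ 2 ^ (2 * k) := Nat.choose_le_two_pow _ _
      _ = 4 ^ k := by rw [pow_mul]; norm_num
  refine (Finset.sum_le_sum this).trans ?_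
  clear this
  induction N with
  | zero => simp
  | succ n ih => rw [Finset.sum_range_succ, pow_succ]; omega

/-- The length of the hypersuccinct code of a nonempty binary tree, for arbitrary weights on
decorated micro trees. -/
theorem length_encodeBinary_le {B w₀ : ℕ} (hB : 1 ≤ B) (t : BTree) {δ : Type} [DecidableEq δ]
    (ds : List δ) (proj : δ → BTree) (hds : ds.map proj = (microTreesBinary B t).map BCover.shape)
    (w : δ → ℝ) (hw : ∀ d ∈ ds, 0 < w d) {Z : ℝ} (hZ : ∑ d ∈ ds.toFinset, w d ≤ Z) :
    ((encodeBinary B w₀ t).length : ℝ) ≤ (ds.map fun d => Real.logb 2 (1 / w d)).sum +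
      ds.length * (Real.logb 2 Z + 6 + 2 * w₀) + 2 * Nat.log 2 (t.numNodes + 1) +
        (16 ^ B * (32 * B + 12) + 3) := by
  have hlen : (microTreesBinary B t).length = ds.length := by
    simpa using (congrArg List.length hds).symm
  have hmem : ∀ d ∈ ds, (proj d).numNodes < 2 * B := by
    intro d hd
    have : proj d ∈ (microTreesBinary B t).map BCover.shape := hds ▸ List.mem_map_of_mem hd
    obtain ⟨c, hc, hcd⟩ := List.mem_map.1 this
    rw [← hcd, numNodes_shape]
    exact (microTreesBinary_local hB t c hc).1
  have hU : (ds.map proj).dedup.length ≤ 16 ^ B := by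
    rw [← List.card_toFinset]
    have : (ds.map proj).toFinset ⊆ treesBelow (2 * B) := by
      intro x hx
      simp only [List.mem_toFinset, List.mem_map] at hx
      obtain ⟨d, hd, rfl⟩ := hx
      simpa using hmem d hd
    refine (Finset.card_le_card this).trans ((card_treesBelow_le _).trans ?_)
    rw [pow_mul]; norm_num
  have h := length_table_add_length_codes_le BinaryTree.numNodes bp ds proj (2 * B) (16 ^ B)
    (fun d _ => length_bp _) (fun d hd => (hmem d hd).le) hU w hw hZ
  have htop : (bp (topTierBinary B t)).length ≤ 2 * ds.length := by
    rw [length_bp, ← hlen]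
    exact Nat.mul_le_mul_left _ (numNodes_topTierBinary_le B t)
  have hlog := nat_log_succ_le ds.length
  have hport : ((microTreesBinary B t).flatMap fun c =>
      fixedWidth w₀ c.portalRanks.1 ++ fixedWidth w₀ c.portalRanks.2).length =
      ds.length * (2 * w₀) := by
    rw [List.length_flatMap]
    simp [hlen, two_mul]
  unfold encodeBinary
  simp only [List.length_append, hport, ← hds, length_eliasGamma, hlen]
  push_cast at h ⊢
  have htop' : ((bp (topTierBinary B t)).length : ℝ) ≤ 2 * ds.length := by exact_mod_cast htop
  have hlog' : (Nat.log 2 (ds.length + 1) : ℝ) ≤ ds.length := by exact_mod_cast hlog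
  nlinarith

end Hypersuccinct

namespace Hypersuccinct

/-! ### Asymptotics of the block parameter -/

theorem one_le_blockParam (n : ℕ) : 1 ≤ blockParam n := le_max_left _ _

theorem le_pow_blockParam {n : ℕ} : n ≤ 256 ^ blockParam n := by
  rcases Nat.eq_zero_or_pos n with rfl | hn
  · simp
  have h1 : Real.logb 2 n / 8 ≤ blockParam n :=
    (Nat.le_ceil _).trans (by exact_mod_cast le_max_right _ _)
  have h2 : Real.logb 2 n ≤ ((8 * blockParam n : ℕ) : ℝ) := by push_cast; linarith
  rw [Real.logb_le_iff_le_rpow (by norm_num) (by exact_mod_cast hn), Real.rpow_natCast, pow_mul] at h2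
  norm_num at h2
  exact_mod_cast h2

theorem pow_blockParam_le {n : ℕ} (hn : 1 ≤ n) : 256 ^ (blockParam n - 1) ≤ n := by
  rcases le_or_gt (blockParam n) 1 with h | h
  · simpa [Nat.sub_eq_zero_of_le h] using hn
  have h1 : blockParam n = ⌈Real.logb 2 n / 8⌉₊ := by
    unfold blockParam at h ⊢
    rcases max_choice 1 ⌈Real.logb 2 n / 8⌉₊ with h' | h'
    · omega
    · exact h'
  have h2 : blockParam n - 1 < ⌈Real.logb 2 n / 8⌉₊ := by omega
  rw [Nat.lt_ceil] at h2
  have h3 : ((8 * (blockParam n - 1) : ℕ) : ℝ) ≤ Real.logb 2 n := by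
    push_cast at h2 ⊢; linarith
  rw [Real.le_logb_iff_rpow_le (by norm_num) (by exact_mod_cast hn), Real.rpow_natCast, pow_mul] at h3
  norm_num at h3
  exact_mod_cast h3

theorem blockParam_le {n : ℕ} (hn : 1 ≤ n) : blockParam n ≤ n := by
  refine le_trans ?_ (pow_blockParam_le hn)
  have := Nat.lt_pow_self (n := blockParam n - 1) (show 1 < 256 by norm_num)
  omega

theorem microBound_le (n : ℕ) : microBound n ≤ 2 * blockParam n := by
  have h1 : Real.logb 2 n / 8 ≤ blockParam n :=
    (Nat.le_ceil _).trans (by exact_mod_cast le_max_right _ _)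
  rw [microBound, Nat.ceil_le]
  push_cast
  linarith

theorem portalWidth_le (n : ℕ) : (portalWidth n : ℝ) ≤ Real.logb 2 (4 * (blockParam n + 1)) := by
  have hB := one_le_blockParam n
  set B := blockParam n
  have h1 : portalWidth n ≤ Nat.clog 2 (2 * B + 1) :=
    Nat.clog_mono_right 2 (Nat.add_le_add_right (microBound_le n) 1)
  have h2 : (Nat.clog 2 (2 * B + 1) : ℝ) ≤ Real.logb 2 ((2 * B + 1 : ℕ) : ℝ) + 1 := by
    rw [← Real.natCeil_logb_natCast]
    refine (Nat.ceil_lt_add_one ?_).le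
    exact Real.logb_nonneg (by norm_num) (by exact_mod_cast (by omega))
  have h3 : Real.logb 2 ((2 * B + 1 : ℕ) : ℝ) + 1 = Real.logb 2 (((2 * B + 1 : ℕ) : ℝ) * 2) := by
    rw [Real.logb_mul (by positivity) (by norm_num), Real.logb_self_eq_one (by norm_num)]
  calc (portalWidth n : ℝ) ≤ Nat.clog 2 (2 * B + 1) := by exact_mod_cast h1
    _ ≤ _ := h2
    _ = _ := h3
    _ ≤ _ := by
      apply Real.logb_le_logb_of_le (by norm_num) (by positivity)
      push_cast; linarith

theorem log_succ_le (n : ℕ) : Nat.log 2 (n + 1) ≤ 8 * blockParam n + 1 := by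
  have h : n + 1 ≤ 2 ^ (8 * blockParam n + 1) := by
    have := le_pow_blockParam (n := n)
    have h1 : 1 ≤ 256 ^ blockParam n := Nat.one_le_pow _ _ (by norm_num)
    rw [pow_succ, pow_mul]; norm_num; omega
  calc Nat.log 2 (n + 1) ≤ Nat.log 2 (2 ^ (8 * blockParam n + 1)) := Nat.log_mono_right h
    _ = _ := Nat.log_pow (by norm_num) _

theorem tendsto_blockParam : Tendsto blockParam atTop atTop := by
  rw [tendsto_atTop_atTop]
  intro b
  refine ⟨256 ^ b, fun n hn => ?_⟩
  exact (Nat.pow_le_pow_iff_right (by norm_num)).1 (hn.trans le_pow_blockParam)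

/-- Functions of the block parameter that tend to zero give sublinear bounds. -/
theorem isLittleO_mul_blockParam {f : ℕ → ℝ} (hf : Tendsto f atTop (nhds 0)) (C : ℝ) :
    (fun n : ℕ => (n : ℝ) * f (blockParam n) + C) =o[atTop] (fun n : ℕ => (n : ℝ)) := by
  apply IsLittleO.add
  · have h : (fun n : ℕ => f (blockParam n)) =o[atTop] (fun _ : ℕ => (1 : ℝ)) :=
      (isLittleO_one_iff ℝ).2 (hf.comp tendsto_blockParam)
    simpa using (isBigO_refl (fun n : ℕ => (n : ℝ)) atTop).mul_isLittleO h
  · exact isLittleO_const_left.2 (Or.inr (tendsto_norm_atTop_atTop.comp tendsto_natCast_atTop_atTop))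

theorem tendsto_logb_div_rpow {C κ : ℝ} (hC : 0 < C) (hκ : 0 < κ) (k : ℕ) :
    Tendsto (fun B : ℕ => Real.logb 2 (C * ((B : ℝ) + 1) ^ k) / (B : ℝ) ^ κ) atTop (nhds 0) := by
  have h1 : Tendsto (fun B : ℕ => ((B : ℝ)) ^ κ) atTop atTop :=
    (tendsto_rpow_atTop hκ).comp tendsto_natCast_atTop_atTop
  have h2 : Tendsto (fun B : ℕ => Real.log ((B : ℝ) + 1) / ((B : ℝ) + 1) ^ κ) atTop (nhds 0) :=
    ((isLittleO_log_rpow_atTop hκ).tendsto_div_nhds_zero).comp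
      (tendsto_atTop_add_const_right _ 1 tendsto_natCast_atTop_atTop)
  have h3 : Tendsto (fun B : ℕ => Real.log ((B : ℝ) + 1) / (B : ℝ) ^ κ) atTop (nhds 0) := by
    have h4 : Tendsto (fun B : ℕ => (2 : ℝ) ^ κ *
        (Real.log ((B : ℝ) + 1) / ((B : ℝ) + 1) ^ κ)) atTop (nhds 0) := by
      simpa using h2.const_mul ((2 : ℝ) ^ κ)
    refine squeeze_zero' ?_ ?_ h4
    · filter_upwards with B
      have : 0 ≤ Real.log ((B : ℝ) + 1) := Real.log_nonneg (by linarith [Nat.cast_nonneg (α := ℝ) B])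
      positivity
    · filter_upwards [eventually_ge_atTop 1] with B hB
      have hB' : (1 : ℝ) ≤ B := by exact_mod_cast hB
      have h5 : ((B : ℝ) + 1) ^ κ ≤ 2 ^ κ * (B : ℝ) ^ κ := by
        rw [← Real.mul_rpow (by norm_num) (by positivity)]
        exact Real.rpow_le_rpow (by positivity) (by linarith) hκ.le
      have h6 : 0 ≤ Real.log ((B : ℝ) + 1) := Real.log_nonneg (by linarith)
      rw [mul_div_assoc', div_le_div_iff₀ (by positivity) (by positivity)]
      nlinarith [mul_le_mul_of_nonneg_left h5 h6]
  have h7 : Tendsto (fun B : ℕ => Real.log C / Real.log 2 * ((B : ℝ) ^ κ)⁻¹ +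
      (k / Real.log 2) * (Real.log ((B : ℝ) + 1) / (B : ℝ) ^ κ)) atTop (nhds 0) := by
    simpa using (h1.inv_tendsto_atTop.const_mul _).add (h3.const_mul (k / Real.log 2))
  refine h7.congr fun B => ?_
  rw [Real.logb, Real.log_mul hC.ne' (by positivity), Real.log_pow]
  ring

/-- The error term common to all bounds, relative to the size of the tree. -/
noncomputable def errorRate (B : ℕ) : ℝ :=
  8 * ((6 + 2 * Real.logb 2 (4 * (B + 1))) / B) +
    (16 * B + 2 + (16 ^ B * (64 * B + 12) + 3)) / 256 ^ (B - 1)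

theorem tendsto_errorRate : Tendsto errorRate atTop (nhds 0) := by
  have h1 := tendsto_logb_div_rpow (C := 4) (κ := 1) (by norm_num) (by norm_num) 1
  have h2 : Tendsto (fun B : ℕ => ((B : ℝ))⁻¹) atTop (nhds 0) :=
    tendsto_inv_atTop_zero.comp tendsto_natCast_atTop_atTop
  have p (k : ℕ) {r : ℝ} (hr : |r| < 1) := tendsto_pow_const_mul_const_pow_of_abs_lt_one k hr
  have e1 := p 1 (r := 1 / 256) (by rw [abs_of_pos] <;> norm_num)
  have e2 := p 0 (r := 1 / 256) (by rw [abs_of_pos] <;> norm_num)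
  have e3 := p 1 (r := 16 / 256) (by rw [abs_of_pos] <;> norm_num)
  have e4 := p 0 (r := 16 / 256) (by rw [abs_of_pos] <;> norm_num)
  have h3 : Tendsto (fun B : ℕ => 8 * (6 * ((B : ℝ))⁻¹ +
        2 * (Real.logb 2 (4 * ((B : ℝ) + 1) ^ 1) / (B : ℝ) ^ (1 : ℝ))) +
      256 * (16 * ((B : ℝ) ^ 1 * (1 / 256) ^ B) + 5 * ((B : ℝ) ^ 0 * (1 / 256) ^ B) +
        64 * ((B : ℝ) ^ 1 * (16 / 256) ^ B) + 12 * ((B : ℝ) ^ 0 * (16 / 256) ^ B)))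
      atTop (nhds 0) := by
    have := (((h2.const_mul 6).add (h1.const_mul 2)).const_mul 8).add
      (((((e1.const_mul 16).add (e2.const_mul 5)).add (e3.const_mul 64)).add
        (e4.const_mul 12)).const_mul 256)
    simpa using this
  refine h3.congr' ?_
  filter_upwards [eventually_ge_atTop 1] with B hB
  have hB' : (B : ℝ) ≠ 0 := by exact_mod_cast (by omega)
  obtain ⟨k, rfl⟩ : ∃ k, B = k + 1 := ⟨B - 1, by omega⟩
  rw [errorRate, Nat.add_sub_cancel]
  simp only [div_pow, one_pow, pow_one, pow_zero, Real.rpow_one, one_mul]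
  have : (256 : ℝ) ^ (k + 1) = 256 * 256 ^ k := by ring
  rw [this]
  field_simp
  ring

theorem errorRate_nonneg (B : ℕ) : 0 ≤ errorRate B := by
  have : 0 ≤ Real.logb 2 (4 * (B + 1)) :=
    Real.logb_nonneg (by norm_num) (by linarith [Nat.cast_nonneg (α := ℝ) B])
  unfold errorRate
  positivity

/-- Collecting the lower-order terms of a code with `m ≤ 8 n / B` micro trees. -/
theorem lower_order_le {n m : ℕ} (hm : blockParam n * m ≤ 8 * n) :
    (m : ℝ) * (6 + 2 * portalWidth n) + 2 * Nat.log 2 (n + 1) +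
        (16 ^ blockParam n * (64 * blockParam n + 12) + 3) ≤
      n * errorRate (blockParam n) + 2000 := by
  rcases Nat.eq_zero_or_pos n with rfl | hn
  · have hb : blockParam 0 = 1 := by simp [blockParam]
    have hm0 : m = 0 := by rw [hb] at hm; omega
    subst hm0
    rw [hb]; norm_num
  have hB := one_le_blockParam n
  have h1 := portalWidth_le n
  have h2 := log_succ_le n
  have h3 := pow_blockParam_le hn
  set B := blockParam n
  have hB0 : (0 : ℝ) < B := by exact_mod_cast hB
  have hm' : (m : ℝ) ≤ 8 * n / B := by
    rw [le_div_iff₀ hB0, mul_comm]; exact_mod_cast hm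
  have h2' : (Nat.log 2 (n + 1) : ℝ) ≤ 8 * B + 1 := by exact_mod_cast h2
  have h3' : (256 : ℝ) ^ (B - 1) ≤ n := by exact_mod_cast h3
  have hq : 0 ≤ 6 + 2 * Real.logb 2 (4 * (B + 1)) := by
    have : 0 ≤ Real.logb 2 (4 * ((B : ℝ) + 1)) := Real.logb_nonneg (by norm_num) (by linarith)
    linarith
  have a1 : (m : ℝ) * (6 + 2 * portalWidth n) ≤
      8 * n / B * (6 + 2 * Real.logb 2 (4 * (B + 1))) := by
    calc (m : ℝ) * (6 + 2 * portalWidth n) ≤ m * (6 + 2 * Real.logb 2 (4 * (B + 1))) := by gcongr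
      _ ≤ _ := by gcongr
  have a2 : 16 * (B : ℝ) + 2 + (16 ^ B * (64 * B + 12) + 3) ≤
      n * ((16 * B + 2 + (16 ^ B * (64 * B + 12) + 3)) / 256 ^ (B - 1)) := by
    rw [mul_div_assoc', le_div_iff₀ (by positivity), mul_comm]
    gcongr
  have e : (n : ℝ) * errorRate B = 8 * n / B * (6 + 2 * Real.logb 2 (4 * (B + 1))) +
      n * ((16 * B + 2 + (16 ^ B * (64 * B + 12) + 3)) / 256 ^ (B - 1)) := by
    unfold errorRate; ring
  rw [e]
  linarith

/-- The code length of a binary tree for arbitrary weights on decorated micro trees. -/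
theorem length_hyperBinary_le (t : BTree) {δ : Type} [DecidableEq δ] (ds : List δ)
    (proj : δ → BTree)
    (hds : ds.map proj = (microTreesBinary (blockParam t.numNodes) t).map BCover.shape)
    (w : δ → ℝ) (hw : ∀ d ∈ ds, 0 < w d) {Z : ℝ} (hZ : ∑ d ∈ ds.toFinset, w d ≤ Z) (hZ1 : 1 ≤ Z) :
    ((hyperBinary t).length : ℝ) ≤ (ds.map fun d => Real.logb 2 (1 / w d)).sum +
      t.numNodes * (8 * Real.logb 2 Z / blockParam t.numNodes + errorRate (blockParam t.numNodes)) +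
        2000 := by
  have h := length_encodeBinary_le (w₀ := portalWidth t.numNodes) (one_le_blockParam t.numNodes)
    t ds proj hds w hw hZ
  have hlen : (microTreesBinary (blockParam t.numNodes) t).length = ds.length := by
    simpa using (congrArg List.length hds).symm
  have hB := one_le_blockParam t.numNodes
  have hm : blockParam t.numNodes * ds.length ≤ 8 * t.numNodes := by
    rw [← hlen]
    rcases eq_or_ne t .nil with rfl | ht
    · simp [microTreesBinary]
    · have : 1 ≤ t.numNodes := by
        cases t with
        | nil => exact absurd rfl ht
        | node a l r => simp [BinaryTree.numNodes]
      have := length_microTreesBinary_le (blockParam_le this)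
      omega
  have hl := lower_order_le hm
  have hlZ : 0 ≤ Real.logb 2 Z := Real.logb_nonneg (by norm_num) hZ1
  have hB0 : (0 : ℝ) < blockParam t.numNodes := by exact_mod_cast hB
  have hm' : (ds.length : ℝ) ≤ 8 * t.numNodes / blockParam t.numNodes := by
    rw [le_div_iff₀ hB0, mul_comm]; exact_mod_cast hm
  have a1 : (ds.length : ℝ) * Real.logb 2 Z ≤
      t.numNodes * (8 * Real.logb 2 Z / blockParam t.numNodes) := by
    calc (ds.length : ℝ) * Real.logb 2 Z ≤
        8 * t.numNodes / blockParam t.numNodes * Real.logb 2 Z := by gcongr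
      _ = _ := by ring
  have a2 : (16 : ℝ) ^ blockParam t.numNodes * (32 * blockParam t.numNodes + 12) ≤
      16 ^ blockParam t.numNodes * (64 * blockParam t.numNodes + 12) := by gcongr; norm_num
  unfold hyperBinary
  linarith

end Hypersuccinct

namespace Hypersuccinct

open BCover
open Finset.HasAntidiagonal (antidiagonal mem_antidiagonal)

/-! ### Monotone fixed-size sources -/

theorem sum_treesOfNumNodesEq_succ (f : BTree → ℝ) (n : ℕ) :
    ∑ t ∈ BinaryTree.treesOfNumNodesEq (n + 1), f t =
      ∑ ij ∈ antidiagonal n, ∑ l ∈ BinaryTree.treesOfNumNodesEq ij.1,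
        ∑ r ∈ BinaryTree.treesOfNumNodesEq ij.2, f (.node () l r) := by
  rw [BinaryTree.treesOfNumNodesEq_succ, Finset.sum_biUnion]
  · refine Finset.sum_congr rfl fun ij _ => ?_
    rw [Finset.sum_map, Finset.sum_product]
    rfl
  · intro i _ j _ hij
    simp only [Function.onFun, Finset.disjoint_left, Finset.mem_map, Finset.mem_product,
      BinaryTree.mem_treesOfNumNodesEq, Prod.exists, not_exists]
    rintro x ⟨l, r, ⟨hl, hr⟩, rfl⟩ l' r' ⟨⟨hl', hr'⟩, he⟩
    obtain ⟨h1, h2⟩ : l' = l ∧ r' = r := by simpa using he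
    exact hij (Prod.ext (by rw [← hl, ← hl', h1]) (by rw [← hr, ← hr', h2]))

/-- `p` assigns nonnegative numbers of sum at most one to the pairs of sizes with a given sum. -/
structure IsSubSource (p : ℕ → ℕ → ℝ) : Prop where
  nonneg : ∀ l r, 0 ≤ p l r
  sum_le_one : ∀ n, ∑ ij ∈ antidiagonal n, p ij.1 ij.2 ≤ 1

namespace IsSubSource

variable {p : ℕ → ℕ → ℝ}

theorem le_one (hp : IsSubSource p) (l r : ℕ) : p l r ≤ 1 :=
  (Finset.single_le_sum (f := fun ij : ℕ × ℕ => p ij.1 ij.2) (fun ij _ => hp.nonneg ij.1 ij.2)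
    (mem_antidiagonal.2 rfl : (l, r) ∈ antidiagonal (l + r))).trans
    (hp.sum_le_one (l + r))

theorem fixedSize_nonneg (hp : IsSubSource p) (t : BTree) : 0 ≤ fixedSize p t := by
  induction t with
  | nil => simp [fixedSize]
  | node a l r hl hr => exact mul_nonneg (mul_nonneg (hp.nonneg _ _) hl) hr

theorem sum_fixedSize_le_one (hp : IsSubSource p) (n : ℕ) :
    ∑ t ∈ BinaryTree.treesOfNumNodesEq n, fixedSize p t ≤ 1 := by
  induction n using Nat.strong_induction_on with
  | _ n ih =>
    cases n with
    | zero => simp [fixedSize]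
    | succ n =>
      rw [sum_treesOfNumNodesEq_succ]
      refine le_trans (Finset.sum_le_sum fun ij hij => ?_) (hp.sum_le_one n)
      have hij' := mem_antidiagonal.1 hij
      have e : ∑ l ∈ BinaryTree.treesOfNumNodesEq ij.1, ∑ r ∈ BinaryTree.treesOfNumNodesEq ij.2,
          fixedSize p (.node () l r) = p ij.1 ij.2 *
            ((∑ l ∈ BinaryTree.treesOfNumNodesEq ij.1, fixedSize p l) *
              ∑ r ∈ BinaryTree.treesOfNumNodesEq ij.2, fixedSize p r) := by
        rw [Finset.sum_mul_sum, Finset.mul_sum]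
        refine Finset.sum_congr rfl fun l hl => ?_
        rw [Finset.mul_sum]
        refine Finset.sum_congr rfl fun r hr => ?_
        rw [BinaryTree.mem_treesOfNumNodesEq] at hl hr
        simp only [fixedSize, hl, hr]
        ring
      rw [e]
      have h1 := ih ij.1 (by omega)
      have h2 := ih ij.2 (by omega)
      have h3 : 0 ≤ ∑ r ∈ BinaryTree.treesOfNumNodesEq ij.2, fixedSize p r :=
        Finset.sum_nonneg fun r _ => hp.fixedSize_nonneg r
      exact mul_le_of_le_one_right (hp.nonneg _ _) (mul_le_one₀ h1 h3 h2)

end IsSubSource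

theorem localSize_le (c : BCover) : c.localSize ≤ c.toTree.numNodes := by
  induction c with
  | nil => simp [localSize]
  | portal c _ => simp [localSize]
  | node l r hl hr => simp only [localSize, toTree, BinaryTree.numNodes]; omega

/-- Cutting at the portals does not decrease the probability under a monotone source. -/
theorem fixedSize_toTree_le {p : ℕ → ℕ → ℝ} (hp : IsSubSource p)
    (hmono : ∀ l r l' r', l' ≤ l → r' ≤ r → p l r ≤ p l' r') (c : BCover) :
    fixedSize p c.toTree ≤
      fixedSize p c.shape * (c.components.map fun d => fixedSize p d.shape).prod := by
  have hnn : ∀ c : BCover, 0 ≤ (c.components.map fun d => fixedSize p d.shape).prod := by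
    intro c
    apply List.prod_nonneg
    intro x hx
    obtain ⟨d, _, rfl⟩ := List.mem_map.1 hx
    exact hp.fixedSize_nonneg _
  induction c with
  | nil => simp [toTree, shape, components, fixedSize]
  | portal c ih => simpa [toTree, shape, components, fixedSize] using ih
  | node l r hl hr =>
    simp only [toTree, shape, components, fixedSize, List.map_append, List.prod_append,
      numNodes_shape]
    have h1 := hmono _ _ _ _ (localSize_le l) (localSize_le r)
    have h2 := hp.fixedSize_nonneg l.shape
    have h3 := hp.fixedSize_nonneg r.shape
    have h4 := hp.fixedSize_nonneg l.toTree
    have h5 := hp.fixedSize_nonneg r.toTree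
    calc p l.toTree.numNodes r.toTree.numNodes * fixedSize p l.toTree * fixedSize p r.toTree
        ≤ p l.localSize r.localSize *
          (fixedSize p l.shape * (l.components.map fun d => fixedSize p d.shape).prod) *
          (fixedSize p r.shape * (r.components.map fun d => fixedSize p d.shape).prod) := by
          have := hp.nonneg l.localSize r.localSize
          have := hnn l
          have := hnn r
          gcongr
      _ = _ := by ring

theorem logb_list_prod_inv {α : Type*} (l : List α) (f : α → ℝ) (hf : ∀ x ∈ l, 0 < f x) :
    (l.map fun x => Real.logb 2 (1 / f x)).sum = Real.logb 2 (1 / (l.map f).prod) := by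
  induction l with
  | nil => simp
  | cons a l ih =>
    have ha := hf a (by simp)
    have hl : ∀ x ∈ l, 0 < f x := fun x hx => hf x (by simp [hx])
    have : 0 < (l.map f).prod := List.prod_pos (by simpa using hl)
    rw [List.map_cons, List.sum_cons, ih hl, List.map_cons, List.prod_cons,
      ← Real.logb_mul (by positivity) (by positivity)]
    congr 1
    field_simp

theorem length_hyperBinary_le_of_monotone {p : ℕ → ℕ → ℝ} (hp : IsSubSource p)
    (hmono : ∀ l r l' r', l' ≤ l → r' ≤ r → p l r ≤ p l' r') (t : BTree)
    (ht : 0 < fixedSize p t) :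
    ((hyperBinary t).length : ℝ) ≤ Real.logb 2 (1 / fixedSize p t) +
      t.numNodes * (8 * (Real.logb 2 (2 * ((blockParam t.numNodes : ℝ) + 1) ^ 1) /
        (blockParam t.numNodes : ℝ) ^ (1 : ℝ)) + errorRate (blockParam t.numNodes)) + 2000 := by
  set B := blockParam t.numNodes with hBdef
  have hB := one_le_blockParam t.numNodes
  have hprod : fixedSize p t ≤ ((microTreesBinary B t).map fun d => fixedSize p d.shape).prod := by
    unfold microTreesBinary
    split_ifs with h
    · simp [h, fixedSize]
    · have := fixedSize_toTree_le hp hmono (.portal (coverBinary B t).1)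
      simpa [toTree, toTree_coverBinary, shape, fixedSize] using this
  have hpos : ∀ d ∈ microTreesBinary B t, 0 < fixedSize p d.shape := by
    intro d hd
    refine lt_of_le_of_ne (hp.fixedSize_nonneg _) fun h0 => ?_
    have : ((microTreesBinary B t).map fun d => fixedSize p d.shape).prod = 0 := by
      rw [List.prod_eq_zero_iff]
      exact List.mem_map.2 ⟨d, hd, h0.symm⟩
    linarith
  have hZ : ∑ d ∈ ((microTreesBinary B t).map BCover.shape).toFinset, fixedSize p d ≤ 2 * B := by
    have hsub : ((microTreesBinary B t).map BCover.shape).toFinset ⊆ treesBelow (2 * B) := by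
      intro x hx
      simp only [List.mem_toFinset, List.mem_map] at hx
      obtain ⟨c, hc, rfl⟩ := hx
      rw [mem_treesBelow, numNodes_shape]
      exact (microTreesBinary_local hB t c hc).1
    refine (Finset.sum_le_sum_of_subset_of_nonneg hsub fun x _ _ => hp.fixedSize_nonneg x).trans ?_
    rw [treesBelow, Finset.sum_biUnion]
    · refine (Finset.sum_le_sum fun k _ => hp.sum_fixedSize_le_one k).trans ?_
      simp
    · intro i _ j _ hij
      simp only [Function.onFun, Finset.disjoint_left, BinaryTree.mem_treesOfNumNodesEq]
      intro x h1 h2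
      exact hij (h1.symm.trans h2)
  have hB' : (1 : ℝ) ≤ B := by exact_mod_cast hB
  have h := length_hyperBinary_le t ((microTreesBinary B t).map BCover.shape) id (by simp [hBdef])
    (fixedSize p) (by simpa using hpos) hZ (by linarith)
  rw [List.map_map] at h
  have e := logb_list_prod_inv (microTreesBinary B t) (fun d => fixedSize p d.shape) hpos
  have h1 : Real.logb 2 (1 / ((microTreesBinary B t).map fun d => fixedSize p d.shape).prod) ≤
      Real.logb 2 (1 / fixedSize p t) := by
    apply Real.logb_le_logb_of_le (by norm_num)
    · exact one_div_pos.2 (ht.trans_le hprod)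
    · exact one_div_le_one_div_of_le ht hprod
  have h2 : 8 * Real.logb 2 (2 * B) / B ≤
      8 * (Real.logb 2 (2 * ((B : ℝ) + 1) ^ 1) / (B : ℝ) ^ (1 : ℝ)) := by
    rw [Real.rpow_one, mul_div_assoc, pow_one]
    have : Real.logb 2 (2 * B) ≤ Real.logb 2 (2 * ((B : ℝ) + 1)) :=
      Real.logb_le_logb_of_le (by norm_num) (by positivity) (by linarith)
    gcongr
  have h3 : (t.numNodes : ℝ) * (8 * Real.logb 2 (2 * B) / B + errorRate B) ≤
      t.numNodes * (8 * (Real.logb 2 (2 * ((B : ℝ) + 1) ^ 1) / (B : ℝ) ^ (1 : ℝ)) +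
        errorRate B) := by gcongr
  simp only [Function.comp_def] at h
  rw [e] at h
  linarith

/-- Bounds whose error rate depends on the block parameter and tends to zero give optimality. -/
theorem optimalPointwise_of_rate {α : Type} {code : α → List Bool} {size : α → ℕ} {P : α → ℝ}
    {f : ℕ → ℝ} (hf : Tendsto f atTop (nhds 0)) (C : ℝ)
    (h : ∀ t, 0 < P t → ((code t).length : ℝ) ≤
      Real.logb 2 (1 / P t) + size t * f (blockParam (size t)) + C) :
    OptimalPointwise code size P :=
  ⟨fun n => n * f (blockParam n) + C, isLittleO_mul_blockParam hf C, fun t ht => by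
    have := h t ht; linarith⟩

theorem tendsto_monotoneRate : Tendsto (fun B : ℕ =>
    8 * (Real.logb 2 (2 * ((B : ℝ) + 1) ^ 1) / (B : ℝ) ^ (1 : ℝ)) + errorRate B) atTop (nhds 0) := by
  have := ((tendsto_logb_div_rpow (C := 2) (κ := 1) (by norm_num) (by norm_num) 1).const_mul 8).add
    tendsto_errorRate
  simpa using this

theorem optimalPointwise_of_monotone {p : ℕ → ℕ → ℝ} (hp : IsSubSource p)
    (hmono : ∀ l r l' r', l' ≤ l → r' ≤ r → p l r ≤ p l' r') :
    OptimalPointwise hyperBinary BinaryTree.numNodes (fixedSize p) :=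
  optimalPointwise_of_rate tendsto_monotoneRate 2000
    fun t ht => length_hyperBinary_le_of_monotone hp hmono t ht

theorem isSubSource_pBst : IsSubSource pBst where
  nonneg l r := by unfold pBst; positivity
  sum_le_one n := by
    have : ∀ ij ∈ antidiagonal n, pBst ij.1 ij.2 = 1 / ((n : ℝ) + 1) := by
      intro ij h
      rw [pBst, ← mem_antidiagonal.1 h]
      push_cast; rfl
    rw [Finset.sum_congr rfl this]
    simp
    field_simp
    rfl

theorem pBst_mono (l r l' r' : ℕ) (hl : l' ≤ l) (hr : r' ≤ r) : pBst l r ≤ pBst l' r' := by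
  unfold pBst
  gcongr

theorem optimalPointwise_bst :
    OptimalPointwise hyperBinary BinaryTree.numNodes (fixedSize pBst) :=
  optimalPointwise_of_monotone isSubSource_pBst pBst_mono

theorem isSubSource_pAlmostPath (K : ℕ) : IsSubSource (pAlmostPath K) where
  nonneg l r := by unfold pAlmostPath; split_ifs <;> positivity
  sum_le_one n := by
    rw [Finset.Nat.sum_antidiagonal_eq_sum_range_succ_mk]
    rcases Nat.lt_or_ge n (2 * K + 1) with hn | hn
    · have : ∀ i ∈ Finset.range n.succ, pAlmostPath K i (n - i) = 1 / ((n : ℝ) + 1) := by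
        intro i hi
        have hi' := Finset.mem_range.1 hi
        rw [pAlmostPath, if_pos (by omega), Nat.cast_sub (by omega), max_eq_left]
        · ring
        · apply one_div_le_one_div_of_le
          · have : (i : ℝ) ≤ n := by exact_mod_cast (by omega)
            have : (0 : ℝ) ≤ i := by positivity
            linarith
          · have : (n : ℝ) + 1 ≤ 2 * (K + 1) := by exact_mod_cast (by omega)
            linarith
      rw [Finset.sum_congr rfl this]
      simp
      field_simp
      rfl
    · have : ∀ i ∈ Finset.range n.succ, pAlmostPath K i (n - i) =
          (if i ∈ Finset.range (K + 1) ∪ Finset.Ico (n - K) (n + 1) then 1 / (2 * ((K : ℝ) + 1))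
            else 0) := by
        intro i hi
        have hi' := Finset.mem_range.1 hi
        have hiff : (i ≤ K ∨ n - i ≤ K) ↔ i ∈ Finset.range (K + 1) ∪ Finset.Ico (n - K) (n + 1) := by
          simp only [Finset.mem_union, Finset.mem_range, Finset.mem_Ico]; omega
        rw [pAlmostPath]
        simp only [hiff]
        split_ifs
        · rw [Nat.cast_sub (by omega), max_eq_right]
          apply one_div_le_one_div_of_le (by positivity)
          have : (2 * (K : ℝ) + 1) ≤ n := by exact_mod_cast hn
          linarith
        · rfl
      rw [Finset.sum_congr rfl this, ← Finset.sum_filter, Finset.sum_const, nsmul_eq_mul]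
      have hcard : (Finset.filter (· ∈ Finset.range (K + 1) ∪ Finset.Ico (n - K) (n + 1))
          (Finset.range n.succ)).card ≤ 2 * (K + 1) := by
        refine (Finset.card_le_card (t := Finset.range (K + 1) ∪ Finset.Ico (n - K) (n + 1))
          (fun x hx => (Finset.mem_filter.1 hx).2)).trans ((Finset.card_union_le _ _).trans ?_)
        simp; omega
      rw [mul_one_div, div_le_one (by positivity)]
      exact_mod_cast hcard

theorem pAlmostPath_mono (K l r l' r' : ℕ) (hl : l' ≤ l) (hr : r' ≤ r) :
    pAlmostPath K l r ≤ pAlmostPath K l' r' := by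
  unfold pAlmostPath
  split_ifs with h1 h2 h2
  · gcongr
  · omega
  · positivity
  · rfl

theorem optimalPointwise_almostPath (K : ℕ) :
    OptimalPointwise hyperBinary BinaryTree.numNodes (fixedSize (pAlmostPath K)) :=
  optimalPointwise_of_monotone (isSubSource_pAlmostPath K) (pAlmostPath_mono K)

theorem fixedSize_pBst_pos (t : BTree) : 0 < fixedSize pBst t := by
  induction t with
  | nil => simp [fixedSize]
  | node a l r hl hr =>
    have : 0 < pBst l.numNodes r.numNodes := by unfold pBst; positivity
    simp only [fixedSize]; positivity

theorem subtreeSizeEntropy_eq (t : BTree) :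
    subtreeSizeEntropy t = Real.logb 2 (1 / fixedSize pBst t) := by
  induction t with
  | nil => simp [subtreeSizeEntropy, fixedSize]
  | node a l r hl hr =>
    have h1 := fixedSize_pBst_pos l
    have h2 := fixedSize_pBst_pos r
    rw [subtreeSizeEntropy, hl, hr, fixedSize, ← Real.logb_mul (by positivity) (by positivity),
      ← Real.logb_mul (by positivity) (by positivity), pBst]
    congr 1
    field_simp

theorem length_hyperBinary_le_subtreeSizeEntropy :
    ∃ r : ℕ → ℝ, r =o[atTop] (fun n : ℕ => (n : ℝ)) ∧
      ∀ t : BTree, ((hyperBinary t).length : ℝ) ≤ subtreeSizeEntropy t + r t.numNodes := by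
  obtain ⟨r, hr, h⟩ := optimalPointwise_bst
  exact ⟨r, hr, fun t => by rw [subtreeSizeEntropy_eq]; exact h t (fixedSize_pBst_pos t)⟩

end Hypersuccinct

namespace Hypersuccinct

open BCover
open scoped ENNReal

/-! ### Sums over code trees -/

namespace CodeTree

variable {α : Type}

/-- A code tree is a leaf or a pair of code trees. -/
def equivSum : CodeTree α ≃ α ⊕ (CodeTree α × CodeTree α) where
  toFun
    | .leaf a => .inl a
    | .node l r => .inr (l, r)
  invFun
    | .inl a => .leaf a
    | .inr (l, r) => .node l r
  left_inv T := by cases T <;> rfl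
  right_inv x := by rcases x with a | ⟨l, r⟩ <;> rfl

theorem tsum_eq (f : CodeTree α → ℝ≥0∞) :
    ∑' T, f T = ∑' a, f (.leaf a) + ∑' l, ∑' r, f (.node l r) := by
  rw [← Equiv.tsum_eq equivSum.symm, Summable.tsum_sum ENNReal.summable ENNReal.summable,
    ENNReal.tsum_prod']
  rfl

/-- The number of nodes on a longest path to a leaf. -/
def depth : CodeTree α → ℕ
  | .leaf _ => 0
  | .node l r => max l.depth r.depth + 1

open Classical in
/-- If the leaves have total weight at most `1/4` and weights are submultiplicative, then all code
trees together have weight at most `1/2`, since `1/4 + (1/2)² = 1/2`. -/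
theorem tsum_depth_le (w : CodeTree α → ℝ≥0∞) (hleaf : ∑' a, w (.leaf a) ≤ 4⁻¹)
    (hnode : ∀ l r, w (.node l r) ≤ w l * w r) (k : ℕ) :
    ∑' T : CodeTree α, (if T.depth ≤ k then w T else 0) ≤ 2⁻¹ := by
  have h42 : (4 : ℝ≥0∞)⁻¹ + 2⁻¹ * 2⁻¹ ≤ 2⁻¹ := by
    have : (4 : ℝ≥0∞)⁻¹ = 2⁻¹ * 2⁻¹ := by
      rw [← ENNReal.mul_inv (by simp) (by simp)]; norm_num
    rw [this, ← mul_add, ENNReal.inv_two_add_inv_two, mul_one]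
  induction k with
  | zero =>
    rw [tsum_eq]
    simp only [depth, le_refl, if_true, Nat.le_zero, Nat.add_eq_zero_iff, one_ne_zero, and_false,
      if_false, tsum_zero, add_zero]
    exact hleaf.trans (le_trans le_self_add h42)
  | succ k ih =>
    rw [tsum_eq]
    simp only [depth, zero_le, if_true, Nat.add_le_add_iff_right, max_le_iff]
    refine le_trans (add_le_add hleaf ?_) h42
    calc ∑' l : CodeTree α, ∑' r : CodeTree α,
          (if l.depth ≤ k ∧ r.depth ≤ k then w (.node l r) else 0)
        ≤ ∑' l : CodeTree α, ∑' r : CodeTree α,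
          (if l.depth ≤ k then w l else 0) * (if r.depth ≤ k then w r else 0) := by
          refine ENNReal.tsum_le_tsum fun l => ENNReal.tsum_le_tsum fun r => ?_
          by_cases h1 : l.depth ≤ k <;> by_cases h2 : r.depth ≤ k <;> simp [h1, h2, hnode]
      _ = (∑' l : CodeTree α, (if l.depth ≤ k then w l else 0)) *
          ∑' r : CodeTree α, (if r.depth ≤ k then w r else 0) := by
          rw [← ENNReal.tsum_mul_right]
          exact tsum_congr fun l => ENNReal.tsum_mul_left
      _ ≤ 2⁻¹ * 2⁻¹ := mul_le_mul' ih ih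

open Classical in
theorem sum_le_of_tsum_depth_le (w : CodeTree α → ℝ) (hw : ∀ T, 0 ≤ w T) {Z : ℝ} (hZ : 0 ≤ Z)
    (h : ∀ k, ∑' T : CodeTree α, (if T.depth ≤ k then ENNReal.ofReal (w T) else 0) ≤
      ENNReal.ofReal Z) (S : Finset (CodeTree α)) : ∑ T ∈ S, w T ≤ Z := by
  rw [← ENNReal.ofReal_le_ofReal_iff hZ, ENNReal.ofReal_sum_of_nonneg fun T _ => hw T]
  refine le_trans (le_of_eq ?_) ((ENNReal.sum_le_tsum S).trans (h (S.sup depth)))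
  exact Finset.sum_congr rfl fun T hT => by rw [if_pos (Finset.le_sup hT)]

end CodeTree

/-! ### Heavy nodes and the fringe -/

/-- The maximal subtrees with fewer than `B` nodes, including the empty ones below heavy nodes, from
left to right. -/
def fringe (B : ℕ) : BTree → List BTree
  | .nil => [.nil]
  | .node _ l r =>
    if l.numNodes + r.numNodes + 1 < B then [.node () l r] else fringe B l ++ fringe B r

theorem fringe_of_light {B : ℕ} {t : BTree} (ht : t.numNodes < B) : fringe B t = [t] := by
  cases t with
  | nil => rfl
  | node a l r => rw [fringe, if_pos (by simpa [BinaryTree.numNodes] using ht)]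

/-- A component cut at its portals and at the heavy nodes: the leaves of the result are the portals
(`none`) and the maximal light subtrees. -/
def splitHeavy (B : ℕ) : BCover → CodeTree (Option BTree)
  | .nil => .leaf (some .nil)
  | .portal _ => .leaf none
  | .node l r =>
    if l.toTree.numNodes + r.toTree.numNodes + 1 < B then
      .leaf (some (.node () l.toTree r.toTree))
    else .node (splitHeavy B l) (splitHeavy B r)

/-- The shape of a component that has been cut. -/
def joinHeavy : CodeTree (Option BTree) → BTree
  | .leaf none => .nil
  | .leaf (some f) => f
  | .node l r => .node () (joinHeavy l) (joinHeavy r)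

/-- Light subtrees of components contain no portals. -/
def LightIntact (B : ℕ) : BCover → Prop
  | .nil => True
  | .portal c => LightIntact B c
  | .node l r =>
    (l.toTree.numNodes + r.toTree.numNodes + 1 < B → ∃ t, BCover.node l r = ofTree t) ∧
      LightIntact B l ∧ LightIntact B r

theorem toTree_ofTree (t : BTree) : (ofTree t).toTree = t := by
  induction t with
  | nil => rfl
  | node a l r hl hr => simp [ofTree, toTree, hl, hr]

theorem lightIntact_ofTree (B : ℕ) (t : BTree) : LightIntact B (ofTree t) := by
  induction t with
  | nil => trivial
  | node a l r hl hr => exact ⟨fun _ => ⟨.node () l r, rfl⟩, hl, hr⟩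

theorem lightIntact_attach {B : ℕ} {x : BCover × Bool} (h : LightIntact B x.1) :
    LightIntact B (attach x) := by
  unfold attach; split_ifs <;> exact h

theorem lightIntact_coverBinary (B : ℕ) (t : BTree) : LightIntact B (coverBinary B t).1 := by
  induction t with
  | nil => trivial
  | node a l r hl hr =>
    by_cases hlt : (BinaryTree.node a l r).numNodes < B
    · rw [coverBinary_light hlt]; exact lightIntact_ofTree _ _
    · simp only [BinaryTree.numNodes] at hlt
      unfold coverBinary
      split_ifs with h
      · exact ⟨fun h' => by simp [toTree, toTree_coverBinary] at h'; omega, hl, hr⟩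
      · exact ⟨fun h' => by simp [toTree_coverBinary] at h'; omega, lightIntact_attach hl,
          lightIntact_attach hr⟩

theorem joinHeavy_splitHeavy {B : ℕ} {c : BCover} (hc : LightIntact B c) :
    joinHeavy (splitHeavy B c) = c.shape := by
  induction c with
  | nil => rfl
  | portal c _ => rfl
  | node l r hl hr =>
    rw [splitHeavy]
    split_ifs with h
    · obtain ⟨t, ht⟩ := hc.1 h
      have : (BCover.node l r).toTree = (BCover.node l r).shape := by
        rw [ht, toTree_ofTree, shape_ofTree]
      simpa [joinHeavy, toTree] using this
    · simp [joinHeavy, shape, hl hc.2.1, hr hc.2.2]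

/-- The weight of a component that has been cut, for given weights `v` of the light subtrees. -/
noncomputable def heavyWeight (B : ℕ) (v : BTree → ℝ) : CodeTree (Option BTree) → ℝ
  | .leaf none => 1 / 8
  | .leaf (some f) => if f.numNodes < B then v f / 8 else 0
  | .node l r => heavyWeight B v l * heavyWeight B v r

theorem heavyWeight_nonneg {B : ℕ} {v : BTree → ℝ} (hv : ∀ f, 0 ≤ v f)
    (T : CodeTree (Option BTree)) : 0 ≤ heavyWeight B v T := by
  induction T with
  | leaf a =>
    cases a with
    | none => simp [heavyWeight]
    | some f => have := hv f; simp only [heavyWeight]; split_ifs <;> positivity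
  | node l r hl hr => exact mul_nonneg hl hr

theorem sum_heavyWeight_le {B : ℕ} {v : BTree → ℝ} (hv : ∀ f, 0 ≤ v f)
    (hsum : ∑ f ∈ treesBelow B, v f ≤ 1) (S : Finset (CodeTree (Option BTree))) :
    ∑ T ∈ S, heavyWeight B v T ≤ 1 := by
  have h2 : (2 : ℝ≥0∞)⁻¹ = ENNReal.ofReal 2⁻¹ := by
    rw [ENNReal.ofReal_inv_of_pos (by norm_num)]; simp
  have h4 : (4 : ℝ≥0∞)⁻¹ = ENNReal.ofReal 4⁻¹ := by
    rw [ENNReal.ofReal_inv_of_pos (by norm_num)]; simp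
  refine (CodeTree.sum_le_of_tsum_depth_le (Z := 2⁻¹) _ (heavyWeight_nonneg hv) (by norm_num)
    (fun k => ?_) S).trans (by norm_num)
  rw [← h2]
  convert CodeTree.tsum_depth_le (fun T => ENNReal.ofReal (heavyWeight B v T)) ?_ ?_ k
  · rw [tsum_eq_sum (s := Finset.insertNone (treesBelow B))]
    · rw [Finset.sum_insertNone, h4, ← ENNReal.ofReal_sum_of_nonneg fun f _ => heavyWeight_nonneg hv _,
        ← ENNReal.ofReal_add (heavyWeight_nonneg hv _)
          (Finset.sum_nonneg fun f _ => heavyWeight_nonneg hv _)]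
      apply ENNReal.ofReal_le_ofReal
      have : ∑ f ∈ treesBelow B, heavyWeight B v (.leaf (some f)) = (∑ f ∈ treesBelow B, v f) / 8 := by
        rw [Finset.sum_div]
        refine Finset.sum_congr rfl fun f hf => ?_
        rw [heavyWeight, if_pos (mem_treesBelow.1 hf)]
      rw [this, heavyWeight]
      linarith
    · intro a ha
      cases a with
      | none => simp at ha
      | some f =>
        rw [Finset.some_mem_insertNone, mem_treesBelow] at ha
        simp [heavyWeight, ha]
  · intro l r
    rw [← ENNReal.ofReal_mul (heavyWeight_nonneg hv l)]
    rfl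

/-- The cost of all components: that of the light subtrees, and three bits for each of them and for
each portal. -/
theorem sum_logb_heavyWeight {B : ℕ} (hB : 1 ≤ B) {v : BTree → ℝ} {c : BCover}
    (hc : LightIntact B c) (hv : ∀ f ∈ fringe B c.toTree, 0 < v f) :
    (0 < heavyWeight B v (splitHeavy B c) ∧
      ∀ d ∈ c.components, 0 < heavyWeight B v (splitHeavy B d)) ∧
    Real.logb 2 (1 / heavyWeight B v (splitHeavy B c)) +
        (c.components.map fun d => Real.logb 2 (1 / heavyWeight B v (splitHeavy B d))).sum =
      ((fringe B c.toTree).map fun f => Real.logb 2 (1 / v f)).sum +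
        3 * (fringe B c.toTree).length + 3 * c.components.length := by
  have h8 : Real.logb 2 8 = 3 := by
    rw [show (8 : ℝ) = 2 ^ (3 : ℝ) by norm_num, Real.logb_rpow (by norm_num) (by norm_num)]
  have hleaf : ∀ f : BTree, 0 < v f → f.numNodes < B →
      0 < heavyWeight B v (.leaf (some f)) ∧
      Real.logb 2 (1 / heavyWeight B v (.leaf (some f))) = Real.logb 2 (1 / v f) + 3 := by
    intro f hf hlt
    rw [heavyWeight, if_pos hlt]
    refine ⟨by positivity, ?_⟩
    rw [← h8, ← Real.logb_mul (by positivity) (by norm_num)]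
    congr 1; field_simp
  induction c with
  | nil =>
    have h0 : (BinaryTree.nil : BTree).numNodes < B := Nat.lt_of_lt_of_le Nat.zero_lt_one hB
    obtain ⟨h1, h2⟩ := hleaf .nil (hv _ (by simp [toTree, fringe])) h0
    simp only [splitHeavy, components, toTree, fringe]
    refine ⟨⟨h1, by simp⟩, ?_⟩
    rw [h2]; simp
  | portal c ih =>
    obtain ⟨⟨h1, h2⟩, h3⟩ := ih hc hv
    simp only [splitHeavy, components, toTree, List.map_cons, List.sum_cons, List.length_cons]
    refine ⟨⟨by simp [heavyWeight], by simpa using ⟨h1, h2⟩⟩, ?_⟩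
    rw [h3, heavyWeight, one_div_one_div, h8]
    push_cast; ring
  | node l r hl hr =>
    by_cases h : l.toTree.numNodes + r.toTree.numNodes + 1 < B
    · obtain ⟨t, ht⟩ := hc.1 h
      have hcomp : (BCover.node l r).components = [] := by rw [ht, components_ofTree]
      rw [hcomp]
      simp only [splitHeavy, toTree, fringe, if_pos h] at hv ⊢
      obtain ⟨h1, h2⟩ := hleaf (.node () l.toTree r.toTree) (hv _ (by simp))
        (by simpa [BinaryTree.numNodes] using h)
      refine ⟨⟨h1, by simp⟩, ?_⟩
      rw [h2]; simp
    · simp only [toTree, fringe, if_neg h, splitHeavy, List.mem_append] at hv ⊢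
      obtain ⟨⟨a1, a2⟩, a3⟩ := hl hc.2.1 fun f hf => hv f (Or.inl hf)
      obtain ⟨⟨b1, b2⟩, b3⟩ := hr hc.2.2 fun f hf => hv f (Or.inr hf)
      refine ⟨⟨mul_pos a1 b1, ?_⟩, ?_⟩
      · intro d hd
        rcases List.mem_append.1 hd with hd | hd
        · exact a2 d hd
        · exact b2 d hd
      · simp only [heavyWeight, components, List.map_append, List.sum_append, List.length_append]
        rw [← one_div_mul_one_div, Real.logb_mul (by positivity) (by positivity)]
        push_cast
        linarith

/-- If light subtrees are coded with weights `v`, the heavy nodes cost only a constant number of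
bits each. -/
theorem length_hyperBinary_le_fringe (t : BTree) (v : BTree → ℝ) (hv0 : ∀ f, 0 ≤ v f)
    (hsum : ∑ f ∈ treesBelow (blockParam t.numNodes), v f ≤ 1)
    (hv : ∀ f ∈ fringe (blockParam t.numNodes) t, 0 < v f) :
    ((hyperBinary t).length : ℝ) ≤
      ((fringe (blockParam t.numNodes) t).map fun f => Real.logb 2 (1 / v f)).sum +
        3 * (fringe (blockParam t.numNodes) t).length +
        t.numNodes * (24 / blockParam t.numNodes + errorRate (blockParam t.numNodes)) + 2000 := by
  set B := blockParam t.numNodes with hBdef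
  have hB : 1 ≤ B := one_le_blockParam t.numNodes
  classical
  set c := BCover.portal (coverBinary B t).1
  have hc : LightIntact B c := lightIntact_coverBinary B t
  have hct : c.toTree = t := toTree_coverBinary B t
  obtain ⟨⟨_, h2⟩, h3⟩ := sum_logb_heavyWeight hB hc (v := v) (by rwa [hct])
  rw [hct] at h3
  have h8 : Real.logb 2 8 = 3 := by
    rw [show (8 : ℝ) = 2 ^ (3 : ℝ) by norm_num, Real.logb_rpow (by norm_num) (by norm_num)]
  have h4 : Real.logb 2 (1 / heavyWeight B v (splitHeavy B c)) = 3 := by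
    simp only [c, splitHeavy, heavyWeight, one_div_one_div, h8]
  rw [h4] at h3
  have hall : ∀ d ∈ c.components, LightIntact B d := by
    have : ∀ c : BCover, LightIntact B c → ∀ d ∈ c.components, LightIntact B d := by
      intro c
      induction c with
      | nil => simp [components]
      | portal c ih =>
        intro h d hd
        rcases List.mem_cons.1 hd with rfl | hd
        · exact h
        · exact ih h d hd
      | node l r hl hr =>
        intro h d hd
        rcases List.mem_append.1 hd with hd | hd
        · exact hl h.2.1 d hd
        · exact hr h.2.2 d hd
    exact this c hc
  have hsub : microTreesBinary B t = if t = .nil then [] else c.components := rfl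
  have hmem : ∀ d ∈ microTreesBinary B t, d ∈ c.components := by
    intro d hd
    rw [hsub] at hd
    split_ifs at hd
    · simp at hd
    · exact hd
  have h := length_hyperBinary_le t ((microTreesBinary B t).map (splitHeavy B)) joinHeavy
    (by
      rw [List.map_map]
      exact List.map_congr_left fun d hd => joinHeavy_splitHeavy (hall d (hmem d hd)))
    (heavyWeight B v) (by
      intro d hd
      obtain ⟨e, he, rfl⟩ := List.mem_map.1 hd
      exact h2 e (hmem e he)) (sum_heavyWeight_le hv0 hsum _) le_rfl
  rw [List.map_map] at h
  simp only [Real.logb_one, mul_zero, zero_div, zero_add] at h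
  by_cases ht : t = .nil
  · have h0 : (microTreesBinary B t) = [] := by rw [hsub, if_pos ht]
    rw [h0] at h
    have e : (t.numNodes : ℝ) = 0 := by simp [ht, BinaryTree.numNodes]
    have : ((fringe B t).map fun f => Real.logb 2 (1 / v f)).sum + 3 * (fringe B t).length ≥ 0 := by
      have hf : fringe B t = [.nil] := by rw [ht]; rfl
      rw [hf] at hv ⊢
      have hn := hv .nil (by simp)
      have : v .nil ≤ 1 := (Finset.single_le_sum (f := v) (fun f _ => hv0 f)
        (mem_treesBelow.2 (Nat.lt_of_lt_of_le Nat.zero_lt_one hB))).trans hsum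
      have : 0 ≤ Real.logb 2 (1 / v .nil) :=
        Real.logb_nonneg (by norm_num) ((one_le_div hn).2 this)
      simp only [List.map_cons, List.map_nil, List.sum_cons, List.sum_nil, List.length_singleton]
      push_cast; linarith
    rw [e] at h ⊢
    simp only [List.map_nil, List.sum_nil, zero_mul] at h ⊢
    linarith
  · have h0 : microTreesBinary B t = c.components := by rw [hsub, if_neg ht]
    have hn : 1 ≤ t.numNodes := by
      cases t with
      | nil => exact absurd rfl ht
      | node a l r => simp [BinaryTree.numNodes]
    have hm := length_microTreesBinary_le (blockParam_le hn)
    rw [← hBdef, h0] at hm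
    have hB0 : (0 : ℝ) < B := by exact_mod_cast hB
    have hm' : (3 * c.components.length : ℝ) ≤ t.numNodes * (24 / B) := by
      rw [mul_div_assoc', le_div_iff₀ hB0]
      have : (B : ℝ) * c.components.length ≤ 4 * t.numNodes := by exact_mod_cast hm
      have : (0 : ℝ) ≤ t.numNodes := by positivity
      linarith
    rw [h0] at h
    simp only [Function.comp_def] at h
    have e : (t.numNodes : ℝ) * (24 / B + errorRate B) =
      t.numNodes * (24 / B) + t.numNodes * errorRate B := by ring
    rw [e]
    linarith

end Hypersuccinct

namespace Hypersuccinct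

open BCover

/-! ### Classes that are closed under replacing subtrees -/

theorem sum_numNodes_fringe {b : ℝ} {B : ℕ} {t : BTree} (h0 : b ≤ t.numNodes + 1)
    (ht : EveryNode (fun l r => B ≤ l.numNodes + r.numNodes + 1 →
      b ≤ (l.numNodes : ℝ) + 1 ∧ b ≤ (r.numNodes : ℝ) + 1) t) :
    (fringe B t).length * b ≤ (t.numNodes : ℝ) + 1 := by
  induction t with
  | nil => simpa [fringe] using h0
  | node a l r hl hr =>
    rw [fringe]
    split_ifs with h
    · simpa using h0
    · obtain ⟨h1, h2, h3⟩ := ht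
      have h4 := h1 (by omega)
      have := hl h4.1 h2
      have := hr h4.2 h3
      rw [List.length_append]
      simp only [BinaryTree.numNodes]
      push_cast
      linarith

theorem EveryNode.imp {P Q : BTree → BTree → Prop} (h : ∀ l r, P l r → Q l r) {t : BTree}
    (ht : EveryNode P t) : EveryNode Q t := by
  induction t with
  | nil => trivial
  | node a l r hl hr => exact ⟨h _ _ ht.1, hl ht.2.1, hr ht.2.2⟩

/-- If the subtrees of a node with `s` nodes have at least `c s ^ κ` nodes, then only a vanishing
fraction of the nodes is heavy. -/
theorem length_fringe_le {c κ : ℝ} (hc : 0 < c) (hκ : 0 < κ) {B : ℕ} (hB : 1 ≤ B) {t : BTree}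
    (hBt : B ≤ t.numNodes)
    (ht : EveryNode (fun l r =>
      c * ((l.numNodes + r.numNodes + 1 : ℕ) : ℝ) ^ κ ≤ (l.numNodes : ℝ) + 1 ∧
      c * ((l.numNodes + r.numNodes + 1 : ℕ) : ℝ) ^ κ ≤ (r.numNodes : ℝ) + 1) t) :
    ((fringe B t).length : ℝ) ≤ t.numNodes * (2 / c / (B : ℝ) ^ κ) := by
  have hB0 : (0 : ℝ) < B := by exact_mod_cast hB
  have hn : (1 : ℝ) ≤ t.numNodes := by exact_mod_cast hB.trans hBt
  have ht' := ht.imp (Q := fun l r => B ≤ l.numNodes + r.numNodes + 1 →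
      c * (B : ℝ) ^ κ ≤ (l.numNodes : ℝ) + 1 ∧ c * (B : ℝ) ^ κ ≤ (r.numNodes : ℝ) + 1)
    (fun l r h hlr => by
      have : c * (B : ℝ) ^ κ ≤ c * ((l.numNodes + r.numNodes + 1 : ℕ) : ℝ) ^ κ := by
        gcongr
      exact ⟨this.trans h.1, this.trans h.2⟩)
  have h0 : c * (B : ℝ) ^ κ ≤ t.numNodes + 1 := by
    cases t with
    | nil => simp [BinaryTree.numNodes] at hBt; omega
    | node a l r =>
      have := (ht'.1 hBt).1
      simp only [BinaryTree.numNodes]; push_cast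
      have : (0 : ℝ) ≤ r.numNodes := by positivity
      linarith
  have h1 := sum_numNodes_fringe h0 ht'
  rw [div_div, mul_div_assoc', le_div_iff₀ (by positivity)]
  linarith

section Classes

variable {Λ : Type} (R : Λ → Set BTree)

/-- Replacing the light subtrees of a tree by others with the same labels yields trees with the
same label as the whole tree, so the product of the numbers of choices is bounded. -/
theorem prod_ncard_fringe_le (hfin : ∀ a, (R a).Finite)
    (hnode : ∀ a l r, BinaryTree.node () l r ∈ R a → ∃ b c, l ∈ R b ∧ r ∈ R c ∧
      ∀ l' ∈ R b, ∀ r' ∈ R c, BinaryTree.node () l' r' ∈ R a)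
    (v : BTree → ℝ) {L : ℝ} (hL : 1 ≤ L) (B : ℕ) (hB : 1 ≤ B)
    (hv : ∀ a f, f ∈ R a → f.numNodes < B → 1 / (L * (R a).ncard) ≤ v f)
    (a : Λ) (t : BTree) (ht : t ∈ R a) :
    (∀ f ∈ fringe B t, 0 < v f) ∧
      ((fringe B t).map fun f => Real.logb 2 (1 / v f)).sum ≤
        Real.logb 2 (R a).ncard + (fringe B t).length * Real.logb 2 L := by
  have hcard : ∀ a f, f ∈ R a → (0 : ℝ) < (R a).ncard := fun a f hf => by
    exact_mod_cast (Set.ncard_pos (hfin a)).2 ⟨f, hf⟩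
  have hlight : ∀ a f, f ∈ R a → f.numNodes < B → fringe B f = [f] →
      (∀ g ∈ fringe B f, 0 < v g) ∧ ((fringe B f).map fun f => Real.logb 2 (1 / v f)).sum ≤
        Real.logb 2 (R a).ncard + (fringe B f).length * Real.logb 2 L := by
    intro a f hf hlt hfr
    have h1 := hv a f hf hlt
    have h2 := hcard a f hf
    have h3 : 0 < v f := lt_of_lt_of_le (by positivity) h1
    rw [hfr]
    refine ⟨by simpa using h3, ?_⟩
    simp only [List.map_cons, List.map_nil, List.sum_cons, List.sum_nil, add_zero,
      List.length_singleton, Nat.cast_one, one_mul]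
    rw [← Real.logb_mul (by positivity) (by positivity)]
    apply Real.logb_le_logb_of_le (by norm_num) (by positivity)
    rw [div_le_iff₀ h3]
    rw [div_le_iff₀ (by positivity)] at h1
    linarith
  induction t generalizing a with
  | nil => exact hlight a _ ht (Nat.lt_of_lt_of_le Nat.zero_lt_one hB) rfl
  | node u l r hl hr =>
    by_cases h : l.numNodes + r.numNodes + 1 < B
    · exact hlight a _ ht h (by rw [fringe, if_pos h])
    · rw [fringe, if_neg h]
      obtain ⟨b, c, hlb, hrc, hrep⟩ := hnode a l r ht
      obtain ⟨a1, a2⟩ := hl b hlb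
      obtain ⟨b1, b2⟩ := hr c hrc
      refine ⟨fun f hf => (List.mem_append.1 hf).elim (a1 f) (b1 f), ?_⟩
      have hmul : (R b).ncard * (R c).ncard ≤ (R a).ncard := by
        rw [← Set.ncard_prod]
        refine Set.ncard_le_ncard_of_injOn (fun x => BinaryTree.node () x.1 x.2) ?_ ?_ (hfin a)
        · rintro ⟨x, y⟩ ⟨hx, hy⟩; exact hrep x hx y hy
        · rintro ⟨x, y⟩ _ ⟨x', y'⟩ _ hxy
          simpa using hxy
      have hb := hcard b l hlb
      have hc := hcard c r hrc
      have hlog : Real.logb 2 (R b).ncard + Real.logb 2 (R c).ncard ≤ Real.logb 2 (R a).ncard := by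
        rw [← Real.logb_mul hb.ne' hc.ne']
        apply Real.logb_le_logb_of_le (by norm_num) (by positivity)
        exact_mod_cast hmul
      simp only [List.map_append, List.sum_append, List.length_append]
      push_cast
      linarith

open Classical in
/-- Weights of light trees that choose one of the possible labels and then a tree with this label,
both uniformly. -/
noncomputable def labelWeight (labels : Finset Λ) (f : BTree) : ℝ :=
  ∑ a ∈ labels, if f ∈ R a then 1 / ((labels.card : ℝ) * (R a).ncard) else 0

theorem sum_labelWeight_le (hfin : ∀ a, (R a).Finite) (labels : Finset Λ) (S : Finset BTree) :
    ∑ f ∈ S, labelWeight R labels f ≤ 1 := by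
  classical
  unfold labelWeight
  rw [Finset.sum_comm]
  have : ∀ a ∈ labels, (∑ f ∈ S, if f ∈ R a then 1 / ((labels.card : ℝ) * (R a).ncard) else 0) ≤
      1 / labels.card := by
    intro a ha
    rw [← Finset.sum_filter, Finset.sum_const, nsmul_eq_mul]
    have hle : (S.filter (· ∈ R a)).card ≤ (R a).ncard := by
      rw [← Set.ncard_coe_finset]
      exact Set.ncard_le_ncard (fun x hx => by simpa using (Finset.mem_filter.1 hx).2) (hfin a)
    have hL : (0 : ℝ) < labels.card := by exact_mod_cast Finset.card_pos.2 ⟨a, ha⟩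
    rcases Nat.eq_zero_or_pos (R a).ncard with h0 | h0
    · rw [h0]; simp
    · have h0' : (0 : ℝ) < (R a).ncard := by exact_mod_cast h0
      have hle' : ((S.filter (· ∈ R a)).card : ℝ) ≤ (R a).ncard := by exact_mod_cast hle
      rw [mul_one_div, div_le_div_iff₀ (by positivity) hL]
      nlinarith
  refine (Finset.sum_le_sum this).trans ?_
  rw [Finset.sum_const, nsmul_eq_mul]
  rcases Nat.eq_zero_or_pos labels.card with h | h
  · simp [h]
  · have : (labels.card : ℝ) ≠ 0 := by exact_mod_cast h.ne'
    rw [mul_one_div, div_self this]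

theorem optimalPointwise_uniformOn_of_labels (S : Set BTree) (index : BTree → ℕ)
    (hfin : ∀ a, (R a).Finite)
    (hnode : ∀ a l r, BinaryTree.node () l r ∈ R a → ∃ b c, l ∈ R b ∧ r ∈ R c ∧
      ∀ l' ∈ R b, ∀ r' ∈ R c, BinaryTree.node () l' r' ∈ R a)
    (labels : ℕ → Finset Λ) (hlabels : ∀ B a f, f ∈ R a → f.numNodes < B → a ∈ labels B)
    {C : ℝ} (hC : 1 ≤ C) {k : ℕ} (hcard : ∀ B, ((labels B).card : ℝ) ≤ C * ((B : ℝ) + 1) ^ k)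
    {c κ : ℝ} (hc : 0 < c) (hκ : 0 < κ)
    (htwig : ∀ a, ∀ t ∈ R a, EveryNode (fun l r =>
      c * ((l.numNodes + r.numNodes + 1 : ℕ) : ℝ) ^ κ ≤ (l.numNodes : ℝ) + 1 ∧
      c * ((l.numNodes + r.numNodes + 1 : ℕ) : ℝ) ^ κ ≤ (r.numNodes : ℝ) + 1) t)
    (hS : ∀ t ∈ S, ∃ a, t ∈ R a ∧ ∀ s ∈ R a, s ∈ S ∧ index s = index t) :
    OptimalPointwise hyperBinary BinaryTree.numNodes (uniformOn S index) := by
  classical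
  have hrate : Tendsto (fun B : ℕ =>
      2 / c * (Real.logb 2 (8 * C * ((B : ℝ) + 1) ^ k) / (B : ℝ) ^ κ) +
        (24 / (B : ℝ) + errorRate B)) atTop (nhds 0) := by
    have h1 := (tendsto_logb_div_rpow (C := 8 * C) (by positivity) hκ k).const_mul (2 / c)
    have h2 : Tendsto (fun B : ℕ => 24 / (B : ℝ)) atTop (nhds 0) :=
      tendsto_const_div_atTop_nhds_zero_nat 24
    simpa using h1.add (h2.add tendsto_errorRate)
  refine optimalPointwise_of_rate hrate (2000 + Real.logb 2 (8 * C * ((1 : ℝ) + 1) ^ k)) ?_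
  intro t hPt
  have htS : t ∈ S := by
    by_contra h
    simp [uniformOn, h] at hPt
  obtain ⟨a, hta, ha⟩ := hS t htS
  rw [uniformOn, if_pos htS] at hPt ⊢
  have hpos : 0 < Set.ncard {s | s ∈ S ∧ index s = index t} := by
    rw [one_div_pos] at hPt
    exact_mod_cast hPt
  have hle : (R a).ncard ≤ Set.ncard {s | s ∈ S ∧ index s = index t} :=
    Set.ncard_le_ncard (fun s hs => ha s hs) (Set.finite_of_ncard_pos hpos)
  rw [one_div_one_div]
  have hRpos : 0 < (R a).ncard := (Set.ncard_pos (hfin a)).2 ⟨t, hta⟩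
  have hlogle : Real.logb 2 (R a).ncard ≤
      Real.logb 2 (Set.ncard {s | s ∈ S ∧ index s = index t}) :=
    Real.logb_le_logb_of_le (by norm_num) (by exact_mod_cast hRpos) (by exact_mod_cast hle)
  set B := blockParam t.numNodes with hBdef
  have hB : 1 ≤ B := one_le_blockParam _
  set L := C * ((B : ℝ) + 1) ^ k with hLdef
  have hL1 : 1 ≤ L := by
    have : (1 : ℝ) ≤ ((B : ℝ) + 1) ^ k := one_le_pow₀ (by linarith [Nat.cast_nonneg (α := ℝ) B])
    rw [hLdef]; nlinarith
  have hw0 : ∀ f, 0 ≤ labelWeight R (labels B) f := by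
    intro f
    unfold labelWeight
    exact Finset.sum_nonneg fun a _ => by split_ifs <;> positivity
  obtain ⟨hp, hs⟩ := prod_ncard_fringe_le R hfin hnode (labelWeight R (labels B)) hL1 B hB
    (by
      intro b f hf hlt
      have hb := hlabels B b f hf hlt
      have hpos : (0 : ℝ) < (labels B).card := by exact_mod_cast Finset.card_pos.2 ⟨b, hb⟩
      have hRb : (0 : ℝ) < (R b).ncard := by exact_mod_cast (Set.ncard_pos (hfin b)).2 ⟨f, hf⟩
      have h1 : 1 / (L * (R b).ncard) ≤ 1 / ((labels B).card * (R b).ncard) := by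
        apply one_div_le_one_div_of_le (by positivity)
        exact mul_le_mul_of_nonneg_right (hcard B) hRb.le
      refine h1.trans ?_
      have := Finset.single_le_sum (s := labels B)
        (f := fun a => if f ∈ R a then 1 / (((labels B).card : ℝ) * (R a).ncard) else 0)
        (fun a _ => by split_ifs <;> positivity) hb
      simpa [labelWeight, hf] using this) a t hta
  have h := length_hyperBinary_le_fringe t (labelWeight R (labels B)) hw0
    (sum_labelWeight_le R hfin _ _) hp
  have h8 : Real.logb 2 (8 * C * ((B : ℝ) + 1) ^ k) = 3 + Real.logb 2 L := by
    have : Real.logb 2 8 = 3 := by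
      rw [show (8 : ℝ) = 2 ^ (3 : ℝ) by norm_num, Real.logb_rpow (by norm_num) (by norm_num)]
    rw [mul_assoc, Real.logb_mul (by norm_num) (by positivity), this]
  have hLnn : 0 ≤ 3 + Real.logb 2 L := by
    have := Real.logb_nonneg (b := 2) (by norm_num) hL1; linarith
  have hF : ((fringe B t).length : ℝ) * (3 + Real.logb 2 L) ≤
      t.numNodes * (2 / c * (Real.logb 2 (8 * C * ((B : ℝ) + 1) ^ k) / (B : ℝ) ^ κ)) +
        Real.logb 2 (8 * C * ((1 : ℝ) + 1) ^ k) := by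
    have hpos1 : 0 ≤ Real.logb 2 (8 * C * ((1 : ℝ) + 1) ^ k) := by
      apply Real.logb_nonneg (by norm_num)
      have : (1 : ℝ) ≤ (1 + 1) ^ k := one_le_pow₀ (by norm_num)
      nlinarith
    rcases Nat.eq_zero_or_pos t.numNodes with h0 | h0
    · have hB1 : B = 1 := by rw [hBdef, h0]; simp [blockParam]
      have : fringe B t = [t] := fringe_of_light (by rw [h0]; omega)
      rw [this, h0, ← h8, hB1]
      simp
    · have := length_fringe_le hc hκ hB (blockParam_le h0) (htwig a t hta)
      rw [h8]
      have h2 := mul_le_mul_of_nonneg_right this hLnn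
      have e : (t.numNodes : ℝ) * (2 / c / (B : ℝ) ^ κ) * (3 + Real.logb 2 L) =
        t.numNodes * (2 / c * ((3 + Real.logb 2 L) / (B : ℝ) ^ κ)) := by ring
      rw [e] at h2
      exact h2.trans (le_add_of_nonneg_right hpos1)
  have e : (t.numNodes : ℝ) * (2 / c * (Real.logb 2 (8 * C * ((B : ℝ) + 1) ^ k) / (B : ℝ) ^ κ) +
        (24 / (B : ℝ) + errorRate B)) =
      t.numNodes * (2 / c * (Real.logb 2 (8 * C * ((B : ℝ) + 1) ^ k) / (B : ℝ) ^ κ)) +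
        t.numNodes * (24 / (B : ℝ) + errorRate B) := by ring
  rw [e]
  linarith

end Classes

theorem finite_of_numNodes (S : Set BTree) (n : ℕ) (h : ∀ t ∈ S, t.numNodes = n) : S.Finite :=
  (BinaryTree.treesOfNumNodesEq n).finite_toSet.subset fun t ht => by simpa using h t ht

/-! ### AVL trees, weight-balanced trees and red-black trees -/

theorem numNodes_succ_le_two_pow_height (t : BTree) : t.numNodes + 1 ≤ 2 ^ t.height := by
  induction t with
  | nil => simp [BinaryTree.numNodes]
  | node a l r hl hr =>
    simp only [BinaryTree.numNodes, BinaryTree.height, pow_succ]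
    have h1 : 2 ^ l.height ≤ 2 ^ max l.height r.height :=
      Nat.pow_le_pow_right (by norm_num) (le_max_left _ _)
    have h2 : 2 ^ r.height ≤ 2 ^ max l.height r.height :=
      Nat.pow_le_pow_right (by norm_num) (le_max_right _ _)
    omega

theorem two_pow_height_le {t : BTree} (ht : t ∈ avlTrees) : 2 ^ t.height ≤ (t.numNodes + 1) ^ 2 := by
  induction t with
  | nil => simp [BinaryTree.numNodes, BinaryTree.height]
  | node a l r hl hr =>
    obtain ⟨h1, h2, h3⟩ := ht
    have hl := hl h2
    have hr := hr h3
    simp only [BinaryTree.numNodes, BinaryTree.height, pow_succ]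
    have key : ∀ (x y a b : ℕ), x ≤ a ^ 2 → y ≤ b ^ 2 → x ≤ 2 * y → x * 2 ≤ (a + b) ^ 2 := by
      intro x y a b hx hy hxy
      have hab : x ≤ 2 * (a * b) := by
        by_contra hcon
        have h5 : (2 * (a * b)) * (2 * (a * b)) < x * x := Nat.mul_self_lt_mul_self (by omega)
        have h6 : x * y ≤ a ^ 2 * b ^ 2 := Nat.mul_le_mul hx hy
        have h7 : x * x ≤ x * (2 * y) := Nat.mul_le_mul_left _ hxy
        nlinarith
      nlinarith
    have hp : ∀ i j : ℕ, i ≤ j + 1 → 2 ^ i ≤ 2 * 2 ^ j := by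
      intro i j hij
      calc 2 ^ i ≤ 2 ^ (j + 1) := Nat.pow_le_pow_right (by norm_num) hij
        _ = 2 * 2 ^ j := by ring
    have e : (l.numNodes + r.numNodes + 1 + 1) = (l.numNodes + 1) + (r.numNodes + 1) := by ring
    have goal' : 2 ^ max l.height r.height * 2 ≤ (l.numNodes + r.numNodes + 1 + 1) ^ 2 := by
      rw [e]
      rcases le_total r.height l.height with h | h
      · rw [max_eq_left h]
        exact key _ _ _ _ hl hr (hp _ _ h1.1)
      · rw [max_eq_right h, add_comm (l.numNodes + 1)]
        exact key _ _ _ _ hr hl (hp _ _ h1.2)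
    simpa [pow_two, mul_comm] using goal'

theorem half_mul_sqrt_le {s x : ℕ} (h : s ≤ 4 * (x + 1) ^ 2) :
    (1 / 2 : ℝ) * (s : ℝ) ^ (1 / 2 : ℝ) ≤ (x : ℝ) + 1 := by
  rw [← Real.sqrt_eq_rpow]
  have h1 : Real.sqrt s ≤ 2 * (x + 1) := by
    apply Real.sqrt_le_iff.2
    refine ⟨by positivity, ?_⟩
    have : (s : ℝ) ≤ 4 * (x + 1) ^ 2 := by exact_mod_cast h
    linarith
  linarith

theorem avlTrees_twigged {t : BTree} (ht : t ∈ avlTrees) : EveryNode (fun l r =>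
      (1 / 2 : ℝ) * ((l.numNodes + r.numNodes + 1 : ℕ) : ℝ) ^ (1 / 2 : ℝ) ≤ (l.numNodes : ℝ) + 1 ∧
      (1 / 2 : ℝ) * ((l.numNodes + r.numNodes + 1 : ℕ) : ℝ) ^ (1 / 2 : ℝ) ≤
        (r.numNodes : ℝ) + 1) t := by
  induction t with
  | nil => trivial
  | node a l r hl hr =>
    obtain ⟨h1, h2, h3⟩ := ht
    refine ⟨?_, hl h2, hr h3⟩
    have hs := numNodes_succ_le_two_pow_height (BinaryTree.node a l r)
    simp only [BinaryTree.numNodes, BinaryTree.height] at hs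
    have hp : ∀ x : BTree, max l.height r.height ≤ x.height + 1 →
        x ∈ avlTrees → l.numNodes + r.numNodes + 1 ≤ 4 * (x.numNodes + 1) ^ 2 := by
      intro x hx hxa
      have h4 : 2 ^ (max l.height r.height + 1) ≤ 2 ^ (x.height + 2) :=
        Nat.pow_le_pow_right (by norm_num) (by omega)
      have h5 := two_pow_height_le hxa
      have h6 : 2 ^ (x.height + 2) = 4 * 2 ^ x.height := by ring
      omega
    exact ⟨half_mul_sqrt_le (hp l (by omega) h2), half_mul_sqrt_le (hp r (by omega) h3)⟩

/-- AVL trees with given size and height. -/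
def avlClass (a : ℕ × ℕ) : Set BTree := {t | t ∈ avlTrees ∧ t.numNodes = a.1 ∧ t.height = a.2}

theorem optimalPointwise_avl (index : BTree → ℕ)
    (hindex : ∀ s t : BTree, s.numNodes = t.numNodes → s.height = t.height → index s = index t) :
    OptimalPointwise hyperBinary BinaryTree.numNodes (uniformOn avlTrees index) := by
  refine optimalPointwise_uniformOn_of_labels avlClass avlTrees index
    (fun a => finite_of_numNodes _ a.1 fun t ht => ht.2.1) ?_
    (fun B => Finset.range B ×ˢ Finset.range B) ?_ (C := 1) le_rfl (k := 2) ?_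
    (c := 1 / 2) (κ := 1 / 2) (by norm_num) (by norm_num) (fun a t ht => avlTrees_twigged ht.1) ?_
  · rintro a l r ⟨⟨h1, h2, h3⟩, h4, h5⟩
    refine ⟨(l.numNodes, l.height), (r.numNodes, r.height), ⟨h2, rfl, rfl⟩, ⟨h3, rfl, rfl⟩, ?_⟩
    rintro l' ⟨hl1, hl2, hl3⟩ r' ⟨hr1, hr2, hr3⟩
    simp only [BinaryTree.numNodes, BinaryTree.height] at *
    refine ⟨⟨by simp only [hl3, hr3]; exact h1, hl1, hr1⟩, ?_, ?_⟩
    · simp only [BinaryTree.numNodes, hl2, hr2, h4]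
    · simp only [BinaryTree.height, hl3, hr3, h5]
  · rintro B a f ⟨_, h1, h2⟩ hlt
    have := f.height_le_numNodes
    simp only [Finset.mem_product, Finset.mem_range]
    omega
  · intro B
    simp only [Finset.card_product, Finset.card_range]
    push_cast
    nlinarith [Nat.cast_nonneg (α := ℝ) B]
  · intro t ht
    exact ⟨(t.numNodes, t.height), ⟨ht, rfl, rfl⟩, fun s hs => ⟨hs.1, hindex s t hs.2.1 hs.2.2⟩⟩

theorem optimalPointwise_weightBalanced {α : ℝ} (hα : 0 < α) :
    OptimalPointwise hyperBinary BinaryTree.numNodes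
      (uniformOn (weightBalancedTrees α) BinaryTree.numNodes) := by
  refine optimalPointwise_uniformOn_of_labels
    (fun n : ℕ => {t | t ∈ weightBalancedTrees α ∧ t.numNodes = n}) _ _
    (fun n => finite_of_numNodes _ n fun t ht => ht.2) ?_ Finset.range ?_ (C := 1) le_rfl (k := 1) ?_
    (c := α) (κ := 1) hα one_pos ?_ ?_
  · rintro n l r ⟨⟨h1, h2, h3⟩, h4⟩
    refine ⟨l.numNodes, r.numNodes, ⟨h2, rfl⟩, ⟨h3, rfl⟩, ?_⟩
    rintro l' ⟨hl1, hl2⟩ r' ⟨hr1, hr2⟩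
    refine ⟨⟨by simp only [hl2, hr2]; exact h1, hl1, hr1⟩, ?_⟩
    rw [← h4]; simp only [BinaryTree.numNodes, hl2, hr2]
  · rintro B n f ⟨_, h1⟩ hlt
    rw [Finset.mem_range]; omega
  · intro B
    simp
  · rintro n t ⟨ht, _⟩
    refine EveryNode.imp (fun l r h => ?_) ht
    rw [Real.rpow_one]
    push_cast
    constructor <;> nlinarith [h.1, h.2]
  · intro t ht
    exact ⟨t.numNodes, ⟨ht, rfl⟩, fun s hs => hs⟩

theorem numNodes_of_redBlackColorable {red : Bool} {b : ℕ} {t : BTree}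
    (h : RedBlackColorable red b t) :
    (if red then 2 else 1) * (t.numNodes + 1) ≤ 4 ^ b ∧ 2 ^ b ≤ t.numNodes + 1 := by
  induction t generalizing red b with
  | nil => obtain ⟨rfl, rfl⟩ := h; simp [BinaryTree.numNodes]
  | node a l r hl hr =>
    obtain ⟨redL, redR, h1, _, h3, h4⟩ := h
    have key : ∀ (redX : Bool) (x : BTree), (∀ {red : Bool} {b : ℕ}, RedBlackColorable red b x →
          (if red then 2 else 1) * (x.numNodes + 1) ≤ 4 ^ b ∧ 2 ^ b ≤ x.numNodes + 1) →
        (redX = true ∧ RedBlackColorable true b x ∨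
          redX = false ∧ ∃ b', b = b' + 1 ∧ RedBlackColorable false b' x) →
        (if redX then 2 else 4) * (x.numNodes + 1) ≤ 4 ^ b ∧ 2 ^ b ≤ 2 * (x.numNodes + 1) := by
      intro redX x ih hx
      rcases hx with ⟨rfl, hx⟩ | ⟨rfl, b', rfl, hx⟩
      · have := ih hx; simp only [if_true] at *; omega
      · have := ih hx; simp only [Bool.false_eq_true, if_false, pow_succ] at *; omega
    have kl := key redL l hl h3
    have kr := key redR r hr h4
    simp only [BinaryTree.numNodes]
    cases red
    · simp only [Bool.false_eq_true, if_false]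
      split_ifs at kl kr <;> omega
    · obtain ⟨rfl, rfl⟩ := h1 rfl
      simp only [Bool.false_eq_true, if_false, if_true] at kl kr ⊢
      omega

theorem redBlack_twigged {red : Bool} {b : ℕ} {t : BTree} (ht : RedBlackColorable red b t) :
    EveryNode (fun l r =>
      (1 / 2 : ℝ) * ((l.numNodes + r.numNodes + 1 : ℕ) : ℝ) ^ (1 / 2 : ℝ) ≤ (l.numNodes : ℝ) + 1 ∧
      (1 / 2 : ℝ) * ((l.numNodes + r.numNodes + 1 : ℕ) : ℝ) ^ (1 / 2 : ℝ) ≤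
        (r.numNodes : ℝ) + 1) t := by
  induction t generalizing red b with
  | nil => trivial
  | node a l r hl hr =>
    have hs := (numNodes_of_redBlackColorable ht).1
    have hs' : l.numNodes + r.numNodes + 1 ≤ 4 ^ b := by
      simp only [BinaryTree.numNodes] at hs
      split_ifs at hs <;> omega
    obtain ⟨redL, redR, _, _, h3, h4⟩ := ht
    have key : ∀ (redX : Bool) (x : BTree), (redX = true ∧ RedBlackColorable true b x ∨
          redX = false ∧ ∃ b', b = b' + 1 ∧ RedBlackColorable false b' x) →
        l.numNodes + r.numNodes + 1 ≤ 4 * (x.numNodes + 1) ^ 2 := by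
      intro redX x hx
      have h5 : 2 ^ b ≤ 2 * (x.numNodes + 1) := by
        rcases hx with ⟨rfl, hx⟩ | ⟨rfl, b', rfl, hx⟩
        · have := (numNodes_of_redBlackColorable hx).2; omega
        · have := (numNodes_of_redBlackColorable hx).2; rw [pow_succ]; omega
      have h6 : (4 : ℕ) ^ b = (2 ^ b) ^ 2 := by rw [← pow_mul, mul_comm, pow_mul]; norm_num
      have h7 : (2 ^ b) ^ 2 ≤ (2 * (x.numNodes + 1)) ^ 2 := Nat.pow_le_pow_left h5 2
      rw [mul_pow] at h7
      omega
    refine ⟨⟨half_mul_sqrt_le (key redL l h3), half_mul_sqrt_le (key redR r h4)⟩, ?_, ?_⟩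
    · rcases h3 with ⟨_, h⟩ | ⟨_, b', _, h⟩ <;> exact hl h
    · rcases h4 with ⟨_, h⟩ | ⟨_, b', _, h⟩ <;> exact hr h

/-- Trees of a given size that can be coloured with a given colour of the edge to the root and a
given black height. -/
def redBlackClass (a : ℕ × Bool × ℕ) : Set BTree :=
  {t | t.numNodes = a.1 ∧ RedBlackColorable a.2.1 a.2.2 t}

theorem optimalPointwise_redBlack :
    OptimalPointwise hyperBinary BinaryTree.numNodes
      (uniformOn redBlackTrees BinaryTree.numNodes) := by
  refine optimalPointwise_uniformOn_of_labels redBlackClass _ _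
    (fun a => finite_of_numNodes _ a.1 fun t ht => ht.1) ?_
    (fun B => Finset.range B ×ˢ (Finset.univ ×ˢ Finset.range B)) ?_ (C := 2) (by norm_num) (k := 2) ?_
    (c := 1 / 2) (κ := 1 / 2) (by norm_num) (by norm_num) (fun a t ht => redBlack_twigged ht.2) ?_
  · rintro ⟨n, red, b⟩ l r ⟨h1, redL, redR, h2, h3, h4, h5⟩
    obtain ⟨bl, hbl, hl⟩ : ∃ bl, RedBlackColorable redL bl l ∧ ∀ l', RedBlackColorable redL bl l' →
        (redL = true ∧ RedBlackColorable true b l') ∨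
        (redL = false ∧ ∃ b', b = b' + 1 ∧ RedBlackColorable false b' l') := by
      rcases h4 with ⟨rfl, h⟩ | ⟨rfl, b', hb', h⟩
      · exact ⟨b, h, fun l' hl' => Or.inl ⟨rfl, hl'⟩⟩
      · exact ⟨b', h, fun l' hl' => Or.inr ⟨rfl, b', hb', hl'⟩⟩
    obtain ⟨br, hbr, hr⟩ : ∃ br, RedBlackColorable redR br r ∧ ∀ r', RedBlackColorable redR br r' →
        (redR = true ∧ RedBlackColorable true b r') ∨
        (redR = false ∧ ∃ b', b = b' + 1 ∧ RedBlackColorable false b' r') := by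
      rcases h5 with ⟨rfl, h⟩ | ⟨rfl, b', hb', h⟩
      · exact ⟨b, h, fun l' hl' => Or.inl ⟨rfl, hl'⟩⟩
      · exact ⟨b', h, fun l' hl' => Or.inr ⟨rfl, b', hb', hl'⟩⟩
    refine ⟨(l.numNodes, redL, bl), (r.numNodes, redR, br), ⟨rfl, hbl⟩, ⟨rfl, hbr⟩, ?_⟩
    rintro l' ⟨hl1, hl2⟩ r' ⟨hr1, hr2⟩
    refine ⟨?_, redL, redR, h2, h3, hl l' hl2, hr r' hr2⟩
    simp only [BinaryTree.numNodes] at *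
    rw [hl1, hr1, h1]
  · rintro B ⟨n, red, b⟩ f ⟨h1, h2⟩ hlt
    have := (numNodes_of_redBlackColorable h2).2
    have := Nat.lt_two_pow_self (n := b)
    simp only [Finset.mem_product, Finset.mem_range, Finset.mem_univ, true_and] at *
    omega
  · intro B
    simp only [Finset.card_product, Finset.card_range, Finset.card_univ, Fintype.card_bool]
    push_cast
    nlinarith [Nat.cast_nonneg (α := ℝ) B]
  · rintro t ⟨b, ht⟩
    exact ⟨(t.numNodes, false, b), ⟨rfl, ht⟩, fun s hs => ⟨⟨b, hs.2⟩, hs.1⟩⟩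

end Hypersuccinct

namespace Hypersuccinct

open Finset.HasAntidiagonal (antidiagonal mem_antidiagonal)

/-! ### Expected code lengths -/

/-- The sum of the square roots of all subtree sizes. -/
noncomputable def sqrtSum : BTree → ℝ
  | .nil => 0
  | .node _ l r => Real.sqrt (l.numNodes + r.numNodes + 1) + sqrtSum l + sqrtSum r

theorem sqrtSum_nonneg (t : BTree) : 0 ≤ sqrtSum t := by
  induction t with
  | nil => simp [sqrtSum]
  | node a l r hl hr => unfold sqrtSum; positivity

theorem length_fringe_le_sqrtSum {B : ℕ} (hB : 1 ≤ B) (t : BTree) :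
    ((fringe B t).length : ℝ) ≤ 1 + sqrtSum t / Real.sqrt B := by
  have hB0 : 0 < Real.sqrt B := Real.sqrt_pos.2 (by exact_mod_cast hB)
  induction t with
  | nil => simp [fringe, sqrtSum]
  | node a l r hl hr =>
    rw [fringe]
    split_ifs with h
    · have : 0 ≤ sqrtSum (.node a l r) / Real.sqrt B := div_nonneg (sqrtSum_nonneg _) hB0.le
      simpa using this
    · rw [List.length_append, sqrtSum, add_div, add_div]
      have : 1 ≤ Real.sqrt (l.numNodes + r.numNodes + 1) / Real.sqrt B := by
        rw [one_le_div hB0]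
        apply Real.sqrt_le_sqrt
        exact_mod_cast (by omega : B ≤ l.numNodes + r.numNodes + 1)
      push_cast
      linarith

theorem sqrt_add_sqrt_ge {i j : ℕ} (h : 0 < i + j) :
    Real.sqrt ((i + j : ℕ) : ℝ) * (1 + (i : ℝ) * j / ((i + j : ℕ) : ℝ) ^ 2) ≤
      Real.sqrt i + Real.sqrt j := by
  have hn : (0 : ℝ) < ((i + j : ℕ) : ℝ) := by exact_mod_cast h
  push_cast at hn ⊢
  have hi : (0 : ℝ) ≤ i := by positivity
  have hj : (0 : ℝ) ≤ j := by positivity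
  set y := (i : ℝ) * j / ((i : ℝ) + j) ^ 2 with hy
  have hy0 : 0 ≤ y := by positivity
  have hy1 : y ≤ 1 / 4 := by
    rw [hy, div_le_div_iff₀ (by positivity) (by norm_num)]
    nlinarith [sq_nonneg ((i : ℝ) - j)]
  have hij : (i : ℝ) * j = y * ((i : ℝ) + j) ^ 2 := by rw [hy]; field_simp
  have hs : y * ((i : ℝ) + j) ≤ 2⁻¹ * Real.sqrt (i * j) := by
    rw [hij, Real.sqrt_mul hy0, Real.sqrt_sq hn.le]
    have : 2 * y ≤ Real.sqrt y := by
      apply Real.le_sqrt_of_sq_le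
      nlinarith
    nlinarith
  refine (pow_le_pow_iff_left₀ (by positivity) (by positivity) two_ne_zero).1 ?_
  rw [mul_pow, Real.sq_sqrt hn.le, add_sq (Real.sqrt i), Real.sq_sqrt hi, Real.sq_sqrt hj, mul_assoc 2,
    ← Real.sqrt_mul hi]
  have h3 := Real.sqrt_nonneg ((i : ℝ) * j)
  nlinarith [mul_nonneg hy0 hn.le]

/-- A source all of whose splits are balanced with positive probability. -/
structure IsBalancedSource (p : ℕ → ℕ → ℝ) : Prop where
  nonneg : ∀ l r, 0 ≤ p l r
  sum_eq_one : ∀ n, ∑ ij ∈ antidiagonal n, p ij.1 ij.2 = 1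
  balanced : ∃ δ : ℝ, 0 < δ ∧ ∃ n₀ : ℕ, ∀ n, n₀ ≤ n →
    δ * (n : ℝ) ^ 2 ≤ ∑ ij ∈ antidiagonal n, p ij.1 ij.2 * ((ij.1 : ℝ) * ij.2)

namespace IsBalancedSource

variable {p : ℕ → ℕ → ℝ}

theorem isSubSource (hp : IsBalancedSource p) : IsSubSource p :=
  ⟨hp.nonneg, fun n => (hp.sum_eq_one n).le⟩

theorem sum_sqrtSum_succ (hp : IsBalancedSource p) (n : ℕ) :
    ∑ t ∈ BinaryTree.treesOfNumNodesEq (n + 1), fixedSize p t * sqrtSum t ≤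
      Real.sqrt (n + 1) + ∑ ij ∈ antidiagonal n, p ij.1 ij.2 *
        ((∑ t ∈ BinaryTree.treesOfNumNodesEq ij.1, fixedSize p t * sqrtSum t) +
          ∑ t ∈ BinaryTree.treesOfNumNodesEq ij.2, fixedSize p t * sqrtSum t) := by
  have hs := hp.isSubSource
  have hE : ∀ n, 0 ≤ ∑ t ∈ BinaryTree.treesOfNumNodesEq n, fixedSize p t * sqrtSum t := fun n =>
    Finset.sum_nonneg fun t _ => mul_nonneg (hs.fixedSize_nonneg t) (sqrtSum_nonneg t)
  have hP : ∀ n, 0 ≤ ∑ t ∈ BinaryTree.treesOfNumNodesEq n, fixedSize p t := fun n =>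
    Finset.sum_nonneg fun t _ => hs.fixedSize_nonneg t
  have h1 : Real.sqrt (n + 1) = ∑ ij ∈ antidiagonal n, p ij.1 ij.2 * Real.sqrt (n + 1) := by
    rw [← Finset.sum_mul, hp.sum_eq_one, one_mul]
  rw [sum_treesOfNumNodesEq_succ, h1, ← Finset.sum_add_distrib]
  refine Finset.sum_le_sum fun ij hij => ?_
  have hij' := mem_antidiagonal.1 hij
  have e : ∑ l ∈ BinaryTree.treesOfNumNodesEq ij.1, ∑ r ∈ BinaryTree.treesOfNumNodesEq ij.2,
      fixedSize p (.node () l r) * sqrtSum (.node () l r) = p ij.1 ij.2 *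
        (Real.sqrt (n + 1) * ((∑ l ∈ BinaryTree.treesOfNumNodesEq ij.1, fixedSize p l) *
            ∑ r ∈ BinaryTree.treesOfNumNodesEq ij.2, fixedSize p r) +
          (∑ l ∈ BinaryTree.treesOfNumNodesEq ij.1, fixedSize p l * sqrtSum l) *
            (∑ r ∈ BinaryTree.treesOfNumNodesEq ij.2, fixedSize p r) +
          (∑ l ∈ BinaryTree.treesOfNumNodesEq ij.1, fixedSize p l) *
            ∑ r ∈ BinaryTree.treesOfNumNodesEq ij.2, fixedSize p r * sqrtSum r) := by
    rw [Finset.sum_mul_sum, Finset.sum_mul_sum, Finset.sum_mul_sum, Finset.mul_sum,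
      ← Finset.sum_add_distrib, ← Finset.sum_add_distrib, Finset.mul_sum]
    refine Finset.sum_congr rfl fun l hl => ?_
    rw [Finset.mul_sum, ← Finset.sum_add_distrib, ← Finset.sum_add_distrib, Finset.mul_sum]
    refine Finset.sum_congr rfl fun r hr => ?_
    rw [BinaryTree.mem_treesOfNumNodesEq] at hl hr
    have hn : ((n : ℝ)) = (ij.1 : ℝ) + ij.2 := by exact_mod_cast hij'.symm
    simp only [fixedSize, sqrtSum, hl, hr, hn]
    ring
  rw [e, ← mul_add]
  apply mul_le_mul_of_nonneg_left _ (hp.nonneg _ _)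
  have a1 := hs.sum_fixedSize_le_one ij.1
  have a2 := hs.sum_fixedSize_le_one ij.2
  have b1 := mul_le_one₀ a1 (hP ij.2) a2
  have b2 := mul_le_of_le_one_right (hE ij.1) a2
  have b3 := mul_le_of_le_one_left (hE ij.2) a1
  have b4 := mul_le_of_le_one_right (Real.sqrt_nonneg ((n : ℝ) + 1)) b1
  linarith

/-- The expected sum of the square roots of the subtree sizes is linear, by the potential
`A n - C √n`: a balanced split gains a constant fraction of `√n`. -/
theorem sum_sqrtSum_le (hp : IsBalancedSource p) : ∃ A : ℝ, 0 ≤ A ∧ ∀ n : ℕ,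
    ∑ t ∈ BinaryTree.treesOfNumNodesEq n, fixedSize p t * sqrtSum t ≤ A * n := by
  obtain ⟨δ, hδ, n₀, hbal⟩ := hp.balanced
  set C := 1 / δ with hC
  have hC0 : 0 < C := by positivity
  have hCδ : C * δ = 1 := by rw [hC]; field_simp
  refine ⟨(n₀ + 2) * (1 + C), by positivity, fun n => ?_⟩
  set A := ((n₀ : ℝ) + 2) * (1 + C) with hA
  suffices h : ∑ t ∈ BinaryTree.treesOfNumNodesEq n, fixedSize p t * sqrtSum t ≤
      A * n - C * Real.sqrt n by
    have := mul_nonneg hC0.le (Real.sqrt_nonneg (n : ℝ))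
    linarith
  induction n using Nat.strong_induction_on with
  | _ n ih =>
    cases n with
    | zero => simp [sqrtSum]
    | succ n =>
      refine (hp.sum_sqrtSum_succ n).trans ?_
      have h1 : ∑ ij ∈ antidiagonal n, p ij.1 ij.2 *
          ((∑ t ∈ BinaryTree.treesOfNumNodesEq ij.1, fixedSize p t * sqrtSum t) +
            ∑ t ∈ BinaryTree.treesOfNumNodesEq ij.2, fixedSize p t * sqrtSum t) ≤
          ∑ ij ∈ antidiagonal n, p ij.1 ij.2 *
            (A * n - C * (Real.sqrt ij.1 + Real.sqrt ij.2)) := by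
        refine Finset.sum_le_sum fun ij hij => mul_le_mul_of_nonneg_left ?_ (hp.nonneg _ _)
        have hij' := mem_antidiagonal.1 hij
        have e1 := ih ij.1 (by omega)
        have e2 := ih ij.2 (by omega)
        have hn : ((n : ℝ)) = (ij.1 : ℝ) + ij.2 := by exact_mod_cast hij'.symm
        rw [hn]
        linarith
      have h2 : ∑ ij ∈ antidiagonal n, p ij.1 ij.2 *
            (A * n - C * (Real.sqrt ij.1 + Real.sqrt ij.2)) =
          A * n - C * ∑ ij ∈ antidiagonal n, p ij.1 ij.2 * (Real.sqrt ij.1 + Real.sqrt ij.2) := by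
        rw [Finset.mul_sum]
        have : A * (n : ℝ) = ∑ ij ∈ antidiagonal n, p ij.1 ij.2 * (A * n) := by
          rw [← Finset.sum_mul, hp.sum_eq_one, one_mul]
        rw [this, ← Finset.sum_sub_distrib, ← this]
        exact Finset.sum_congr rfl fun ij _ => by ring
      rw [h2] at h1
      have hsq : Real.sqrt ((n : ℝ) + 1) ≤ Real.sqrt n + 1 := by
        apply Real.sqrt_le_iff.2
        have := Real.sq_sqrt (Nat.cast_nonneg (α := ℝ) n)
        have := Real.sqrt_nonneg (n : ℝ)
        exact ⟨by linarith, by nlinarith⟩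
      push_cast
      rcases Nat.lt_or_ge n (n₀ + 1) with hn | hn
      · have h3 : 0 ≤ ∑ ij ∈ antidiagonal n, p ij.1 ij.2 * (Real.sqrt ij.1 + Real.sqrt ij.2) :=
          Finset.sum_nonneg fun ij _ => mul_nonneg (hp.nonneg _ _) (by positivity)
        have h4 : Real.sqrt ((n : ℝ) + 1) ≤ n₀ + 2 := by
          have hn' : (n : ℝ) ≤ n₀ := by exact_mod_cast (by omega)
          apply Real.sqrt_le_iff.2
          exact ⟨by positivity, by nlinarith [Nat.cast_nonneg (α := ℝ) n₀]⟩
        have h5 := mul_le_mul_of_nonneg_right h4 (by positivity : 0 ≤ 1 + C)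
        have h6 := mul_nonneg hC0.le h3
        rw [← hA] at h5
        nlinarith
      · have hn0 : 0 < n := by omega
        have hn0' : (0 : ℝ) < n := by exact_mod_cast hn0
        have h3 : Real.sqrt n * (1 + δ) ≤
            ∑ ij ∈ antidiagonal n, p ij.1 ij.2 * (Real.sqrt ij.1 + Real.sqrt ij.2) := by
          have e : Real.sqrt n * (1 + (∑ ij ∈ antidiagonal n, p ij.1 ij.2 *
              ((ij.1 : ℝ) * ij.2)) / (n : ℝ) ^ 2) =
              ∑ ij ∈ antidiagonal n, p ij.1 ij.2 *
                (Real.sqrt n * (1 + (ij.1 : ℝ) * ij.2 / (n : ℝ) ^ 2)) := by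
            rw [mul_add, mul_one, Finset.sum_div, Finset.mul_sum]
            nth_rewrite 1 [← mul_one (Real.sqrt n)]
            have h1' : Real.sqrt n * 1 = ∑ ij ∈ antidiagonal n, Real.sqrt n * p ij.1 ij.2 := by
              rw [← Finset.mul_sum, hp.sum_eq_one]
            rw [h1', ← Finset.sum_add_distrib]
            exact Finset.sum_congr rfl fun ij _ => by ring
          have h4 : δ ≤ (∑ ij ∈ antidiagonal n, p ij.1 ij.2 *
              ((ij.1 : ℝ) * ij.2)) / (n : ℝ) ^ 2 := by
            rw [le_div_iff₀ (by positivity)]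
            exact hbal n (by omega)
          calc Real.sqrt n * (1 + δ) ≤ Real.sqrt n * (1 + (∑ ij ∈ antidiagonal n, p ij.1 ij.2 *
              ((ij.1 : ℝ) * ij.2)) / (n : ℝ) ^ 2) := by gcongr
            _ = _ := e
            _ ≤ _ := by
              refine Finset.sum_le_sum fun ij hij => mul_le_mul_of_nonneg_left ?_ (hp.nonneg _ _)
              have hij' := mem_antidiagonal.1 hij
              rw [← hij']
              exact sqrt_add_sqrt_ge (by omega)
        have h4 := mul_le_mul_of_nonneg_left h3 hC0.le
        have h5 : C * (Real.sqrt n * (1 + δ)) = C * Real.sqrt n + Real.sqrt n := by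
          linear_combination Real.sqrt n * hCδ
        have h6 : 1 + C ≤ A := by
          rw [hA]; nlinarith [Nat.cast_nonneg (α := ℝ) n₀]
        nlinarith

end IsBalancedSource

theorem sum_logb_fringe_le {p : ℕ → ℕ → ℝ} (hp : IsSubSource p) {B : ℕ} (hB : 1 ≤ B) (t : BTree)
    (ht : 0 < fixedSize p t) :
    (∀ f ∈ fringe B t, 0 < fixedSize p f) ∧
      ((fringe B t).map fun f => Real.logb 2 (1 / (fixedSize p f / B))).sum ≤
        Real.logb 2 (1 / fixedSize p t) + (fringe B t).length * Real.logb 2 B := by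
  have hB0 : (0 : ℝ) < B := by exact_mod_cast hB
  have hone : ∀ t, 0 < fixedSize p t → fringe B t = [t] → (∀ f ∈ fringe B t, 0 < fixedSize p f) ∧
      ((fringe B t).map fun f => Real.logb 2 (1 / (fixedSize p f / B))).sum ≤
        Real.logb 2 (1 / fixedSize p t) + (fringe B t).length * Real.logb 2 B := by
    intro t ht h
    rw [h]
    refine ⟨by simpa using ht, ?_⟩
    simp only [List.map_cons, List.map_nil, List.sum_cons, List.sum_nil, add_zero,
      List.length_singleton, Nat.cast_one, one_mul]
    rw [← Real.logb_mul (by positivity) (by positivity)]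
    apply le_of_eq; congr 1; field_simp
  induction t with
  | nil => exact hone _ ht rfl
  | node a l r hl hr =>
    by_cases h : l.numNodes + r.numNodes + 1 < B
    · exact hone _ ht (by rw [fringe, if_pos h])
    · rw [fringe, if_neg h]
      rw [fixedSize] at ht
      have h0 := hp.nonneg l.numNodes r.numNodes
      have h1 := hp.fixedSize_nonneg l
      have h2 := hp.fixedSize_nonneg r
      have h2' : 0 < fixedSize p r := lt_of_le_of_ne h2 fun e => by rw [← e, mul_zero] at ht; linarith
      have h1' : 0 < fixedSize p l := lt_of_le_of_ne h1 fun e => by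
        rw [← e, mul_zero, zero_mul] at ht; linarith
      obtain ⟨a1, a2⟩ := hl h1'
      obtain ⟨b1, b2⟩ := hr h2'
      refine ⟨fun f hf => (List.mem_append.1 hf).elim (a1 f) (b1 f), ?_⟩
      have h3 : Real.logb 2 (1 / fixedSize p l) + Real.logb 2 (1 / fixedSize p r) ≤
          Real.logb 2 (1 / fixedSize p (.node a l r)) := by
        rw [← Real.logb_mul (by positivity) (by positivity)]
        apply Real.logb_le_logb_of_le (by norm_num) (by positivity)
        rw [one_div_mul_one_div, fixedSize]
        apply one_div_le_one_div_of_le ht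
        rw [mul_assoc]
        exact mul_le_of_le_one_left (by positivity) (hp.le_one _ _)
      simp only [List.map_append, List.sum_append, List.length_append]
      push_cast
      linarith

theorem optimalOnAverage_of_balanced {p : ℕ → ℕ → ℝ} (hp : IsBalancedSource p) :
    OptimalOnAverage hyperBinary (fixedSize p) := by
  obtain ⟨A, hA, hE⟩ := hp.sum_sqrtSum_le
  have hs := hp.isSubSource
  have hrate : Tendsto (fun B : ℕ =>
      (A + 1) * (Real.logb 2 (8 * ((B : ℝ) + 1) ^ 1) / (B : ℝ) ^ (1 / 2 : ℝ)) +
        (24 / (B : ℝ) + errorRate B)) atTop (nhds 0) := by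
    have h1 := (tendsto_logb_div_rpow (C := 8) (κ := 1 / 2) (by norm_num) (by norm_num) 1).const_mul
      (A + 1)
    have h2 : Tendsto (fun B : ℕ => 24 / (B : ℝ)) atTop (nhds 0) :=
      tendsto_const_div_atTop_nhds_zero_nat 24
    simpa using h1.add (h2.add tendsto_errorRate)
  refine ⟨_, isLittleO_mul_blockParam hrate (2000 + Real.logb 2 (8 * ((1 : ℝ) + 1) ^ 1)),
    fun n => ?_⟩
  set B := blockParam n with hBdef
  have hB : 1 ≤ B := one_le_blockParam n
  have hB0 : (0 : ℝ) < B := by exact_mod_cast hB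
  set K := n * (24 / (B : ℝ) + errorRate B) + 2000 with hK
  have hK0 : 0 ≤ K := by
    have := errorRate_nonneg B
    positivity
  set D := 3 + Real.logb 2 B with hD
  have hD0 : 0 ≤ D := by
    have : 0 ≤ Real.logb 2 B := Real.logb_nonneg (by norm_num) (by exact_mod_cast hB)
    positivity
  have hpoint : ∀ t ∈ BinaryTree.treesOfNumNodesEq n, fixedSize p t * ((hyperBinary t).length : ℝ) ≤
      fixedSize p t * Real.logb 2 (1 / fixedSize p t) +
        fixedSize p t * (D + K) + D / Real.sqrt B * (fixedSize p t * sqrtSum t) := by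
    intro t ht
    rw [BinaryTree.mem_treesOfNumNodesEq] at ht
    rcases (hs.fixedSize_nonneg t).eq_or_lt with h0 | h0
    · rw [← h0]; simp
    obtain ⟨h1, h2⟩ := sum_logb_fringe_le hs hB t h0
    have h3 := length_hyperBinary_le_fringe t (fun f => fixedSize p f / B)
      (fun f => div_nonneg (hs.fixedSize_nonneg f) hB0.le)
      (by
        rw [ht, ← hBdef, ← Finset.sum_div, div_le_one hB0, treesBelow, Finset.sum_biUnion]
        · refine (Finset.sum_le_sum fun k _ => hs.sum_fixedSize_le_one k).trans ?_
          simp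
        · intro i _ j _ hij
          simp only [Function.onFun, Finset.disjoint_left, BinaryTree.mem_treesOfNumNodesEq]
          intro x h1 h2
          exact hij (h1.symm.trans h2))
      (by
        rw [ht, ← hBdef]
        exact fun f hf => div_pos (h1 f hf) hB0)
    rw [ht, ← hBdef] at h3
    have h4 := length_fringe_le_sqrtSum hB t
    have h5 := mul_le_mul_of_nonneg_right h4 hD0
    have h6 : ((hyperBinary t).length : ℝ) ≤ Real.logb 2 (1 / fixedSize p t) + (D + K) +
        D / Real.sqrt B * sqrtSum t := by
      have e : (1 + sqrtSum t / Real.sqrt B) * D = D + D / Real.sqrt B * sqrtSum t := by ring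
      rw [e] at h5
      rw [hD] at h5 ⊢
      rw [hK]
      linarith
    have := mul_le_mul_of_nonneg_left h6 h0.le
    linarith
  refine (Finset.sum_le_sum hpoint).trans ?_
  rw [Finset.sum_add_distrib, Finset.sum_add_distrib, ← Finset.sum_mul, ← Finset.mul_sum, add_assoc]
  have h1 := mul_le_mul_of_nonneg_right (hs.sum_fixedSize_le_one n) (by positivity : 0 ≤ D + K)
  have h2 := mul_le_mul_of_nonneg_left (hE n)
    (div_nonneg hD0 (Real.sqrt_nonneg (B : ℝ)))
  have hD' : D ≤ Real.logb 2 (8 * ((B : ℝ) + 1) ^ 1) := by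
    have : Real.logb 2 8 = 3 := by
      rw [show (8 : ℝ) = 2 ^ (3 : ℝ) by norm_num, Real.logb_rpow (by norm_num) (by norm_num)]
    rw [hD, ← this, ← Real.logb_mul (by norm_num) (by positivity)]
    apply Real.logb_le_logb_of_le (by norm_num) (by positivity)
    rw [pow_one]; linarith
  have h3 : D + D / Real.sqrt B * (A * n) ≤
      n * ((A + 1) * (Real.logb 2 (8 * ((B : ℝ) + 1) ^ 1) / (B : ℝ) ^ (1 / 2 : ℝ))) +
        Real.logb 2 (8 * ((1 : ℝ) + 1) ^ 1) := by
    have hpos1 : 0 ≤ Real.logb 2 (8 * ((1 : ℝ) + 1) ^ 1) :=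
      Real.logb_nonneg (by norm_num) (by norm_num)
    rw [← Real.sqrt_eq_rpow]
    rcases Nat.eq_zero_or_pos n with h0 | h0
    · have hB1 : B = 1 := by rw [hBdef, h0]; simp [blockParam]
      have hB1' : (B : ℝ) = 1 := by exact_mod_cast hB1
      rw [hB1'] at hD'
      simp only [h0, Nat.cast_zero, mul_zero, zero_mul, add_zero, zero_add]
      exact hD'
    · have hsB : Real.sqrt B ≤ n := by
        have h4 : (B : ℝ) ≤ n := by exact_mod_cast blockParam_le h0
        refine le_trans ?_ h4
        apply Real.sqrt_le_iff.2
        have : (1 : ℝ) ≤ B := by exact_mod_cast hB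
        exact ⟨hB0.le, by nlinarith⟩
      have hsB0 : 0 < Real.sqrt B := Real.sqrt_pos.2 hB0
      have h4 : D ≤ n * (D / Real.sqrt B) := by
        rw [mul_div_assoc', le_div_iff₀ hsB0]
        nlinarith
      have h5 : D / Real.sqrt B ≤ Real.logb 2 (8 * ((B : ℝ) + 1) ^ 1) / Real.sqrt B := by gcongr
      have h6 : n * ((A + 1) * (D / Real.sqrt B)) ≤
          n * ((A + 1) * (Real.logb 2 (8 * ((B : ℝ) + 1) ^ 1) / Real.sqrt B)) := by gcongr
      have h7 : n * ((A + 1) * (D / Real.sqrt B)) =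
          n * (D / Real.sqrt B) + D / Real.sqrt B * (A * n) := by ring
      refine le_trans ?_ (le_add_of_nonneg_right hpos1)
      linarith
  rw [one_mul] at h1
  have e : (n : ℝ) * ((A + 1) * (Real.logb 2 (8 * ((B : ℝ) + 1) ^ 1) / (B : ℝ) ^ (1 / 2 : ℝ)) +
        (24 / (B : ℝ) + errorRate B)) =
      n * ((A + 1) * (Real.logb 2 (8 * ((B : ℝ) + 1) ^ 1) / (B : ℝ) ^ (1 / 2 : ℝ))) +
        n * (24 / (B : ℝ) + errorRate B) := by ring
  rw [e]
  linarith

/-! ### Binomial random trees and fringe-balanced search trees -/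

theorem sum_antidiagonal_interior (f : ℕ → ℕ → ℝ) (n : ℕ) (h1 : ∀ j, f 0 j = 0)
    (h2 : ∀ i, f i 0 = 0) :
    ∑ ij ∈ antidiagonal (n + 2), f ij.1 ij.2 =
      ∑ ij ∈ antidiagonal n, f (ij.1 + 1) (ij.2 + 1) := by
  rw [Finset.Nat.sum_antidiagonal_succ, Finset.Nat.sum_antidiagonal_succ', h1, h2]
  simp

theorem isBalancedSource_pBinomial {α : ℝ} (h0 : 0 < α) (h1 : α < 1) :
    IsBalancedSource (pBinomial α) where
  nonneg l r := by
    have : 0 ≤ 1 - α := by linarith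
    unfold pBinomial; positivity
  sum_eq_one n := by
    have h := (Commute.all α (1 - α)).add_pow' n
    rw [add_sub_cancel, one_pow] at h
    rw [h]
    refine Finset.sum_congr rfl fun ij hij => ?_
    rw [pBinomial, mem_antidiagonal.1 hij, nsmul_eq_mul]
    ring
  balanced := by
    have hq : 0 < 1 - α := by linarith
    refine ⟨α * (1 - α) / 2, by positivity, 2, fun n hn => ?_⟩
    obtain ⟨k, rfl⟩ : ∃ k, n = k + 2 := ⟨n - 2, by omega⟩
    rw [sum_antidiagonal_interior (fun i j => pBinomial α i j * ((i : ℝ) * j)) k (by simp) (by simp)]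
    have hterm : ∀ ij ∈ antidiagonal k,
        pBinomial α (ij.1 + 1) (ij.2 + 1) * (((ij.1 + 1 : ℕ) : ℝ) * ((ij.2 + 1 : ℕ) : ℝ)) =
          α * (1 - α) * ((k + 2 : ℝ) * (k + 1)) * (k.choose ij.1 • (α ^ ij.1 * (1 - α) ^ ij.2)) := by
      rintro ⟨i, j⟩ hij
      have hk := mem_antidiagonal.1 hij
      simp only at hk ⊢
      subst hk
      have c1 : ((i + j + 2).choose (i + 1)) * (i + 1) = (i + j + 2) * (i + j + 1).choose i := by
        rw [← Nat.add_one_mul_choose_eq]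
      have c2 : ((i + j + 1).choose i) * (j + 1) = (i + j + 1) * (i + j).choose i := by
        have e1 : (i + j + 1).choose i = (i + j + 1).choose (j + 1) := by
          rw [← Nat.choose_symm_of_eq_add]; omega
        have e2 : (i + j).choose i = (i + j).choose j := by
          rw [Nat.choose_symm_add]
        rw [e1, e2, Nat.add_one_mul_choose_eq]
      have c3 : ((i + j + 2).choose (i + 1) : ℝ) * ((i + 1) * (j + 1)) =
          (i + j + 2) * (i + j + 1) * (i + j).choose i := by
        have c1' : ((i + j + 2).choose (i + 1) : ℝ) * (i + 1) = (i + j + 2) * (i + j + 1).choose i := by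
          exact_mod_cast c1
        have c2' : ((i + j + 1).choose i : ℝ) * (j + 1) = (i + j + 1) * (i + j).choose i := by
          exact_mod_cast c2
        linear_combination (j + 1 : ℝ) * c1' + (i + j + 2 : ℝ) * c2'
      rw [pBinomial, nsmul_eq_mul, show i + 1 + (j + 1) = i + j + 2 by ring]
      push_cast
      linear_combination (α ^ (i + 1) * (1 - α) ^ (j + 1)) * c3
    rw [Finset.sum_congr rfl hterm, ← Finset.mul_sum, ← (Commute.all α (1 - α)).add_pow' k,
      add_sub_cancel, one_pow, mul_one]
    push_cast
    rw [div_mul_eq_mul_div, ← mul_div_assoc']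
    refine mul_le_mul_of_nonneg_left ?_ (by positivity)
    nlinarith [Nat.cast_nonneg (α := ℝ) k]

theorem sum_choose_mul_choose (a b n : ℕ) :
    ∑ ij ∈ antidiagonal n, ij.1.choose a * ij.2.choose b = (n + 1).choose (a + b + 1) := by
  induction n generalizing a with
  | zero =>
    cases a <;> cases b <;> simp
    all_goals exact (Nat.choose_eq_zero_of_lt (by omega)).symm
  | succ n ih =>
    rw [Finset.Nat.sum_antidiagonal_succ]
    cases a with
    | zero =>
      have := ih 0
      simp only [Nat.choose_zero_right, one_mul, zero_add] at this ⊢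
      rw [this, Nat.choose_succ_succ (n + 1) b]
    | succ a =>
      simp only [Nat.choose_zero_succ, zero_mul, zero_add]
      have e : ∀ ij : ℕ × ℕ, (ij.1 + 1).choose (a + 1) * ij.2.choose b =
          ij.1.choose a * ij.2.choose b + ij.1.choose (a + 1) * ij.2.choose b := by
        intro ij; rw [Nat.choose_succ_succ, add_mul]
      simp only [e]
      rw [Finset.sum_add_distrib, ih, ih, show a + 1 + b + 1 = (a + b + 1) + 1 by ring,
        Nat.choose_succ_succ (n + 1)]

theorem isBalancedSource_pFringeBalanced (s : ℕ) : IsBalancedSource (pFringeBalanced s) where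
  nonneg l r := by unfold pFringeBalanced; split_ifs <;> positivity
  sum_eq_one n := by
    have hn : ∀ ij ∈ antidiagonal n, pFringeBalanced s ij.1 ij.2 =
        if 2 * s + 1 ≤ n + 1 then
          ((ij.1.choose s * ij.2.choose s : ℕ) : ℝ) / ((n + 1).choose (2 * s + 1) : ℝ)
        else 1 / ((n : ℝ) + 1) := by
      intro ij hij
      have h := mem_antidiagonal.1 hij
      have h' : (ij.1 : ℝ) + ij.2 = n := by exact_mod_cast h
      rw [pFringeBalanced, h, h']
      push_cast; rfl
    rw [Finset.sum_congr rfl hn]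
    split_ifs with h
    · rw [← Finset.sum_div, ← Nat.cast_sum, sum_choose_mul_choose, ← two_mul]
      exact div_self (by exact_mod_cast (Nat.choose_pos h).ne')
    · rw [Finset.sum_const, Finset.Nat.card_antidiagonal, nsmul_eq_mul]
      push_cast
      field_simp
  balanced := by
    refine ⟨((s : ℝ) + 1) ^ 2 / (4 * ((2 * s + 3) * (2 * s + 2))), by positivity, 4 * s + 2,
      fun n hn => ?_⟩
    have hpos : 0 < (n + 1).choose (2 * s + 1) := Nat.choose_pos (by omega)
    have h1 : ((s : ℝ) + 1) ^ 2 * ((n + 1).choose (2 * s + 3) : ℝ) / (n + 1).choose (2 * s + 1) ≤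
        ∑ ij ∈ antidiagonal n, pFringeBalanced s ij.1 ij.2 * ((ij.1 : ℝ) * ij.2) := by
      have e : (n + 1).choose (2 * s + 3) =
          ∑ ij ∈ antidiagonal n, ij.1.choose (s + 1) * ij.2.choose (s + 1) := by
        rw [sum_choose_mul_choose]; congr 1; ring
      rw [e, Nat.cast_sum, Finset.mul_sum, Finset.sum_div]
      refine Finset.sum_le_sum fun ij hij => ?_
      have h := mem_antidiagonal.1 hij
      rw [pFringeBalanced, h, if_pos (by omega), div_mul_eq_mul_div]
      have hb : ∀ i : ℕ, ((s : ℝ) + 1) * (i.choose (s + 1) : ℝ) ≤ (i.choose s : ℝ) * i := by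
        intro i
        have h2 := Nat.choose_succ_right_eq i s
        have h3 : i.choose s * (i - s) ≤ i.choose s * i := Nat.mul_le_mul_left _ (Nat.sub_le _ _)
        rw [← h2] at h3
        have : ((i.choose (s + 1) : ℝ)) * ((s : ℝ) + 1) ≤ i.choose s * i := by exact_mod_cast h3
        linarith
      have hm := mul_le_mul (hb ij.1) (hb ij.2) (by positivity) (by positivity)
      apply div_le_div_of_nonneg_right _ (Nat.cast_nonneg _)
      push_cast
      nlinarith
    refine le_trans ?_ h1
    have e2 : (n + 1).choose (2 * s + 3) * ((2 * s + 3) * (2 * s + 2)) =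
        (n + 1).choose (2 * s + 1) * ((n - 2 * s) * (n - 2 * s - 1)) := by
      have f1 := Nat.choose_succ_right_eq (n + 1) (2 * s + 2)
      have f2 := Nat.choose_succ_right_eq (n + 1) (2 * s + 1)
      have g1 : n + 1 - (2 * s + 2) = n - 2 * s - 1 := by omega
      have g2 : n + 1 - (2 * s + 1) = n - 2 * s := by omega
      rw [g1] at f1
      rw [g2] at f2
      calc (n + 1).choose (2 * s + 3) * ((2 * s + 3) * (2 * s + 2))
          = (n + 1).choose (2 * s + 2 + 1) * (2 * s + 2 + 1) * (2 * s + 2) := by ring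
        _ = (n + 1).choose (2 * s + 1 + 1) * (2 * s + 1 + 1) * (n - 2 * s - 1) := by rw [f1]; ring
        _ = _ := by rw [f2]; ring
    have e3 : ((n + 1).choose (2 * s + 3) : ℝ) * ((2 * s + 3) * (2 * s + 2)) =
        (n + 1).choose (2 * s + 1) * (((n - 2 * s : ℕ) : ℝ) * ((n - 2 * s - 1 : ℕ) : ℝ)) := by
      exact_mod_cast e2
    have hlow : (n : ℝ) ^ 2 / 4 ≤ ((n - 2 * s : ℕ) : ℝ) * ((n - 2 * s - 1 : ℕ) : ℝ) := by
      have b1 : (n : ℝ) / 2 ≤ ((n - 2 * s : ℕ) : ℝ) := by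
        have : (n : ℝ) ≤ 2 * ((n - 2 * s : ℕ) : ℝ) := by exact_mod_cast (by omega)
        linarith
      have b2 : (n : ℝ) / 2 ≤ ((n - 2 * s - 1 : ℕ) : ℝ) := by
        have : (n : ℝ) ≤ 2 * ((n - 2 * s - 1 : ℕ) : ℝ) := by exact_mod_cast (by omega)
        linarith
      have := mul_le_mul b1 b2 (by positivity) (by positivity)
      linarith
    have hpos' : (0 : ℝ) < (n + 1).choose (2 * s + 1) := by exact_mod_cast hpos
    rw [div_mul_eq_mul_div, div_le_div_iff₀ (by positivity) hpos']
    have hs2 : (0 : ℝ) < ((s : ℝ) + 1) ^ 2 := by positivity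
    calc ((s : ℝ) + 1) ^ 2 * (n : ℝ) ^ 2 * (n + 1).choose (2 * s + 1)
        = ((s : ℝ) + 1) ^ 2 * 4 * ((n + 1).choose (2 * s + 1) * ((n : ℝ) ^ 2 / 4)) := by ring
      _ ≤ ((s : ℝ) + 1) ^ 2 * 4 * ((n + 1).choose (2 * s + 1) *
          (((n - 2 * s : ℕ) : ℝ) * ((n - 2 * s - 1 : ℕ) : ℝ))) := by gcongr
      _ = _ := by rw [← e3]; ring

end Hypersuccinct

namespace Hypersuccinct

open BCover
open scoped ENNReal

/-! ### Components as code trees -/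

/-- A component without what is below its portals: leaves are null pointers, and those labelled
`true` are the portals. -/
def BCover.toCodeTree : BCover → CodeTree Bool
  | .nil => .leaf false
  | .portal _ => .leaf true
  | .node l r => .node l.toCodeTree r.toCodeTree

namespace CodeTree

/-- The binary tree of the inner nodes. -/
def innerTree : CodeTree Bool → BTree
  | .leaf _ => .nil
  | .node l r => .node () l.innerTree r.innerTree

/-- Whether there is a node of the decomposed tree at the root. -/
def present : CodeTree Bool → Bool
  | .leaf b => b
  | .node _ _ => true

end CodeTree

open CodeTree

theorem innerTree_toCodeTree (c : BCover) : c.toCodeTree.innerTree = c.shape := by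
  induction c with
  | nil => rfl
  | portal c _ => rfl
  | node l r hl hr => simp [toCodeTree, innerTree, shape, hl, hr]

theorem present_toCodeTree {c : BCover} (hc : c.WF) :
    c.toCodeTree.present = true ↔ c.toTree ≠ .nil := by
  cases c with
  | nil => simp [toCodeTree, present, toTree]
  | node l r => simp [toCodeTree, present, toTree]
  | portal c =>
    obtain ⟨h1, _⟩ := hc
    cases c with
    | nil => exact absurd h1 (by simp [IsNode])
    | portal c => exact absurd h1 (by simp [IsNode])
    | node l r => simp [toCodeTree, present, toTree]

theorem isNode_of_mem_components {c : BCover} (hc : c.WF) :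
    ∀ d ∈ c.components, d.IsNode ∧ d.WF := by
  induction c with
  | nil => simp [components]
  | portal c ih =>
    intro d hd
    rcases List.mem_cons.1 hd with rfl | hd
    · exact hc
    · exact ih hc.2 d hd
  | node l r hl hr =>
    intro d hd
    rcases List.mem_append.1 hd with hd | hd
    · exact hl hc.1 d hd
    · exact hr hc.2 d hd

/-! ### Type processes -/

/-- The type of a node, from the presence of its left and of its right child. -/
def typeOf : Bool → Bool → Fin 4
  | false, false => 0
  | true, false => 1
  | true, true => 2
  | false, true => 3

theorem nodeType_eq (l r : BTree) :
    nodeType l r = typeOf (decide (l ≠ .nil)) (decide (r ≠ .nil)) := by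
  cases l <;> cases r <;> simp [nodeType, typeOf]

/-- The weight of a component in the process that generates the types of nodes from their
histories with probabilities `τ`, and makes every node the portal of another component with
probability `ε`. -/
def typeWeight (ε : ℝ) (τ : List (Fin 4) → Fin 4 → ℝ) : List (Fin 4) → CodeTree Bool → ℝ
  | _, .leaf true => ε
  | _, .leaf false => 1
  | z, .node l r =>
    (1 - ε) * τ z (typeOf l.present r.present) *
      (typeWeight ε τ (z ++ [typeOf l.present r.present]).tail l *
        typeWeight ε τ (z ++ [typeOf l.present r.present]).tail r)

section

variable {ε : ℝ} {τ : List (Fin 4) → Fin 4 → ℝ}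

theorem typeWeight_nonneg (h0 : 0 ≤ ε) (h1 : ε ≤ 1) (hτ : ∀ z i, 0 ≤ τ z i)
    (T : CodeTree Bool) : ∀ z, 0 ≤ typeWeight ε τ z T := by
  induction T with
  | leaf b => intro z; cases b <;> simp [typeWeight, h0]
  | node l r hl hr =>
    intro z
    have := hτ z (typeOf l.present r.present)
    have := hl (z ++ [typeOf l.present r.present]).tail
    have := hr (z ++ [typeOf l.present r.present]).tail
    have : 0 ≤ 1 - ε := by linarith
    unfold typeWeight
    positivity

open Classical in
/-- A node is a portal with probability `ε`, and otherwise its type determines which children are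
generated, so that all components together have weight at most `ε + (1 - ε) = 1`. -/
theorem tsum_typeWeight_le (h0 : 0 ≤ ε) (h1 : ε ≤ 1) (hτ : ∀ z i, 0 ≤ τ z i)
    (hsum : ∀ z, ∑ i, τ z i ≤ 1) (k : ℕ) (b : Bool) (z : List (Fin 4)) :
    ∑' T : CodeTree Bool, (if T.depth ≤ k ∧ T.present = b then
      ENNReal.ofReal (typeWeight ε τ z T) else 0) ≤ 1 := by
  have hε : ENNReal.ofReal ε + ENNReal.ofReal (1 - ε) = 1 := by
    rw [← ENNReal.ofReal_add h0 (by linarith)]; simp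
  induction k generalizing b z with
  | zero =>
    rw [CodeTree.tsum_eq]
    simp only [depth, Nat.le_zero, Nat.add_eq_zero_iff, one_ne_zero, and_false,
      false_and, if_false, tsum_zero, add_zero, tsum_bool, present]
    cases b
    · simp [typeWeight]
    · simpa [typeWeight] using h1
  | succ k ih =>
    rw [CodeTree.tsum_eq]
    simp only [depth, zero_le, true_and, Nat.add_le_add_iff_right, max_le_iff, tsum_bool, present]
    cases b
    · simp [typeWeight]
    · simp only [typeWeight, Bool.false_eq_true, if_false, zero_add, if_true, and_true]
      rw [← hε]
      refine add_le_add le_rfl ?_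
      set S : Bool → List (Fin 4) → ℝ≥0∞ := fun b z =>
        ∑' T : CodeTree Bool, (if T.depth ≤ k ∧ T.present = b then
          ENNReal.ofReal (typeWeight ε τ z T) else 0) with hS
      have hz : ∑ a : Bool, ∑ b : Bool, ENNReal.ofReal (τ z (typeOf a b)) ≤ 1 := by
        have e : ∑ a : Bool, ∑ b : Bool, ENNReal.ofReal (τ z (typeOf a b)) =
            ∑ i, ENNReal.ofReal (τ z i) := by
          rw [Fin.sum_univ_four]
          simp only [Fintype.sum_bool, typeOf]
          ring
        rw [e, ← ENNReal.ofReal_sum_of_nonneg fun i _ => hτ z i]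
        simpa using hsum z
      calc ∑' l : CodeTree Bool, ∑' r : CodeTree Bool, (if l.depth ≤ k ∧ r.depth ≤ k then
            ENNReal.ofReal ((1 - ε) * τ z (typeOf l.present r.present) *
              (typeWeight ε τ (z ++ [typeOf l.present r.present]).tail l *
              typeWeight ε τ (z ++ [typeOf l.present r.present]).tail r)) else 0)
          = ∑' l : CodeTree Bool, ∑' r : CodeTree Bool, ∑ a : Bool, ∑ b : Bool,
            ENNReal.ofReal (1 - ε) * ENNReal.ofReal (τ z (typeOf a b)) *
            ((if l.depth ≤ k ∧ l.present = a then
              ENNReal.ofReal (typeWeight ε τ (z ++ [typeOf a b]).tail l) else 0) *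
            (if r.depth ≤ k ∧ r.present = b then
              ENNReal.ofReal (typeWeight ε τ (z ++ [typeOf a b]).tail r) else 0)) := by
            refine tsum_congr fun l => tsum_congr fun r => ?_
            have hw := typeWeight_nonneg h0 h1 hτ l
            rw [Finset.sum_eq_single l.present, Finset.sum_eq_single r.present]
            · by_cases e1 : l.depth ≤ k <;> by_cases e2 : r.depth ≤ k <;> simp only [e1, e2,
                true_and, false_and, and_false, if_true, if_false, mul_zero, zero_mul]
              rw [ENNReal.ofReal_mul (mul_nonneg (by linarith) (hτ _ _)),
                ENNReal.ofReal_mul (by linarith), ENNReal.ofReal_mul (hw _)]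
            · intro b _ hb
              rw [if_neg (fun h : r.depth ≤ k ∧ r.present = b => hb h.2.symm), mul_zero, mul_zero]
            · simp
            · intro a _ ha
              refine Finset.sum_eq_zero fun b _ => ?_
              rw [if_neg (fun h : l.depth ≤ k ∧ l.present = a => ha h.2.symm), zero_mul, mul_zero]
            · simp
        _ = ∑ a : Bool, ∑ b : Bool, ENNReal.ofReal (1 - ε) * ENNReal.ofReal (τ z (typeOf a b)) *
            (S a (z ++ [typeOf a b]).tail * S b (z ++ [typeOf a b]).tail) := by
            have hfin : ∀ f : CodeTree Bool → CodeTree Bool → Bool → Bool → ℝ≥0∞,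
                ∑' l, ∑' r, ∑ a, ∑ b, f l r a b = ∑ a, ∑ b, ∑' l, ∑' r, f l r a b := by
              intro f
              simp only [Fintype.sum_bool, ENNReal.tsum_add]
            rw [hfin]
            refine Finset.sum_congr rfl fun a _ => Finset.sum_congr rfl fun b _ => ?_
            simp only [ENNReal.tsum_mul_left, ENNReal.tsum_mul_right]
            rfl
        _ ≤ ∑ a : Bool, ∑ b : Bool, ENNReal.ofReal (1 - ε) * ENNReal.ofReal (τ z (typeOf a b)) *
            (1 * 1) := by
            refine Finset.sum_le_sum fun a _ => Finset.sum_le_sum fun b _ => ?_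
            exact mul_le_mul' le_rfl (mul_le_mul' (ih a _) (ih b _))
        _ = ENNReal.ofReal (1 - ε) * ∑ a : Bool, ∑ b : Bool, ENNReal.ofReal (τ z (typeOf a b)) := by
            simp only [mul_one, Finset.mul_sum]
        _ ≤ ENNReal.ofReal (1 - ε) := mul_le_of_le_one_right bot_le hz

open Classical in
theorem sum_typeWeight_le (h0 : 0 ≤ ε) (h1 : ε ≤ 1) (hτ : ∀ z i, 0 ≤ τ z i)
    (hsum : ∀ z, ∑ i, τ z i ≤ 1) (z : List (Fin 4)) (S : Finset (CodeTree Bool))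
    (hS : ∀ T ∈ S, T.present = true) : ∑ T ∈ S, typeWeight ε τ z T ≤ 1 := by
  have h := CodeTree.sum_le_of_tsum_depth_le
    (fun T => if T.present = true then typeWeight ε τ z T else 0)
    (fun T => by split_ifs <;> [exact typeWeight_nonneg h0 h1 hτ T z; exact le_rfl])
    (Z := 1) zero_le_one (fun k => by
      rw [ENNReal.ofReal_one]
      refine le_trans (le_of_eq (tsum_congr fun T => ?_))
        (tsum_typeWeight_le h0 h1 hτ hsum k true z)
      by_cases h1 : T.depth ≤ k <;> by_cases h2 : T.present = true <;> simp [h1, h2]) S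
  refine le_trans (le_of_eq (Finset.sum_congr rfl fun T hT => ?_)) h
  rw [if_pos (hS T hT)]

/-- The components below a component, each with the `k`-history of its root; `z` is the `k`-history of
the root. -/
def componentsWithHistory : List (Fin 4) → BCover → List (List (Fin 4) × BCover)
  | _, .nil => []
  | z, .portal c => (z, c) :: componentsWithHistory z c
  | z, .node l r =>
    componentsWithHistory
        (z ++ [typeOf l.toCodeTree.present r.toCodeTree.present]).tail l ++
      componentsWithHistory
        (z ++ [typeOf l.toCodeTree.present r.toCodeTree.present]).tail r

theorem map_snd_componentsWithHistory (c : BCover) :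
    ∀ z, (componentsWithHistory z c).map Prod.snd = c.components := by
  induction c with
  | nil => simp [componentsWithHistory, components]
  | portal c ih => simp [componentsWithHistory, components, ih]
  | node l r hl hr => simp [componentsWithHistory, components, hl, hr]

theorem kHistory_append (k : ℕ) (h : List (Fin 4)) (i : Fin 4) :
    kHistory k (h ++ [i]) = (kHistory k h ++ [i]).tail := by
  unfold kHistory
  rw [← List.append_assoc, List.length_append, List.length_singleton, ← List.drop_drop,
    List.drop_append_of_le_length (by simp), List.drop_one]

theorem sum_logb_typeWeight (k : ℕ) (h0 : 0 < ε) (h1 : ε < 1) {c : BCover} (hc : c.WF)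
    (h : List (Fin 4)) (hpos : ∀ x ∈ histories h c.toTree, 0 < τ (kHistory k x.1) x.2) :
    (0 < typeWeight ε τ (kHistory k h) c.toCodeTree ∧
      ∀ d ∈ componentsWithHistory (kHistory k h) c, 0 < typeWeight ε τ d.1 d.2.toCodeTree) ∧
    Real.logb 2 (1 / typeWeight ε τ (kHistory k h) c.toCodeTree) +
        ((componentsWithHistory (kHistory k h) c).map fun d =>
          Real.logb 2 (1 / typeWeight ε τ d.1 d.2.toCodeTree)).sum =
      ((histories h c.toTree).map fun x => Real.logb 2 (1 / τ (kHistory k x.1) x.2)).sum +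
        c.toTree.numNodes * Real.logb 2 (1 / (1 - ε)) +
        c.components.length * Real.logb 2 (1 / ε) := by
  induction c generalizing h with
  | nil => simp [toCodeTree, typeWeight, componentsWithHistory, histories, toTree, components,
      BinaryTree.numNodes]
  | portal c ih =>
    obtain ⟨⟨a1, a2⟩, a3⟩ := ih hc.2 h hpos
    simp only [toCodeTree, typeWeight, componentsWithHistory, toTree, components, List.map_cons,
      List.sum_cons, List.length_cons]
    refine ⟨⟨h0, by simpa using ⟨a1, fun a b => a2 (a, b)⟩⟩, ?_⟩
    rw [a3]
    push_cast; ring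
  | node l r hl hr =>
    have e : nodeType l.toTree r.toTree = typeOf l.toCodeTree.present r.toCodeTree.present := by
      rw [nodeType_eq]
      congr 1
      · rw [Bool.eq_iff_iff, present_toCodeTree hc.1, decide_eq_true_iff]
      · rw [Bool.eq_iff_iff, present_toCodeTree hc.2, decide_eq_true_iff]
    simp only [toTree, histories, List.mem_cons, List.mem_append] at hpos
    obtain ⟨⟨a1, a2⟩, a3⟩ := hl hc.1 (h ++ [nodeType l.toTree r.toTree])
      fun x hx => hpos x (by simp [hx])
    obtain ⟨⟨b1, b2⟩, b3⟩ := hr hc.2 (h ++ [nodeType l.toTree r.toTree])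
      fun x hx => hpos x (by simp [hx])
    have hp := hpos _ (Or.inl (Or.inl rfl))
    simp only at hp
    rw [kHistory_append] at a1 a2 a3 b1 b2 b3
    rw [e] at a1 a2 a3 b1 b2 b3 hp
    have hε : 0 < 1 - ε := by linarith
    simp only [toCodeTree, typeWeight, componentsWithHistory, toTree, components, List.map_append,
      List.sum_append, List.length_append, histories, List.map_cons, List.sum_cons,
      BinaryTree.numNodes, List.cons_append]
    refine ⟨⟨by positivity, ?_⟩, ?_⟩
    · intro d hd
      rcases List.mem_append.1 hd with hd | hd
      · exact a2 d hd
      · exact b2 d hd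
    · rw [e, ← one_div_mul_one_div, ← one_div_mul_one_div, ← one_div_mul_one_div,
        Real.logb_mul (by positivity) (by positivity), Real.logb_mul (by positivity) (by positivity),
        Real.logb_mul (by positivity) (by positivity)]
      push_cast
      linarith

end

/-! ### Empirical type entropy -/

theorem histories_ne_zero (t : BTree) : ∀ h : List (Fin 4), (∀ a ∈ h, a ≠ 0) →
    ∀ x ∈ histories h t, ∀ a ∈ x.1, a ≠ 0 := by
  induction t with
  | nil => simp [histories]
  | node a l r hl hr =>
    intro h hh x hx
    simp only [histories, List.mem_append, List.mem_cons] at hx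
    have hnext : ∀ s : BTree, (s = l ∨ s = r) → x ∈ histories (h ++ [nodeType l r]) s →
        ∀ a ∈ h ++ [nodeType l r], a ≠ 0 := by
      intro s hs hx a ha
      rcases List.mem_append.1 ha with ha | ha
      · exact hh a ha
      · rw [List.mem_singleton] at ha
        subst ha
        cases l <;> cases r <;> simp_all [nodeType, histories]
    rcases hx with (rfl | hx) | hx
    · exact hh
    · exact hl _ (hnext l (Or.inl rfl) hx) x hx
    · exact hr _ (hnext r (Or.inr rfl) hx) x hx

theorem exists_kHistory_eq (k : ℕ) {h : List (Fin 4)} (hh : ∀ a ∈ h, a ≠ 0) :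
    ∃ z : Fin k → Fin 3, kHistory k h = List.ofFn fun j => (z j).succ := by
  have hlen : (kHistory k h).length = k := by simp [kHistory]
  have hne : ∀ a ∈ kHistory k h, a ≠ 0 := by
    intro a ha
    rcases List.mem_append.1 (List.mem_of_mem_drop ha) with ha | ha
    · rw [List.mem_replicate] at ha
      rw [ha.2]; decide
    · exact hh a ha
  have hget : ∀ j : Fin k, (kHistory k h)[j.val]'(by rw [hlen]; exact j.2) ≠ 0 :=
    fun j => hne _ (List.getElem_mem _)
  refine ⟨fun j => ((kHistory k h)[j.val]'(by rw [hlen]; exact j.2)).pred (hget j), ?_⟩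
  refine List.ext_getElem (by simp [hlen]) fun i h1 h2 => ?_
  simp

/-- Sums over nodes grouped by `k`-history and type. -/
theorem sum_map_eq_sum_countP (k : ℕ) (L : List (List (Fin 4) × Fin 4))
    (hL : ∀ x ∈ L, ∀ a ∈ x.1, a ≠ 0) (f : List (Fin 4) → Fin 4 → ℝ) :
    (L.map fun x => f (kHistory k x.1) x.2).sum =
      ∑ z : Fin k → Fin 3, ∑ i : Fin 4,
        ((L.countP fun x => decide (kHistory k x.1 = (List.ofFn fun j => (z j).succ) ∧ x.2 = i)) : ℝ) *
          f (List.ofFn fun j => (z j).succ) i := by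
  induction L with
  | nil => simp
  | cons x L ih =>
    rw [List.map_cons, List.sum_cons, ih fun y hy => hL y (List.mem_cons_of_mem _ hy)]
    obtain ⟨z₀, hz₀⟩ := exists_kHistory_eq k (hL x List.mem_cons_self)
    have hinj : ∀ z : Fin k → Fin 3, kHistory k x.1 = (List.ofFn fun j => (z j).succ) ↔ z₀ = z := by
      intro z
      rw [hz₀, List.ofFn_inj]
      constructor
      · intro h; funext j; exact Fin.succ_injective _ (congrFun h j)
      · rintro rfl; rfl
    simp only [List.countP_cons, decide_eq_true_eq, Nat.cast_add, Nat.cast_ite, Nat.cast_one,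
      Nat.cast_zero, add_mul, Finset.sum_add_distrib, hinj]
    rw [add_comm]
    congr 1
    rw [Finset.sum_eq_single z₀, Finset.sum_eq_single x.2]
    · simp [hz₀]
    · intro i _ hi; simp [Ne.symm hi]
    · simp
    · intro z _ hz; simp [Ne.symm hz]
    · simp

/-- The empirical distribution of the types of the nodes with a given `k`-history. -/
noncomputable def empirical (k : ℕ) (t : BTree) (z : List (Fin 4)) (i : Fin 4) : ℝ :=
  (countHistoryType k t z i : ℝ) / countHistory k t z

theorem sum_countHistoryType (k : ℕ) (t : BTree) (z : List (Fin 4)) :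
    ∑ i, countHistoryType k t z i = countHistory k t z := by
  unfold countHistoryType countHistory
  induction histories [] t with
  | nil => simp
  | cons x L ih =>
    simp only [List.countP_cons, Finset.sum_add_distrib, ih]
    congr 1
    by_cases h : kHistory k x.1 = z <;> simp [h]

theorem empirical_nonneg (k : ℕ) (t : BTree) (z : List (Fin 4)) (i : Fin 4) :
    0 ≤ empirical k t z i := by
  unfold empirical; positivity

theorem sum_empirical_le (k : ℕ) (t : BTree) (z : List (Fin 4)) : ∑ i, empirical k t z i ≤ 1 := by
  unfold empirical
  rw [← Finset.sum_div, ← Nat.cast_sum, sum_countHistoryType]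
  exact div_self_le_one _

theorem empirical_pos (k : ℕ) {t : BTree} {x : List (Fin 4) × Fin 4} (hx : x ∈ histories [] t) :
    0 < empirical k t (kHistory k x.1) x.2 := by
  have h1 : 0 < countHistory k t (kHistory k x.1) :=
    List.countP_pos_iff.2 ⟨x, hx, by simp⟩
  have h2 : 0 < countHistoryType k t (kHistory k x.1) x.2 :=
    List.countP_pos_iff.2 ⟨x, hx, by simp⟩
  unfold empirical
  positivity

theorem sum_logb_empirical (k : ℕ) (t : BTree) :
    ((histories [] t).map fun x =>
      Real.logb 2 (1 / empirical k t (kHistory k x.1) x.2)).sum = typeEntropy k t := by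
  rw [sum_map_eq_sum_countP k _ (histories_ne_zero t [] (by simp))
    fun z i => Real.logb 2 (1 / empirical k t z i)]
  simp only [empirical, one_div_div]
  rfl

/-- If a node is made a portal with probability `1 / (B + 1)`, this costs `O(1 / B)` bits for every
node and `O(lg B)` bits for every component. -/
theorem portal_cost_le {n m B : ℕ} (hB : 1 ≤ B) (hm : B * m ≤ 8 * n) :
    (n : ℝ) * Real.logb 2 (1 / (1 - 1 / ((B : ℝ) + 1))) +
        m * Real.logb 2 (1 / (1 / ((B : ℝ) + 1))) ≤
      n * (2 / (B : ℝ) + 8 * (Real.logb 2 (1 * ((B : ℝ) + 1) ^ 1) / (B : ℝ) ^ (1 : ℝ))) := by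
  have hB0 : (0 : ℝ) < B := by exact_mod_cast hB
  have e2 : Real.logb 2 (1 / (1 / ((B : ℝ) + 1))) = Real.logb 2 (1 * ((B : ℝ) + 1) ^ 1) := by
    rw [one_div_one_div, one_mul, pow_one]
  have e3 : Real.logb 2 (1 / (1 - 1 / ((B : ℝ) + 1))) ≤ 2 / B := by
    have : 1 / (1 - 1 / ((B : ℝ) + 1)) = 1 + 1 / (B : ℝ) := by
      have h1 : 1 - 1 / ((B : ℝ) + 1) = B / (B + 1) := by field_simp; ring
      rw [h1, one_div_div, add_div, div_self hB0.ne']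
    rw [this, Real.logb, div_le_iff₀ (Real.log_pos (by norm_num))]
    have h4 := Real.log_le_sub_one_of_pos (by positivity : (0 : ℝ) < 1 + 1 / B)
    have h5 : (1 : ℝ) / 2 ≤ Real.log 2 := by linarith [Real.log_two_gt_d9]
    calc Real.log (1 + 1 / (B : ℝ)) ≤ 2 / B * (1 / 2) := by
          refine h4.trans (le_of_eq ?_); ring
      _ ≤ 2 / B * Real.log 2 := by gcongr
  rw [e2, Real.rpow_one]
  set lB := Real.logb 2 (1 * ((B : ℝ) + 1) ^ 1) with hlB
  have hlB0 : 0 ≤ lB := Real.logb_nonneg (by norm_num) (by rw [one_mul, pow_one]; linarith)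
  have hm' : (m : ℝ) ≤ n * (8 / B) := by
    rw [mul_div_assoc', le_div_iff₀ hB0]
    have : (B : ℝ) * m ≤ 8 * n := by exact_mod_cast hm
    have : (0 : ℝ) ≤ n := by positivity
    linarith
  have h6 := mul_le_mul_of_nonneg_right hm' hlB0
  have h7 := mul_le_mul_of_nonneg_left e3 (Nat.cast_nonneg (α := ℝ) n)
  have e : (n : ℝ) * (2 / B + 8 * (lB / B)) = n * (2 / B) + n * (8 / B) * lB := by ring
  linarith

theorem length_hyperBinary_le_typeEntropy (k : ℕ) {t : BTree} (ht : t ≠ .nil) :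
    ((hyperBinary t).length : ℝ) ≤ typeEntropy k t +
      t.numNodes * (2 / (blockParam t.numNodes : ℝ) + 8 * (Real.logb 2
        (1 * ((blockParam t.numNodes : ℝ) + 1) ^ 1) / (blockParam t.numNodes : ℝ) ^ (1 : ℝ)) +
        errorRate (blockParam t.numNodes)) +
      t.numNodes * (8 * (k * Real.logb 2 3) / blockParam t.numNodes) + 2000 := by
  set B := blockParam t.numNodes with hBdef
  have hB : 1 ≤ B := one_le_blockParam t.numNodes
  have hB0 : (0 : ℝ) < B := by exact_mod_cast hB
  classical
  set τ := empirical k t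
  set ε : ℝ := 1 / ((B : ℝ) + 1) with hε
  have hε0 : 0 < ε := by positivity
  have hε1 : ε < 1 := by rw [hε, div_lt_one (by positivity)]; linarith
  set c := (coverBinary B t).1 with hc
  have hct : c.toTree = t := toTree_coverBinary B t
  have hw : c.WF := wf_coverBinary hB t
  have hwp : (BCover.portal c).WF := ⟨isNode_coverBinary B ht, hw⟩
  have hpt : (BCover.portal c).toTree = t := hct
  obtain ⟨⟨_, h2⟩, h3⟩ := sum_logb_typeWeight (τ := τ) k hε0 hε1 hwp []
    (by rw [hpt]; exact fun x hx => empirical_pos k hx)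
  rw [hpt, sum_logb_empirical] at h3
  have hmicro : microTreesBinary B t = (BCover.portal c).components := by
    rw [microTreesBinary, if_neg ht]
  set ds := componentsWithHistory (kHistory k []) (BCover.portal c) with hds
  have hmap : ds.map Prod.snd = microTreesBinary B t := by
    rw [hds, map_snd_componentsWithHistory, hmicro]
  have hroot : ∀ d ∈ ds, d.2.toCodeTree.present = true := by
    intro d hd
    have : d.2 ∈ (BCover.portal c).components := by
      rw [← hmicro, ← hmap]; exact List.mem_map_of_mem hd
    obtain ⟨e1, _⟩ := isNode_of_mem_components hwp _ this
    cases h : d.2 with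
    | nil => rw [h] at e1; exact absurd e1 (by simp [IsNode])
    | portal c => rw [h] at e1; exact absurd e1 (by simp [IsNode])
    | node l r => rfl
  have hletters : ∀ (c : BCover), c.WF → ∀ h : List (Fin 4), (∀ a ∈ h, a ≠ 0) →
      ∀ d ∈ componentsWithHistory (kHistory k h) c,
        ∃ z : Fin k → Fin 3, d.1 = List.ofFn fun j => (z j).succ := by
    intro c
    induction c with
    | nil => simp [componentsWithHistory]
    | portal c ih =>
      intro hc h hh d hd
      rcases List.mem_cons.1 hd with rfl | hd
      · exact exists_kHistory_eq k hh
      · exact ih hc.2 h hh d hd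
    | node l r hl hr =>
      intro hc h hh d hd
      simp only [componentsWithHistory, ← kHistory_append, List.mem_append] at hd
      set i := typeOf l.toCodeTree.present r.toCodeTree.present with hi
      have key : ∀ s : BCover, (s = l ∨ s = r) →
          d ∈ componentsWithHistory (kHistory k (h ++ [i])) s → ∀ a ∈ h ++ [i], a ≠ 0 := by
        intro s hs hd a ha
        rcases List.mem_append.1 ha with ha | ha
        · exact hh a ha
        · rw [List.mem_singleton] at ha
          have : s.toCodeTree.present = true := by
            cases s with
            | nil => simp [componentsWithHistory] at hd
            | portal _ => rfl
            | node _ _ => rfl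
          rw [ha, hi]
          rcases hs with rfl | rfl <;> rw [this] <;> [cases r.toCodeTree.present;
            cases l.toCodeTree.present] <;> decide
      rcases hd with hd | hd
      · exact hl hc.1 _ (key l (Or.inl rfl) hd) d hd
      · exact hr hc.2 _ (key r (Or.inr rfl) hd) d hd
  have hZ : ∑ d ∈ (ds.map fun d => (d.1, d.2.toCodeTree)).toFinset, typeWeight ε τ d.1 d.2 ≤
      (3 : ℝ) ^ k := by
    set Zs : Finset (List (Fin 4)) :=
      Finset.univ.image fun z : Fin k → Fin 3 => List.ofFn fun j => (z j).succ with hZs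
    set Ts : Finset (CodeTree Bool) := (ds.map fun d => d.2.toCodeTree).toFinset with hTs
    have hnn := typeWeight_nonneg hε0.le hε1.le (empirical_nonneg k t)
    have hsub : (ds.map fun d => (d.1, d.2.toCodeTree)).toFinset ⊆ Zs ×ˢ Ts := by
      intro x hx
      simp only [List.mem_toFinset, List.mem_map] at hx
      obtain ⟨d, hd, rfl⟩ := hx
      obtain ⟨z, hz⟩ := hletters _ hwp [] (by simp) d hd
      rw [Finset.mem_product]
      refine ⟨Finset.mem_image.2 ⟨z, Finset.mem_univ _, hz.symm⟩, ?_⟩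
      rw [hTs, List.mem_toFinset]
      exact List.mem_map.2 ⟨d, hd, rfl⟩
    refine (Finset.sum_le_sum_of_subset_of_nonneg hsub fun x _ _ => hnn _ _).trans ?_
    rw [Finset.sum_product]
    refine (Finset.sum_le_sum (g := fun _ => (1 : ℝ)) fun z _ =>
      sum_typeWeight_le hε0.le hε1.le (empirical_nonneg k t) (sum_empirical_le k t) z Ts
        fun T hT => ?_).trans ?_
    · rw [hTs, List.mem_toFinset, List.mem_map] at hT
      obtain ⟨d, hd, rfl⟩ := hT
      exact hroot d hd
    · rw [Finset.sum_const, nsmul_eq_mul, mul_one]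
      have : Zs.card ≤ 3 ^ k := Finset.card_image_le.trans (by simp)
      exact_mod_cast this
  have h := length_hyperBinary_le t (ds.map fun d => (d.1, d.2.toCodeTree))
    (fun d => d.2.innerTree) (by
      rw [List.map_map, ← hBdef, ← hmap, List.map_map]
      exact List.map_congr_left fun d _ => innerTree_toCodeTree d.2)
    (fun d => typeWeight ε τ d.1 d.2) (by
      intro d hd
      obtain ⟨e, he, rfl⟩ := List.mem_map.1 hd
      exact h2 e he) hZ (one_le_pow₀ (by norm_num))
  rw [List.map_map, ← hBdef, Real.logb_pow] at h
  simp only [Function.comp_def] at h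
  have e1 : Real.logb 2 (1 / typeWeight ε τ (kHistory k []) (BCover.portal c).toCodeTree) =
      Real.logb 2 (1 / ε) := rfl
  rw [e1] at h3
  have hn : 1 ≤ t.numNodes := by
    cases t with
    | nil => exact absurd rfl ht
    | node a l r => simp [BinaryTree.numNodes]
  have hm := length_microTreesBinary_le (blockParam_le hn)
  rw [← hBdef, hmicro] at hm
  have hcost := portal_cost_le (n := t.numNodes) hB (hm.trans (by omega))
  rw [← hε] at hcost
  rw [mul_add] at h
  rw [mul_add (t.numNodes : ℝ) (2 / (B : ℝ) + _)]
  have hlε : 0 ≤ Real.logb 2 (1 / ε) :=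
    Real.logb_nonneg (by norm_num) ((one_le_div hε0).2 hε1.le)
  linarith

theorem length_hyperBinary_le_typeEntropy_add (k : ℕ → ℕ)
    (hk : (fun n : ℕ => (k n : ℝ)) =o[atTop] fun n : ℕ => Real.log n) :
    ∃ r : ℕ → ℝ, r =o[atTop] (fun n : ℕ => (n : ℝ)) ∧
      ∀ t : BTree, ((hyperBinary t).length : ℝ) ≤ typeEntropy (k t.numNodes) t + r t.numNodes := by
  have hrate : Tendsto (fun B : ℕ => 2 / (B : ℝ) + 8 * (Real.logb 2 (1 * ((B : ℝ) + 1) ^ 1) /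
      (B : ℝ) ^ (1 : ℝ)) + errorRate B) atTop (nhds 0) := by
    have h1 := (tendsto_logb_div_rpow (C := 1) (κ := 1) (by norm_num) (by norm_num) 1).const_mul 8
    have h2 : Tendsto (fun B : ℕ => 2 / (B : ℝ)) atTop (nhds 0) :=
      tendsto_const_div_atTop_nhds_zero_nat 2
    simpa using (h2.add h1).add tendsto_errorRate
  have hkB : (fun n : ℕ => (n : ℝ) * (8 * (k n * Real.logb 2 3) / blockParam n)) =o[atTop]
      fun n : ℕ => (n : ℝ) := by
    have hle : (fun n : ℕ => (blockParam n : ℝ)⁻¹) =O[atTop] fun n : ℕ => (Real.log n)⁻¹ := by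
      refine IsBigO.of_bound (8 * Real.log 2) ?_
      filter_upwards [eventually_ge_atTop 2] with n hn
      have hn' : (1 : ℝ) < n := by exact_mod_cast hn
      have hlog : 0 < Real.log n := Real.log_pos hn'
      have hB : Real.log n / (8 * Real.log 2) ≤ blockParam n := by
        have h1 : Real.logb 2 n / 8 ≤ blockParam n := by
          unfold blockParam
          exact (Nat.le_ceil _).trans (by exact_mod_cast le_max_right _ _)
        rw [Real.logb, div_div, mul_comm (Real.log 2)] at h1
        exact h1
      have h2 : 0 < Real.log 2 := Real.log_pos (by norm_num)
      rw [norm_inv, norm_inv, Real.norm_of_nonneg (Nat.cast_nonneg _), Real.norm_of_nonneg hlog.le]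
      have h3 := inv_anti₀ (by positivity) hB
      rwa [inv_div, div_eq_mul_inv] at h3
    have h0 : (fun n : ℕ => Real.log n * (Real.log n)⁻¹) =O[atTop] fun _ : ℕ => (1 : ℝ) := by
      refine IsBigO.of_bound 1 (Eventually.of_forall fun n => ?_)
      by_cases h : Real.log n = 0
      · simp [h]
      · simp [mul_inv_cancel₀ h]
    have h1 := (hk.mul_isBigO hle).trans_isBigO h0
    have h2 := (isBigO_refl (fun n : ℕ => (n : ℝ)) atTop).mul_isLittleO
      (h1.const_mul_left (8 * Real.logb 2 3))
    simp only [mul_one] at h2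
    refine h2.congr_left fun n => ?_
    ring
  refine ⟨_, (isLittleO_mul_blockParam hrate (2000 + (hyperBinary .nil).length)).add hkB,
    fun t => ?_⟩
  rcases eq_or_ne t .nil with rfl | ht
  · simp only [BinaryTree.numNodes, Nat.cast_zero, zero_mul, zero_add, add_zero]
    have : typeEntropy (k 0) .nil = 0 := by
      rw [← sum_logb_empirical]; simp [histories]
    rw [this]; linarith
  · have := length_hyperBinary_le_typeEntropy (k t.numNodes) ht
    have h0 : (0 : ℝ) ≤ (hyperBinary .nil).length := Nat.cast_nonneg _
    linarith

end Hypersuccinct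

namespace Hypersuccinct

open BCover CodeTree
open scoped ENNReal

/-! ### Classes given by the admissible node types -/

/-- The trees all of whose nodes have admissible types; `q` is applied to the presence of the left
and of the right child. -/
def typeClass (q : Bool → Bool → Prop) : Set BTree :=
  {t | EveryNode (fun l r => q (decide (l ≠ .nil)) (decide (r ≠ .nil))) t}

theorem mem_typeClass_node {q : Bool → Bool → Prop} {a : Unit} {l r : BTree} :
    BinaryTree.node a l r ∈ typeClass q ↔
      q (decide (l ≠ .nil)) (decide (r ≠ .nil)) ∧ l ∈ typeClass q ∧ r ∈ typeClass q := Iff.rfl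

/-- Replace the first leaf of a nonempty tree by another tree. -/
def graft : BTree → BTree → BTree
  | .nil, y => y
  | .node _ l r, y =>
    if l = .nil then if r = .nil then y else .node () .nil (graft r y)
    else .node () (graft l y) r

theorem graft_ne_nil {x y : BTree} (hy : y ≠ .nil) : graft x y ≠ .nil := by
  cases x with
  | nil => exact hy
  | node a l r => unfold graft; split_ifs <;> simp [hy]

theorem numNodes_graft {x y : BTree} (hx : x ≠ .nil) :
    (graft x y).numNodes + 1 = x.numNodes + y.numNodes := by
  induction x with
  | nil => exact absurd rfl hx
  | node a l r hl hr =>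
    unfold graft
    split_ifs with h1 h2
    · subst h1 h2; simp [BinaryTree.numNodes]; omega
    · have := hr h2
      subst h1
      simp only [BinaryTree.numNodes]; omega
    · have := hl h1
      simp only [BinaryTree.numNodes]; omega

theorem graft_mem_typeClass {q : Bool → Bool → Prop} {x y : BTree} (hx : x ∈ typeClass q)
    (hy : y ∈ typeClass q) (hy0 : y ≠ .nil) : graft x y ∈ typeClass q := by
  induction x with
  | nil => exact hy
  | node a l r hl hr =>
    obtain ⟨h, h1, h2⟩ := mem_typeClass_node.1 hx
    unfold graft
    split_ifs with e1 e2
    · exact hy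
    · refine mem_typeClass_node.2 ⟨?_, trivial, hr h2⟩
      simpa [e1, e2, graft_ne_nil hy0] using h
    · refine mem_typeClass_node.2 ⟨?_, hl h1, h2⟩
      simpa [e1, graft_ne_nil hy0] using h

theorem graft_inj {x x' y y' : BTree} (hx : x ≠ .nil) (hx' : x' ≠ .nil) (hy : y ≠ .nil)
    (hy' : y' ≠ .nil) (h1 : x.numNodes = x'.numNodes)
    (h : graft x y = graft x' y') : x = x' ∧ y = y' := by
  induction x generalizing x' with
  | nil => exact absurd rfl hx
  | node a l r hl hr =>
    cases x' with
    | nil => exact absurd rfl hx'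
    | node a' l' r' =>
      have hz : ∀ s : BTree, s.numNodes = 0 → s = .nil := by
        intro s hs; cases s <;> simp_all [BinaryTree.numNodes]
      simp only [BinaryTree.numNodes] at h1
      unfold graft at h
      by_cases e1 : l = .nil <;> by_cases e1' : l' = .nil
      · by_cases e2 : r = .nil <;> by_cases e2' : r' = .nil
        · subst e1 e2 e1' e2'; exact ⟨rfl, by simpa using h⟩
        · exfalso; subst e1 e2 e1'
          exact e2' (hz _ (by simp [BinaryTree.numNodes] at h1; omega))
        · exfalso; subst e1 e2' e1'
          exact e2 (hz _ (by simp [BinaryTree.numNodes] at h1; omega))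
        · subst e1 e1'
          simp only [if_true, e2, e2', if_false, BinaryTree.node.injEq, true_and] at h
          obtain ⟨a, b⟩ := hr e2 e2' (by omega) h
          exact ⟨by rw [a], b⟩
      · exfalso
        subst e1
        by_cases e2 : r = .nil
        · subst e2
          exact e1' (hz _ (by simp [BinaryTree.numNodes] at h1; omega))
        · simp only [if_true, e2, e1', if_false, BinaryTree.node.injEq, true_and] at h
          exact graft_ne_nil hy' h.1.symm
      · exfalso
        subst e1'
        by_cases e2 : r' = .nil
        · subst e2
          exact e1 (hz _ (by simp [BinaryTree.numNodes] at h1; omega))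
        · simp only [if_true, e2, e1, if_false, BinaryTree.node.injEq, true_and] at h
          exact graft_ne_nil hy h.1
      · simp only [e1, e1', if_false, BinaryTree.node.injEq, true_and] at h
        obtain ⟨h3, rfl⟩ := h
        obtain ⟨a, b⟩ := hl e1 e1' (by omega) h3
        exact ⟨by rw [a], b⟩

open Classical in
/-- The trees of a class with `k + 1` nodes. -/
noncomputable def classOfSize (q : Bool → Bool → Prop) (k : ℕ) : Finset BTree :=
  (BinaryTree.treesOfNumNodesEq (k + 1)).filter (· ∈ typeClass q)

theorem mem_classOfSize {q : Bool → Bool → Prop} {k : ℕ} {t : BTree} :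
    t ∈ classOfSize q k ↔ t.numNodes = k + 1 ∧ t ∈ typeClass q := by
  simp [classOfSize, BinaryTree.mem_treesOfNumNodesEq]

theorem ne_nil_of_mem_classOfSize {q : Bool → Bool → Prop} {k : ℕ} {t : BTree}
    (ht : t ∈ classOfSize q k) : t ≠ .nil := by
  rintro rfl
  simpa [BinaryTree.numNodes] using (mem_classOfSize.1 ht).1

theorem card_classOfSize_mul_le (q : Bool → Bool → Prop) (i j : ℕ) :
    (classOfSize q i).card * (classOfSize q j).card ≤ (classOfSize q (i + j)).card := by
  rw [← Finset.card_product]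
  refine Finset.card_le_card_of_injOn (fun x => graft x.1 x.2) ?_ ?_
  · rintro ⟨x, y⟩ hxy
    obtain ⟨hx, hy⟩ := Finset.mem_product.1 hxy
    have h := numNodes_graft (y := y) (ne_nil_of_mem_classOfSize hx)
    have hx' := mem_classOfSize.1 hx
    have hy' := mem_classOfSize.1 hy
    refine Finset.mem_coe.2 (mem_classOfSize.2 ⟨?_, graft_mem_typeClass hx'.2 hy'.2
      (ne_nil_of_mem_classOfSize hy)⟩)
    simp only at h hx' hy' ⊢
    omega
  · rintro ⟨x, y⟩ hxy ⟨x', y'⟩ hxy' h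
    obtain ⟨hx, hy⟩ := Finset.mem_product.1 (Finset.mem_coe.1 hxy)
    obtain ⟨hx', hy'⟩ := Finset.mem_product.1 (Finset.mem_coe.1 hxy')
    obtain ⟨a, b⟩ := graft_inj (ne_nil_of_mem_classOfSize hx) (ne_nil_of_mem_classOfSize hx')
      (ne_nil_of_mem_classOfSize hy) (ne_nil_of_mem_classOfSize hy')
      (by rw [(mem_classOfSize.1 hx).1, (mem_classOfSize.1 hx').1]) h
    exact Prod.ext a b

theorem prod_card_classOfSize_le {q : Bool → Bool → Prop} (hq : q false false) (l : List ℕ) :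
    (l.map fun i => (classOfSize q i).card).prod ≤ (classOfSize q l.sum).card := by
  induction l with
  | nil =>
    simp only [List.map_nil, List.prod_nil, List.sum_nil]
    refine Finset.card_pos.2 ⟨.node () .nil .nil, mem_classOfSize.2 ⟨rfl, ?_⟩⟩
    exact mem_typeClass_node.2 ⟨by simpa using hq, trivial, trivial⟩
  | cons i l ih =>
    simp only [List.map_cons, List.prod_cons, List.sum_cons]
    exact (Nat.mul_le_mul_left _ ih).trans (card_classOfSize_mul_le q _ _)

namespace CodeTree

/-- The component with a leaf in the place of every portal. -/
def plug : CodeTree Bool → BTree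
  | .leaf false => .nil
  | .leaf true => .node () .nil .nil
  | .node l r => .node () l.plug r.plug

theorem plug_ne_nil (T : CodeTree Bool) : T.plug ≠ .nil ↔ T.present = true := by
  cases T with
  | leaf b => cases b <;> simp [plug, present]
  | node l r => simp [plug, present]

end CodeTree

theorem numNodes_plug (c : BCover) :
    c.toCodeTree.plug.numNodes = c.localSize + c.portals := by
  induction c with
  | nil => rfl
  | portal c _ => rfl
  | node l r hl hr =>
    simp only [toCodeTree, plug, BinaryTree.numNodes, hl, hr, localSize, portals]; omega

theorem plug_mem_typeClass {q : Bool → Bool → Prop} (hq : q false false) {c : BCover}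
    (hc : c.WF) (h : c.toTree ∈ typeClass q) :
    c.toCodeTree.plug ∈ typeClass q ∧
      ∀ d ∈ c.components, d.toCodeTree.plug ∈ typeClass q := by
  induction c with
  | nil => exact ⟨h, by simp [components]⟩
  | portal c ih =>
    obtain ⟨h1, h2⟩ := ih hc.2 h
    refine ⟨mem_typeClass_node.2 ⟨by simpa using hq, trivial, trivial⟩, ?_⟩
    intro d hd
    rcases List.mem_cons.1 hd with rfl | hd
    · exact h1
    · exact h2 d hd
  | node l r hl hr =>
    obtain ⟨h0, h1, h2⟩ := mem_typeClass_node.1 h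
    obtain ⟨a1, a2⟩ := hl hc.1 h1
    obtain ⟨b1, b2⟩ := hr hc.2 h2
    refine ⟨mem_typeClass_node.2 ⟨?_, a1, b1⟩, ?_⟩
    · have e : ∀ s : BCover, s.WF → decide (s.toCodeTree.plug ≠ .nil) =
          decide (s.toTree ≠ .nil) := by
        intro s hs
        rw [decide_eq_decide, plug_ne_nil, present_toCodeTree hs]
      rw [e l hc.1, e r hc.2]
      exact h0
    · intro d hd
      rcases List.mem_append.1 hd with hd | hd
      · exact a2 d hd
      · exact b2 d hd

theorem sum_numNodes_plug (c : BCover) :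
    c.toCodeTree.plug.numNodes +
        (c.components.map fun d => d.toCodeTree.plug.numNodes).sum =
      c.toTree.numNodes + c.components.length := by
  induction c with
  | nil => rfl
  | portal c ih =>
    simp only [toCodeTree, plug, BinaryTree.numNodes, components, toTree, List.map_cons,
      List.sum_cons, List.length_cons]
    omega
  | node l r hl hr =>
    simp only [toCodeTree, plug, BinaryTree.numNodes, components, toTree, List.map_append,
      List.sum_append, List.length_append]
    omega

/-- The weight of the portals of a component: a node is a portal with probability `ε`. -/
noncomputable def portalWeight (ε : ℝ) (T : CodeTree Bool) : ℝ :=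
  typeWeight ε (fun _ _ => 1) [] T

theorem portalWeight_node (ε : ℝ) (l r : CodeTree Bool) :
    portalWeight ε (.node l r) = (1 - ε) * (portalWeight ε l * portalWeight ε r) := by
  simp [portalWeight, typeWeight]

theorem portalWeight_nonneg {ε : ℝ} (h0 : 0 ≤ ε) (h1 : ε ≤ 1) (T : CodeTree Bool) :
    0 ≤ portalWeight ε T :=
  typeWeight_nonneg h0 h1 (by simp) T []

theorem componentsWithHistory_nil (c : BCover) :
    componentsWithHistory [] c = c.components.map fun d => ([], d) := by
  induction c with
  | nil => rfl
  | portal c ih => simp [componentsWithHistory, components, ih]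
  | node l r hl hr => simp [componentsWithHistory, components, hl, hr]

open Classical in
/-- A leaf of a tree is either a node of the component or a portal, with total weight `1`. -/
theorem sum_portalWeight_le {ε : ℝ} (h0 : 0 ≤ ε) (h1 : ε ≤ 1) (x : BTree)
    (S : Finset (CodeTree Bool)) (hS : ∀ T ∈ S, T.plug = x) :
    ∑ T ∈ S, portalWeight ε T ≤ 1 := by
  have hnn := portalWeight_nonneg h0 h1
  induction x generalizing S with
  | nil =>
    have hsub : S ⊆ {.leaf false} := by
      intro T hT
      have := hS T hT
      match T, this with
      | .leaf false, _ => simp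
      | .leaf true, h => simp [plug] at h
      | .node _ _, h => simp [plug] at h
    refine (Finset.sum_le_sum_of_subset_of_nonneg hsub fun T _ _ => hnn T).trans ?_
    simp [portalWeight, typeWeight]
  | node a l r hl hr =>
    by_cases hleaf : l = .nil ∧ r = .nil
    · obtain ⟨rfl, rfl⟩ := hleaf
      have hsub : S ⊆ {.leaf true, .node (.leaf false) (.leaf false)} := by
        intro T hT
        have h := hS T hT
        match T, h with
        | .leaf false, h => simp [plug] at h
        | .leaf true, _ => simp
        | .node l r, h =>
          have hz : ∀ T : CodeTree Bool, T.plug = .nil → T = .leaf false := by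
            intro T hT
            match T, hT with
            | .leaf false, _ => rfl
            | .leaf true, h => simp [plug] at h
            | .node _ _, h => simp [plug] at h
          simp only [plug, BinaryTree.node.injEq, true_and] at h
          rw [hz l h.1, hz r h.2]; simp
      refine (Finset.sum_le_sum_of_subset_of_nonneg hsub fun T _ _ => hnn T).trans ?_
      rw [Finset.sum_pair (by simp)]
      simp [portalWeight, typeWeight]
    · set L : CodeTree Bool → CodeTree Bool := fun T => match T with
        | .leaf _ => T
        | .node l _ => l
      set R : CodeTree Bool → CodeTree Bool := fun T => match T with
        | .leaf _ => T
        | .node _ r => r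
      have hnode : ∀ T ∈ S, T = .node (L T) (R T) ∧ (L T).plug = l ∧ (R T).plug = r := by
        intro T hT
        have h := hS T hT
        match T, h with
        | .leaf false, h => simp [plug] at h
        | .leaf true, h =>
          simp only [plug, BinaryTree.node.injEq, true_and] at h
          exact absurd ⟨h.1.symm, h.2.symm⟩ hleaf
        | .node l r, h =>
          simp only [plug, BinaryTree.node.injEq, true_and] at h
          exact ⟨rfl, h⟩
      have hinj : Set.InjOn (fun T => (L T, R T)) S := by
        intro T hT T' hT' h
        rw [(hnode T hT).1, (hnode T' hT').1, (Prod.mk.inj h).1, (Prod.mk.inj h).2]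
      calc ∑ T ∈ S, portalWeight ε T
          ≤ ∑ T ∈ S, portalWeight ε (L T) * portalWeight ε (R T) := by
            refine Finset.sum_le_sum fun T hT => ?_
            conv_lhs => rw [(hnode T hT).1]
            rw [portalWeight_node]
            exact mul_le_of_le_one_left (mul_nonneg (hnn _) (hnn _)) (by linarith)
        _ = ∑ p ∈ S.image fun T => (L T, R T), portalWeight ε p.1 * portalWeight ε p.2 := by
            rw [Finset.sum_image hinj]
        _ ≤ ∑ p ∈ S.image L ×ˢ S.image R, portalWeight ε p.1 * portalWeight ε p.2 := by
            refine Finset.sum_le_sum_of_subset_of_nonneg ?_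
              fun p _ _ => mul_nonneg (hnn _) (hnn _)
            intro p hp
            obtain ⟨T, hT, rfl⟩ := Finset.mem_image.1 hp
            exact Finset.mem_product.2 ⟨Finset.mem_image_of_mem L hT, Finset.mem_image_of_mem R hT⟩
        _ = (∑ T ∈ S.image L, portalWeight ε T) * ∑ T ∈ S.image R, portalWeight ε T := by
            rw [Finset.sum_mul_sum, Finset.sum_product]
        _ ≤ 1 := by
            refine mul_le_one₀ ?_ (Finset.sum_nonneg fun T _ => hnn T) ?_
            · refine hl _ fun T hT => ?_
              obtain ⟨T', hT', rfl⟩ := Finset.mem_image.1 hT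
              exact (hnode T' hT').2.1
            · refine hr _ fun T hT => ?_
              obtain ⟨T', hT', rfl⟩ := Finset.mem_image.1 hT
              exact (hnode T' hT').2.2

open Classical in
theorem sum_portalWeight_div_card_le {ε : ℝ} (h0 : 0 ≤ ε) (h1 : ε ≤ 1) (q : Bool → Bool → Prop)
    (M : ℕ) (S : Finset (CodeTree Bool))
    (hS : ∀ T ∈ S, T.plug ∈ typeClass q ∧ T.plug ≠ .nil ∧ T.plug.numNodes ≤ M) :
    ∑ T ∈ S, portalWeight ε T / ((classOfSize q (T.plug.numNodes - 1)).card : ℝ) ≤ M := by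
  have hnn := portalWeight_nonneg h0 h1
  set F : Finset BTree := (Finset.range M).biUnion fun k => classOfSize q k
  have hmaps : ∀ T ∈ S, T.plug ∈ F := by
    intro T hT
    obtain ⟨a, b, c⟩ := hS T hT
    have hpos : 1 ≤ T.plug.numNodes := by
      cases h : T.plug with
      | nil => exact absurd h b
      | node a l r => simp [BinaryTree.numNodes]
    exact Finset.mem_biUnion.2 ⟨T.plug.numNodes - 1, Finset.mem_range.2 (by omega),
      mem_classOfSize.2 ⟨by omega, a⟩⟩
  rw [← Finset.sum_fiberwise_of_maps_to hmaps]
  calc ∑ x ∈ F, ∑ T ∈ S with T.plug = x,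
        portalWeight ε T / ((classOfSize q (T.plug.numNodes - 1)).card : ℝ)
      ≤ ∑ x ∈ F, 1 / ((classOfSize q (x.numNodes - 1)).card : ℝ) := by
        refine Finset.sum_le_sum fun x _ => ?_
        have e : ∑ T ∈ S with T.plug = x,
            portalWeight ε T / ((classOfSize q (T.plug.numNodes - 1)).card : ℝ) =
            (∑ T ∈ S with T.plug = x, portalWeight ε T) /
              ((classOfSize q (x.numNodes - 1)).card : ℝ) := by
          rw [Finset.sum_div]
          exact Finset.sum_congr rfl fun T hT => by rw [(Finset.mem_filter.1 hT).2]
        rw [e]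
        apply div_le_div_of_nonneg_right _ (Nat.cast_nonneg _)
        exact sum_portalWeight_le h0 h1 x _ fun T hT => (Finset.mem_filter.1 hT).2
    _ ≤ ∑ k ∈ Finset.range M, ∑ x ∈ classOfSize q k,
          1 / ((classOfSize q (x.numNodes - 1)).card : ℝ) := by
        refine le_of_eq (Finset.sum_biUnion ?_)
        intro i _ j _ hij
        simp only [Function.onFun, Finset.disjoint_left, mem_classOfSize]
        intro x h1 h2
        omega
    _ ≤ ∑ k ∈ Finset.range M, (1 : ℝ) := by
        refine Finset.sum_le_sum fun k _ => ?_
        have e : ∀ x ∈ classOfSize q k, 1 / ((classOfSize q (x.numNodes - 1)).card : ℝ) =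
            1 / ((classOfSize q k).card : ℝ) := by
          intro x hx
          rw [(mem_classOfSize.1 hx).1, Nat.add_sub_cancel]
        rw [Finset.sum_congr rfl e, Finset.sum_const, nsmul_eq_mul, mul_one_div]
        exact div_self_le_one _
    _ = M := by simp

theorem length_hyperBinary_le_typeClass {q : Bool → Bool → Prop} (hq : q false false) {t : BTree}
    (ht : t ≠ .nil) (htq : t ∈ typeClass q) :
    ((hyperBinary t).length : ℝ) ≤ Real.logb 2 (classOfSize q (t.numNodes - 1)).card +
      t.numNodes * (2 / (blockParam t.numNodes : ℝ) + 8 * (Real.logb 2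
        (1 * ((blockParam t.numNodes : ℝ) + 1) ^ 1) / (blockParam t.numNodes : ℝ) ^ (1 : ℝ)) +
        8 * (Real.logb 2 (2 * ((blockParam t.numNodes : ℝ) + 1) ^ 1) /
          (blockParam t.numNodes : ℝ) ^ (1 : ℝ)) +
        errorRate (blockParam t.numNodes)) + 2000 := by
  set B := blockParam t.numNodes with hBdef
  have hB : 1 ≤ B := one_le_blockParam t.numNodes
  have hB0 : (0 : ℝ) < B := by exact_mod_cast hB
  classical
  set ε : ℝ := 1 / ((B : ℝ) + 1) with hε
  have hε0 : 0 < ε := by positivity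
  have hε1 : ε < 1 := by rw [hε, div_lt_one (by positivity)]; linarith
  set c := (coverBinary B t).1 with hc
  have hwp : (BCover.portal c).WF := ⟨isNode_coverBinary B ht, wf_coverBinary hB t⟩
  have hpt : (BCover.portal c).toTree = t := toTree_coverBinary B t
  obtain ⟨⟨_, h2⟩, h3⟩ := sum_logb_typeWeight (τ := fun _ _ => 1) 0 hε0 hε1 hwp [] (by simp)
  have hk : kHistory 0 [] = [] := rfl
  rw [hpt, hk, componentsWithHistory_nil, List.map_map] at h3
  rw [hk, componentsWithHistory_nil] at h2
  have h3' : ((BCover.portal c).components.map fun d =>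
      Real.logb 2 (1 / portalWeight ε d.toCodeTree)).sum ≤
        t.numNodes * Real.logb 2 (1 / (1 - ε)) +
        (BCover.portal c).components.length * Real.logb 2 (1 / ε) := by
    have hlε : 0 ≤ Real.logb 2 (1 / typeWeight ε (fun _ _ => 1) [] (BCover.portal c).toCodeTree) :=
      Real.logb_nonneg (by norm_num) ((one_le_div hε0).2 hε1.le)
    have e : ((histories [] t).map fun _ => Real.logb 2 (1 / (1 : ℝ))).sum = 0 := by simp
    rw [e] at h3
    have e2 : (List.map ((fun d : List (Fin 4) × BCover =>
        Real.logb 2 (1 / typeWeight ε (fun _ _ => 1) d.1 d.2.toCodeTree)) ∘ fun d => ([], d))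
        (BCover.portal c).components).sum = ((BCover.portal c).components.map fun d =>
          Real.logb 2 (1 / portalWeight ε d.toCodeTree)).sum := rfl
    rw [e2] at h3
    linarith
  have hw : ∀ d ∈ (BCover.portal c).components, 0 < portalWeight ε d.toCodeTree :=
    fun d hd => h2 ([], d) (List.mem_map.2 ⟨d, hd, rfl⟩)
  have hmicro : microTreesBinary B t = (BCover.portal c).components := by
    rw [microTreesBinary, if_neg ht]
  set cs := (BCover.portal c).components with hcs
  have hlocal := microTreesBinary_local hB t
  rw [hmicro] at hlocal
  have hclass := (plug_mem_typeClass hq hwp (by rwa [hpt])).2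
  have hnode := isNode_of_mem_components hwp
  have hne : ∀ d ∈ cs, d.toCodeTree.plug ≠ .nil := by
    intro d hd
    have := (hnode d hd).1
    cases h : d with
    | nil => rw [h] at this; exact absurd this (by simp [IsNode])
    | portal c => rw [h] at this; exact absurd this (by simp [IsNode])
    | node l r => simp [toCodeTree, plug]
  have hsucc : ∀ d ∈ cs, d.toCodeTree.plug.numNodes = d.toCodeTree.plug.numNodes - 1 + 1 := by
    intro d hd
    have := hne d hd
    cases h : d.toCodeTree.plug with
    | nil => exact absurd h this
    | node a l r => simp [BinaryTree.numNodes]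
  set N : BCover → ℝ := fun d => ((classOfSize q (d.toCodeTree.plug.numNodes - 1)).card : ℝ)
    with hN
  have hNpos : ∀ d ∈ cs, 0 < N d := by
    intro d hd
    exact Nat.cast_pos.2 <| Finset.card_pos.2 ⟨d.toCodeTree.plug,
      mem_classOfSize.2 ⟨hsucc d hd, hclass d hd⟩⟩
  have hn : 1 ≤ t.numNodes := by
    cases t with
    | nil => exact absurd rfl ht
    | node a l r => simp [BinaryTree.numNodes]
  -- The components with leaves in the places of the portals have `n - 1` edges in total.
  have hsum : (cs.map fun d => d.toCodeTree.plug.numNodes - 1).sum = t.numNodes - 1 := by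
    have h := sum_numNodes_plug (BCover.portal c)
    rw [hpt, ← hcs] at h
    have h5 : (cs.map fun d => d.toCodeTree.plug.numNodes).sum =
        (cs.map fun d => d.toCodeTree.plug.numNodes - 1).sum + cs.length := by
      rw [List.map_congr_left hsucc, List.sum_map_add]
      simp
    simp only [toCodeTree, plug, BinaryTree.numNodes] at h
    omega
  have hprod : (cs.map N).prod ≤ (classOfSize q (t.numNodes - 1)).card := by
    have h := prod_card_classOfSize_le hq (cs.map fun d => d.toCodeTree.plug.numNodes - 1)
    rw [hsum, List.map_map] at h
    have h' : (((cs.map ((fun i => (classOfSize q i).card) ∘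
        fun d => d.toCodeTree.plug.numNodes - 1)).prod : ℕ) : ℝ) ≤
          (classOfSize q (t.numNodes - 1)).card := by exact_mod_cast h
    rw [Nat.cast_list_prod, List.map_map] at h'
    exact h'
  have hZ : ∑ T ∈ (cs.map toCodeTree).toFinset,
      portalWeight ε T / ((classOfSize q (T.plug.numNodes - 1)).card : ℝ) ≤
        2 * ((B : ℝ) + 1) ^ 1 := by
    refine (sum_portalWeight_div_card_le hε0.le hε1.le q (2 * B + 1) _ fun T hT => ?_).trans ?_
    · rw [List.mem_toFinset, List.mem_map] at hT
      obtain ⟨d, hd, rfl⟩ := hT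
      refine ⟨hclass d hd, hne d hd, ?_⟩
      have := hlocal d hd
      rw [numNodes_plug]
      omega
    · push_cast; linarith
  have h := length_hyperBinary_le t (cs.map toCodeTree) innerTree (by
      rw [List.map_map, ← hBdef, hmicro]
      exact List.map_congr_left fun d _ => innerTree_toCodeTree d)
    (fun T => portalWeight ε T / ((classOfSize q (T.plug.numNodes - 1)).card : ℝ)) (by
      intro T hT
      obtain ⟨d, hd, rfl⟩ := List.mem_map.1 hT
      exact div_pos (hw d hd) (hNpos d hd)) hZ (by rw [pow_one]; linarith)
  rw [← hBdef, List.map_map] at h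
  have hsplit : (cs.map ((fun T => Real.logb 2 (1 / (portalWeight ε T /
      ((classOfSize q (T.plug.numNodes - 1)).card : ℝ)))) ∘ toCodeTree)).sum =
      (cs.map fun d => Real.logb 2 (1 / portalWeight ε d.toCodeTree)).sum +
        (cs.map fun d => Real.logb 2 (1 / (1 / N d))).sum := by
    rw [← List.sum_map_add]
    congr 1
    refine List.map_congr_left fun d hd => ?_
    have h1 := hw d hd
    have h2 := hNpos d hd
    have e : ∀ x y : ℝ, 0 < x → 0 < y →
        Real.logb 2 (1 / (x / y)) = Real.logb 2 (1 / x) + Real.logb 2 (1 / (1 / y)) := by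
      intro x y hx hy
      rw [← Real.logb_mul (by positivity) (by positivity)]
      congr 1
      field_simp
    exact e _ _ h1 h2
  have hlogN : (cs.map fun d => Real.logb 2 (1 / (1 / N d))).sum ≤
      Real.logb 2 (classOfSize q (t.numNodes - 1)).card := by
    have hpos : 0 < (cs.map N).prod := by
      apply List.prod_pos
      intro x hx
      obtain ⟨d, hd, rfl⟩ := List.mem_map.1 hx
      exact hNpos d hd
    have hinv : (cs.map fun d => 1 / N d).prod = 1 / (cs.map N).prod := by
      simp only [one_div]
      rw [List.prod_inv, List.map_map]
      rfl
    rw [logb_list_prod_inv cs (fun d => 1 / N d) fun d hd => one_div_pos.2 (hNpos d hd), hinv,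
      one_div_one_div]
    exact Real.logb_le_logb_of_le (by norm_num) hpos hprod
  have hm := length_microTreesBinary_le (blockParam_le hn)
  rw [← hBdef, hmicro] at hm
  have hcost := portal_cost_le (n := t.numNodes) hB (hm.trans (by omega))
  rw [← hε] at hcost
  rw [hsplit] at h
  have e : (t.numNodes : ℝ) * (2 / (B : ℝ) + 8 * (Real.logb 2 (1 * ((B : ℝ) + 1) ^ 1) /
        (B : ℝ) ^ (1 : ℝ)) + 8 * (Real.logb 2 (2 * ((B : ℝ) + 1) ^ 1) / (B : ℝ) ^ (1 : ℝ)) +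
        errorRate B) =
      t.numNodes * (2 / (B : ℝ) + 8 * (Real.logb 2 (1 * ((B : ℝ) + 1) ^ 1) /
        (B : ℝ) ^ (1 : ℝ))) +
      t.numNodes * (8 * Real.logb 2 (2 * ((B : ℝ) + 1) ^ 1) / B + errorRate B) := by
    rw [Real.rpow_one]; ring
  rw [e]
  linarith

theorem uniformOn_typeClass {q : Bool → Bool → Prop} {t : BTree} (ht : t ≠ .nil)
    (htq : t ∈ typeClass q) :
    uniformOn (typeClass q) BinaryTree.numNodes t = 1 / (classOfSize q (t.numNodes - 1)).card := by
  have hn : t.numNodes = t.numNodes - 1 + 1 := by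
    cases t with
    | nil => exact absurd rfl ht
    | node a l r => simp [BinaryTree.numNodes]
  rw [uniformOn, if_pos htq, ← Set.ncard_coe_finset]
  congr 3
  ext s
  rw [Finset.mem_coe, mem_classOfSize, ← hn, and_comm]
  rfl

theorem optimalPointwise_typeClass {q : Bool → Bool → Prop} (hq : q false false) :
    OptimalPointwise hyperBinary BinaryTree.numNodes
      (uniformOn (typeClass q) BinaryTree.numNodes) := by
  have hrate : Tendsto (fun B : ℕ => 2 / (B : ℝ) + 8 * (Real.logb 2 (1 * ((B : ℝ) + 1) ^ 1) /
      (B : ℝ) ^ (1 : ℝ)) + 8 * (Real.logb 2 (2 * ((B : ℝ) + 1) ^ 1) / (B : ℝ) ^ (1 : ℝ)) +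
      errorRate B) atTop (nhds 0) := by
    have h1 := (tendsto_logb_div_rpow (C := 1) (κ := 1) (by norm_num) (by norm_num) 1).const_mul 8
    have h3 := (tendsto_logb_div_rpow (C := 2) (κ := 1) (by norm_num) (by norm_num) 1).const_mul 8
    have h2 : Tendsto (fun B : ℕ => 2 / (B : ℝ)) atTop (nhds 0) :=
      tendsto_const_div_atTop_nhds_zero_nat 2
    simpa using ((h2.add h1).add h3).add tendsto_errorRate
  refine ⟨_, isLittleO_mul_blockParam hrate (2000 + (hyperBinary .nil).length), fun t ht => ?_⟩
  have htq : t ∈ typeClass q := by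
    by_contra h
    rw [uniformOn, if_neg h] at ht
    exact lt_irrefl _ ht
  rcases eq_or_ne t .nil with rfl | ht0
  · rw [uniformOn, if_pos htq, one_div_one_div]
    have h1 : (0 : ℝ) ≤ Real.logb 2 (Set.ncard {s | s ∈ typeClass q ∧
        BinaryTree.numNodes s = BinaryTree.numNodes (.nil : BTree)} : ℝ) :=
      div_nonneg (Real.log_natCast_nonneg _) (Real.log_nonneg (by norm_num))
    simp only [BinaryTree.numNodes, Nat.cast_zero, zero_mul, zero_add] at h1 ⊢
    linarith
  · have h := length_hyperBinary_le_typeClass hq ht0 htq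
    rw [uniformOn_typeClass ht0 htq, one_div_one_div]
    have h0 : (0 : ℝ) ≤ (hyperBinary .nil).length := Nat.cast_nonneg _
    linarith

theorem univ_eq_typeClass : (Set.univ : Set BTree) = typeClass fun _ _ => True := by
  ext t
  simp only [Set.mem_univ, true_iff]
  induction t with
  | nil => trivial
  | node a l r hl hr => exact ⟨trivial, hl, hr⟩

theorem fullTrees_eq_typeClass : fullTrees = typeClass fun a b => a = b := by
  unfold fullTrees typeClass
  congr! 5 with t l r
  by_cases h1 : l = .nil <;> by_cases h2 : r = .nil <;> simp [h1, h2]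

theorem unaryPaths_eq_typeClass : unaryPaths = typeClass fun a b => a = false ∨ b = false := by
  unfold unaryPaths typeClass
  congr! 5 with t l r
  by_cases h1 : l = .nil <;> by_cases h2 : r = .nil <;> simp [h1, h2]

theorem motzkinTrees_eq_typeClass : motzkinTrees = typeClass fun a b => b = true → a = true := by
  unfold motzkinTrees typeClass
  congr! 5 with t l r
  by_cases h1 : l = .nil <;> by_cases h2 : r = .nil <;> simp [h1, h2]

end Hypersuccinct

namespace Hypersuccinct

/-! ### Induction on ordinal trees and their components -/

theorem OTree.induct {P : OTree → Prop} (h : ∀ ts, (∀ t ∈ ts, P t) → P (.node ts)) (t : OTree) :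
    P t :=
  OTree.rec (motive_1 := P) (motive_2 := fun ts => ∀ t ∈ ts, P t) h (by simp)
    (fun t ts h1 h2 => by simpa using ⟨h1, h2⟩) t

theorem OCover.induct {P : OCover → Prop} (hn : ∀ ps, (∀ p ∈ ps, P p) → P (.node ps))
    (hp : ∀ cs, (∀ c ∈ cs, P c) → P (.portal cs)) (x : OCover) : P x :=
  OCover.rec (motive_1 := P) (motive_2 := fun xs => ∀ x ∈ xs, P x) hn hp (by simp)
    (fun x xs h1 h2 => by simpa using ⟨h1, h2⟩) x

theorem sizeList_eq (ts : List OTree) : OTree.sizeList ts = (ts.map OTree.size).sum := by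
  induction ts with
  | nil => simp [OTree.sizeList]
  | cons t ts ih => simp [OTree.sizeList, ih]

theorem one_le_size (t : OTree) : 1 ≤ t.size := by
  cases t; simp [OTree.size]

/-! ### The decomposition of ordinal trees -/

namespace OCover

theorem localSizeList_eq (ps : List OCover) : localSizeList ps = (ps.map localSize).sum := by
  induction ps with
  | nil => simp [localSizeList]
  | cons p ps ih => simp [localSizeList, ih]

theorem localSizeList_append (ps qs : List OCover) :
    localSizeList (ps ++ qs) = localSizeList ps + localSizeList qs := by
  simp [localSizeList_eq]

theorem one_le_localSize {p : OCover} (hp : p.isNode = true) : 1 ≤ p.localSize := by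
  cases p with
  | node ps => simp [localSize]
  | portal cs => simp [isNode] at hp

theorem localSize_of_not_isNode {p : OCover} (hp : ¬ p.isNode = true) : p.localSize = 0 := by
  cases p with
  | node ps => simp [isNode] at hp
  | portal cs => simp [localSize]

theorem localSizeList_of_any_eq_false {ps : List OCover} (h : ¬ ps.any isNode = true) :
    localSizeList ps = 0 := by
  rw [localSizeList_eq, List.sum_eq_zero_iff]
  simp only [List.any_eq_true, not_exists, not_and, List.mem_map] at h ⊢
  rintro _ ⟨p, hp, rfl⟩
  exact localSize_of_not_isNode (h p hp)

mutual
/-- The decomposed subtree below a node of a component. -/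
def toTree : OCover → OTree
  | .node ps => .node (toTreeList ps)
  | .portal cs => .node (childrenList cs)
def toTreeList : List OCover → List OTree
  | [] => []
  | p :: ps => p.toTree :: toTreeList ps
/-- The children of the root of a component, in the decomposed tree. -/
def children : OCover → List OTree
  | .node ps => toTreeList ps
  | .portal _ => []
/-- The children that several components with the same root have together. -/
def childrenList : List OCover → List OTree
  | [] => []
  | c :: cs => c.children ++ childrenList cs
end

theorem toTreeList_eq (ps : List OCover) : toTreeList ps = ps.map toTree := by
  induction ps with
  | nil => simp [toTreeList]
  | cons p ps ih => simp [toTreeList, ih]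

theorem childrenList_map_node (gs : List (List OCover)) :
    childrenList (gs.map node) = gs.flatten.map toTree := by
  induction gs with
  | nil => simp [childrenList]
  | cons g gs ih => simp [childrenList, children, ih, toTreeList_eq]

mutual
/-- The components reached through the portals of a component, and all components below them. -/
def lower : OCover → List OCover
  | .node ps => lowerList ps
  | .portal cs => group cs
def lowerList : List OCover → List OCover
  | [] => []
  | p :: ps => p.lower ++ lowerList ps
/-- Several components and all components below them. -/
def group : List OCover → List OCover
  | [] => []
  | c :: cs => c :: c.lower ++ group cs
end

theorem lowerList_append (ps qs : List OCover) : lowerList (ps ++ qs) = lowerList ps ++ lowerList qs := by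
  induction ps with
  | nil => simp [lowerList]
  | cons p ps ih => simp [lowerList, ih]

theorem mem_lowerList {ps : List OCover} {d : OCover} :
    d ∈ lowerList ps ↔ ∃ p ∈ ps, d ∈ p.lower := by
  induction ps with
  | nil => simp [lowerList]
  | cons p ps ih => simp [lowerList, ih]

theorem mem_group {cs : List OCover} {d : OCover} :
    d ∈ group cs ↔ ∃ c ∈ cs, d = c ∨ d ∈ c.lower := by
  induction cs with
  | nil => simp [group]
  | cons c cs ih => simp [group, ih, or_assoc]

theorem length_lowerList (ps : List OCover) :
    (lowerList ps).length = (ps.map fun p => p.lower.length).sum := by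
  induction ps with
  | nil => simp [lowerList]
  | cons p ps ih => simp [lowerList, ih]

theorem length_group_map_node (gs : List (List OCover)) :
    (group (gs.map node)).length = gs.length + (lowerList gs.flatten).length := by
  induction gs with
  | nil => simp [group, lowerList]
  | cons g gs ih => simp [group, ih, lowerList_append, lower]; omega

mutual
/-- Portals lead to at least one component. -/
def WF : OCover → Prop
  | .node ps => WFList ps
  | .portal cs => (cs ≠ [] ∧ ∀ c ∈ cs, c.isNode = true) ∧ WFList cs
def WFList : List OCover → Prop
  | [] => True
  | p :: ps => p.WF ∧ WFList ps
end

theorem wfList_iff {ps : List OCover} : WFList ps ↔ ∀ p ∈ ps, p.WF := by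
  induction ps with
  | nil => simp [WFList]
  | cons p ps ih => simp [WFList, ih]

mutual
theorem map_snd_itemComponents (e e' : EdgeType) : ∀ {x : OCover}, x.WF →
    (itemComponents e e' x).map Prod.snd = x.lower
  | .node ps, h => by rw [itemComponents, lower]; exact map_snd_innerComponents h
  | .portal cs, h => by rw [itemComponents, lower]; exact map_snd_groupComponents e e' h.1.2 h.2
theorem map_snd_innerComponents : ∀ {ps : List OCover}, WFList ps →
    (innerComponents ps).map Prod.snd = lowerList ps
  | [], _ => by simp [innerComponents, lowerList]
  | p :: ps, h => by
    rw [innerComponents, lowerList, List.map_append, map_snd_itemComponents _ _ h.1,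
      map_snd_innerComponents h.2]
theorem map_snd_rootComponents (seen : Bool) : ∀ {ps : List OCover}, WFList ps →
    (rootComponents seen ps).map Prod.snd = lowerList ps
  | [], _ => by simp [rootComponents, lowerList]
  | p :: ps, h => by
    rw [rootComponents, lowerList, List.map_append, map_snd_rootComponents _ h.2]
    congr 1
    split_ifs <;> exact map_snd_itemComponents _ _ h.1
theorem map_snd_ownComponents : ∀ {c : OCover}, c.isNode = true → c.WF →
    (ownComponents c).map Prod.snd = c.lower
  | .node ps, _, h => by rw [ownComponents, lower]; exact map_snd_rootComponents _ h
theorem map_snd_groupComponents (e e' : EdgeType) : ∀ {cs : List OCover},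
    (∀ c ∈ cs, c.isNode = true) → WFList cs → (groupComponents e e' cs).map Prod.snd = group cs
  | [], _, _ => by simp [groupComponents, group]
  | c :: cs, h, hw => by
    rw [groupComponents, group, List.map_append, List.map_cons,
      map_snd_ownComponents (h c List.mem_cons_self) hw.1,
      map_snd_groupComponents e' e' (fun d hd => h d (List.mem_cons_of_mem _ hd)) hw.2]
end

mutual
theorem sizeList_topsBelow : ∀ x : OCover, OTree.sizeList x.topsBelow = x.lower.length
  | .node ps => by rw [topsBelow, lower]; exact sizeList_topsBelowList ps
  | .portal cs => by rw [topsBelow, lower]; exact sizeList_contract cs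
theorem sizeList_topsBelowList : ∀ ps : List OCover,
    OTree.sizeList (topsBelowList ps) = (lowerList ps).length
  | [] => by simp [topsBelowList, lowerList, OTree.sizeList]
  | p :: ps => by
    have h1 := sizeList_topsBelow p
    have h2 := sizeList_topsBelowList ps
    rw [sizeList_eq] at *
    simp [topsBelowList, lowerList, h1, h2]
theorem sizeList_contract : ∀ cs : List OCover, OTree.sizeList (contract cs) = (group cs).length
  | [] => by simp [contract, group, OTree.sizeList]
  | c :: cs => by
    have h1 := sizeList_topsBelow c
    have h2 := sizeList_contract cs
    simp [contract, group, OTree.sizeList, OTree.size, h1, h2]; omega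
end

mutual
theorem sizeList_shapes : ∀ x : OCover, OTree.sizeList x.shapes = x.localSize
  | .node ps => by
    simp [shapes, localSize, OTree.sizeList, OTree.size, sizeList_shapesList ps]
  | .portal cs => by simp [shapes, localSize, OTree.sizeList]
theorem sizeList_shapesList : ∀ ps : List OCover,
    OTree.sizeList (shapesList ps) = localSizeList ps
  | [] => by simp [shapesList, localSizeList, OTree.sizeList]
  | p :: ps => by
    have h1 := sizeList_shapes p
    have h2 := sizeList_shapesList ps
    rw [sizeList_eq] at *
    simp [shapesList, localSizeList, h1, h2]
end

theorem size_shape {c : OCover} (hc : c.isNode = true) : c.shape.size = c.localSize := by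
  cases c with
  | node ps => simp [shape, localSize, OTree.size, sizeList_shapesList]
  | portal cs => simp [isNode] at hc

end OCover

open OCover

mutual
theorem length_bpOrd : ∀ t : OTree, (bpOrd t).length = 2 * t.size
  | .node ts => by simp [bpOrd, OTree.size, length_bpOrdList ts]; omega
theorem length_bpOrdList : ∀ ts : List OTree, (bpOrdList ts).length = 2 * OTree.sizeList ts
  | [] => by simp [bpOrdList, OTree.sizeList]
  | t :: ts => by simp [bpOrdList, OTree.sizeList, length_bpOrd t, length_bpOrdList ts]; omega
end

/-! ### Packing -/

theorem flatten_pack (B : ℕ) (br : Bool) (cur items : List OCover) :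
    (pack B br cur items).flatten = cur ++ items := by
  induction items generalizing cur with
  | nil => simp [pack]
  | cons p ps ih =>
    unfold pack
    split_ifs <;> simp [ih]

theorem pack_ne_nil (B : ℕ) (br : Bool) (cur items : List OCover) : pack B br cur items ≠ [] := by
  induction items generalizing cur with
  | nil => simp [pack]
  | cons p ps ih =>
    unfold pack
    split_ifs <;> simp [ih]

theorem pack_eq_of_lt {B : ℕ} {cur items : List OCover}
    (h : 1 + localSizeList (cur ++ items) < B) : pack B false cur items = [cur ++ items] := by
  induction items generalizing cur with
  | nil => simp [pack]
  | cons p ps ih =>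
    have e : cur ++ p :: ps = cur ++ [p] ++ ps := by simp
    rw [e] at h ⊢
    have h1 := localSizeList_append (cur ++ [p]) ps
    unfold pack
    rw [if_neg (by simp : ¬ (false = true ∧ cur.any isNode = true)), if_neg (by omega : ¬ B ≤ _),
      ih h, ite_self]

/-- All groups but the last contain at least `B` nodes with the root, or are followed by a portal. -/
theorem length_pack_le {B : ℕ} (br : Bool) (cur items : List OCover) :
    B * (pack B br cur items).length ≤ B + 2 * localSizeList (cur ++ items) +
      if br then B * items.countP (fun p => !p.isNode) else 0 := by
  induction items generalizing cur with
  | nil => simp [pack]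
  | cons p ps ih =>
    have e : cur ++ p :: ps = cur ++ [p] ++ ps := by simp
    have h0 := localSizeList_append (cur ++ [p]) ps
    have h0' := localSizeList_append cur [p]
    have h0'' : localSizeList [p] = p.localSize := by simp [localSizeList]
    have h1' := ih (cur ++ [p])
    rw [e, List.countP_cons]
    unfold pack
    by_cases h1 : p.isNode = true
    · rw [if_pos h1]
      have hs := one_le_localSize h1
      simp only [h1, Bool.not_true, Bool.false_eq_true, if_false, add_zero]
      by_cases h2 : B ≤ 1 + localSizeList (cur ++ [p])
      · rw [if_pos h2]
        have h3 := ih []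
        rw [List.nil_append] at h3
        by_cases h4 : ps.any isNode = true
        · rw [if_pos h4, List.length_cons, Nat.mul_add, Nat.mul_one]
          omega
        · rw [if_neg h4, List.length_singleton, Nat.mul_one]
          omega
      · rw [if_neg h2]
        exact h1'
    · rw [if_neg h1]
      simp only [h1, Bool.not_false, if_true, Nat.mul_add, Nat.mul_one]
      by_cases hb : br = true ∧ cur.any isNode = true
      · rw [if_pos hb]
        have h3 := ih [p]
        have h5 := localSizeList_append [p] ps
        simp only [hb.1, if_true] at h3 ⊢
        by_cases h4 : ps.any isNode = true
        · rw [if_pos h4, List.length_cons, Nat.mul_add, Nat.mul_one, ← hb.1]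
          rw [← hb.1] at h3
          omega
        · rw [if_neg h4, List.length_singleton, Nat.mul_one]
          omega
      · rw [if_neg hb]
        split_ifs at h1' ⊢ <;> omega

/-- If the items have fewer than `B` nodes each, the groups have fewer than `2 B` nodes each. -/
theorem localSizeList_pack_lt {B : ℕ} (br : Bool) (cur items : List OCover)
    (hitems : ∀ p ∈ items, p.isNode = true → p.localSize < B)
    (hcur : 1 + localSizeList cur ≤ B) :
    ∀ g ∈ pack B br cur items, 1 + localSizeList g < 2 * B := by
  induction items generalizing cur with
  | nil => intro g hg; simp only [pack, List.mem_singleton] at hg; subst hg; omega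
  | cons p ps ih =>
    have e : cur ++ p :: ps = cur ++ [p] ++ ps := by simp
    have h0 := localSizeList_append (cur ++ [p]) ps
    have h0' := localSizeList_append cur [p]
    have h0'' : localSizeList [p] = p.localSize := by simp [localSizeList]
    have hps : ∀ p ∈ ps, p.isNode = true → p.localSize < B :=
      fun q hq => hitems q (List.mem_cons_of_mem _ hq)
    have hp := hitems p List.mem_cons_self
    intro g hg
    unfold pack at hg
    by_cases h1 : p.isNode = true
    · rw [if_pos h1] at hg
      have hp' := hp h1
      by_cases h2 : B ≤ 1 + localSizeList (cur ++ [p])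
      · rw [if_pos h2] at hg
        by_cases h4 : ps.any isNode = true
        · rw [if_pos h4] at hg
          rcases List.mem_cons.1 hg with rfl | hg
          · omega
          · exact ih [] hps (by simp [localSizeList]; omega) g hg
        · rw [if_neg h4, List.mem_singleton] at hg
          have := localSizeList_of_any_eq_false h4
          subst hg; omega
      · rw [if_neg h2] at hg
        exact ih _ hps (by omega) g hg
    · rw [if_neg h1] at hg
      have hz := localSize_of_not_isNode h1
      by_cases hb : br = true ∧ cur.any isNode = true
      · rw [if_pos hb] at hg
        by_cases h4 : ps.any isNode = true
        · rw [if_pos h4] at hg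
          rcases List.mem_cons.1 hg with rfl | hg
          · omega
          · exact ih [p] hps (by omega) g hg
        · rw [if_neg h4, List.mem_singleton, e] at hg
          have := localSizeList_of_any_eq_false h4
          subst hg; omega
      · rw [if_neg hb] at hg
        exact ih _ hps (by omega) g hg

/-! ### The components of an ordinal tree -/

theorem coverOrdinalList_eq (B : ℕ) (ts : List OTree) :
    coverOrdinalList B ts = ts.map fun t => (decide (B ≤ t.size), coverOrdinal B t) := by
  induction ts with
  | nil => simp [coverOrdinalList]
  | cons t ts ih => simp [coverOrdinalList, ih]

/-- A component that is not permanent is the only one at its node, and small. -/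
theorem coverOrdinal_of_not_permanent {B : ℕ} {t : OTree} (h : (coverOrdinal B t).2 = false) :
    ∃ ps, (coverOrdinal B t).1 = [OCover.node ps] ∧ 1 + localSizeList ps < B := by
  cases t with
  | node ts =>
    rw [coverOrdinal, coverStep] at h ⊢
    simp only [Bool.or_eq_false_iff, decide_eq_false_iff_not, List.length_map, not_le] at h ⊢
    obtain ⟨⟨_, h2⟩, h3⟩ := h
    generalize hgs : pack B _ [] _ = gs at h2 h3 ⊢
    match gs, h2, h3, hgs with
    | [], _, _, hgs => exact absurd hgs (pack_ne_nil _ _ _ _)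
    | [g], _, h3, _ => exact ⟨g, rfl, by simpa [localSizeList, localSize] using h3⟩
    | _ :: _ :: _, h2, _, _ => simp at h2

/-- What becomes of a child in the component of its parent; `br` tells whether the parent has at
least two heavy children. -/
def childItem (B : ℕ) (br : Bool) (t : OTree) : OCover :=
  if (coverOrdinal B t).2 || (br && decide (B ≤ t.size)) then .portal (coverOrdinal B t).1
  else (coverOrdinal B t).1.headD (.node [])

/-- Whether at least two children are heavy. -/
def branching (B : ℕ) (ts : List OTree) : Bool :=
  decide (2 ≤ ts.countP fun t => decide (B ≤ t.size))

theorem coverOrdinal_node (B : ℕ) (ts : List OTree) :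
    coverOrdinal B (.node ts) =
      ((pack B (branching B ts) [] (ts.map (childItem B (branching B ts)))).map OCover.node,
        branching B ts ||
          decide (2 ≤ (pack B (branching B ts) [] (ts.map (childItem B (branching B ts)))).length) ||
          decide (B ≤ localSizeList
            ((pack B (branching B ts) [] (ts.map (childItem B (branching B ts)))).map
              OCover.node))) := by
  have h : ∀ br : Bool, ((coverOrdinalList B ts).flatMap fun x =>
      if x.2.2 || (br && x.1) then [OCover.portal x.2.1] else x.2.1) =
        ts.map (childItem B br) := by
    intro br
    rw [coverOrdinalList_eq, List.flatMap_map, List.map_eq_flatMap]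
    congr 1
    funext t
    unfold childItem
    by_cases hp : ((coverOrdinal B t).2 || (br && decide (B ≤ t.size))) = true
    · simp only [hp, if_true]
    · simp only [hp]
      simp only [Bool.or_eq_true, not_or, Bool.not_eq_true] at hp
      obtain ⟨ps, h1, _⟩ := coverOrdinal_of_not_permanent hp.1
      rw [h1]; rfl
  have hbr : (decide (2 ≤ (coverOrdinalList B ts).countP fun x => x.1)) = branching B ts := by
    rw [coverOrdinalList_eq, List.countP_map]; rfl
  rw [coverOrdinal, coverStep]
  simp only [hbr, h, List.length_map]

theorem childItem_cases (B : ℕ) (br : Bool) (t : OTree) :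
    (childItem B br t = .portal (coverOrdinal B t).1 ∧
      ((coverOrdinal B t).2 = true ∨ br = true ∧ B ≤ t.size)) ∨
    ∃ ps, childItem B br t = .node ps ∧ coverOrdinal B t = ([.node ps], false) ∧
      1 + localSizeList ps < B ∧ ¬ (br = true ∧ B ≤ t.size) := by
  unfold childItem
  by_cases hp : ((coverOrdinal B t).2 || (br && decide (B ≤ t.size))) = true
  · left
    rw [if_pos hp]
    exact ⟨rfl, by simpa using hp⟩
  · right
    rw [if_neg hp]
    simp only [Bool.or_eq_true, not_or, Bool.not_eq_true] at hp
    obtain ⟨ps, h1, h2⟩ := coverOrdinal_of_not_permanent hp.1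
    refine ⟨ps, by rw [h1]; rfl, Prod.ext h1 hp.1, h2, by simpa using hp.2⟩

theorem wf_coverOrdinal (B : ℕ) (t : OTree) : (OCover.portal (coverOrdinal B t).1).WF := by
  induction t using OTree.induct with
  | h ts ih =>
    rw [coverOrdinal_node]
    refine ⟨⟨by simpa using pack_ne_nil _ _ _ _, ?_⟩, wfList_iff.2 ?_⟩
    · intro c hc
      obtain ⟨g, _, rfl⟩ := List.mem_map.1 hc
      rfl
    · intro c hc
      obtain ⟨g, hg, rfl⟩ := List.mem_map.1 hc
      refine wfList_iff.2 fun p hp => ?_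
      have : p ∈ (pack B (branching B ts) [] (ts.map (childItem B (branching B ts)))).flatten :=
        List.mem_flatten.2 ⟨g, hg, hp⟩
      rw [flatten_pack, List.nil_append] at this
      obtain ⟨t, ht, rfl⟩ := List.mem_map.1 this
      have hw := ih t ht
      rcases childItem_cases B (branching B ts) t with ⟨h, _⟩ | ⟨ps, h, hc, _⟩
      · rw [h]; exact hw
      · rw [h]
        rw [hc] at hw
        exact hw.2.1

theorem toTree_coverOrdinal (B : ℕ) (t : OTree) :
    (OCover.portal (coverOrdinal B t).1).toTree = t := by
  induction t using OTree.induct with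
  | h ts ih =>
    rw [coverOrdinal_node, toTree, childrenList_map_node, flatten_pack, List.nil_append, List.map_map]
    congr 1
    refine (List.map_congr_left fun t ht => ?_).trans (List.map_id _)
    have hw := ih t ht
    rcases childItem_cases B (branching B ts) t with ⟨h, _⟩ | ⟨ps, h, hc, _⟩
    · rw [Function.comp_apply, h]; exact hw
    · rw [Function.comp_apply, h]
      rw [hc] at hw
      simpa [toTree, childrenList, children] using hw

theorem coverOrdinal_local {B : ℕ} (hB : 1 ≤ B) (t : OTree) :
    ∀ d ∈ group (coverOrdinal B t).1, d.localSize < 2 * B := by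
  induction t using OTree.induct with
  | h ts ih =>
    rw [coverOrdinal_node]
    intro d hd
    obtain ⟨c, hc, hd⟩ := mem_group.1 hd
    obtain ⟨g, hg, rfl⟩ := List.mem_map.1 hc
    rcases hd with rfl | hd
    · refine localSizeList_pack_lt _ [] _ ?_ (by simpa [localSizeList] using hB) g hg
      intro p hp hn
      obtain ⟨t, _, rfl⟩ := List.mem_map.1 hp
      rcases childItem_cases B (branching B ts) t with ⟨h, _⟩ | ⟨ps, h, _, h2, _⟩
      · rw [h] at hn; simp [isNode] at hn
      · rw [h]; exact h2
    · rw [lower, mem_lowerList] at hd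
      obtain ⟨p, hp, hd⟩ := hd
      have : p ∈ (pack B (branching B ts) [] (ts.map (childItem B (branching B ts)))).flatten :=
        List.mem_flatten.2 ⟨g, hg, hp⟩
      rw [flatten_pack, List.nil_append] at this
      obtain ⟨t, ht, rfl⟩ := List.mem_map.1 this
      have hw := ih t ht d
      rcases childItem_cases B (branching B ts) t with ⟨h, _⟩ | ⟨ps, h, hc, _⟩
      · rw [h] at hd; exact hw hd
      · rw [h] at hd
        rw [hc] at hw
        exact hw (by simp [group, hd])

theorem localSizeList_map_node (gs : List (List OCover)) :
    localSizeList (gs.map OCover.node) = gs.length + localSizeList gs.flatten := by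
  induction gs with
  | nil => simp [localSizeList]
  | cons g gs ih => simp [localSizeList, localSize, ih, localSizeList_append]; omega

theorem coverOrdinal_light {B : ℕ} {t : OTree} (ht : t.size < B) :
    ∃ ps, coverOrdinal B t = ([.node ps], false) ∧ lowerList ps = [] ∧
      1 + localSizeList ps = t.size := by
  induction t using OTree.induct with
  | h ts ih =>
    rw [OTree.size, sizeList_eq] at ht
    have hlt : ∀ t ∈ ts, t.size < B := by
      intro t h
      have := List.single_le_sum (l := ts.map OTree.size) (by simp) t.size (List.mem_map_of_mem h)
      omega
    have hbr : branching B ts = false := by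
      have : ts.countP (fun t => decide (B ≤ t.size)) = 0 := by
        rw [List.countP_eq_zero]
        intro t h
        simpa using hlt t h
      simp [branching, this]
    have hitem : ∀ t ∈ ts, (childItem B false t).lower = [] ∧
        (childItem B false t).localSize = t.size := by
      intro t h
      obtain ⟨ps, h1, h2, h3⟩ := ih t h (hlt t h)
      have : childItem B false t = .node ps := by simp [childItem, h1]
      rw [this]
      exact ⟨h2, h3⟩
    have hsize : localSizeList (ts.map (childItem B false)) = (ts.map OTree.size).sum := by
      rw [localSizeList_eq, List.map_map]
      exact congrArg List.sum (List.map_congr_left fun t h => (hitem t h).2)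
    have hpack : pack B false [] (ts.map (childItem B false)) = [ts.map (childItem B false)] := by
      rw [pack_eq_of_lt, List.nil_append]
      rw [List.nil_append, hsize]; exact ht
    refine ⟨ts.map (childItem B false), ?_, ?_, ?_⟩
    · rw [coverOrdinal_node, hbr, hpack]
      simp only [List.map_cons, List.map_nil, localSizeList, localSize,
        hsize, List.length_singleton, Bool.false_or]
      simp; omega
    · rw [List.eq_nil_iff_forall_not_mem]
      intro d hd
      obtain ⟨p, hp, hd⟩ := mem_lowerList.1 hd
      obtain ⟨t, h, rfl⟩ := List.mem_map.1 hp
      rw [(hitem t h).1] at hd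
      simp at hd
    · rw [hsize, OTree.size, sizeList_eq]

/-- The number of micro trees is controlled by the potential `B M + 4 a`, where `M` counts the
permanent components and `a` is the size of an active one. -/
theorem coverOrdinal_potential {B : ℕ} {t : OTree} (ht : B ≤ t.size) :
    ((coverOrdinal B t).2 = true → B * (group (coverOrdinal B t).1).length + 5 * B ≤ 8 * t.size) ∧
    ∀ ps, coverOrdinal B t = ([.node ps], false) →
      B * (lowerList ps).length + 4 * (1 + localSizeList ps) + 5 * B ≤ 8 * t.size := by
  induction t using OTree.induct with
  | h ts ih =>
    have hlight : ∀ br : Bool, ∀ t : OTree, t.size < B →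
        (childItem B br t).isNode = true ∧ (childItem B br t).lower = [] ∧
          (childItem B br t).localSize = t.size := by
      intro br t h
      obtain ⟨ps, h1, h2, h3⟩ := coverOrdinal_light h
      have : childItem B br t = .node ps := by
        simp only [childItem, h1, Bool.false_or]
        rw [if_neg (by simp; omega)]
        rfl
      rw [this]
      exact ⟨rfl, h2, h3⟩
    have hheavy : ∀ t ∈ ts, B ≤ t.size →
        (B * (childItem B false t).lower.length + 4 * (childItem B false t).localSize + 5 * B ≤
          8 * t.size) ∧
        (B * (childItem B true t).lower.length + 2 * (childItem B true t).localSize + 4 * B ≤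
          8 * t.size) := by
      intro t h hB
      obtain ⟨h1, h2⟩ := ih t h hB
      rcases hp : (coverOrdinal B t).2 with _ | _
      · obtain ⟨ps, h3, _⟩ := coverOrdinal_of_not_permanent hp
        have h4 := h2 ps (Prod.ext h3 hp)
        have e1 : childItem B false t = .node ps := by simp [childItem, hp, h3]
        have e2 : childItem B true t = .portal [.node ps] := by simp [childItem, h3, hB]
        rw [e1, e2]
        simp only [lower, group, localSize, List.append_nil, List.length_cons, Nat.mul_add,
          Nat.mul_one]
        omega
      · have h4 := h1 hp
        have e1 : ∀ br, childItem B br t = .portal (coverOrdinal B t).1 := by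
          intro br; simp [childItem, hp]
        rw [e1, e1]
        simp only [lower, localSize]
        omega
    -- The sums over all children.
    have hfalse : B * (lowerList (ts.map (childItem B false))).length +
        4 * localSizeList (ts.map (childItem B false)) +
        5 * B * ts.countP (fun t => decide (B ≤ t.size)) ≤ 8 * (ts.map OTree.size).sum := by
      clear ih ht
      induction ts with
      | nil => simp [lowerList, localSizeList]
      | cons t ts ih' =>
        have h1 := ih' fun t ht => hheavy t (List.mem_cons_of_mem _ ht)
        have h2 := hheavy t List.mem_cons_self
        have h3 := hlight false t
        simp only [List.map_cons, lowerList, localSizeList, List.length_append, List.countP_cons,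
          List.sum_cons, Nat.mul_add]
        by_cases hB : B ≤ t.size
        · have := h2 hB
          simp only [hB, decide_true, if_true]
          omega
        · obtain ⟨_, h4, h5⟩ := h3 (by omega)
          simp only [hB, h4, h5, List.length_nil, decide_false, Bool.false_eq_true, if_false]
          omega
    have hfalse0 : ts.countP (fun t => decide (B ≤ t.size)) = 0 →
        (lowerList (ts.map (childItem B false))).length = 0 ∧
        localSizeList (ts.map (childItem B false)) = (ts.map OTree.size).sum := by
      intro h
      rw [List.countP_eq_zero] at h
      have h' : ∀ t ∈ ts, t.size < B := fun t ht => by simpa using h t ht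
      constructor
      · rw [length_lowerList, List.sum_eq_zero_iff, List.map_map]
        intro x hx
        obtain ⟨t, ht, rfl⟩ := List.mem_map.1 hx
        simp [(hlight false t (h' t ht)).2.1]
      · rw [localSizeList_eq, List.map_map]
        exact congrArg List.sum (List.map_congr_left fun t ht => (hlight false t (h' t ht)).2.2)
    have htrue : B * (lowerList (ts.map (childItem B true))).length +
        2 * localSizeList (ts.map (childItem B true)) +
        4 * B * ts.countP (fun t => decide (B ≤ t.size)) ≤ 8 * (ts.map OTree.size).sum ∧
        (ts.map (childItem B true)).countP (fun p => !p.isNode) ≤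
          ts.countP (fun t => decide (B ≤ t.size)) := by
      clear ih ht hfalse hfalse0
      induction ts with
      | nil => simp [lowerList, localSizeList]
      | cons t ts ih' =>
        have h1 := ih' (fun t ht => hheavy t (List.mem_cons_of_mem _ ht))
        have h2 := hheavy t List.mem_cons_self
        have h3 := hlight true t
        simp only [List.map_cons, lowerList, localSizeList, List.length_append, List.countP_cons,
          List.sum_cons, Nat.mul_add]
        by_cases hB : B ≤ t.size
        · have := h2 hB
          simp only [hB, decide_true, if_true]
          split_ifs <;> omega
        · obtain ⟨h0, h4, h5⟩ := h3 (by omega)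
          simp only [hB, h0, h4, h5, List.length_nil, decide_false, Bool.false_eq_true, if_false,
            Bool.not_true]
          omega
    rw [OTree.size, sizeList_eq] at ht ⊢
    set S := (ts.map OTree.size).sum with hS
    rw [coverOrdinal_node]
    set h := ts.countP fun t => decide (B ≤ t.size) with hh
    rcases hbr : branching B ts with _ | _
    · have hh1 : h ≤ 1 := by
        simp only [branching, decide_eq_false_iff_not, not_le] at hbr
        omega
      have hp := length_pack_le (B := B) false [] (ts.map (childItem B false))
      have hf := flatten_pack B false [] (ts.map (childItem B false))
      have hs := pack_eq_of_lt (B := B) (cur := []) (items := ts.map (childItem B false))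
      rw [List.nil_append] at hp hf hs
      set gs := pack B false [] (ts.map (childItem B false)) with hgs
      set X := (lowerList (ts.map (childItem B false))).length
      set Y := localSizeList (ts.map (childItem B false))
      simp only [Bool.false_eq_true, if_false, add_zero] at hp
      have hh : h = 0 ∨ h = 1 := by omega
      have hperm : 1 + Y < B → gs.length = 1 ∧ localSizeList (gs.map OCover.node) = 1 + Y := by
        intro hlt
        rw [localSizeList_map_node, hf, hs hlt]
        exact ⟨rfl, rfl⟩
      constructor
      · intro hperm'
        have hY : B ≤ 1 + Y := by
          by_contra hlt
          obtain ⟨a, b⟩ := hperm (by omega)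
          simp only [Bool.false_or, Bool.or_eq_true, decide_eq_true_iff] at hperm'
          omega
        rw [length_group_map_node, hf, Nat.mul_add]
        change B * gs.length + B * X + 5 * B ≤ _
        rcases hh with h0 | h0
        · obtain ⟨a, b⟩ := hfalse0 h0
          rw [a, Nat.mul_zero]
          omega
        · rw [h0] at hfalse
          omega
      · intro ps hps
        obtain ⟨h1, h2⟩ := Prod.mk.inj hps
        have hg : gs = [ps] := by
          have : gs.map OCover.node = [ps].map OCover.node := h1
          exact (List.map_injective_iff.2 fun a b h => by simpa using h) this
        rw [hg] at hf
        have hps' : ps = ts.map (childItem B false) := by simpa using hf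
        rw [hps']
        simp only [hg, localSizeList_map_node, Bool.false_or, Bool.or_eq_false_iff,
          decide_eq_false_iff_not, List.flatten_singleton, List.length_singleton] at h2
        rw [hps'] at h2
        change B * X + 4 * (1 + Y) + 5 * B ≤ _
        have h2' : ¬ B ≤ 1 + Y := h2.2
        rcases hh with h0 | h0
        · obtain ⟨a, b⟩ := hfalse0 h0
          omega
        · rw [h0] at hfalse
          omega
    · have hh2 : 2 ≤ h := by simpa [branching] using hbr
      have hp := length_pack_le (B := B) true [] (ts.map (childItem B true))
      have hf := flatten_pack B true [] (ts.map (childItem B true))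
      rw [List.nil_append] at hp hf
      simp only [if_true] at hp
      obtain ⟨ht1, ht2⟩ := htrue
      have ht3 := Nat.mul_le_mul_left B ht2
      have ht4 := Nat.mul_le_mul_left B hh2
      refine ⟨fun _ => ?_, fun ps hps => by simp at hps⟩
      rw [length_group_map_node, hf, Nat.mul_add]
      rw [Nat.mul_assoc] at ht1
      omega

/-! ### The code length of ordinal trees -/

mutual
/-- The first-child next-sibling representation of the sequence of the children of the root. -/
def OTree.toBinary : OTree → BTree
  | .node ts => OTree.forestToBinary ts
/-- The first-child next-sibling representation of a forest. -/
def OTree.forestToBinary : List OTree → BTree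
  | [] => .nil
  | t :: ts => .node () t.toBinary (OTree.forestToBinary ts)
end

mutual
theorem numNodes_toBinary : ∀ t : OTree, t.toBinary.numNodes + 1 = t.size
  | .node ts => by rw [OTree.toBinary, OTree.size, numNodes_forestToBinary ts, add_comm]
theorem numNodes_forestToBinary : ∀ ts : List OTree,
    (OTree.forestToBinary ts).numNodes = OTree.sizeList ts
  | [] => by simp [OTree.forestToBinary, OTree.sizeList, BinaryTree.numNodes]
  | t :: ts => by
    have h1 := numNodes_toBinary t
    have h2 := numNodes_forestToBinary ts
    simp only [OTree.forestToBinary, OTree.sizeList, BinaryTree.numNodes]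
    omega
end

mutual
theorem toBinary_inj : ∀ {s t : OTree}, s.toBinary = t.toBinary → s = t
  | .node ss, .node ts, h => by
    rw [OTree.toBinary, OTree.toBinary] at h
    rw [forestToBinary_inj h]
theorem forestToBinary_inj : ∀ {ss ts : List OTree},
    OTree.forestToBinary ss = OTree.forestToBinary ts → ss = ts
  | [], [], _ => rfl
  | [], _ :: _, h => by simp [OTree.forestToBinary] at h
  | _ :: _, [], h => by simp [OTree.forestToBinary] at h
  | s :: ss, t :: ts, h => by
    simp only [OTree.forestToBinary, BinaryTree.node.injEq, true_and] at h
    rw [toBinary_inj h.1, forestToBinary_inj h.2]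
end

theorem card_le_of_size_lt (F : Finset OTree) (N : ℕ) (hF : ∀ t ∈ F, t.size < N) :
    F.card ≤ 4 ^ N := by
  refine le_trans ?_ (card_treesBelow_le N)
  refine Finset.card_le_card_of_injOn OTree.toBinary (fun t ht => ?_)
    fun s _ t _ h => toBinary_inj h
  rw [Finset.mem_coe, mem_treesBelow]
  have h1 := numNodes_toBinary t
  have h2 := hF t ht
  omega

theorem finite_size_eq (N : ℕ) : {t : OTree | t.size = N}.Finite := by
  refine Set.Finite.of_finite_image (f := OTree.toBinary) ?_ fun s _ t _ h => toBinary_inj h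
  refine (treesBelow N).finite_toSet.subset ?_
  rintro _ ⟨t, ht, rfl⟩
  have h1 := numNodes_toBinary t
  change t.size = N at ht
  rw [Finset.mem_coe, mem_treesBelow]
  omega

/-- The micro trees of an ordinal tree. -/
theorem map_snd_microTreesOrdinal (B : ℕ) (t : OTree) :
    (microTreesOrdinal B t).map Prod.snd = group (coverOrdinal B t).1 :=
  map_snd_groupComponents _ _ (wf_coverOrdinal B t).1.2 (wf_coverOrdinal B t).2

theorem mul_length_group_le {B : ℕ} {t : OTree} (ht : B ≤ t.size) :
    B * (group (coverOrdinal B t).1).length ≤ 8 * t.size := by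
  have h := coverOrdinal_potential ht
  rcases hp : (coverOrdinal B t).2 with _ | _
  · obtain ⟨ps, h1, _⟩ := coverOrdinal_of_not_permanent hp
    have h2 := h.2 ps (Prod.ext h1 hp)
    rw [h1]
    simp only [group, lower, List.append_nil, List.length_cons, Nat.mul_add, Nat.mul_one]
    omega
  · have := h.1 hp
    omega

theorem isNode_wf_of_mem_group {x : OCover} (hx : x.WF) :
    ∀ d ∈ x.lower, d.isNode = true ∧ d.WF := by
  induction x using OCover.induct with
  | hn ps ih =>
    intro d hd
    obtain ⟨p, hp, hd⟩ := mem_lowerList.1 hd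
    exact ih p hp (wfList_iff.1 hx p hp) d hd
  | hp cs ih =>
    intro d hd
    obtain ⟨c, hc, hd⟩ := mem_group.1 hd
    have hw := wfList_iff.1 hx.2 c hc
    rcases hd with rfl | hd
    · exact ⟨hx.1.2 d hc, hw⟩
    · exact ih c hc hw d hd

/-- The code length of an ordinal tree for arbitrary weights on decorated micro trees. -/
theorem length_hyperOrdinal_le (t : OTree) {δ : Type} [DecidableEq δ] (ds : List δ)
    (proj : δ → OTree)
    (hds : ds.map proj = (group (coverOrdinal (blockParam t.size) t).1).map OCover.shape)
    (w : δ → ℝ) (hw : ∀ d ∈ ds, 0 < w d) {Z : ℝ} (hZ : ∑ d ∈ ds.toFinset, w d ≤ Z) (hZ1 : 1 ≤ Z) :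
    ((hyperOrdinal t).length : ℝ) ≤ (ds.map fun d => Real.logb 2 (1 / w d)).sum +
      t.size * (8 * (Real.logb 2 Z + 3) / blockParam t.size + errorRate (blockParam t.size)) +
        2002 := by
  set B := blockParam t.size with hBdef
  have hB : 1 ≤ B := one_le_blockParam t.size
  have hn := one_le_size t
  set cs := group (coverOrdinal B t).1 with hcs
  have hlen : cs.length = ds.length := by
    simpa using (congrArg List.length hds).symm
  have hmt := map_snd_microTreesOrdinal B t
  have hmlen : (microTreesOrdinal B t).length = ds.length := by
    rw [← hlen, hcs, ← hmt, List.length_map]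
  have hshapes : (microTreesOrdinal B t).map (fun c => c.2.shape) = ds.map proj := by
    rw [hds, hcs, ← hmt, List.map_map]; rfl
  have hnode := isNode_wf_of_mem_group (wf_coverOrdinal B t)
  have hmem : ∀ d ∈ ds, (proj d).size < 2 * B := by
    intro d hd
    have : proj d ∈ cs.map OCover.shape := hds ▸ List.mem_map_of_mem hd
    obtain ⟨c, hc, hcd⟩ := List.mem_map.1 this
    rw [← hcd, size_shape (hnode c hc).1]
    exact coverOrdinal_local hB t c hc
  have hU : (ds.map proj).dedup.length ≤ 16 ^ B := by
    rw [← List.card_toFinset]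
    refine (card_le_of_size_lt _ (2 * B) fun x hx => ?_).trans ?_
    · simp only [List.mem_toFinset, List.mem_map] at hx
      obtain ⟨d, hd, rfl⟩ := hx
      exact hmem d hd
    · rw [pow_mul]; norm_num
  have h := length_table_add_length_codes_le OTree.size bpOrd ds proj (2 * B) (16 ^ B)
    (fun d _ => length_bpOrd _) (fun d hd => (hmem d hd).le) hU w hw hZ
  have htop : (bpOrd (topTierOrdinal B t)).length = 2 * (1 + ds.length) := by
    rw [length_bpOrd, topTierOrdinal, OTree.size, sizeList_contract, ← hlen]
  have hlog : Nat.log 2 ds.length ≤ ds.length := Nat.log_le_self 2 _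
  have hlog2 : Nat.log 2 t.size ≤ Nat.log 2 (t.size + 1) := Nat.log_mono_right (by omega)
  have hport : ((microTreesOrdinal B t).flatMap fun c =>
      fixedWidth (portalWidth t.size) c.2.externalPortal.1 ++
        fixedWidth (portalWidth t.size) c.2.externalPortal.2).length =
      ds.length * (2 * portalWidth t.size) := by
    rw [List.length_flatMap]
    simp [hmlen, two_mul]
  have hedge : ((microTreesOrdinal B t).flatMap fun c => c.1.code).length = ds.length * 3 := by
    have : ∀ e : EdgeType, e.code.length = 3 := by intro e; cases e <;> simp [EdgeType.code]
    rw [List.length_flatMap]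
    simp [hmlen, this]
  have hm : B * ds.length ≤ 8 * t.size := by
    rw [← hlen]; exact mul_length_group_le (blockParam_le hn)
  have hl := lower_order_le hm
  have hlZ : 0 ≤ Real.logb 2 Z := Real.logb_nonneg (by norm_num) hZ1
  have hB0 : (0 : ℝ) < B := by exact_mod_cast hB
  have hm' : (ds.length : ℝ) ≤ 8 * t.size / B := by
    rw [le_div_iff₀ hB0, mul_comm]; exact_mod_cast hm
  have a1 : (ds.length : ℝ) * (Real.logb 2 Z + 3) ≤
      t.size * (8 * (Real.logb 2 Z + 3) / B) := by
    calc (ds.length : ℝ) * (Real.logb 2 Z + 3) ≤ 8 * t.size / B * (Real.logb 2 Z + 3) := by gcongr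
      _ = _ := by ring
  have a2 : (16 : ℝ) ^ B * (32 * B + 12) ≤ 16 ^ B * (64 * B + 12) := by gcongr; norm_num
  unfold hyperOrdinal encodeOrdinal
  simp only [← hBdef, List.length_append, hport, hedge, hshapes, htop, length_eliasGamma, hmlen]
  push_cast at h ⊢
  have hlog' : (Nat.log 2 ds.length : ℝ) ≤ ds.length := by exact_mod_cast hlog
  have hlog2' : (Nat.log 2 t.size : ℝ) ≤ Nat.log 2 (t.size + 1) := by exact_mod_cast hlog2
  have e : ((16 : ℝ) ^ B * (16 * (2 * B) + 12) + 1) = 16 ^ B * (32 * B + 12) + 1 := by ring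
  rw [e] at h
  linarith

end Hypersuccinct

namespace Hypersuccinct

open OCover
open scoped ENNReal
open Finset.HasAntidiagonal (antidiagonal mem_antidiagonal)

/-! ### Sequential sources of ordinal trees -/

/-- The probability of generating the sizes `ns` one by one after subtrees of total size `s`, where
`r` is the factor for a subtree, depending on the total size of the subtrees before it. -/
def seqWeight (r : ℕ → ℕ → ℝ) : ℕ → List ℕ → ℝ
  | _, [] => 1
  | s, x :: xs => r s x * seqWeight r (s + x) xs

/-- The factors `r s x` are antitone, and for every total size `s + x > 0` have sum at most one. -/
structure IsSequentialSource (r : ℕ → ℕ → ℝ) : Prop where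
  nonneg : ∀ s x, 0 ≤ r s x
  antitone : ∀ s s' x x', s' ≤ s → 1 ≤ x' → x' ≤ x → r s x ≤ r s' x'
  sum_le_one : ∀ n, ∑ ij ∈ antidiagonal n, r ij.1 (ij.2 + 1) ≤ 1

theorem seqWeight_append (r : ℕ → ℕ → ℝ) (s : ℕ) (a b : List ℕ) :
    seqWeight r s (a ++ b) = seqWeight r s a * seqWeight r (s + a.sum) b := by
  induction a generalizing s with
  | nil => simp [seqWeight]
  | cons x a ih => simp [seqWeight, ih, mul_assoc, add_assoc]

theorem eq_seqWeight {p : List ℕ → ℝ} {r : ℕ → ℕ → ℝ} (h0 : p [] = 1)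
    (h : ∀ ns x, p (ns ++ [x]) = p ns * r ns.sum x) : p = seqWeight r 0 := by
  funext ns
  induction ns using List.reverseRecOn with
  | nil => exact h0
  | append_singleton ns x ih => rw [h, ih, seqWeight_append]; simp [seqWeight]

theorem fixedSizeOrdinalList_eq (p : List ℕ → ℝ) (ts : List OTree) :
    fixedSizeOrdinalList p ts = (ts.map (fixedSizeOrdinal p)).prod := by
  induction ts with
  | nil => simp [fixedSizeOrdinalList]
  | cons t ts ih => simp [fixedSizeOrdinalList, ih]

/-- A list is empty or has a last element. -/
def listEquivSum (α : Type) : List α ≃ Unit ⊕ (List α × α) where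
  toFun l := if h : l = [] then .inl () else .inr (l.dropLast, l.getLast h)
  invFun := Sum.elim (fun _ => []) fun x => x.1 ++ [x.2]
  left_inv l := by
    by_cases h : l = []
    · simp [h]
    · simp [h, List.dropLast_append_getLast]
  right_inv x := by rcases x with ⟨⟩ | ⟨l, a⟩ <;> simp

/-- An ordinal tree is the sequence of the subtrees of its root. -/
def otreeEquivList : List OTree ≃ OTree where
  toFun := .node
  invFun | .node ts => ts
  left_inv _ := rfl
  right_inv t := by cases t; rfl

theorem tsum_list_eq (f : List OTree → ℝ≥0∞) :
    ∑' ts, f ts = f [] + ∑' l, ∑' ts, f (l ++ [.node ts]) := by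
  rw [← Equiv.tsum_eq (listEquivSum OTree).symm, Summable.tsum_sum ENNReal.summable ENNReal.summable,
    ENNReal.tsum_prod', tsum_fintype, Fintype.sum_unique]
  congr 1
  refine tsum_congr fun l => ?_
  rw [← Equiv.tsum_eq otreeEquivList]
  rfl

/-- The children of the root of a component, including the missing ones. -/
def OCover.items : OCover → List OCover
  | .node ps => ps
  | .portal _ => []

namespace IsSequentialSource

variable {r : ℕ → ℕ → ℝ}

theorem le_one (hr : IsSequentialSource r) (s : ℕ) {x : ℕ} (hx : 1 ≤ x) : r s x ≤ 1 := by
  obtain ⟨y, rfl⟩ : ∃ y, x = y + 1 := ⟨x - 1, by omega⟩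
  exact (Finset.single_le_sum (f := fun ij : ℕ × ℕ => r ij.1 (ij.2 + 1))
    (fun ij _ => hr.nonneg _ _) (mem_antidiagonal.2 rfl : (s, y) ∈ antidiagonal (s + y))).trans
    (hr.sum_le_one (s + y))

theorem seqWeight_nonneg (hr : IsSequentialSource r) (s : ℕ) (ns : List ℕ) :
    0 ≤ seqWeight r s ns := by
  induction ns generalizing s with
  | nil => simp [seqWeight]
  | cons x ns ih => exact mul_nonneg (hr.nonneg _ _) (ih _)

theorem fixedSizeOrdinal_nonneg (hr : IsSequentialSource r) (t : OTree) :
    0 ≤ fixedSizeOrdinal (seqWeight r 0) t := by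
  induction t using OTree.induct with
  | h ts ih =>
    rw [fixedSizeOrdinal, fixedSizeOrdinalList_eq]
    refine mul_nonneg (hr.seqWeight_nonneg _ _) (List.prod_nonneg fun x hx => ?_)
    obtain ⟨t, ht, rfl⟩ := List.mem_map.1 hx
    exact ih t ht

theorem fixedSizeOrdinal_node_append (ts : List OTree) (u : OTree) :
    fixedSizeOrdinal (seqWeight r 0) (.node (ts ++ [u])) =
      r (OTree.sizeList ts) u.size * (fixedSizeOrdinal (seqWeight r 0) (.node ts) *
        fixedSizeOrdinal (seqWeight r 0) u) := by
  simp only [fixedSizeOrdinal, fixedSizeOrdinalList_eq, List.map_append, List.map_cons, List.map_nil,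
    seqWeight_append, List.prod_append, List.prod_cons, List.prod_nil, seqWeight, sizeList_eq,
    zero_add, mul_one]
  ring

/-- The trees of a given size have total probability at most one. -/
theorem tsum_fixedSizeOrdinal_le (hr : IsSequentialSource r) (n : ℕ) :
    ∑' ts : List OTree, (if OTree.sizeList ts = n then
      ENNReal.ofReal (fixedSizeOrdinal (seqWeight r 0) (.node ts)) else 0) ≤ 1 := by
  have hnn := hr.fixedSizeOrdinal_nonneg
  induction n using Nat.strong_induction_on with
  | _ n ih =>
    rw [tsum_list_eq]
    cases n with
    | zero =>
      have h : ∀ (l : List OTree) (ts : List OTree),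
          ¬ OTree.sizeList (l ++ [.node ts]) = 0 := by
        intro l ts
        simp [sizeList_eq, OTree.size]
      simp only [h, if_false, tsum_zero, add_zero]
      simp [OTree.sizeList, fixedSizeOrdinal, seqWeight, fixedSizeOrdinalList]
    | succ n =>
      set A : ℕ → ℝ≥0∞ := fun n => ∑' ts : List OTree, (if OTree.sizeList ts = n then
        ENNReal.ofReal (fixedSizeOrdinal (seqWeight r 0) (.node ts)) else 0) with hA
      have h0 : ¬ OTree.sizeList [] = n + 1 := by simp [OTree.sizeList]
      rw [if_neg h0, zero_add]
      calc ∑' l : List OTree, ∑' ts : List OTree, (if OTree.sizeList (l ++ [.node ts]) = n + 1 then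
            ENNReal.ofReal (fixedSizeOrdinal (seqWeight r 0) (.node (l ++ [.node ts]))) else 0)
          = ∑' l : List OTree, ∑' ts : List OTree, ∑ ij ∈ antidiagonal n,
            ENNReal.ofReal (r ij.1 (ij.2 + 1)) *
            ((if OTree.sizeList l = ij.1 then
              ENNReal.ofReal (fixedSizeOrdinal (seqWeight r 0) (.node l)) else 0) *
            (if OTree.sizeList ts = ij.2 then
              ENNReal.ofReal (fixedSizeOrdinal (seqWeight r 0) (.node ts)) else 0)) := by
            refine tsum_congr fun l => tsum_congr fun ts => ?_
            have e : OTree.sizeList (l ++ [.node ts]) =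
                OTree.sizeList l + OTree.sizeList ts + 1 := by
              rw [sizeList_eq, List.map_append, List.sum_append, ← sizeList_eq]
              simp only [List.map_cons, List.map_nil, List.sum_cons, List.sum_nil, OTree.size]
              omega
            rw [e]
            by_cases h : OTree.sizeList l + OTree.sizeList ts = n
            · rw [if_pos (by omega), Finset.sum_eq_single (OTree.sizeList l, OTree.sizeList ts),
                if_pos rfl, if_pos rfl, fixedSizeOrdinal_node_append, OTree.size, add_comm 1,
                ENNReal.ofReal_mul (hr.nonneg _ _), ENNReal.ofReal_mul (hnn _)]
              · rintro ⟨i, j⟩ _ hne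
                by_cases h1 : OTree.sizeList l = i
                · have h2 : ¬ OTree.sizeList ts = j := fun h2 => hne (by rw [h1, h2])
                  rw [if_neg h2, mul_zero, mul_zero]
                · rw [if_neg h1, zero_mul, mul_zero]
              · exact fun h' => absurd (mem_antidiagonal.2 h) h'
            · rw [if_neg (by omega)]
              refine (Finset.sum_eq_zero fun ij hij => ?_).symm
              have hij' := mem_antidiagonal.1 hij
              by_cases h1 : OTree.sizeList l = ij.1
              · have h2 : ¬ OTree.sizeList ts = ij.2 := fun h2 => h (by rw [h1, h2, hij'])
                rw [if_neg h2, mul_zero, mul_zero]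
              · rw [if_neg h1, zero_mul, mul_zero]
        _ = ∑ ij ∈ antidiagonal n, ENNReal.ofReal (r ij.1 (ij.2 + 1)) * (A ij.1 * A ij.2) := by
            have hfin : ∀ f : List OTree → List OTree → ℕ × ℕ → ℝ≥0∞,
                ∑' l, ∑' ts, ∑ ij ∈ antidiagonal n, f l ts ij =
                  ∑ ij ∈ antidiagonal n, ∑' l, ∑' ts, f l ts ij := by
              intro f
              rw [← Summable.tsum_finsetSum fun _ _ => ENNReal.summable]
              exact tsum_congr fun l => Summable.tsum_finsetSum fun _ _ => ENNReal.summable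
            rw [hfin]
            refine Finset.sum_congr rfl fun ij _ => ?_
            simp only [ENNReal.tsum_mul_left, ENNReal.tsum_mul_right]
            rfl
        _ ≤ ∑ ij ∈ antidiagonal n, ENNReal.ofReal (r ij.1 (ij.2 + 1)) * (1 * 1) := by
            refine Finset.sum_le_sum fun ij hij => mul_le_mul' le_rfl ?_
            have hij' := mem_antidiagonal.1 hij
            exact mul_le_mul' (ih _ (by omega)) (ih _ (by omega))
        _ ≤ 1 := by
            simp only [mul_one]
            rw [← ENNReal.ofReal_sum_of_nonneg fun ij _ => hr.nonneg _ _]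
            simpa using hr.sum_le_one n

theorem sum_fixedSizeOrdinal_le (hr : IsSequentialSource r) (N : ℕ) (F : Finset OTree)
    (hF : ∀ t ∈ F, t.size < N) : ∑ t ∈ F, fixedSizeOrdinal (seqWeight r 0) t ≤ N := by
  have hnn := hr.fixedSizeOrdinal_nonneg
  have hmaps : ∀ t ∈ F, t.size ∈ Finset.range N := fun t ht => Finset.mem_range.2 (hF t ht)
  rw [← Finset.sum_fiberwise_of_maps_to hmaps]
  refine (Finset.sum_le_sum (g := fun _ => (1 : ℝ)) fun k _ => ?_).trans (by simp)
  rw [← ENNReal.ofReal_le_ofReal_iff zero_le_one, ENNReal.ofReal_one,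
    ENNReal.ofReal_sum_of_nonneg fun t _ => hnn t]
  refine le_trans ?_ (hr.tsum_fixedSizeOrdinal_le (k - 1))
  have e := Equiv.tsum_eq otreeEquivList fun t : OTree => if t.size = k - 1 + 1 then
    ENNReal.ofReal (fixedSizeOrdinal (seqWeight r 0) t) else 0
  have e' : (∑' ts : List OTree, if OTree.sizeList ts = k - 1 then
      ENNReal.ofReal (fixedSizeOrdinal (seqWeight r 0) (.node ts)) else 0) =
      ∑' ts : List OTree, if (otreeEquivList ts).size = k - 1 + 1 then
        ENNReal.ofReal (fixedSizeOrdinal (seqWeight r 0) (otreeEquivList ts)) else 0 := by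
    refine tsum_congr fun ts => ?_
    have : (otreeEquivList ts).size = 1 + OTree.sizeList ts := by
      change (OTree.node ts).size = _
      rw [OTree.size]
    rw [this, add_comm 1]
    simp only [Nat.add_right_cancel_iff]
    rfl
  rw [e', e]
  refine le_trans (le_of_eq ?_) (ENNReal.sum_le_tsum (F.filter fun t => t.size = k))
  refine Finset.sum_congr rfl fun t ht => ?_
  have h1 := (Finset.mem_filter.1 ht).2
  have h2 := one_le_size t
  rw [if_pos (by omega)]

theorem localSize_le_size (x : OCover) : x.localSize ≤ x.toTree.size := by
  induction x using OCover.induct with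
  | hn ps ih =>
    rw [localSize, toTree, OTree.size, sizeList_eq, toTreeList_eq, localSizeList_eq, List.map_map]
    exact Nat.add_le_add_left (List.sum_le_sum fun p hp => ih p hp) 1
  | hp cs _ => simp [localSize]

/-- Missing and smaller subtrees do not decrease the probability of the sequence of sizes. -/
theorem seqWeight_toTreeList_le (hr : IsSequentialSource r) (ps : List OCover) {s s' : ℕ}
    (hs : s' ≤ s) :
    seqWeight r s ((toTreeList ps).map OTree.size) ≤
      seqWeight r s' ((shapesList ps).map OTree.size) := by
  induction ps generalizing s s' with
  | nil => simp [toTreeList, shapesList, seqWeight]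
  | cons p ps ih =>
    have hle := localSize_le_size p
    rw [toTreeList, shapesList, List.map_cons, seqWeight]
    cases p with
    | portal cs =>
      simp only [shapes, List.nil_append]
      calc _ ≤ 1 * seqWeight r s' ((shapesList ps).map OTree.size) :=
            mul_le_mul (hr.le_one _ (one_le_size _)) (ih (by omega)) (hr.seqWeight_nonneg _ _)
              zero_le_one
        _ = _ := one_mul _
    | node qs =>
      have e : (OTree.node (shapesList qs)).size = (OCover.node qs).localSize := by
        rw [OTree.size, sizeList_shapesList, localSize]
      simp only [shapes, List.cons_append, List.nil_append, List.map_cons, seqWeight, e]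
      exact mul_le_mul (hr.antitone _ _ _ _ hs (one_le_localSize rfl) hle) (ih (by omega))
        (hr.seqWeight_nonneg _ _) (hr.nonneg _ _)

/-- Distributing the children of a node among several components does not decrease the
probability. -/
theorem seqWeight_childrenList_le (hr : IsSequentialSource r) (cs : List OCover)
    (hcs : ∀ c ∈ cs, c.isNode = true) (s : ℕ) :
    seqWeight r s ((childrenList cs).map OTree.size) ≤
      (cs.map fun c => seqWeight r 0 ((shapesList c.items).map OTree.size)).prod := by
  induction cs generalizing s with
  | nil => simp [childrenList, seqWeight]
  | cons c cs ih =>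
    have h1 := hcs c List.mem_cons_self
    cases c with
    | portal _ => simp [isNode] at h1
    | node ps =>
      rw [childrenList, children, List.map_append, seqWeight_append, List.map_cons, List.prod_cons]
      exact mul_le_mul (hr.seqWeight_toTreeList_le ps (Nat.zero_le s))
        (ih (fun d hd => hcs d (List.mem_cons_of_mem _ hd)) _) (hr.seqWeight_nonneg _ _)
        (hr.seqWeight_nonneg _ _)

/-- Cutting at the portals does not decrease the probability. -/
theorem fixedSizeOrdinal_toTree_le (hr : IsSequentialSource r) {x : OCover} (hx : x.WF) :
    fixedSizeOrdinal (seqWeight r 0) x.toTree ≤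
      (x.shapes.map (fixedSizeOrdinal (seqWeight r 0))).prod *
        (x.lower.map fun d => fixedSizeOrdinal (seqWeight r 0) d.shape).prod := by
  set P := fixedSizeOrdinal (seqWeight r 0) with hP
  have hnn := hr.fixedSizeOrdinal_nonneg
  have hl : ∀ l : List OTree, 0 ≤ (l.map P).prod := fun l =>
    List.prod_nonneg fun x hx => by obtain ⟨t, _, rfl⟩ := List.mem_map.1 hx; exact hnn t
  have hl' : ∀ l : List OCover, 0 ≤ (l.map fun d => P d.shape).prod := fun l =>
    List.prod_nonneg fun x hx => by obtain ⟨t, _, rfl⟩ := List.mem_map.1 hx; exact hnn _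
  have hnode : ∀ ts : List OTree,
      P (.node ts) = seqWeight r 0 (ts.map OTree.size) * (ts.map P).prod := by
    intro ts
    rw [hP, fixedSizeOrdinal, fixedSizeOrdinalList_eq]
  have hlist : ∀ ps : List OCover, (∀ p ∈ ps, P p.toTree ≤
      (p.shapes.map P).prod * (p.lower.map fun d => P d.shape).prod) →
      ((toTreeList ps).map P).prod ≤
        ((shapesList ps).map P).prod * ((lowerList ps).map fun d => P d.shape).prod := by
    intro ps h
    induction ps with
    | nil => simp [toTreeList, shapesList, lowerList]
    | cons p ps ih =>
      have h1 := h p List.mem_cons_self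
      have h2 := ih fun q hq => h q (List.mem_cons_of_mem _ hq)
      rw [toTreeList, shapesList, lowerList, List.map_cons, List.prod_cons, List.map_append,
        List.map_append, List.prod_append, List.prod_append, mul_mul_mul_comm]
      exact mul_le_mul h1 h2 (hl _) (mul_nonneg (hl _) (hl' _))
  suffices h : P x.toTree ≤ (x.shapes.map P).prod * (x.lower.map fun d => P d.shape).prod ∧
      ((toTreeList x.items).map P).prod ≤
        ((shapesList x.items).map P).prod * ((lowerList x.items).map fun d => P d.shape).prod from h.1
  induction x using OCover.induct with
  | hn ps ih =>
    have h := hlist ps fun p hp => (ih p hp (wfList_iff.1 hx p hp)).1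
    refine ⟨?_, h⟩
    rw [toTree, hnode, shapes, lower, List.map_singleton, List.prod_singleton, hnode, mul_assoc]
    exact mul_le_mul (hr.seqWeight_toTreeList_le ps le_rfl) h (hl _) (hr.seqWeight_nonneg _ _)
  | hp cs ih =>
    refine ⟨?_, by simp [items, toTreeList, shapesList, lowerList]⟩
    rw [toTree, hnode, shapes, lower, List.map_nil, List.prod_nil, one_mul]
    refine (mul_le_mul_of_nonneg_right (hr.seqWeight_childrenList_le cs hx.1.2 0) (hl _)).trans ?_
    have hw := wfList_iff.1 hx.2
    have hn := hx.1.2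
    clear hx
    induction cs with
    | nil => simp [childrenList, group]
    | cons c cs ih' =>
      have h1 := ih' (fun d hd => ih d (List.mem_cons_of_mem _ hd))
        (fun d hd => hw d (List.mem_cons_of_mem _ hd)) fun d hd => hn d (List.mem_cons_of_mem _ hd)
      have h2 := (ih c List.mem_cons_self (hw c List.mem_cons_self)).2
      have h3 := hn c List.mem_cons_self
      cases c with
      | portal _ => simp [isNode] at h3
      | node ps =>
        simp only [items] at h2
        rw [childrenList, children, group, lower, List.map_append, List.map_append, List.prod_append,
          List.prod_append, List.map_cons, List.map_cons, List.prod_cons, List.prod_cons,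
          mul_mul_mul_comm, shape, hnode, items]
        refine mul_le_mul ?_ h1 (mul_nonneg (List.prod_nonneg fun x hx => ?_) (hl _)) ?_
        · rw [mul_assoc]
          exact mul_le_mul_of_nonneg_left h2 (hr.seqWeight_nonneg _ _)
        · obtain ⟨d, _, rfl⟩ := List.mem_map.1 hx
          exact hr.seqWeight_nonneg _ _
        · exact mul_nonneg (mul_nonneg (hr.seqWeight_nonneg _ _) (hl _)) (hl' _)

theorem optimalPointwise (hr : IsSequentialSource r) :
    OptimalPointwise hyperOrdinal OTree.size (fixedSizeOrdinal (seqWeight r 0)) := by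
  have hrate : Tendsto (fun B : ℕ => 8 * (Real.logb 2 (2 * ((B : ℝ) + 1) ^ 1) / (B : ℝ) ^ (1 : ℝ)) +
      24 / (B : ℝ) + errorRate B) atTop (nhds 0) := by
    have h1 := (tendsto_logb_div_rpow (C := 2) (κ := 1) (by norm_num) (by norm_num) 1).const_mul 8
    have h2 : Tendsto (fun B : ℕ => 24 / (B : ℝ)) atTop (nhds 0) :=
      tendsto_const_div_atTop_nhds_zero_nat 24
    simpa using (h1.add h2).add tendsto_errorRate
  refine ⟨_, isLittleO_mul_blockParam hrate 2002, fun t ht => ?_⟩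
  set B := blockParam t.size with hBdef
  have hB : 1 ≤ B := one_le_blockParam t.size
  set cs := group (coverOrdinal B t).1 with hcs
  have hnn := hr.fixedSizeOrdinal_nonneg
  have hprod : fixedSizeOrdinal (seqWeight r 0) t ≤
      (cs.map fun d => fixedSizeOrdinal (seqWeight r 0) d.shape).prod := by
    have h := hr.fixedSizeOrdinal_toTree_le (wf_coverOrdinal B t)
    rw [toTree_coverOrdinal] at h
    simpa [shapes, lower] using h
  have hpos' : 0 < (cs.map fun d => fixedSizeOrdinal (seqWeight r 0) d.shape).prod :=
    ht.trans_le hprod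
  have hpos : ∀ d ∈ cs, 0 < fixedSizeOrdinal (seqWeight r 0) d.shape := by
    intro d hd
    refine lt_of_le_of_ne (hnn _) fun e => hpos'.ne' ?_
    exact List.prod_eq_zero (List.mem_map.2 ⟨d, hd, e.symm⟩)
  have hnode := isNode_wf_of_mem_group (wf_coverOrdinal B t)
  have h := length_hyperOrdinal_le t (cs.map shape) id (by rw [List.map_id])
    (fixedSizeOrdinal (seqWeight r 0)) (by
      intro s hs
      obtain ⟨d, hd, rfl⟩ := List.mem_map.1 hs
      exact hpos d hd)
    (Z := 2 * ((B : ℝ) + 1) ^ 1) (by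
      refine (hr.sum_fixedSizeOrdinal_le (2 * B) _ fun s hs => ?_).trans ?_
      · rw [List.mem_toFinset, List.mem_map] at hs
        obtain ⟨d, hd, rfl⟩ := hs
        rw [size_shape (hnode d hd).1]
        exact coverOrdinal_local hB t d hd
      · push_cast; linarith)
    (by rw [pow_one]; linarith [Nat.cast_nonneg (α := ℝ) B])
  rw [List.map_map] at h
  have e1 : (cs.map ((fun d => Real.logb 2 (1 / fixedSizeOrdinal (seqWeight r 0) d)) ∘ shape)).sum ≤
      Real.logb 2 (1 / fixedSizeOrdinal (seqWeight r 0) t) := by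
    have := logb_list_prod_inv cs (fun d => fixedSizeOrdinal (seqWeight r 0) d.shape) hpos
    simp only [Function.comp_def]
    rw [this]
    exact Real.logb_le_logb_of_le (by norm_num) (by positivity) (one_div_le_one_div_of_le ht hprod)
  have e2 : (t.size : ℝ) * (8 * (Real.logb 2 (2 * ((B : ℝ) + 1) ^ 1) / (B : ℝ) ^ (1 : ℝ)) +
      24 / (B : ℝ) + errorRate B) =
      t.size * (8 * (Real.logb 2 (2 * ((B : ℝ) + 1) ^ 1) + 3) / B + errorRate B) := by
    rw [Real.rpow_one]; ring
  rw [e2]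
  rw [← hBdef] at h
  linarith

end IsSequentialSource

/-! ### Composition trees and LRM-trees -/

theorem optimalPointwise_composition :
    OptimalPointwise hyperOrdinal OTree.size (fixedSizeOrdinal pComposition) := by
  set r : ℕ → ℕ → ℝ := fun s x => if s = 0 then (1 / 2) ^ (x - 1) else (1 / 2) ^ x with hr
  have h : IsSequentialSource r := by
    refine ⟨fun s x => by rw [hr]; positivity, fun s s' x x' hs hx hx' => ?_, fun n => ?_⟩
    · simp only [hr]
      split_ifs with h1 h2 h2
      · exact pow_le_pow_of_le_one (by norm_num) (by norm_num) (by omega)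
      · omega
      · exact pow_le_pow_of_le_one (by norm_num) (by norm_num) (by omega)
      · exact pow_le_pow_of_le_one (by norm_num) (by norm_num) (by omega)
    · rw [Finset.Nat.sum_antidiagonal_eq_sum_range_succ_mk]
      have hgeom : ∀ n : ℕ, ∑ k ∈ Finset.range n, (1 / 2 : ℝ) ^ (n - k) = 1 - (1 / 2) ^ n := by
        intro n
        induction n with
        | zero => simp
        | succ n ih =>
          rw [Finset.sum_range_succ']
          simp only [Nat.add_sub_add_right, ih, Nat.sub_zero]
          ring
      rw [Finset.sum_range_succ']
      have e : ∀ k ∈ Finset.range n, r (k + 1) (n - (k + 1) + 1) = (1 / 2 : ℝ) ^ (n - k) := by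
        intro k hk
        have := Finset.mem_range.1 hk
        simp only [hr]
        rw [if_neg (by omega)]
        congr 1; omega
      rw [Finset.sum_congr rfl e, hgeom]
      simp [hr]
  have e : pComposition = seqWeight r 0 := by
    refine eq_seqWeight (by simp [pComposition]) fun ns x => ?_
    simp only [pComposition, List.sum_append, List.sum_singleton, hr]
    split_ifs with h0
    · simp [h0]
    · rw [show ns.sum + x - 1 = ns.sum - 1 + x by omega, pow_add, one_div_pow, one_div_mul_one_div]
  rw [e]
  exact h.optimalPointwise

theorem optimalPointwise_lrm :
    OptimalPointwise hyperOrdinal OTree.size (fixedSizeOrdinal pLrm) := by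
  set r : ℕ → ℕ → ℝ := fun s x => 1 / ((s + x : ℕ) : ℝ) with hr
  have h : IsSequentialSource r := by
    refine ⟨fun s x => by rw [hr]; positivity, fun s s' x x' hs hx hx' => ?_, fun n => ?_⟩
    · simp only [hr]
      apply one_div_le_one_div_of_le
      · exact_mod_cast (by omega)
      · exact_mod_cast (by omega)
    · have e : ∀ ij ∈ antidiagonal n, r ij.1 (ij.2 + 1) = 1 / ((n + 1 : ℕ) : ℝ) := by
        intro ij hij
        have := mem_antidiagonal.1 hij
        simp only [hr]
        rw [show ij.1 + (ij.2 + 1) = n + 1 by omega]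
      rw [Finset.sum_congr rfl e, Finset.sum_const, Finset.Nat.card_antidiagonal, nsmul_eq_mul,
        mul_one_div]
      exact div_self_le_one _
  have e : pLrm = seqWeight r 0 := by
    refine eq_seqWeight (by simp [pLrm]) fun ns x => ?_
    simp only [pLrm, List.length_append, List.length_singleton, Finset.prod_range_succ, hr]
    congr 1
    · refine Finset.prod_congr rfl fun j hj => ?_
      have := Finset.mem_range.1 hj
      rw [List.take_append_of_le_length (by omega)]
    · rw [List.take_of_length_le (by simp), List.sum_append, List.sum_singleton]
  rw [e]
  exact h.optimalPointwise

end Hypersuccinct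

namespace Hypersuccinct

open OCover

/-! ### Full ordinal trees -/

theorem OTree.isFull_node {m : ℕ} {ts : List OTree} :
    (OTree.node ts).IsFull m ↔ (ts = [] ∨ ts.length = m) ∧ ∀ t ∈ ts, t.IsFull m := by
  have h : ∀ ts : List OTree, OTree.AllFull m ts ↔ ∀ t ∈ ts, t.IsFull m := by
    intro ts
    induction ts with
    | nil => simp [OTree.AllFull]
    | cons t ts ih => simp [OTree.AllFull, ih]
  rw [OTree.IsFull, h]

/-- The tree `x` with its leftmost leaf replaced by `y`. -/
def OTree.graft : OTree → OTree → OTree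
  | .node [], y => y
  | .node (t :: ts), y => .node (t.graft y :: ts)

theorem OTree.size_graft (x y : OTree) : (x.graft y).size + 1 = x.size + y.size := by
  induction x using OTree.induct with
  | h ts ih =>
    cases ts with
    | nil => simp [OTree.graft, OTree.size, OTree.sizeList]; omega
    | cons t ts =>
      have := ih t List.mem_cons_self
      simp only [OTree.graft, OTree.size, OTree.sizeList]
      omega

theorem OTree.IsFull.graft {m : ℕ} {x y : OTree} (hx : x.IsFull m) (hy : y.IsFull m) :
    (x.graft y).IsFull m := by
  induction x using OTree.induct with
  | h ts ih =>
    cases ts with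
    | nil => exact hy
    | cons t ts =>
      rw [OTree.isFull_node] at hx
      rw [OTree.graft, OTree.isFull_node]
      refine ⟨Or.inr (by simpa using hx.1), fun u hu => ?_⟩
      rcases List.mem_cons.1 hu with rfl | hu
      · exact ih t List.mem_cons_self (hx.2 t List.mem_cons_self)
      · exact hx.2 u (List.mem_cons_of_mem _ hu)

theorem OTree.graft_inj {x x' y y' : OTree} (hs : x.size = x'.size)
    (h : x.graft y = x'.graft y') : x = x' ∧ y = y' := by
  induction x using OTree.induct generalizing x' with
  | h ts ih =>
    obtain ⟨ts'⟩ := x'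
    cases ts with
    | nil =>
      cases ts' with
      | nil => exact ⟨rfl, h⟩
      | cons t' ts' =>
        have := one_le_size t'
        simp only [OTree.size, OTree.sizeList] at hs
        omega
    | cons t ts =>
      cases ts' with
      | nil =>
        have := one_le_size t
        simp only [OTree.size, OTree.sizeList] at hs
        omega
      | cons t' ts' =>
        simp only [OTree.graft, OTree.node.injEq, List.cons.injEq] at h
        obtain ⟨h1, rfl⟩ := h
        simp only [OTree.size, OTree.sizeList] at hs
        obtain ⟨rfl, rfl⟩ := ih t List.mem_cons_self (by omega) h1
        exact ⟨rfl, rfl⟩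

open Classical in
/-- The full `m`-ary trees with `k` nodes besides the root. -/
noncomputable def fullOfSize (m k : ℕ) : Finset OTree :=
  (finite_size_eq (k + 1)).toFinset.filter (OTree.IsFull m)

theorem mem_fullOfSize {m k : ℕ} {t : OTree} :
    t ∈ fullOfSize m k ↔ t.size = k + 1 ∧ t.IsFull m := by
  simp [fullOfSize]

theorem card_fullOfSize_mul_le (m i j : ℕ) :
    (fullOfSize m i).card * (fullOfSize m j).card ≤ (fullOfSize m (i + j)).card := by
  rw [← Finset.card_product]
  refine Finset.card_le_card_of_injOn (fun x => x.1.graft x.2) (fun x hx => ?_) fun x hx y hy h => ?_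
  · have hx' := Finset.mem_product.1 hx
    obtain ⟨h1, h2⟩ := mem_fullOfSize.1 hx'.1
    obtain ⟨h3, h4⟩ := mem_fullOfSize.1 hx'.2
    have := OTree.size_graft x.1 x.2
    exact mem_fullOfSize.2 ⟨show (x.1.graft x.2).size = _ by omega, h2.graft h4⟩
  · have h1 := mem_fullOfSize.1 (Finset.mem_product.1 hx).1
    have h2 := mem_fullOfSize.1 (Finset.mem_product.1 hy).1
    obtain ⟨h3, h4⟩ := OTree.graft_inj (h1.1.trans h2.1.symm) h
    exact Prod.ext h3 h4

theorem one_le_card_fullOfSize_mul (m q : ℕ) : 1 ≤ (fullOfSize m (m * q)).card := by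
  induction q with
  | zero =>
    refine Finset.card_pos.2 ⟨.node [], mem_fullOfSize.2 ⟨by simp [OTree.size, OTree.sizeList], ?_⟩⟩
    simp [OTree.isFull_node]
  | succ q ih =>
    have h : 1 ≤ (fullOfSize m m).card := by
      refine Finset.card_pos.2 ⟨.node (List.replicate m (.node [])), mem_fullOfSize.2 ⟨?_, ?_⟩⟩
      · simp [OTree.size, sizeList_eq, OTree.sizeList, add_comm]
      · rw [OTree.isFull_node]
        refine ⟨Or.inr (by simp), fun t ht => ?_⟩
        rw [List.eq_of_mem_replicate ht]
        simp [OTree.isFull_node]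
    exact (Nat.mul_le_mul ih h).trans (card_fullOfSize_mul_le m _ _)

theorem prod_card_fullOfSize_le (m : ℕ) {α : Type} (l : List α) (f : α → ℕ) (q : ℕ) :
    (l.map fun a => (fullOfSize m (f a)).card).prod ≤
      (fullOfSize m ((l.map f).sum + m * q)).card := by
  induction l with
  | nil => simpa using one_le_card_fullOfSize_mul m q
  | cons a l ih =>
    simp only [List.map_cons, List.prod_cons, List.sum_cons, add_assoc]
    exact (Nat.mul_le_mul_left _ ih).trans (card_fullOfSize_mul_le m _ _)

theorem uniformOn_fullOrdinalTrees {m : ℕ} {t : OTree} (ht : t ∈ fullOrdinalTrees m) :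
    uniformOn (fullOrdinalTrees m) OTree.size t = 1 / (fullOfSize m (t.size - 1)).card := by
  have h : {s | s ∈ fullOrdinalTrees m ∧ s.size = t.size} = ↑(fullOfSize m (t.size - 1)) := by
    ext s
    have := one_le_size t
    rw [Finset.mem_coe, mem_fullOfSize, Nat.sub_add_cancel this]
    exact and_comm
  rw [uniformOn, if_pos ht, h, Set.ncard_coe_finset]

/-! ### Filling the portals of components -/

namespace OCover

/-- Induction on well-formed components, where the components that a portal leads to are given by
their lists of items. -/
@[elab_as_elim]
theorem wf_induct {P : OCover → Prop} (hn : ∀ ps, (∀ p ∈ ps, P p) → P (.node ps))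
    (hp : ∀ gs : List (List OCover), gs ≠ [] → (∀ p ∈ gs.flatten, P p) → P (.portal (gs.map .node)))
    {x : OCover} (hx : x.WF) : P x := by
  suffices h : P x ∧ ∀ p ∈ x.items, P p from h.1
  induction x using OCover.induct with
  | hn ps ih =>
    have h : ∀ p ∈ ps, P p := fun p h => (ih p h (wfList_iff.1 hx p h)).1
    exact ⟨hn ps h, h⟩
  | hp cs ih =>
    refine ⟨?_, by simp [items]⟩
    obtain ⟨⟨h1, h2⟩, h3⟩ := hx
    have e : cs = (cs.map items).map node := by
      rw [List.map_map]
      refine ((List.map_congr_left fun c hc => ?_).trans (List.map_id cs)).symm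
      have := h2 c hc
      cases c with
      | node ps => rfl
      | portal _ => simp [isNode] at this
    rw [e]
    refine hp _ (by simpa using h1) fun p hp => ?_
    rw [List.mem_flatten] at hp
    obtain ⟨_, hg, hp⟩ := hp
    obtain ⟨c, hc, rfl⟩ := List.mem_map.1 hg
    exact (ih c hc (wfList_iff.1 h3 c hc)).2 p hp

/-- The items of all components below. -/
def inner (x : OCover) : List OCover :=
  x.lower.flatMap items

theorem perm_inner_portal (gs : List (List OCover)) :
    (inner (.portal (gs.map node))).Perm (gs.flatten.flatMap fun p => p :: p.inner) := by
  have hl : ∀ g : List OCover, (g ++ (lowerList g).flatMap items).Perm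
      (g.flatMap fun p => p :: p.inner) := by
    intro g
    induction g with
    | nil => simp [lowerList]
    | cons p g ih =>
      rw [lowerList, List.flatMap_append, List.flatMap_cons, List.cons_append, List.cons_append]
      refine List.Perm.cons p ?_
      change (g ++ (p.inner ++ _)).Perm _
      rw [← List.append_assoc]
      refine (List.perm_append_comm.append_right _).trans ?_
      rw [List.append_assoc]
      exact ih.append_left _
  simp only [inner, lower] at *
  induction gs with
  | nil => simp [group]
  | cons g gs ih =>
    rw [List.map_cons, group, List.flatten_cons, List.flatMap_append, List.flatMap_append]
    exact (hl g).append ih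

theorem inner_node (ps : List OCover) : inner (.node ps) = ps.flatMap inner := by
  simp only [inner, lower]
  induction ps with
  | nil => simp [lowerList]
  | cons p ps ih => rw [lowerList, List.flatMap_append, ih]; rfl

theorem mem_inner_portal {gs : List (List OCover)} {p : OCover} :
    p ∈ inner (.portal (gs.map node)) ↔ ∃ q ∈ gs.flatten, p = q ∨ p ∈ q.inner := by
  rw [(perm_inner_portal gs).mem_iff, List.mem_flatMap]
  simp only [List.mem_cons]

theorem sum_inner_portal {M : Type} [AddCommMonoid M] (gs : List (List OCover)) (f : OCover → M) :
    ((inner (.portal (gs.map node))).map f).sum =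
      (gs.flatten.map fun p => f p + (p.inner.map f).sum).sum := by
  rw [((perm_inner_portal gs).map f).sum_eq]
  induction gs.flatten with
  | nil => simp
  | cons p l ih => simp only [List.flatMap_cons, List.map_append, List.sum_append, List.map_cons,
      List.sum_cons, ih]

theorem sum_inner_node {M : Type} [AddCommMonoid M] (ps : List OCover) (f : OCover → M) :
    ((inner (.node ps)).map f).sum = (ps.map fun p => (p.inner.map f).sum).sum := by
  rw [inner_node]
  induction ps with
  | nil => simp
  | cons p l ih => simp only [List.flatMap_cons, List.map_append, List.sum_append, List.map_cons,
      List.sum_cons, ih]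

mutual
/-- The tree obtained from a component by making every portal a leaf. -/
def plug : OCover → OTree
  | .node ps => .node (plugList ps)
  | .portal _ => .node []
def plugList : List OCover → List OTree
  | [] => []
  | p :: ps => p.plug :: plugList ps
end

theorem plugList_eq (ps : List OCover) : plugList ps = ps.map plug := by
  induction ps with
  | nil => simp [plugList]
  | cons p ps ih => simp [plugList, ih]

mutual
/-- A component without the components that its portals lead to. -/
def strip : OCover → OCover
  | .node ps => .node (stripList ps)
  | .portal _ => .portal []
def stripList : List OCover → List OCover
  | [] => []
  | p :: ps => p.strip :: stripList ps
end

theorem stripList_eq (ps : List OCover) : stripList ps = ps.map strip := by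
  induction ps with
  | nil => simp [stripList]
  | cons p ps ih => simp [stripList, ih]

mutual
/-- The probability of a component if every node is a portal with probability `ε`. -/
noncomputable def weight (ε : ℝ) : OCover → ℝ
  | .node ps => (1 - ε) * weightList ε ps
  | .portal _ => ε
noncomputable def weightList (ε : ℝ) : List OCover → ℝ
  | [] => 1
  | p :: ps => p.weight ε * weightList ε ps
end

theorem weightList_eq (ε : ℝ) (ps : List OCover) : weightList ε ps = (ps.map (weight ε)).prod := by
  induction ps with
  | nil => simp [weightList]
  | cons p ps ih => simp [weightList, ih]

theorem shapesList_eq (ps : List OCover) : shapesList ps = ps.flatMap shapes := by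
  induction ps with
  | nil => simp [shapesList]
  | cons p ps ih => simp [shapesList, ih]

theorem strip_strip (x : OCover) : x.strip.strip = x.strip := by
  induction x using OCover.induct with
  | hn ps ih => simpa [strip, stripList_eq] using ih
  | hp cs _ => simp [strip]

theorem plug_strip (x : OCover) : x.strip.plug = x.plug := by
  induction x using OCover.induct with
  | hn ps ih => simpa [strip, stripList_eq, plug, plugList_eq] using ih
  | hp cs _ => simp [strip, plug]

theorem weight_strip (ε : ℝ) (x : OCover) : x.strip.weight ε = x.weight ε := by
  induction x using OCover.induct with
  | hn ps ih =>
    rw [strip, weight, weight, weightList_eq, weightList_eq, stripList_eq, List.map_map]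
    congr 2
    exact List.map_congr_left ih
  | hp cs _ => simp [strip, weight]

theorem shapes_strip (x : OCover) : x.strip.shapes = x.shapes := by
  induction x using OCover.induct with
  | hn ps ih =>
    rw [strip, shapes, shapes, shapesList_eq, shapesList_eq, stripList_eq, List.flatMap_map]
    congr 2
    rw [List.flatMap_def, List.flatMap_def, List.map_congr_left ih]
  | hp cs _ => simp [strip, shapes]

theorem weight_pos {ε : ℝ} (h0 : 0 < ε) (h1 : ε < 1) (x : OCover) : 0 < x.weight ε := by
  induction x using OCover.induct with
  | hn ps ih =>
    rw [weight, weightList_eq]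
    refine mul_pos (by linarith) (List.prod_pos fun y hy => ?_)
    obtain ⟨p, hp, rfl⟩ := List.mem_map.1 hy
    exact ih p hp
  | hp cs _ => exact h0

end OCover

/-- If the candidates for each entry have total weight at most one, then the candidates for the
list have total weight at most one. -/
theorem sum_prod_le_one_of_forall₂ {α β : Type} [Inhabited α] {V : α → β → Prop} {w : α → ℝ}
    (hw : ∀ a, 0 ≤ w a) (xs : List β)
    (h : ∀ x ∈ xs, ∀ F : Finset α, (∀ a ∈ F, V a x) → ∑ a ∈ F, w a ≤ 1) (G : Finset (List α))
    (hG : ∀ l ∈ G, List.Forall₂ V l xs) : ∑ l ∈ G, (l.map w).prod ≤ 1 := by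
  classical
  have hnn : ∀ l : List α, 0 ≤ (l.map w).prod := fun l =>
    List.prod_nonneg fun x hx => by obtain ⟨a, _, rfl⟩ := List.mem_map.1 hx; exact hw a
  induction xs generalizing G with
  | nil =>
    refine (Finset.sum_le_sum_of_subset_of_nonneg (t := {[]}) (fun l hl => ?_)
      fun l _ _ => hnn l).trans (by simp)
    exact Finset.mem_singleton.2 (List.forall₂_nil_right_iff.1 (hG l hl))
  | cons x xs ih =>
    have hcons : ∀ l ∈ G, l = l.headI :: l.tail ∧ V l.headI x ∧ List.Forall₂ V l.tail xs := by
      intro l hl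
      obtain ⟨a, l', h1, h2, rfl⟩ := List.forall₂_cons_right_iff.1 (hG l hl)
      exact ⟨rfl, h1, h2⟩
    calc ∑ l ∈ G, (l.map w).prod
        = ∑ l ∈ G, (fun y : α × List α => w y.1 * (y.2.map w).prod) (l.headI, l.tail) := by
          refine Finset.sum_congr rfl fun l hl => ?_
          rw [(hcons l hl).1]
          simp
      _ = ∑ y ∈ G.image fun l => (l.headI, l.tail), w y.1 * (y.2.map w).prod := by
          rw [Finset.sum_image]
          intro l hl l' hl' e
          rw [(hcons l hl).1, (hcons l' hl').1, (Prod.mk.inj e).1, (Prod.mk.inj e).2]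
      _ ≤ ∑ y ∈ G.image List.headI ×ˢ G.image List.tail, w y.1 * (y.2.map w).prod := by
          refine Finset.sum_le_sum_of_subset_of_nonneg (fun y hy => ?_)
            fun y _ _ => mul_nonneg (hw _) (hnn _)
          obtain ⟨l, hl, rfl⟩ := Finset.mem_image.1 hy
          exact Finset.mem_product.2
            ⟨Finset.mem_image_of_mem _ hl, Finset.mem_image_of_mem _ hl⟩
      _ = (∑ a ∈ G.image List.headI, w a) * ∑ l ∈ G.image List.tail, (l.map w).prod := by
          rw [Finset.sum_mul_sum, Finset.sum_product]
      _ ≤ 1 * 1 := by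
          refine mul_le_mul (h x List.mem_cons_self _ fun a ha => ?_)
            (ih (fun y hy => h y (List.mem_cons_of_mem _ hy)) _ fun l hl => ?_)
            (Finset.sum_nonneg fun l _ => hnn l) zero_le_one
          · obtain ⟨l, hl, rfl⟩ := Finset.mem_image.1 ha
            exact (hcons l hl).2.1
          · obtain ⟨l', hl', rfl⟩ := Finset.mem_image.1 hl
            exact (hcons l' hl').2.2
      _ = 1 := one_mul 1

instance : Inhabited OCover := ⟨.portal []⟩

/-- The ways of making some leaves of a tree portals have total probability at most one. -/
theorem sum_weight_le_one {ε : ℝ} (h0 : 0 < ε) (h1 : ε < 1) (x : OTree) (F : Finset OCover)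
    (hF : ∀ p ∈ F, p.strip = p ∧ p.plug = x) : ∑ p ∈ F, p.weight ε ≤ 1 := by
  classical
  induction x using OTree.induct generalizing F with
  | h ts ih =>
    rw [← Finset.sum_filter_add_sum_filter_not F fun p => p.isNode = true]
    have hnode : ∀ p ∈ F.filter fun p => p.isNode = true, p = .node p.items ∧
        List.Forall₂ (fun q t => q.strip = q ∧ q.plug = t) p.items ts := by
      intro p hp
      obtain ⟨hp, hn⟩ := Finset.mem_filter.1 hp
      obtain ⟨hs, hx⟩ := hF p hp
      cases p with
      | portal _ => simp [isNode] at hn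
      | node ps =>
        refine ⟨rfl, ?_⟩
        rw [strip, stripList_eq, OCover.node.injEq] at hs
        rw [plug, plugList_eq, OTree.node.injEq] at hx
        rw [items, ← hx, List.forall₂_map_right_iff, List.forall₂_same]
        refine fun q hq => ⟨?_, rfl⟩
        exact List.map_inj_left.1 (hs.trans (List.map_id ps).symm) q hq
    have hA : ∑ p ∈ F.filter (fun p => p.isNode = true), p.weight ε ≤ 1 - ε := by
      have hl := sum_prod_le_one_of_forall₂ (w := weight ε) (fun p => (weight_pos h0 h1 p).le) ts ih
        ((F.filter fun p => p.isNode = true).image items) (by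
          intro l hl
          obtain ⟨p, hp, rfl⟩ := Finset.mem_image.1 hl
          exact (hnode p hp).2)
      rw [Finset.sum_image (by
        intro p hp q hq e
        rw [(hnode p hp).1, (hnode q hq).1, e])] at hl
      calc _ = ∑ p ∈ F.filter (fun p => p.isNode = true), (1 - ε) * (p.items.map (weight ε)).prod := by
            refine Finset.sum_congr rfl fun p hp => ?_
            conv_lhs => rw [(hnode p hp).1]
            rw [weight, weightList_eq]
        _ = (1 - ε) * ∑ p ∈ F.filter (fun p => p.isNode = true), (p.items.map (weight ε)).prod := by
            rw [Finset.mul_sum]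
        _ ≤ (1 - ε) * 1 := mul_le_mul_of_nonneg_left hl (by linarith)
        _ = _ := mul_one _
    have hC : ∑ p ∈ F.filter (fun p => ¬ p.isNode = true), p.weight ε ≤ ε := by
      refine (Finset.sum_le_sum_of_subset_of_nonneg (t := {.portal []}) (fun p hp => ?_)
        fun p _ _ => (weight_pos h0 h1 p).le).trans (by simp [weight])
      obtain ⟨hp, hn⟩ := Finset.mem_filter.1 hp
      have := (hF p hp).1
      cases p with
      | node ps => simp [isNode] at hn
      | portal _ => rw [Finset.mem_singleton, ← this, strip]
    linarith

end Hypersuccinct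

namespace Hypersuccinct

open OCover

namespace OCover

theorem isFull_plug_node {m : ℕ} {ps : List OCover} :
    (plug (.node ps)).IsFull m ↔
      (ps = [] ∨ ps.length = m) ∧ ∀ p ∈ ps, p.plug.IsFull m := by
  rw [plug, plugList_eq, OTree.isFull_node]
  simp

theorem isFull_toTree_node {m : ℕ} {ps : List OCover} :
    (toTree (.node ps)).IsFull m ↔
      (ps = [] ∨ ps.length = m) ∧ ∀ p ∈ ps, p.toTree.IsFull m := by
  rw [toTree, toTreeList_eq, OTree.isFull_node]
  simp

theorem isFull_toTree_portal {m : ℕ} {gs : List (List OCover)} :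
    (toTree (.portal (gs.map node))).IsFull m ↔
      (gs.flatten = [] ∨ gs.flatten.length = m) ∧ ∀ p ∈ gs.flatten, p.toTree.IsFull m := by
  rw [toTree, childrenList_map_node, OTree.isFull_node]
  simp only [List.map_eq_nil_iff, List.length_map, List.forall_mem_map]

/-- The components of a full tree, with their portals made leaves, are full below their roots. -/
theorem isFull_plug {m : ℕ} {x : OCover} (hx : x.WF) (h : x.toTree.IsFull m) :
    x.plug.IsFull m ∧ ∀ p ∈ x.inner, p.plug.IsFull m := by
  revert h
  refine wf_induct ?_ ?_ hx
  · intro ps ih h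
    rw [isFull_toTree_node] at h
    rw [isFull_plug_node, inner_node]
    refine ⟨⟨h.1, fun p hp => (ih p hp (h.2 p hp)).1⟩, fun p hp => ?_⟩
    obtain ⟨q, hq, hp⟩ := List.mem_flatMap.1 hp
    exact (ih q hq (h.2 q hq)).2 p hp
  · intro gs _ ih h
    rw [isFull_toTree_portal] at h
    refine ⟨by simp [plug, OTree.isFull_node], fun p hp => ?_⟩
    obtain ⟨q, hq, hp⟩ := mem_inner_portal.1 hp
    rcases hp with rfl | hp
    · exact (ih p hq (h.2 p hq)).1
    · exact (ih q hq (h.2 q hq)).2 p hp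

theorem length_items_le {m : ℕ} {x : OCover} (hx : x.WF) (h : x.toTree.IsFull m) :
    ∀ d ∈ x.lower, d.items.length ≤ m := by
  revert h
  refine wf_induct ?_ ?_ hx
  · intro ps ih h d hd
    rw [isFull_toTree_node] at h
    rw [lower, mem_lowerList] at hd
    obtain ⟨p, hp, hd⟩ := hd
    exact ih p hp (h.2 p hp) d hd
  · intro gs _ ih h d hd
    rw [isFull_toTree_portal] at h
    rw [lower, mem_group] at hd
    obtain ⟨c, hc, hd⟩ := hd
    obtain ⟨g, hg, rfl⟩ := List.mem_map.1 hc
    have hle : g.length ≤ gs.flatten.length := (List.sublist_flatten_of_mem hg).length_le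
    rcases hd with rfl | hd
    · rw [items]
      rcases h.1 with h1 | h1
      · rw [h1] at hle; simp only [List.length_nil] at hle; omega
      · omega
    · rw [lower, mem_lowerList] at hd
      obtain ⟨p, hp, hd⟩ := hd
      have hp' : p ∈ gs.flatten := List.mem_flatten.2 ⟨g, hg, hp⟩
      exact ih p hp' (h.2 p hp') d hd

theorem size_plug_le {m : ℕ} {p : OCover} (hp : p.plug.IsFull m) :
    p.plug.size ≤ 1 + m * p.localSize := by
  induction p using OCover.induct with
  | hn ps ih =>
    rw [isFull_plug_node] at hp
    rw [plug, plugList_eq, OTree.size, sizeList_eq, localSize, localSizeList_eq, List.map_map]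
    have h : ∀ l : List OCover, (∀ p ∈ l, p.plug.size ≤ 1 + m * p.localSize) →
        (l.map (OTree.size ∘ plug)).sum ≤ l.length + m * (l.map localSize).sum := by
      intro l hl
      induction l with
      | nil => simp
      | cons p l ih =>
        have h1 := hl p List.mem_cons_self
        have h2 := ih fun q hq => hl q (List.mem_cons_of_mem _ hq)
        simp only [List.map_cons, List.sum_cons, List.length_cons, Function.comp_apply, Nat.mul_add]
        omega
    have h1 := h ps fun p h => ih p h (hp.2 p h)
    have h2 : ps.length ≤ m := by
      rcases hp.1 with h | h
      · simp [h]
      · omega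
    rw [Nat.mul_add]
    omega
  | hp cs _ => simp [plug, OTree.size, OTree.sizeList]

/-- The components of a full tree have the right number of nodes in total, up to a multiple
of `m`. -/
theorem sum_size_plug {m : ℕ} {x : OCover} (hx : x.WF) (h : x.toTree.IsFull m) :
    ∃ q, x.plug.size + (x.inner.map fun p => p.plug.size - 1).sum + m * q = x.toTree.size := by
  have hl : ∀ l : List OCover, (∀ p ∈ l, ∃ q, p.plug.size +
      (p.inner.map fun p => p.plug.size - 1).sum + m * q = p.toTree.size) →
      ∃ q, (l.map fun p => p.plug.size + (p.inner.map fun p => p.plug.size - 1).sum).sum + m * q =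
        (l.map fun p => p.toTree.size).sum := by
    intro l hl
    induction l with
    | nil => exact ⟨0, by simp⟩
    | cons p l ih =>
      obtain ⟨q1, h1⟩ := hl p List.mem_cons_self
      obtain ⟨q2, h2⟩ := ih fun q hq => hl q (List.mem_cons_of_mem _ hq)
      refine ⟨q1 + q2, ?_⟩
      simp only [List.map_cons, List.sum_cons, Nat.mul_add]
      omega
  revert h
  refine wf_induct ?_ ?_ hx
  · intro ps ih h
    rw [isFull_toTree_node] at h
    obtain ⟨q, hq⟩ := hl ps fun p hp => ih p hp (h.2 p hp)
    refine ⟨q, ?_⟩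
    rw [sum_inner_node, plug, plugList_eq, toTree, toTreeList_eq, OTree.size, OTree.size,
      sizeList_eq, sizeList_eq, List.map_map, List.map_map]
    rw [List.sum_map_add] at hq
    simp only [Function.comp_def]
    omega
  · intro gs _ ih h
    rw [isFull_toTree_portal] at h
    obtain ⟨q, hq⟩ := hl gs.flatten fun p hp => ih p hp (h.2 p hp)
    have hsub : (gs.flatten.map fun p => p.plug.size +
        (p.inner.map fun p => p.plug.size - 1).sum).sum =
        (gs.flatten.map fun p => p.plug.size - 1 +
          (p.inner.map fun p => p.plug.size - 1).sum).sum + gs.flatten.length := by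
      induction gs.flatten with
      | nil => simp
      | cons p l ih =>
        have := one_le_size p.plug
        simp only [List.map_cons, List.sum_cons, List.length_cons, ih]
        omega
    rw [sum_inner_portal, plug, toTree, childrenList_map_node, OTree.size, OTree.size,
      sizeList_eq, sizeList_eq, List.map_map]
    simp only [List.map_nil, List.sum_nil, Function.comp_def]
    rcases h.1 with h1 | h1
    · refine ⟨q, ?_⟩
      rw [h1] at hq hsub ⊢
      simp only [List.map_nil, List.sum_nil, List.length_nil] at hq hsub ⊢
      omega
    · refine ⟨q + 1, ?_⟩
      rw [Nat.mul_add]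
      omega

theorem logb_weight_node {ε : ℝ} (h0 : 0 < ε) (h1 : ε < 1) (ps : List OCover) :
    Real.logb 2 (1 / weight ε (.node ps)) =
      Real.logb 2 (1 / (1 - ε)) + (ps.map fun p => Real.logb 2 (1 / weight ε p)).sum := by
  rw [weight, weightList_eq, logb_list_prod_inv ps _ fun p _ => weight_pos h0 h1 p,
    ← one_div_mul_one_div, Real.logb_mul]
  · have : 0 < 1 - ε := by linarith
    positivity
  · have : 0 < (ps.map (weight ε)).prod := List.prod_pos fun y hy => by
      obtain ⟨p, _, rfl⟩ := List.mem_map.1 hy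
      exact weight_pos h0 h1 p
    positivity

/-- The information content of the positions of the portals. -/
theorem sum_logb_weight_le {ε : ℝ} (h0 : 0 < ε) (h1 : ε < 1) {x : OCover} (hx : x.WF) :
    Real.logb 2 (1 / x.weight ε) + (x.inner.map fun p =>
      if p.isNode = true then Real.logb 2 (1 / p.weight ε) else 0).sum ≤
      x.toTree.size * Real.logb 2 (1 / (1 - ε)) + x.lower.length * Real.logb 2 (1 / ε) := by
  set a := Real.logb 2 (1 / (1 - ε)) with ha
  set b := Real.logb 2 (1 / ε) with hb
  set f : OCover → ℝ := fun p => if p.isNode = true then Real.logb 2 (1 / p.weight ε) else 0 with hf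
  have ha0 : 0 ≤ a := Real.logb_nonneg (by norm_num)
    (by rw [le_div_iff₀ (by linarith)]; linarith)
  have hb0 : 0 ≤ b := Real.logb_nonneg (by norm_num) (by rw [le_div_iff₀ h0]; linarith)
  have hl : ∀ l : List OCover, (∀ p ∈ l, Real.logb 2 (1 / p.weight ε) + (p.inner.map f).sum ≤
      p.toTree.size * a + p.lower.length * b) →
      (l.map fun p => Real.logb 2 (1 / p.weight ε)).sum + (l.map fun p => (p.inner.map f).sum).sum ≤
        ((l.map fun p => p.toTree.size).sum : ℕ) * a + (lowerList l).length * b := by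
    intro l hl
    induction l with
    | nil => simp [lowerList]
    | cons p l ih =>
      have h1 := hl p List.mem_cons_self
      have h2 := ih fun q hq => hl q (List.mem_cons_of_mem _ hq)
      simp only [List.map_cons, List.sum_cons, lowerList, List.length_append]
      push_cast at h2 ⊢
      linarith
  refine wf_induct ?_ ?_ hx
  · intro ps ih
    have h := hl ps ih
    rw [sum_inner_node, logb_weight_node h0 h1, toTree, toTreeList_eq, OTree.size, sizeList_eq,
      List.map_map, lower]
    simp only [Function.comp_def]
    push_cast at h ⊢
    linarith
  · intro gs hgs ih
    have h := hl gs.flatten ih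
    have hfle : (gs.flatten.map f).sum ≤
        (gs.flatten.map fun p => Real.logb 2 (1 / p.weight ε)).sum := by
      refine List.sum_le_sum fun p _ => ?_
      rw [hf]
      dsimp only
      split_ifs with hp
      · rfl
      · cases p with
        | node ps => simp [isNode] at hp
        | portal _ => exact hb0
    have hlen : (1 : ℝ) ≤ gs.length := by
      exact_mod_cast List.length_pos_iff.2 hgs
    rw [sum_inner_portal, List.sum_map_add, weight, toTree, childrenList_map_node, OTree.size,
      sizeList_eq, List.map_map, lower, length_group_map_node]
    simp only [Function.comp_def]
    push_cast at h ⊢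
    nlinarith [mul_le_mul_of_nonneg_right hlen hb0]

end OCover

/-! ### Full `m`-ary trees -/

/-- The weight of an item: the portals are chosen at random, and the tree obtained by filling them
is uniform among the full `m`-ary trees of its size; the sizes up to `Q` are equally likely. -/
noncomputable def itemWeight (m : ℕ) (Q ε : ℝ) (p : OCover) : ℝ :=
  p.weight ε / ((fullOfSize m (p.plug.size - 1)).card * Q)

theorem one_le_card_of_isFull {m : ℕ} {x : OTree} (hx : x.IsFull m) :
    1 ≤ (fullOfSize m (x.size - 1)).card :=
  Finset.card_pos.2 ⟨x, mem_fullOfSize.2 ⟨by have := one_le_size x; omega, hx⟩⟩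

theorem itemWeight_nonneg {m : ℕ} {Q : ℕ} {ε : ℝ} (h0 : 0 < ε) (h1 : ε < 1) (p : OCover) :
    0 ≤ itemWeight m Q ε p :=
  div_nonneg (weight_pos h0 h1 p).le (by positivity)

theorem sum_itemWeight_le_one {m Q : ℕ} {ε : ℝ} (hQ : 1 ≤ Q) (h0 : 0 < ε) (h1 : ε < 1)
    (F : Finset OCover) (hF : ∀ p ∈ F, p.strip = p ∧ p.plug.IsFull m ∧ p.plug.size ≤ Q) :
    ∑ p ∈ F, itemWeight m Q ε p ≤ 1 := by
  classical
  have hQ0 : (0 : ℝ) < Q := by exact_mod_cast hQ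
  have hmaps : ∀ p ∈ F, p.plug.size - 1 ∈ Finset.range Q := fun p hp => by
    have h2 := one_le_size p.plug
    have h3 := (hF p hp).2.2
    exact Finset.mem_range.2 (by omega)
  rw [← Finset.sum_fiberwise_of_maps_to hmaps]
  refine (Finset.sum_le_sum (g := fun _ => 1 / (Q : ℝ)) fun k _ => ?_).trans (by
    rw [Finset.sum_const, Finset.card_range, nsmul_eq_mul, mul_one_div, div_self hQ0.ne'])
  set Fk := F.filter fun p => p.plug.size - 1 = k with hFk
  have hmaps' : ∀ p ∈ Fk, p.plug ∈ fullOfSize m k := fun p hp => by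
    obtain ⟨hp, hk⟩ := Finset.mem_filter.1 hp
    have h2 := one_le_size p.plug
    exact mem_fullOfSize.2 ⟨by omega, (hF p hp).2.1⟩
  have hsum : ∑ p ∈ Fk, p.weight ε ≤ (fullOfSize m k).card := by
    rw [← Finset.sum_fiberwise_of_maps_to hmaps']
    refine (Finset.sum_le_sum (g := fun _ => (1 : ℝ)) fun x _ => ?_).trans (by simp)
    refine sum_weight_le_one h0 h1 x _ fun p hp => ?_
    obtain ⟨hp, hx⟩ := Finset.mem_filter.1 hp
    exact ⟨(hF p (Finset.mem_filter.1 hp).1).1, hx⟩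
  calc ∑ p ∈ Fk, itemWeight m Q ε p = ∑ p ∈ Fk, p.weight ε / ((fullOfSize m k).card * Q) := by
        refine Finset.sum_congr rfl fun p hp => ?_
        rw [itemWeight, (Finset.mem_filter.1 hp).2]
    _ = (∑ p ∈ Fk, p.weight ε) / ((fullOfSize m k).card * Q) := by rw [Finset.sum_div]
    _ ≤ (fullOfSize m k).card / ((fullOfSize m k).card * Q) :=
        div_le_div_of_nonneg_right hsum (by positivity)
    _ ≤ 1 / Q := by
        rw [← div_div]
        exact div_le_div_of_nonneg_right (div_self_le_one _) hQ0.le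

theorem sum_prod_itemWeight_le {m Q : ℕ} {ε : ℝ} (hQ : 1 ≤ Q) (h0 : 0 < ε) (h1 : ε < 1)
    (G : Finset (List OCover)) (hlen : ∀ l ∈ G, l.length ≤ m)
    (hG : ∀ l ∈ G, ∀ p ∈ l, p.strip = p ∧ p.plug.IsFull m ∧ p.plug.size ≤ Q) :
    ∑ l ∈ G, (l.map (itemWeight m Q ε)).prod ≤ m + 1 := by
  classical
  have hmaps : ∀ l ∈ G, l.length ∈ Finset.range (m + 1) := fun l hl =>
    Finset.mem_range.2 (Nat.lt_succ_of_le (hlen l hl))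
  rw [← Finset.sum_fiberwise_of_maps_to hmaps]
  refine (Finset.sum_le_sum (g := fun _ => (1 : ℝ)) fun k _ => ?_).trans (by simp)
  refine sum_prod_le_one_of_forall₂
    (V := fun p (_ : Unit) => p.strip = p ∧ p.plug.IsFull m ∧ p.plug.size ≤ Q)
    (fun p => itemWeight_nonneg h0 h1 p) (List.replicate k ())
    (fun _ _ F hF => sum_itemWeight_le_one hQ h0 h1 F hF) _ fun l hl => ?_
  obtain ⟨hlG, rfl⟩ := Finset.mem_filter.1 hl
  rw [List.forall₂_iff_zip]
  refine ⟨by simp, fun {p u} hpu => hG l hlG p (List.of_mem_zip hpu).1⟩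

/-- The data from which a micro tree is drawn: the stripped subtrees at the children of its root. -/
def OCover.rootItems (d : OCover) : List OCover :=
  (d.items.filter OCover.isNode).map OCover.strip

theorem node_shapesList_rootItems {d : OCover} (hd : d.isNode = true) :
    OTree.node (shapesList d.rootItems) = d.shape := by
  cases d with
  | portal _ => simp [isNode] at hd
  | node ps =>
    rw [shape, rootItems, items, shapesList_eq, shapesList_eq, List.flatMap_map]
    congr 1
    induction ps with
    | nil => simp
    | cons p ps ih =>
      rw [List.filter_cons, List.flatMap_cons]
      cases p with
      | portal _ => simpa [isNode, shapes] using ih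
      | node qs =>
        rw [if_pos (by rfl), List.flatMap_cons, shapes_strip, ih rfl]

theorem sum_rootItems (l : List OCover) (f : OCover → ℝ) (hf : ∀ p, f p.strip = f p) :
    (l.map fun d => (d.rootItems.map f).sum).sum =
      ((l.flatMap items).map fun p => if p.isNode = true then f p else 0).sum := by
  have h : ∀ ps : List OCover, (((ps.filter isNode).map strip).map f).sum =
      (ps.map fun p => if p.isNode = true then f p else 0).sum := by
    intro ps
    induction ps with
    | nil => simp
    | cons p ps ih =>
      rw [List.filter_cons, List.map_cons, List.sum_cons]
      split_ifs with hp
      · rw [List.map_cons, List.map_cons, List.sum_cons, ih, hf]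
      · rw [ih, zero_add]
  induction l with
  | nil => simp
  | cons d l ih =>
    rw [List.map_cons, List.sum_cons, List.flatMap_cons, List.map_append, List.sum_append, ih,
      rootItems, h]

theorem length_hyperOrdinal_le_full {m : ℕ} (hm : 1 ≤ m) {t : OTree} (ht : t.IsFull m) :
    ((hyperOrdinal t).length : ℝ) ≤ Real.logb 2 (fullOfSize m (t.size - 1)).card +
      t.size * (2 / blockParam t.size +
        8 * (Real.logb 2 (1 * ((blockParam t.size : ℝ) + 1) ^ 1) / (blockParam t.size : ℝ) ^ (1 : ℝ)) +
        8 * m * (Real.logb 2 (2 * m * ((blockParam t.size : ℝ) + 1) ^ 1) /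
          (blockParam t.size : ℝ) ^ (1 : ℝ)) +
        (8 * (Real.logb 2 (m + 1) + 3) / blockParam t.size + errorRate (blockParam t.size))) +
      2002 := by
  classical
  set B := blockParam t.size with hBdef
  have hB : 1 ≤ B := one_le_blockParam t.size
  have hB0 : (0 : ℝ) < B := by exact_mod_cast hB
  have hm0 : (0 : ℝ) < m := by exact_mod_cast hm
  set ε : ℝ := 1 / ((B : ℝ) + 1) with hε
  have h0 : 0 < ε := by positivity
  have h1 : ε < 1 := by rw [hε, div_lt_one (by positivity)]; linarith
  set x := OCover.portal (coverOrdinal B t).1 with hx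
  have hwf : x.WF := wf_coverOrdinal B t
  have htree : x.toTree = t := toTree_coverOrdinal B t
  have hfull : x.toTree.IsFull m := htree ▸ ht
  have hlower : x.lower = group (coverOrdinal B t).1 := by rw [hx, lower]
  set Q := 2 * B * m with hQdef
  have hQ : 1 ≤ Q := Nat.mul_pos (by omega) hm
  have hQ0 : (0 : ℝ) < Q := by exact_mod_cast hQ
  have hlen : B * x.lower.length ≤ 8 * t.size :=
    hlower ▸ mul_length_group_le (blockParam_le (one_le_size t))
  have hnode := isNode_wf_of_mem_group hwf
  -- The items that are nodes of a micro tree.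
  have hitem : ∀ d ∈ x.lower, ∀ p ∈ d.rootItems,
      p.strip = p ∧ p.plug.IsFull m ∧ p.plug.size ≤ Q := by
    intro d hd p hp
    obtain ⟨p, hpf, rfl⟩ := List.mem_map.1 hp
    obtain ⟨hp, _⟩ := List.mem_filter.1 hpf
    have h2 := (isFull_plug hwf hfull).2 p (List.mem_flatMap.2 ⟨d, hd, hp⟩)
    rw [strip_strip, plug_strip]
    refine ⟨rfl, h2, (size_plug_le h2).trans ?_⟩
    have h3 := coverOrdinal_local hB t d (hlower ▸ hd)
    have h4 : p.localSize + 1 ≤ d.localSize := by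
      cases d with
      | portal _ => simp [items] at hp
      | node ps =>
        rw [items] at hp
        rw [localSize, localSizeList_eq]
        have := List.single_le_sum (l := ps.map localSize) (by simp) _ (List.mem_map_of_mem hp)
        omega
    have h5 : m * (p.localSize + 1) ≤ m * (2 * B) := Nat.mul_le_mul_left m (by omega)
    rw [hQdef, Nat.mul_comm _ m]
    rw [Nat.mul_add] at h5
    omega
  have hpos : ∀ d ∈ x.lower, ∀ p ∈ d.rootItems, 0 < itemWeight m Q ε p := by
    intro d hd p hp
    have h2 := one_le_card_of_isFull (hitem d hd p hp).2.1
    exact div_pos (weight_pos h0 h1 p) (mul_pos (by exact_mod_cast h2) hQ0)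
  have hleni : ∀ d ∈ x.lower, d.rootItems.length ≤ m := by
    intro d hd
    rw [rootItems, List.length_map]
    exact (List.length_filter_le _ _).trans (length_items_le hwf hfull d hd)
  have h := length_hyperOrdinal_le t (x.lower.map rootItems) (fun l => .node (shapesList l))
    (by
      rw [List.map_map, hlower]
      exact List.map_congr_left fun d hd => node_shapesList_rootItems (hnode d (hlower ▸ hd)).1)
    (fun l => (l.map (itemWeight m Q ε)).prod)
    (by
      intro l hl
      obtain ⟨d, hd, rfl⟩ := List.mem_map.1 hl
      refine List.prod_pos fun y hy => ?_
      obtain ⟨p, hp, rfl⟩ := List.mem_map.1 hy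
      exact hpos d hd p hp)
    (Z := (m : ℝ) + 1)
    (by
      refine sum_prod_itemWeight_le hQ h0 h1 _ (fun l hl => ?_) fun l hl => ?_
      · rw [List.mem_toFinset, List.mem_map] at hl
        obtain ⟨d, hd, rfl⟩ := hl
        exact hleni d hd
      · rw [List.mem_toFinset, List.mem_map] at hl
        obtain ⟨d, hd, rfl⟩ := hl
        exact hitem d hd)
    (by linarith)
  rw [← hBdef] at h
  set N : OCover → ℝ := fun p => (fullOfSize m (p.plug.size - 1)).card with hN
  have hcost : ((x.lower.map rootItems).map fun l =>
      Real.logb 2 (1 / (l.map (itemWeight m Q ε)).prod)).sum =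
      (x.lower.map fun d => (d.rootItems.map fun p => Real.logb 2 (1 / p.weight ε)).sum).sum +
      (x.lower.map fun d => (d.rootItems.map fun p => Real.logb 2 (N p)).sum).sum +
      (x.lower.map fun d => (d.rootItems.map fun _ => Real.logb 2 (Q : ℝ)).sum).sum := by
    rw [List.map_map, ← List.sum_map_add, ← List.sum_map_add]
    congr 1
    refine List.map_congr_left fun d hd => ?_
    rw [Function.comp_apply, ← logb_list_prod_inv _ _ (hpos d hd), ← List.sum_map_add,
      ← List.sum_map_add]
    congr 1
    refine List.map_congr_left fun p hp => ?_
    have h2 : 0 < N p := Nat.cast_pos.2 (one_le_card_of_isFull (hitem d hd p hp).2.1)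
    have h3 := weight_pos h0 h1 p
    rw [itemWeight, one_div_div, ← Real.logb_mul (by positivity) h2.ne',
      ← Real.logb_mul (by positivity) hQ0.ne']
    congr 1
    rw [hN]
    ring
  have hA : (x.lower.map fun d => (d.rootItems.map fun p => Real.logb 2 (1 / p.weight ε)).sum).sum ≤
      t.size * Real.logb 2 (1 / (1 - ε)) + x.lower.length * Real.logb 2 (1 / ε) := by
    rw [sum_rootItems _ _ fun p => by rw [weight_strip]]
    have h2 := sum_logb_weight_le h0 h1 hwf
    rw [htree] at h2
    have h3 : 0 ≤ Real.logb 2 (1 / x.weight ε) :=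
      Real.logb_nonneg (by norm_num) (by rw [hx, weight, le_div_iff₀ h0]; linarith)
    have h4 : x.inner = x.lower.flatMap items := rfl
    rw [h4] at h2
    linarith
  have hC : (x.lower.map fun d => (d.rootItems.map fun p => Real.logb 2 (N p)).sum).sum ≤
      Real.logb 2 (fullOfSize m (t.size - 1)).card := by
    rw [sum_rootItems _ _ fun p => by simp only [hN, plug_strip]]
    have hNpos : ∀ p ∈ x.inner, 1 ≤ (fullOfSize m (p.plug.size - 1)).card := fun p hp =>
      one_le_card_of_isFull ((isFull_plug hwf hfull).2 p hp)
    have h2 : (x.inner.map fun p => if p.isNode = true then Real.logb 2 (N p) else 0).sum ≤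
        (x.inner.map fun p => Real.logb 2 (N p)).sum := by
      refine List.sum_le_sum fun p hp => ?_
      split_ifs
      · rfl
      · exact Real.logb_nonneg (by norm_num) (Nat.one_le_cast.2 (hNpos p hp))
    refine h2.trans ?_
    have h3 : (x.inner.map fun p => Real.logb 2 (N p)).sum =
        Real.logb 2 ((x.inner.map fun p => (fullOfSize m (p.plug.size - 1)).card).prod : ℕ) := by
      clear h2
      generalize x.inner = l at hNpos ⊢
      induction l with
      | nil => simp
      | cons p l ih =>
        have h4 : ∀ q ∈ l, 1 ≤ (fullOfSize m (q.plug.size - 1)).card :=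
          fun q hq => hNpos q (List.mem_cons_of_mem _ hq)
        have h5 := hNpos p List.mem_cons_self
        have h6 : 0 < (l.map fun p => (fullOfSize m (p.plug.size - 1)).card).prod :=
          List.prod_pos fun y hy => by
            obtain ⟨q, hq, rfl⟩ := List.mem_map.1 hy
            exact h4 q hq
        rw [List.map_cons, List.sum_cons, ih h4, List.map_cons, List.prod_cons, Nat.cast_mul,
          Real.logb_mul (by exact_mod_cast (by omega)) (by exact_mod_cast h6.ne')]
    rw [h3]
    obtain ⟨q, hq⟩ := sum_size_plug hwf hfull
    have h4 := prod_card_fullOfSize_le m x.inner (fun p => p.plug.size - 1) q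
    have h5 : (x.inner.map fun p => p.plug.size - 1).sum + m * q = t.size - 1 := by
      rw [htree, hx, plug, ← hx] at hq
      simp only [OTree.size, OTree.sizeList] at hq
      omega
    rw [h5] at h4
    have h6 : 0 < (x.inner.map fun p => (fullOfSize m (p.plug.size - 1)).card).prod :=
      List.prod_pos fun y hy => by
        obtain ⟨q, hq, rfl⟩ := List.mem_map.1 hy
        exact hNpos q hq
    exact Real.logb_le_logb_of_le (by norm_num) (by exact_mod_cast h6) (by exact_mod_cast h4)
  have hlQ : 0 ≤ Real.logb 2 (Q : ℝ) := Real.logb_nonneg (by norm_num) (by exact_mod_cast hQ)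
  have hD : (x.lower.map fun d => (d.rootItems.map fun _ => Real.logb 2 (Q : ℝ)).sum).sum ≤
      t.size * (8 * m * (Real.logb 2 (2 * m * ((B : ℝ) + 1) ^ 1) / (B : ℝ) ^ (1 : ℝ))) := by
    have h2 : (x.lower.map fun d => (d.rootItems.map fun _ => Real.logb 2 (Q : ℝ)).sum).sum ≤
        x.lower.length * (m * Real.logb 2 Q) := by
      have := List.sum_le_card_nsmul (x.lower.map fun d =>
        (d.rootItems.map fun _ => Real.logb 2 (Q : ℝ)).sum) (m * Real.logb 2 Q) (by
          intro y hy
          obtain ⟨d, hd, rfl⟩ := List.mem_map.1 hy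
          rw [List.map_const', List.sum_replicate, nsmul_eq_mul]
          exact mul_le_mul_of_nonneg_right (by exact_mod_cast hleni d hd) hlQ)
      rwa [List.length_map, nsmul_eq_mul] at this
    have h3 : (x.lower.length : ℝ) ≤ 8 * t.size / B := by
      rw [le_div_iff₀ hB0, mul_comm]; exact_mod_cast hlen
    have h4 : Real.logb 2 (Q : ℝ) ≤ Real.logb 2 (2 * m * ((B : ℝ) + 1) ^ 1) := by
      refine Real.logb_le_logb_of_le (by norm_num) hQ0 ?_
      rw [hQdef]
      push_cast
      nlinarith
    calc _ ≤ x.lower.length * (m * Real.logb 2 Q) := h2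
      _ ≤ 8 * t.size / B * (m * Real.logb 2 (2 * m * ((B : ℝ) + 1) ^ 1)) := by gcongr
      _ = _ := by rw [Real.rpow_one]; ring
  have hE := portal_cost_le (n := t.size) hB hlen
  rw [← hε] at hE
  rw [hcost] at h
  linarith

theorem optimalPointwise_fullOrdinal {m : ℕ} (hm : 1 ≤ m) :
    OptimalPointwise hyperOrdinal OTree.size (uniformOn (fullOrdinalTrees m) OTree.size) := by
  have hm0 : (0 : ℝ) < m := by exact_mod_cast hm
  have hrate : Tendsto (fun B : ℕ => 2 / (B : ℝ) +
      8 * (Real.logb 2 (1 * ((B : ℝ) + 1) ^ 1) / (B : ℝ) ^ (1 : ℝ)) +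
      8 * m * (Real.logb 2 (2 * m * ((B : ℝ) + 1) ^ 1) / (B : ℝ) ^ (1 : ℝ)) +
      (8 * (Real.logb 2 (m + 1) + 3) / (B : ℝ) + errorRate B)) atTop (nhds 0) := by
    have h1 := (tendsto_logb_div_rpow (C := 1) (κ := 1) (by norm_num) (by norm_num) 1).const_mul 8
    have h2 := (tendsto_logb_div_rpow (C := 2 * m) (κ := 1) (by positivity) (by norm_num) 1).const_mul
      (8 * m : ℝ)
    have h3 : Tendsto (fun B : ℕ => 2 / (B : ℝ)) atTop (nhds 0) :=
      tendsto_const_div_atTop_nhds_zero_nat 2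
    have h4 : Tendsto (fun B : ℕ => 8 * (Real.logb 2 (m + 1) + 3) / (B : ℝ)) atTop (nhds 0) :=
      tendsto_const_div_atTop_nhds_zero_nat _
    simpa using ((h3.add h1).add h2).add (h4.add tendsto_errorRate)
  refine ⟨_, isLittleO_mul_blockParam hrate 2002, fun t ht => ?_⟩
  have hmem : t ∈ fullOrdinalTrees m := by
    by_contra hn
    rw [uniformOn, if_neg hn] at ht
    exact lt_irrefl _ ht
  rw [uniformOn_fullOrdinalTrees hmem, one_div_one_div, ← add_assoc]
  exact length_hyperOrdinal_le_full hm hmem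

end Hypersuccinct

theorem mainTheorem2 :
    -- binary trees, full binary trees, unary paths and Motzkin trees, uniform among those of size n
    (Hypersuccinct.OptimalPointwise Hypersuccinct.hyperBinary BinaryTree.numNodes
      (Hypersuccinct.uniformOn Set.univ BinaryTree.numNodes)) ∧
    (Hypersuccinct.OptimalPointwise Hypersuccinct.hyperBinary BinaryTree.numNodes
      (Hypersuccinct.uniformOn Hypersuccinct.fullTrees BinaryTree.numNodes)) ∧
    (Hypersuccinct.OptimalPointwise Hypersuccinct.hyperBinary BinaryTree.numNodes
      (Hypersuccinct.uniformOn Hypersuccinct.unaryPaths BinaryTree.numNodes)) ∧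
    (Hypersuccinct.OptimalPointwise Hypersuccinct.hyperBinary BinaryTree.numNodes
      (Hypersuccinct.uniformOn Hypersuccinct.motzkinTrees BinaryTree.numNodes)) ∧
    -- random binary search trees, binomial random trees, almost paths, fringe-balanced trees
    (Hypersuccinct.OptimalPointwise Hypersuccinct.hyperBinary BinaryTree.numNodes
      (Hypersuccinct.fixedSize Hypersuccinct.pBst)) ∧
    (∀ α : ℝ, 0 < α → α < 1 →
      Hypersuccinct.OptimalOnAverage Hypersuccinct.hyperBinary
        (Hypersuccinct.fixedSize (Hypersuccinct.pBinomial α))) ∧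
    (∀ K : ℕ,
      Hypersuccinct.OptimalPointwise Hypersuccinct.hyperBinary BinaryTree.numNodes
        (Hypersuccinct.fixedSize (Hypersuccinct.pAlmostPath K))) ∧
    (∀ s : ℕ,
      Hypersuccinct.OptimalOnAverage Hypersuccinct.hyperBinary
        (Hypersuccinct.fixedSize (Hypersuccinct.pFringeBalanced s))) ∧
    -- AVL trees of a given height, weight-balanced trees, AVL and red-black trees of a given size
    (Hypersuccinct.OptimalPointwise Hypersuccinct.hyperBinary BinaryTree.numNodes
      (Hypersuccinct.uniformOn Hypersuccinct.avlTrees BinaryTree.height)) ∧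
    (∀ α : ℝ, 0 < α →
      Hypersuccinct.OptimalPointwise Hypersuccinct.hyperBinary BinaryTree.numNodes
        (Hypersuccinct.uniformOn (Hypersuccinct.weightBalancedTrees α) BinaryTree.numNodes)) ∧
    (Hypersuccinct.OptimalPointwise Hypersuccinct.hyperBinary BinaryTree.numNodes
      (Hypersuccinct.uniformOn Hypersuccinct.avlTrees BinaryTree.numNodes)) ∧
    (Hypersuccinct.OptimalPointwise Hypersuccinct.hyperBinary BinaryTree.numNodes
      (Hypersuccinct.uniformOn Hypersuccinct.redBlackTrees BinaryTree.numNodes)) ∧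
    -- full m-ary trees, uniform composition trees and random LRM-trees
    (∀ m : ℕ, 2 ≤ m →
      Hypersuccinct.OptimalPointwise Hypersuccinct.hyperOrdinal Hypersuccinct.OTree.size
        (Hypersuccinct.uniformOn (Hypersuccinct.fullOrdinalTrees m) Hypersuccinct.OTree.size)) ∧
    (Hypersuccinct.OptimalPointwise Hypersuccinct.hyperOrdinal Hypersuccinct.OTree.size
      (Hypersuccinct.fixedSizeOrdinal Hypersuccinct.pComposition)) ∧
    (Hypersuccinct.OptimalPointwise Hypersuccinct.hyperOrdinal Hypersuccinct.OTree.size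
      (Hypersuccinct.fixedSizeOrdinal Hypersuccinct.pLrm)) ∧
    -- empirical type entropy
    (∀ k : ℕ → ℕ,
      Asymptotics.IsLittleO Filter.atTop (fun n : ℕ => (k n : ℝ)) (fun n : ℕ => Real.log n) →
      ∃ r : ℕ → ℝ, Asymptotics.IsLittleO Filter.atTop r (fun n : ℕ => (n : ℝ)) ∧
        ∀ t : Hypersuccinct.BTree, ((Hypersuccinct.hyperBinary t).length : ℝ) ≤
          Hypersuccinct.typeEntropy (k t.numNodes) t + r t.numNodes) ∧
    -- subtree-size entropy
    (∃ r : ℕ → ℝ, Asymptotics.IsLittleO Filter.atTop r (fun n : ℕ => (n : ℝ)) ∧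
      ∀ t : Hypersuccinct.BTree, ((Hypersuccinct.hyperBinary t).length : ℝ) ≤
        Hypersuccinct.subtreeSizeEntropy t + r t.numNodes) := by
  refine ⟨?_, ?_, ?_, ?_, Hypersuccinct.optimalPointwise_bst,
    fun α h0 h1 =>
      Hypersuccinct.optimalOnAverage_of_balanced (Hypersuccinct.isBalancedSource_pBinomial h0 h1),
    Hypersuccinct.optimalPointwise_almostPath,
    fun s =>
      Hypersuccinct.optimalOnAverage_of_balanced (Hypersuccinct.isBalancedSource_pFringeBalanced s),
    Hypersuccinct.optimalPointwise_avl _ fun _ _ _ h => h,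
    fun α hα => Hypersuccinct.optimalPointwise_weightBalanced hα,
    Hypersuccinct.optimalPointwise_avl _ fun _ _ h _ => h,
    Hypersuccinct.optimalPointwise_redBlack,
    fun m hm => Hypersuccinct.optimalPointwise_fullOrdinal (by omega),
    Hypersuccinct.optimalPointwise_composition, Hypersuccinct.optimalPointwise_lrm,
    Hypersuccinct.length_hyperBinary_le_typeEntropy_add,
    Hypersuccinct.length_hyperBinary_le_subtreeSizeEntropy⟩
  · rw [Hypersuccinct.univ_eq_typeClass]
    exact Hypersuccinct.optimalPointwise_typeClass trivial
  · rw [Hypersuccinct.fullTrees_eq_typeClass]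
    exact Hypersuccinct.optimalPointwise_typeClass rfl
  · rw [Hypersuccinct.unaryPaths_eq_typeClass]
    exact Hypersuccinct.optimalPointwise_typeClass (Or.inl rfl)
  · rw [Hypersuccinct.motzkinTrees_eq_typeClass]
    exact Hypersuccinct.optimalPointwise_typeClass fun h => h
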